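/- Let $K$ be a field of characteristic $0$ (e.g. $K=\mathbb R$ or $\mathbb C$) and let $so(4,2)$ be the Lie algebra of $6\times 6$ matrices over $K$ that are skew for a diagonal form with four entries $1$ and two entries $-1$. It has a basis $J_i,K_i,P_\mu,C_\mu,D$ ($i=1,2,3$; $\mu=0,\dots,3$) with non-vanishing commutators $[J_i,J_j]=\epsilon_{ijk}J_k$, $[J_i,K_j]=\epsilon_{ijk}K_k$, $[J_i,P_j]=\epsilon_{ijk}P_k$, $[J_i,C_j]=\epsilon_{ijk}C_k$, $[K_i,K_j]=-\epsilon_{ijk}J_k$, $[K_i,P_i]=P_0$, $[K_i,P_0]=P_i$, $[K_i,C_0]=C_i$, $[K_i,C_i]=C_0$, $[P_0,C_0]=D$, $[P_0,C_i]=-K_i$, $[P_i,C_0]=K_i$, $[P_i,C_j]=-\delta_{ij}D+\epsilon_{ijk}J_k$, $[P_\mu,D]=-P_\mu$, $[C_\mu,D]=C_\mu$. Put $$H_\pm=\tfrac12(D\pm K_1),\quad T_\pm=\tfrac12(P_0\pm P_1),\quad T_2=\tfrac12(P_2-P_3),\quad T_3=\tfrac12(P_2+P_3),$$ $$B_2=\tfrac12(K_2+J_3-K_3+J_2),\quad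 B_3=\tfrac12(K_2+J_3+K_3-J_2),$$ $$A_2=\tfrac12(K_2-J_3-K_3-J_2),\quad A_3=\tfrac12(K_2-J_3+K_3+J_2).$$ Let $\mathcal L$ be the Lie subalgebra generated by $H_\pm,T_\pm,T_a,B_a$ ($a=2,3$) and $\mathcal{WP}\supset\mathcal L$ the Weyl–Poincaré subalgebra generated by $J_i,K_i,P_\mu,D$. Then the eight elements $H_\pm,T_\pm,T_a,B_a$ are a basis of $\mathcal L$, with non-vanishing brackets $[H_\pm,T_\pm]=T_\pm$, $[H_\pm,T_a]=\tfrac12T_a$, $[H_\pm,B_a]=\mp\tfrac12B_a$, $[B_a,T_+]=T_a$, $[B_a,T_a]=T_-$; and the eleven elements $J_i,K_i,P_\mu,D$ are a basis of $\mathcal{WP}$. Let $z$ be a formal parameter. For each $\mathfrak a\in\{\mathcal L,\mathcal{WP},so(4,2)\}$ let $U(\mathfrak a)$ be the universal enveloping algebra with its standard Hopf structure $(\Delta,\epsilon,S)$, extended $z$-linearly and $z$-adically continuously to $U(\mathfrak a)[[z]]$. Tensor products are $z$-adically completed, so the tensor square is $(U(\mathfrak a)\otimes U(\mathfrak a))[[z]]$.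 Define $$\sigma_-=\ln(1-2zT_-),\qquad T=T_++z(T_2^2+T_3^2)e^{-\sigma_-},\qquad \sigma_+=\ln(1-2zT),$$ $$\Phi_{\mathcal J}=e^{H_-\otimes\sigma_-},\qquad \Phi_{\mathcal A}=e^{H_+\otimes\sigma_+},\qquad \Phi_{\mathcal E}=\exp(-2zB_3\otimes T_3e^{-\frac12\sigma_-})\exp(-2zB_2\otimes T_2e^{-\frac12\sigma_-}),$$ $$\mathcal F=\Phi_{\mathcal A}\Phi_{\mathcal E}\Phi_{\mathcal J}.$$ For a coproduct $\Delta'$ and an invertible $\Phi$ write $\Delta'_\Phi(a)=\Phi\,\Delta'(a)\,\Phi^{-1}$. Call $\Phi$ a factorizable twist for $\Delta'$ if it is invertible and $$(\epsilon\otimes id)\Phi=(id\otimes\epsilon)\Phi=1,\qquad \Phi_{12}(\Delta'\otimes id)\Phi=\Phi_{23}(id\otimes\Delta')\Phi,$$ $$(\Delta'\otimes id)\Phi=\Phi_{13}\Phi_{23},\qquad (id\otimes\Delta'_\Phi)\Phi=\Phi_{12}\Phi_{13}.$$ Put $\Delta_{\mathcal J}=\Delta_{\Phi_{\mathcal J}}$,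 $\Delta_{\mathcal E}=\Delta_{\Phi_{\mathcal E}\Phi_{\mathcal J}}$, $\Delta_{\mathcal F}(a)=\mathcal F\Delta(a)\mathcal F^{-1}$, $v=\sum f^{(1)}S(f^{(2)})$ for $\mathcal F=\sum f^{(1)}\otimes f^{(2)}$, $S_{\mathcal F}(a)=vS(a)v^{-1}$, and $\mathcal R=\tau(\mathcal F)\mathcal F^{-1}$, where $\tau(a\otimes b)=b\otimes a$. Then: 1. For each of the three $\mathfrak a$, $\mathcal F$ is a factorizable twist for $\Delta$. Moreover the Jordanian twist $\Phi_{\mathcal J}$ and the extended twist $\Phi_{\mathcal E}\Phi_{\mathcal J}$ are factorizable twists for $\Delta$, the additional Jordanian twist $\Phi_{\mathcal A}$ is a factorizable twist for $\Delta_{\mathcal E}$ which turns $\Delta_{\mathcal E}$ into $\Delta_{\mathcal F}$, and $[H_+,T]=T$. 2. $\mathcal L$ is the carrier of $\mathcal F$: it is the least Lie subalgebra $\mathfrak h\subset so(4,2)$ such that all coefficients of $\mathcal F$ lie in (the image of) $U(\mathfrak h)\otimes U(\mathfrak h)$. 3. For each of the three $\mathfrak a$, $v$ is invertible and $\Delta_{\mathcal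 F},\epsilon,S_{\mathcal F}$ make the algebra $U(\mathfrak a)[[z]]$ a topological Hopf algebra $U_z(\mathfrak a)$ over $K[[z]]$. The maps induced by $\mathcal L\subset\mathcal{WP}\subset so(4,2)$ are injective Hopf algebra maps $U_z(\mathcal L)\subset U_z(\mathcal{WP})\subset U_z(so(4,2))$ that carry the twisting elements $\mathcal F$ to one another. 4. In each of these algebras, with $a=2,3$, $$\Delta_{\mathcal F}(H_+)=H_+\otimes e^{-\sigma_+}+1\otimes H_+,\qquad \Delta_{\mathcal F}(T_-)=T_-\otimes e^{\sigma_-}+1\otimes T_-,$$ $$\Delta_{\mathcal F}(H_-)=H_-\otimes e^{-\sigma_-}+1\otimes H_-+2z\sum_{a}B_a\otimes T_ae^{-\frac12(\sigma_++3\sigma_-)}+2z^2H_+\otimes(T_2^2+T_3^2)e^{-(\sigma_++2\sigma_-)},$$ $$\Delta_{\mathcal F}(B_a)=B_a\otimes e^{-\frac12(\sigma_++\sigma_-)}+1\otimes B_a+2zH_+\otimes T_ae^{-(\sigma_++\sigma_-)},$$ $$\Delta_{\mathcal F}(T_+)=T_+\otimes e^{\sigma_+}+1\otimes T_+-2z\sum_aT_a\otimes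 T_ae^{\frac12(\sigma_+-\sigma_-)}+2z^2T_-\otimes(T_2^2+T_3^2)e^{-\sigma_-},$$ $$\Delta_{\mathcal F}(T_a)=T_a\otimes e^{\frac12(\sigma_++\sigma_-)}+e^{\sigma_-}\otimes T_a,$$ and in $U_z(\mathcal{WP})$ and $U_z(so(4,2))$ the element $J_1$ is primitive for $\Delta_{\mathcal J}$, $\Delta_{\mathcal E}$ and $\Delta_{\mathcal F}$, and $$\Delta_{\mathcal J}(A_a)=A_a\otimes e^{-\frac12\sigma_-}+1\otimes A_a+2zH_-\otimes T_ae^{-\sigma_-},$$ $$\Delta_{\mathcal E}(A_a)=A_a\otimes e^{-\frac12\sigma_-}+1\otimes A_a+2zH_+\otimes T_ae^{-\sigma_-}+2zB_a\otimes Te^{-\frac12\sigma_-}-2z\epsilon_{1ab}J_1\otimes T_be^{-\sigma_-},$$ $$\Delta_{\mathcal F}(A_a)=A_a\otimes e^{\frac12(\sigma_+-\sigma_-)}+1\otimes A_a+2zH_+\otimes T_ae^{-(\sigma_++\sigma_-)}+2zB_a\otimes Te^{-\frac12(\sigma_++\sigma_-)}-2z\epsilon_{1ab}J_1\otimes T_be^{-\sigma_-}.$$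 5. For each of the three $\mathfrak a$, $\mathcal R$ is a triangular universal $R$-matrix of $U_z(\mathfrak a)$: it is invertible, $\mathcal R\Delta_{\mathcal F}(a)=\tau(\Delta_{\mathcal F}(a))\mathcal R$, $(\Delta_{\mathcal F}\otimes id)\mathcal R=\mathcal R_{13}\mathcal R_{23}$, $(id\otimes\Delta_{\mathcal F})\mathcal R=\mathcal R_{13}\mathcal R_{12}$, $\tau(\mathcal R)\mathcal R=1$; also $\mathcal R=\tau(\Phi_{\mathcal A})\tau(\Phi_{\mathcal E})\tau(\Phi_{\mathcal J})\Phi_{\mathcal J}^{-1}\Phi_{\mathcal E}^{-1}\Phi_{\mathcal A}^{-1}$. Furthermore $\mathcal R=1+r+O(z^2)$ with $$r=2z\,(H_+\wedge T_++H_-\wedge T_-+B_2\wedge T_2+B_3\wedge T_3),\qquad x\wedge y=x\otimes y-y\otimes x,$$ which satisfies the classical Yang–Baxter equation and, in $so(4,2)$, equals $$z(D\wedge P_0+K_1\wedge P_1+K_2\wedge P_2+K_3\wedge P_3)+z(J_3\wedge P_2-J_2\wedge P_3).$$ -/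

import Mathlib

open scoped TensorProduct PowerSeries

attribute [local instance 100] LieRing.ofAssociativeRing

noncomputable section

namespace ConformalTwist

/-!
### Formal power series in the deformation parameter

Throughout `K` is the ground field and `z = PowerSeries.X` is the deformation parameter. For a
`K`-algebra `A` the completed tensor product of `A⟦z⟧` with `B⟦z⟧` over `K⟦z⟧` is `(A ⊗ B)⟦z⟧`.
-/

section Formal

variable (K : Type*) [Field K]
variable {A B A' B' : Type*} [Ring A] [Algebra K A] [Ring B] [Algebra K B]
  [Ring A'] [Algebra K A'] [Ring B'] [Algebra K B']

/-- `exp x = ∑ xᵏ / k!`, for a formal power series `x` without constant term: since `xᵏ` has order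
at least `k`, only the terms with `k ≤ n` contribute to the coefficient of `zⁿ`. -/
def fexp (x : A⟦X⟧) : A⟦X⟧ :=
  PowerSeries.mk fun n =>
    ∑ k ∈ Finset.range (n + 1), ((k.factorial : K)⁻¹) • PowerSeries.coeff n (x ^ k)

/-- `ln (1 + x) = ∑_{k ≥ 1} (-1)ᵏ⁺¹ xᵏ / k`, for a formal power series `x` without constant
term. -/
def flog (x : A⟦X⟧) : A⟦X⟧ :=
  PowerSeries.mk fun n =>
    ∑ k ∈ Finset.Icc 1 n, ((-1 : K) ^ (k + 1) / (k : K)) • PowerSeries.coeff n (x ^ k)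

/-- The tensor product `a ⊗ b ∈ (A ⊗ B)⟦z⟧` of `a ∈ A⟦z⟧` and `b ∈ B⟦z⟧`. -/
def ftmul (a : A⟦X⟧) (b : B⟦X⟧) : (A ⊗[K] B)⟦X⟧ :=
  PowerSeries.mapAlgHom (Algebra.TensorProduct.includeLeft : A →ₐ[K] A ⊗[K] B) a *
    PowerSeries.mapAlgHom (Algebra.TensorProduct.includeRight : B →ₐ[K] A ⊗[K] B) b

/-- Constants, as a `K`-linear map `A → A⟦z⟧`. -/
def constL : A →ₗ[K] A⟦X⟧ where
  toFun := PowerSeries.C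
  map_add' := map_add _
  map_smul' c a := by
    ext n
    rcases n with _ | n <;> simp [PowerSeries.coeff_C]

/-- The coefficientwise extension `A⟦z⟧ → B⟦z⟧` of a `K`-linear map `A → B`. -/
def coeffwise (f : A →ₗ[K] B) : A⟦X⟧ →ₗ[K] B⟦X⟧ where
  toFun x := PowerSeries.mk fun n => f (PowerSeries.coeff n x)
  map_add' x y := by ext n; simp
  map_smul' c x := by ext n; simp

/-- The `z`-linear, `z`-adically continuous extension `A⟦z⟧ → B⟦z⟧` of a `K`-linear map
`f : A → B⟦z⟧`, that is `∑ aᵢ zⁱ ↦ ∑ f(aᵢ) zⁱ`. -/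
def zExt (f : A →ₗ[K] B⟦X⟧) : A⟦X⟧ →ₗ[K] B⟦X⟧ where
  toFun x := PowerSeries.mk fun n =>
    ∑ p ∈ Finset.HasAntidiagonal.antidiagonal n, PowerSeries.coeff p.2 (f (PowerSeries.coeff p.1 x))
  map_add' x y := by ext n; simp [Finset.sum_add_distrib]
  map_smul' c x := by ext n; simp [Finset.smul_sum]

/-- The tensor product `a ⊗ b ↦ f a ⊗ g b` of linear maps `f : A → A'⟦z⟧` and `g : B → B'⟦z⟧`. -/
def zTensor (f : A →ₗ[K] A'⟦X⟧) (g : B →ₗ[K] B'⟦X⟧) : A ⊗[K] B →ₗ[K] (A' ⊗[K] B')⟦X⟧ :=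
  TensorProduct.lift (LinearMap.mk₂ K (fun a b => ftmul K (f a) (g b))
    (by intro a a' b; simp [ftmul, add_mul])
    (by intro c a b; simp [ftmul])
    (by intro a b b'; simp [ftmul, mul_add])
    (by intro c a b; simp [ftmul]))

/-! ### Legs of tensors -/

/-- `a ⊗ b ↦ a ⊗ b ⊗ 1`. -/
def leg12 : A ⊗[K] A →ₐ[K] A ⊗[K] (A ⊗[K] A) :=
  Algebra.TensorProduct.map (AlgHom.id K A) Algebra.TensorProduct.includeLeft

/-- `a ⊗ b ↦ a ⊗ 1 ⊗ b`. -/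
def leg13 : A ⊗[K] A →ₐ[K] A ⊗[K] (A ⊗[K] A) :=
  Algebra.TensorProduct.map (AlgHom.id K A) Algebra.TensorProduct.includeRight

/-- `a ⊗ b ↦ 1 ⊗ a ⊗ b`. -/
def leg23 : A ⊗[K] A →ₐ[K] A ⊗[K] (A ⊗[K] A) :=
  Algebra.TensorProduct.includeRight

/-- `F₁₂`. -/
def fleg12 (F : (A ⊗[K] A)⟦X⟧) : (A ⊗[K] (A ⊗[K] A))⟦X⟧ := PowerSeries.mapAlgHom (leg12 K) F

/-- `F₁₃`. -/
def fleg13 (F : (A ⊗[K] A)⟦X⟧) : (A ⊗[K] (A ⊗[K] A))⟦X⟧ := PowerSeries.mapAlgHom (leg13 K) F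

/-- `F₂₃`. -/
def fleg23 (F : (A ⊗[K] A)⟦X⟧) : (A ⊗[K] (A ⊗[K] A))⟦X⟧ := PowerSeries.mapAlgHom (leg23 K) F

/-- `τ(F)`, where `τ(a ⊗ b) = b ⊗ a`. -/
def flip (F : (A ⊗[K] A)⟦X⟧) : (A ⊗[K] A)⟦X⟧ :=
  PowerSeries.mapAlgHom (Algebra.TensorProduct.comm K A A).toAlgHom F

/-- `(f ⊗ id)(F)` for `f : A → (A ⊗ A)⟦z⟧`. -/
def comulTensorId (f : A →ₗ[K] (A ⊗[K] A)⟦X⟧) (F : (A ⊗[K] A)⟦X⟧) : (A ⊗[K] (A ⊗[K] A))⟦X⟧ :=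
  PowerSeries.mapAlgHom (Algebra.TensorProduct.assoc K K K A A A).toAlgHom
    (zExt K (zTensor K f (constL K)) F)

/-- `(id ⊗ f)(F)` for `f : A → (A ⊗ A)⟦z⟧`. -/
def idTensorComul (f : A →ₗ[K] (A ⊗[K] A)⟦X⟧) (F : (A ⊗[K] A)⟦X⟧) : (A ⊗[K] (A ⊗[K] A))⟦X⟧ :=
  zExt K (zTensor K (constL K) f) F

/-- `(ε ⊗ id)(F)`, with `K ⊗ A` identified with `A`. -/
def counitTensorId (ε : A →ₗ[K] K⟦X⟧) (F : (A ⊗[K] A)⟦X⟧) : A⟦X⟧ :=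
  PowerSeries.mapAlgHom (Algebra.TensorProduct.lid K A).toAlgHom
    (zExt K (zTensor K ε (constL K)) F)

/-- `(id ⊗ ε)(F)`, with `A ⊗ K` identified with `A`. -/
def idTensorCounit (ε : A →ₗ[K] K⟦X⟧) (F : (A ⊗[K] A)⟦X⟧) : A⟦X⟧ :=
  PowerSeries.mapAlgHom (Algebra.TensorProduct.rid K K A).toAlgHom
    (zExt K (zTensor K (constL K) ε) F)

/-- `m (f ⊗ g)(F)`, with `m` the multiplication. -/
def mulTensor (f g : A →ₗ[K] A⟦X⟧) (F : (A ⊗[K] A)⟦X⟧) : A⟦X⟧ :=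
  coeffwise K (LinearMap.mul' K A) (zExt K (zTensor K f g) F)

/-! ### Topological Hopf algebras over `K⟦z⟧` and twists

A topological Hopf algebra with underlying algebra `A⟦z⟧` has structure maps that are `z`-linear
and continuous, so they are given by their restrictions to `A`. -/

/-- `Δ`, `ε`, `S` make the algebra `A⟦z⟧` a topological Hopf algebra over `K⟦z⟧`. -/
structure IsFormalHopfAlgebra (Δ : A →ₗ[K] (A ⊗[K] A)⟦X⟧) (ε : A →ₗ[K] K⟦X⟧)
    (S : A →ₗ[K] A⟦X⟧) : Prop where
  comul_one : Δ 1 = 1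
  comul_mul : ∀ a b, Δ (a * b) = Δ a * Δ b
  counit_one : ε 1 = 1
  counit_mul : ∀ a b, ε (a * b) = ε a * ε b
  coassoc : ∀ a, comulTensorId K Δ (Δ a) = idTensorComul K Δ (Δ a)
  counit_comul_left : ∀ a, counitTensorId K ε (Δ a) = PowerSeries.C a
  counit_comul_right : ∀ a, idTensorCounit K ε (Δ a) = PowerSeries.C a
  antipode_left : ∀ a, mulTensor K S (constL K) (Δ a) = PowerSeries.map (algebraMap K A) (ε a)
  antipode_right : ∀ a, mulTensor K (constL K) S (Δ a) = PowerSeries.map (algebraMap K A) (ε a)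

/-- The algebra map `f : A⟦z⟧ → B⟦z⟧` extending `f : A → B` respects the Hopf structures. -/
structure IsFormalHopfHom (f : A →ₐ[K] B)
    (ΔA : A →ₗ[K] (A ⊗[K] A)⟦X⟧) (εA : A →ₗ[K] K⟦X⟧) (SA : A →ₗ[K] A⟦X⟧)
    (ΔB : B →ₗ[K] (B ⊗[K] B)⟦X⟧) (εB : B →ₗ[K] K⟦X⟧) (SB : B →ₗ[K] B⟦X⟧) : Prop where
  comul : ∀ a, ΔB (f a) = PowerSeries.mapAlgHom (Algebra.TensorProduct.map f f) (ΔA a)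
  counit : ∀ a, εB (f a) = εA a
  antipode : ∀ a, SB (f a) = PowerSeries.mapAlgHom f (SA a)

/-- The twisted coproduct `Δ_F(a) = F Δ(a) F⁻¹`. (`Ring.inverse F` is `F⁻¹` for invertible `F`.) -/
def twistComul (Δ : A →ₗ[K] (A ⊗[K] A)⟦X⟧) (F : (A ⊗[K] A)⟦X⟧) : A →ₗ[K] (A ⊗[K] A)⟦X⟧ :=
  (LinearMap.mulLeft K F ∘ₗ LinearMap.mulRight K (Ring.inverse F)) ∘ₗ Δ

/-- `v = ∑ f⁽¹⁾ S(f⁽²⁾)` for `F = ∑ f⁽¹⁾ ⊗ f⁽²⁾`. -/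
def twistV (S : A →ₗ[K] A⟦X⟧) (F : (A ⊗[K] A)⟦X⟧) : A⟦X⟧ := mulTensor K (constL K) S F

/-- The twisted antipode `S_F(a) = v S(a) v⁻¹`. -/
def twistAntipode (S : A →ₗ[K] A⟦X⟧) (F : (A ⊗[K] A)⟦X⟧) : A →ₗ[K] A⟦X⟧ :=
  (LinearMap.mulLeft K (twistV K S F) ∘ₗ LinearMap.mulRight K (Ring.inverse (twistV K S F))) ∘ₗ S

/-- `F` is a twisting element for the coproduct `Δ` with counit `ε`: it is invertible, normalized,
and satisfies `F₁₂ (Δ ⊗ id)(F) = F₂₃ (id ⊗ Δ)(F)`. -/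
structure IsTwist (Δ : A →ₗ[K] (A ⊗[K] A)⟦X⟧) (ε : A →ₗ[K] K⟦X⟧) (F : (A ⊗[K] A)⟦X⟧) :
    Prop where
  isUnit : IsUnit F
  counit_left : counitTensorId K ε F = 1
  counit_right : idTensorCounit K ε F = 1
  cocycle : fleg12 K F * comulTensorId K Δ F = fleg23 K F * idTensorComul K Δ F

/-- `F` is a factorizable twist: a twist with `(Δ ⊗ id)(F) = F₁₃ F₂₃` and
`(id ⊗ Δ_F)(F) = F₁₂ F₁₃`. -/
structure IsFactorizableTwist (Δ : A →ₗ[K] (A ⊗[K] A)⟦X⟧) (ε : A →ₗ[K] K⟦X⟧)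
    (F : (A ⊗[K] A)⟦X⟧) : Prop extends IsTwist K Δ ε F where
  factor_left : comulTensorId K Δ F = fleg13 K F * fleg23 K F
  factor_right : idTensorComul K (twistComul K Δ F) F = fleg12 K F * fleg13 K F

/-- `R` is a (triangular) universal `R`-matrix for the coproduct `Δ`. -/
structure IsTriangularRMatrix (Δ : A →ₗ[K] (A ⊗[K] A)⟦X⟧) (R : (A ⊗[K] A)⟦X⟧) : Prop where
  isUnit : IsUnit R
  intertwines : ∀ a, R * Δ a = flip K (Δ a) * R
  comul_left : comulTensorId K Δ R = fleg13 K R * fleg23 K R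
  comul_right : idTensorComul K Δ R = fleg13 K R * fleg12 K R
  triangular : flip K R * R = 1

end Formal

notation:75 a:75 " ⊠[" K "] " b:76 => ftmul K a b

/-! ### Universal enveloping algebras as Hopf algebras -/

section Enveloping

variable (K : Type*) [Field K] (𝔞 : Type*) [LieRing 𝔞] [LieAlgebra K 𝔞]

/-- The universal enveloping algebra `U(𝔞)`. -/
abbrev U := UniversalEnvelopingAlgebra K 𝔞

/-- The coproduct of `U(𝔞)`, the algebra map with `Δ(x) = x ⊗ 1 + 1 ⊗ x` for `x ∈ 𝔞`. -/
def uComul : U K 𝔞 →ₐ[K] U K 𝔞 ⊗[K] U K 𝔞 :=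
  UniversalEnvelopingAlgebra.lift K
    { toFun := fun x =>
        UniversalEnvelopingAlgebra.ι K x ⊗ₜ[K] 1 + 1 ⊗ₜ[K] UniversalEnvelopingAlgebra.ι K x
      map_add' := fun x y => by
        simp only [map_add, TensorProduct.add_tmul, TensorProduct.tmul_add]; abel
      map_smul' := fun c x => by
        simp only [map_smul, TensorProduct.smul_tmul', TensorProduct.tmul_smul, smul_add,
          RingHom.id_apply]
      map_lie' := fun {x y} => by
        simp only [LieHom.map_lie, LieRing.of_associative_ring_bracket, mul_add, add_mul,
          Algebra.TensorProduct.tmul_mul_tmul, one_mul, mul_one, TensorProduct.sub_tmul,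
          TensorProduct.tmul_sub]
        abel }

/-- The counit of `U(𝔞)`, the algebra map that vanishes on `𝔞`. -/
def uCounit : U K 𝔞 →ₐ[K] K := UniversalEnvelopingAlgebra.lift K (0 : 𝔞 →ₗ⁅K⁆ K)

/-- The antipode of `U(𝔞)`, the anti-multiplicative map with `S(x) = -x` for `x ∈ 𝔞`, as an algebra
map to the opposite algebra. -/
def uAntipodeOp : U K 𝔞 →ₐ[K] (U K 𝔞)ᵐᵒᵖ :=
  UniversalEnvelopingAlgebra.lift K
    { toFun := fun x => MulOpposite.op (-UniversalEnvelopingAlgebra.ι K x)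
      map_add' := fun x y => by
        simp only [map_add, neg_add, MulOpposite.op_add]
      map_smul' := fun c x => by
        simp only [map_smul, ← smul_neg, MulOpposite.op_smul, RingHom.id_apply]
      map_lie' := fun {x y} => by
        apply MulOpposite.unop_injective
        simp [LieHom.map_lie, LieRing.of_associative_ring_bracket] }

/-- The undeformed coproduct on `U(𝔞)⟦z⟧`. -/
def Δ₀ : U K 𝔞 →ₗ[K] (U K 𝔞 ⊗[K] U K 𝔞)⟦X⟧ := constL K ∘ₗ (uComul K 𝔞).toLinearMap

/-- The counit on `U(𝔞)⟦z⟧`. -/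
def ε₀ : U K 𝔞 →ₗ[K] K⟦X⟧ := constL K ∘ₗ (uCounit K 𝔞).toLinearMap

/-- The undeformed antipode on `U(𝔞)⟦z⟧`. -/
def S₀ : U K 𝔞 →ₗ[K] (U K 𝔞)⟦X⟧ :=
  constL K ∘ₗ (MulOpposite.opLinearEquiv K).symm.toLinearMap ∘ₗ (uAntipodeOp K 𝔞).toLinearMap

variable {𝔞}

/-- An element of `𝔞`, seen in `U(𝔞)⟦z⟧`. -/
def gen (x : 𝔞) : (U K 𝔞)⟦X⟧ := PowerSeries.C (UniversalEnvelopingAlgebra.ι K x)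

variable {𝔟 : Type*} [LieRing 𝔟] [LieAlgebra K 𝔟]

/-- The algebra map `U(𝔞) → U(𝔟)` induced by a Lie algebra map `𝔞 → 𝔟`. -/
def uMap (f : 𝔞 →ₗ⁅K⁆ 𝔟) : U K 𝔞 →ₐ[K] U K 𝔟 :=
  UniversalEnvelopingAlgebra.lift K ((UniversalEnvelopingAlgebra.ι K).comp f)

/-- The coefficients of `F ∈ (U(𝔞) ⊗ U(𝔞))⟦z⟧` lie in `U(𝔥) ⊗ U(𝔥)`. -/
def SupportedOn (𝔥 : LieSubalgebra K 𝔞) (F : (U K 𝔞 ⊗[K] U K 𝔞)⟦X⟧) : Prop :=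
  ∀ n, PowerSeries.coeff n F ∈
    (Algebra.TensorProduct.map (uMap K 𝔥.incl) (uMap K 𝔥.incl)).range

/-- `x ∧ y = x ⊗ y - y ⊗ x`. -/
def wedge (x y : 𝔞) : 𝔞 ⊗[K] 𝔞 := x ⊗ₜ[K] y - y ⊗ₜ[K] x

/-- The image of `r ∈ 𝔞 ⊗ 𝔞` in `U(𝔞) ⊗ U(𝔞)`. -/
def toU2 (r : 𝔞 ⊗[K] 𝔞) : U K 𝔞 ⊗[K] U K 𝔞 :=
  TensorProduct.map (UniversalEnvelopingAlgebra.ι K : 𝔞 →ₗ⁅K⁆ U K 𝔞).toLinearMap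
    (UniversalEnvelopingAlgebra.ι K : 𝔞 →ₗ⁅K⁆ U K 𝔞).toLinearMap r

/-- The commutator `a b - b a`. -/
def ringCommutator {A : Type*} [Ring A] (a b : A) : A := a * b - b * a

/-- The classical Yang--Baxter equation `[r₁₂, r₁₃] + [r₁₂, r₂₃] + [r₁₃, r₂₃] = 0`. -/
def ClassicalYangBaxter (r : 𝔞 ⊗[K] 𝔞) : Prop :=
  ringCommutator (leg12 K (toU2 K r)) (leg13 K (toU2 K r)) +
    ringCommutator (leg12 K (toU2 K r)) (leg23 K (toU2 K r)) +
    ringCommutator (leg13 K (toU2 K r)) (leg23 K (toU2 K r)) = 0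

end Enveloping

/-! ### The twisting element

Indices `a, b ∈ {2, 3}` are represented by `Fin 2`: `0` stands for `2` and `1` stands for `3`. -/

/-- Eight elements `H_±, T_±, T_a, B_a` of a Lie algebra. -/
structure CarrierGens (𝔞 : Type*) where
  Hp : 𝔞
  Hm : 𝔞
  Tp : 𝔞
  Tm : 𝔞
  T : Fin 2 → 𝔞
  B : Fin 2 → 𝔞

/-- Eleven elements `H_±, T_±, T_a, B_a, A_a, J_1` of a Lie algebra. -/
structure WeylGens (𝔞 : Type*) extends CarrierGens 𝔞 where
  A : Fin 2 → 𝔞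
  J1 : 𝔞

/-- The symbol `ε_{1ab}` for `a, b ∈ {2, 3}`. -/
def eps2 (a b : Fin 2) : ℤ := (b.val : ℤ) - (a.val : ℤ)

namespace CarrierGens

section

variable (K : Type*) [Field K] {𝔞 : Type*} [LieRing 𝔞] [LieAlgebra K 𝔞]
variable (o : CarrierGens 𝔞)

/-- The commutation relations of the carrier algebra. -/
structure Relations : Prop where
  Hp_Hm : ⁅o.Hp, o.Hm⁆ = 0
  Hp_Tp : ⁅o.Hp, o.Tp⁆ = o.Tp
  Hp_Tm : ⁅o.Hp, o.Tm⁆ = 0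
  Hp_T : ∀ a, ⁅o.Hp, o.T a⁆ = (1 / 2 : K) • o.T a
  Hp_B : ∀ a, ⁅o.Hp, o.B a⁆ = -(1 / 2 : K) • o.B a
  Hm_Tp : ⁅o.Hm, o.Tp⁆ = 0
  Hm_Tm : ⁅o.Hm, o.Tm⁆ = o.Tm
  Hm_T : ∀ a, ⁅o.Hm, o.T a⁆ = (1 / 2 : K) • o.T a
  Hm_B : ∀ a, ⁅o.Hm, o.B a⁆ = (1 / 2 : K) • o.B a
  B_Tp : ∀ a, ⁅o.B a, o.Tp⁆ = o.T a
  B_Tm : ∀ a, ⁅o.B a, o.Tm⁆ = 0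
  B_T : ∀ a b, ⁅o.B a, o.T b⁆ = if a = b then o.Tm else 0
  B_B : ∀ a b, ⁅o.B a, o.B b⁆ = 0
  Tp_Tm : ⁅o.Tp, o.Tm⁆ = 0
  Tp_T : ∀ a, ⁅o.Tp, o.T a⁆ = 0
  Tm_T : ∀ a, ⁅o.Tm, o.T a⁆ = 0
  T_T : ∀ a b, ⁅o.T a, o.T b⁆ = 0

/-- `σ_- = ln (1 - 2 z T_-)`. -/
def σm : (U K 𝔞)⟦X⟧ := flog K (-((2 : K) • (PowerSeries.X * gen K o.Tm)))

/-- `T = T_+ + z (T_2² + T_3²) e^{-σ_-}`. -/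
def Tz : (U K 𝔞)⟦X⟧ :=
  gen K o.Tp +
    PowerSeries.X * ((gen K (o.T 0) ^ 2 + gen K (o.T 1) ^ 2) * fexp K (-o.σm K))

/-- `σ_+ = ln (1 - 2 z T)`. -/
def σp : (U K 𝔞)⟦X⟧ := flog K (-((2 : K) • (PowerSeries.X * o.Tz K)))

/-- `e^{α σ_+ + β σ_-}`. -/
def e (α β : K) : (U K 𝔞)⟦X⟧ := fexp K (α • o.σp K + β • o.σm K)

/-- `Φ_J = exp (H_- ⊗ σ_-)`. -/
def ΦJ : (U K 𝔞 ⊗[K] U K 𝔞)⟦X⟧ := fexp K (gen K o.Hm ⊠[K] o.σm K)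

/-- `Φ_E = exp (-2 z B_3 ⊗ T_3 e^{-½ σ_-}) exp (-2 z B_2 ⊗ T_2 e^{-½ σ_-})`. -/
def ΦE : (U K 𝔞 ⊗[K] U K 𝔞)⟦X⟧ :=
  fexp K (-((2 : K) • (PowerSeries.X *
      gen K (o.B 1) ⊠[K] (gen K (o.T 1) * fexp K (-(1 / 2 : K) • o.σm K))))) *
    fexp K (-((2 : K) • (PowerSeries.X *
      gen K (o.B 0) ⊠[K] (gen K (o.T 0) * fexp K (-(1 / 2 : K) • o.σm K)))))

/-- `Φ_A = exp (H_+ ⊗ σ_+)`. -/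
def ΦA : (U K 𝔞 ⊗[K] U K 𝔞)⟦X⟧ := fexp K (gen K o.Hp ⊠[K] o.σp K)

/-- The twisting element `F = Φ_A Φ_E Φ_J`. -/
def F : (U K 𝔞 ⊗[K] U K 𝔞)⟦X⟧ := o.ΦA K * o.ΦE K * o.ΦJ K

/-- `Δ_J`, the coproduct twisted by `Φ_J`. -/
def ΔJ : U K 𝔞 →ₗ[K] (U K 𝔞 ⊗[K] U K 𝔞)⟦X⟧ := twistComul K (Δ₀ K 𝔞) (o.ΦJ K)

/-- `Δ_E`, the coproduct twisted by `Φ_E Φ_J`. -/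
def ΔE : U K 𝔞 →ₗ[K] (U K 𝔞 ⊗[K] U K 𝔞)⟦X⟧ := twistComul K (Δ₀ K 𝔞) (o.ΦE K * o.ΦJ K)

/-- `Δ_F`, the coproduct twisted by `F`. -/
def ΔF : U K 𝔞 →ₗ[K] (U K 𝔞 ⊗[K] U K 𝔞)⟦X⟧ := twistComul K (Δ₀ K 𝔞) (o.F K)

/-- `S_F`, the antipode twisted by `F`. -/
def SF : U K 𝔞 →ₗ[K] (U K 𝔞)⟦X⟧ := twistAntipode K (S₀ K 𝔞) (o.F K)

/-- `R = τ(F) F⁻¹`. -/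
def R : (U K 𝔞 ⊗[K] U K 𝔞)⟦X⟧ := flip K (o.F K) * Ring.inverse (o.F K)

/-- `2 (H_+ ∧ T_+ + H_- ∧ T_- + B_2 ∧ T_2 + B_3 ∧ T_3)`. -/
def r : 𝔞 ⊗[K] 𝔞 :=
  (2 : K) • (wedge K o.Hp o.Tp + wedge K o.Hm o.Tm + wedge K (o.B 0) (o.T 0) +
    wedge K (o.B 1) (o.T 1))

/-- The coproduct `Δ_F` on `H_±, T_±, T_a, B_a`. -/
structure Coproducts : Prop where
  Hp : o.ΔF K (UniversalEnvelopingAlgebra.ι K o.Hp) =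
    gen K o.Hp ⊠[K] o.e K (-1) 0 + 1 ⊠[K] gen K o.Hp
  Hm : o.ΔF K (UniversalEnvelopingAlgebra.ι K o.Hm) =
    gen K o.Hm ⊠[K] o.e K 0 (-1) + 1 ⊠[K] gen K o.Hm +
      (2 : K) • (PowerSeries.X *
        gen K (o.B 0) ⊠[K] (gen K (o.T 0) * o.e K (-(1 / 2)) (-(3 / 2)))) +
      (2 : K) • (PowerSeries.X *
        gen K (o.B 1) ⊠[K] (gen K (o.T 1) * o.e K (-(1 / 2)) (-(3 / 2)))) +
      (2 : K) • (PowerSeries.X ^ 2 *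
        gen K o.Hp ⊠[K] ((gen K (o.T 0) ^ 2 + gen K (o.T 1) ^ 2) * o.e K (-1) (-2)))
  B : ∀ a, o.ΔF K (UniversalEnvelopingAlgebra.ι K (o.B a)) =
    gen K (o.B a) ⊠[K] o.e K (-(1 / 2)) (-(1 / 2)) + 1 ⊠[K] gen K (o.B a) +
      (2 : K) • (PowerSeries.X * gen K o.Hp ⊠[K] (gen K (o.T a) * o.e K (-1) (-1)))
  Tp : o.ΔF K (UniversalEnvelopingAlgebra.ι K o.Tp) =
    gen K o.Tp ⊠[K] o.e K 1 0 + 1 ⊠[K] gen K o.Tp -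
      (2 : K) • (PowerSeries.X *
        gen K (o.T 0) ⊠[K] (gen K (o.T 0) * o.e K (1 / 2) (-(1 / 2)))) -
      (2 : K) • (PowerSeries.X *
        gen K (o.T 1) ⊠[K] (gen K (o.T 1) * o.e K (1 / 2) (-(1 / 2)))) +
      (2 : K) • (PowerSeries.X ^ 2 *
        gen K o.Tm ⊠[K] ((gen K (o.T 0) ^ 2 + gen K (o.T 1) ^ 2) * o.e K 0 (-1)))
  Tm : o.ΔF K (UniversalEnvelopingAlgebra.ι K o.Tm) =
    gen K o.Tm ⊠[K] o.e K 0 1 + 1 ⊠[K] gen K o.Tm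
  T : ∀ a, o.ΔF K (UniversalEnvelopingAlgebra.ι K (o.T a)) =
    gen K (o.T a) ⊠[K] o.e K (1 / 2) (1 / 2) + o.e K 0 1 ⊠[K] gen K (o.T a)

/-- The assertions about the twisting element `F ∈ (U(𝔞) ⊗ U(𝔞))⟦z⟧` and about the Hopf algebra
`U_z(𝔞)` that it defines, for a Lie algebra `𝔞` that contains the eight generators. -/
structure TwistedHopf : Prop where
  /-- `F` is a factorizable twist. -/
  twist : IsFactorizableTwist K (Δ₀ K 𝔞) (ε₀ K 𝔞) (o.F K)
  /-- `Φ_J` is a Jordanian twist. -/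
  jordanian : IsFactorizableTwist K (Δ₀ K 𝔞) (ε₀ K 𝔞) (o.ΦJ K)
  /-- `Φ_E Φ_J` is an extended Jordanian twist. -/
  extended : IsFactorizableTwist K (Δ₀ K 𝔞) (ε₀ K 𝔞) (o.ΦE K * o.ΦJ K)
  /-- `Φ_A` is a twist for the coproduct `Δ_E`. -/
  additional : IsFactorizableTwist K (o.ΔE K) (ε₀ K 𝔞) (o.ΦA K)
  /-- `Φ_A` turns `Δ_E` into `Δ_F`. -/
  comul_additional : twistComul K (o.ΔE K) (o.ΦA K) = o.ΔF K
  /-- `Φ_A` is Jordanian for the pair `H_+, T`. -/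
  Hp_Tz : ringCommutator (gen K o.Hp) (o.Tz K) = o.Tz K
  /-- `v` is invertible, so that `S_F = v S v⁻¹` makes sense. -/
  isUnit_v : IsUnit (twistV K (S₀ K 𝔞) (o.F K))
  /-- `U(𝔞)⟦z⟧` with `Δ_F`, `ε`, `S_F` is a topological Hopf algebra. -/
  hopf : IsFormalHopfAlgebra K (o.ΔF K) (ε₀ K 𝔞) (o.SF K)
  /-- The coproducts of the eight generators. -/
  coproducts : o.Coproducts K
  /-- `R = τ(F) F⁻¹` is a universal `R`-matrix. -/
  rMatrix : IsTriangularRMatrix K (o.ΔF K) (o.R K)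
  /-- `R = τ(Φ_A) τ(Φ_E) τ(Φ_J) Φ_J⁻¹ Φ_E⁻¹ Φ_A⁻¹`. -/
  rMatrix_eq : o.R K = flip K (o.ΦA K) * flip K (o.ΦE K) * flip K (o.ΦJ K) *
    Ring.inverse (o.ΦJ K) * Ring.inverse (o.ΦE K) * Ring.inverse (o.ΦA K)
  /-- `R = 1 + z r + O(z²)`. -/
  rMatrix_zero : PowerSeries.coeff 0 (o.R K) = 1
  rMatrix_one : PowerSeries.coeff 1 (o.R K) = toU2 K (o.r K)
  /-- `r` is a classical `r`-matrix. -/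
  yangBaxter : ClassicalYangBaxter K (o.r K)

end

end CarrierGens

namespace WeylGens

variable (K : Type*) [Field K] {𝔞 : Type*} [LieRing 𝔞] [LieAlgebra K 𝔞]
variable (w : WeylGens 𝔞)

/-- The three successive coproducts of `J_1` and `A_a`. -/
structure Coproducts : Prop where
  J1_J : w.ΔJ K (UniversalEnvelopingAlgebra.ι K w.J1) = gen K w.J1 ⊠[K] 1 + 1 ⊠[K] gen K w.J1
  J1_E : w.ΔE K (UniversalEnvelopingAlgebra.ι K w.J1) = gen K w.J1 ⊠[K] 1 + 1 ⊠[K] gen K w.J1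
  J1_F : w.ΔF K (UniversalEnvelopingAlgebra.ι K w.J1) = gen K w.J1 ⊠[K] 1 + 1 ⊠[K] gen K w.J1
  A_J : ∀ a, w.ΔJ K (UniversalEnvelopingAlgebra.ι K (w.A a)) =
    gen K (w.A a) ⊠[K] w.e K 0 (-(1 / 2)) + 1 ⊠[K] gen K (w.A a) +
      (2 : K) • (PowerSeries.X * gen K w.Hm ⊠[K] (gen K (w.T a) * w.e K 0 (-1)))
  A_E : ∀ a, w.ΔE K (UniversalEnvelopingAlgebra.ι K (w.A a)) =
    gen K (w.A a) ⊠[K] w.e K 0 (-(1 / 2)) + 1 ⊠[K] gen K (w.A a) +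
      (2 : K) • (PowerSeries.X * gen K w.Hp ⊠[K] (gen K (w.T a) * w.e K 0 (-1))) +
      (2 : K) • (PowerSeries.X * gen K (w.B a) ⊠[K] (w.Tz K * w.e K 0 (-(1 / 2)))) -
      ∑ b, ((2 : K) * (eps2 a b : K)) •
        (PowerSeries.X * gen K w.J1 ⊠[K] (gen K (w.T b) * w.e K 0 (-1)))
  A_F : ∀ a, w.ΔF K (UniversalEnvelopingAlgebra.ι K (w.A a)) =
    gen K (w.A a) ⊠[K] w.e K (1 / 2) (-(1 / 2)) + 1 ⊠[K] gen K (w.A a) +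
      (2 : K) • (PowerSeries.X * gen K w.Hp ⊠[K] (gen K (w.T a) * w.e K (-1) (-1))) +
      (2 : K) • (PowerSeries.X *
        gen K (w.B a) ⊠[K] (w.Tz K * w.e K (-(1 / 2)) (-(1 / 2)))) -
      ∑ b, ((2 : K) * (eps2 a b : K)) •
        (PowerSeries.X * gen K w.J1 ⊠[K] (gen K (w.T b) * w.e K 0 (-1)))

end WeylGens

/-! ### The conformal algebra `so(4,2)` -/

section SO42

variable (K : Type*) [Field K]

/-- `so(4,2)`, the `6 × 6` matrices that are skew for the form `diag(1,1,1,1,-1,-1)`. -/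
abbrev so42 : LieSubalgebra K (Matrix (Fin 4 ⊕ Fin 2) (Fin 4 ⊕ Fin 2) K) :=
  LieAlgebra.Orthogonal.so' (Fin 4) (Fin 2) K

/-- The diagonal entries `η_a` of the form. -/
def η : Fin 4 ⊕ Fin 2 → K := Sum.elim (fun _ => 1) (fun _ => -1)

/-- `M_{ab} = η_b E_{ab} - η_a E_{ba}`, with `E_{ab}` the matrix units. -/
def M (a b : Fin 4 ⊕ Fin 2) : so42 K :=
  ⟨Matrix.single a b (η K b) - Matrix.single b a (η K a), by
    change _ ∈ skewAdjointMatricesSubmodule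
      (LieAlgebra.Orthogonal.indefiniteDiagonal (Fin 4) (Fin 2) K)
    rw [mem_skewAdjointMatricesSubmodule]
    change (_ : Matrix _ _ K).transpose * Matrix.diagonal (η K) = Matrix.diagonal (η K) * _
    ext i j
    simp only [Matrix.mul_diagonal, Matrix.diagonal_mul, Matrix.transpose_apply, Matrix.sub_apply,
      Matrix.neg_apply, Matrix.single_apply]
    grind⟩

/-- The coordinates `x¹, x², x³` (positive). -/
def xs (i : Fin 3) : Fin 4 ⊕ Fin 2 := Sum.inl i.castSucc
/-- The coordinate `x⁴` (positive). -/
def x4 : Fin 4 ⊕ Fin 2 := Sum.inl 3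
/-- The coordinate `x⁰` (negative). -/
def x0 : Fin 4 ⊕ Fin 2 := Sum.inr 0
/-- The coordinate `x⁵` (negative). -/
def x5 : Fin 4 ⊕ Fin 2 := Sum.inr 1

/-! The conformal basis. Spatial indices `1, 2, 3` are represented by `0, 1, 2 : Fin 3`. -/

/-- The rotations `J_1, J_2, J_3`. -/
def J (i : Fin 3) : so42 K := M K (xs (i + 2)) (xs (i + 1))

/-- The boosts `K_1, K_2, K_3`. -/
def Kb (i : Fin 3) : so42 K := M K x0 (xs i)

/-- The time translation `P_0`. -/
def P0 : so42 K := M K x0 x4 + M K x0 x5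

/-- The space translations `P_1, P_2, P_3`. -/
def P (i : Fin 3) : so42 K := M K (xs i) x4 + M K (xs i) x5

/-- The conformal transformation `C_0`. -/
def C0 : so42 K := (1 / 2 : K) • (M K x0 x4 - M K x0 x5)

/-- The conformal transformations `C_1, C_2, C_3`. -/
def C (i : Fin 3) : so42 K := (1 / 2 : K) • (M K (xs i) x4 - M K (xs i) x5)

/-- The dilation `D`. -/
def D : so42 K := -M K x4 x5

/-- The symbol `ε_{ijk}`. -/
def eps3 (i j k : Fin 3) : ℤ :=
  ((j.val : ℤ) - i.val) * ((k.val : ℤ) - j.val) * ((k.val : ℤ) - i.val) / 2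

/-- The fifteen conformal generators `J_i, K_i, P_0, P_i, C_0, C_i, D`. -/
def conformalGens : Fin 15 → so42 K :=
  ![J K 0, J K 1, J K 2, Kb K 0, Kb K 1, Kb K 2, P0 K, P K 0, P K 1, P K 2,
    C0 K, C K 0, C K 1, C K 2, D K]

/-- The commutation relations of `so(4,2)` in the conformal basis. -/
structure ConformalRelations : Prop where
  J_J : ∀ i j, ⁅J K i, J K j⁆ = ∑ k, eps3 i j k • J K k
  J_K : ∀ i j, ⁅J K i, Kb K j⁆ = ∑ k, eps3 i j k • Kb K k
  J_P : ∀ i j, ⁅J K i, P K j⁆ = ∑ k, eps3 i j k • P K k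
  J_C : ∀ i j, ⁅J K i, C K j⁆ = ∑ k, eps3 i j k • C K k
  J_P0 : ∀ i, ⁅J K i, P0 K⁆ = 0
  J_C0 : ∀ i, ⁅J K i, C0 K⁆ = 0
  J_D : ∀ i, ⁅J K i, D K⁆ = 0
  K_K : ∀ i j, ⁅Kb K i, Kb K j⁆ = -∑ k, eps3 i j k • J K k
  K_P : ∀ i j, ⁅Kb K i, P K j⁆ = if i = j then P0 K else 0
  K_P0 : ∀ i, ⁅Kb K i, P0 K⁆ = P K i
  K_C : ∀ i j, ⁅Kb K i, C K j⁆ = if i = j then C0 K else 0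
  K_C0 : ∀ i, ⁅Kb K i, C0 K⁆ = C K i
  K_D : ∀ i, ⁅Kb K i, D K⁆ = 0
  P0_C0 : ⁅P0 K, C0 K⁆ = D K
  P0_C : ∀ i, ⁅P0 K, C K i⁆ = -Kb K i
  P_C0 : ∀ i, ⁅P K i, C0 K⁆ = Kb K i
  P_C : ∀ i j, ⁅P K i, C K j⁆ = -(if i = j then D K else 0) + ∑ k, eps3 i j k • J K k
  P0_D : ⁅P0 K, D K⁆ = -P0 K
  P_D : ∀ i, ⁅P K i, D K⁆ = -P K i
  C0_D : ⁅C0 K, D K⁆ = C0 K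
  C_D : ∀ i, ⁅C K i, D K⁆ = C K i
  P0_P : ∀ i, ⁅P0 K, P K i⁆ = 0
  P_P : ∀ i j, ⁅P K i, P K j⁆ = 0
  C0_C : ∀ i, ⁅C0 K, C K i⁆ = 0
  C_C : ∀ i j, ⁅C K i, C K j⁆ = 0

/-- The generators `H_±, T_±, T_a, B_a, A_a, J_1` of the conformal null-plane basis. -/
def weylSO : WeylGens (so42 K) where
  Hp := (1 / 2 : K) • (D K + Kb K 0)
  Hm := (1 / 2 : K) • (D K - Kb K 0)
  Tp := (1 / 2 : K) • (P0 K + P K 0)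
  Tm := (1 / 2 : K) • (P0 K - P K 0)
  T := ![(1 / 2 : K) • (P K 1 - P K 2), (1 / 2 : K) • (P K 1 + P K 2)]
  B := ![(1 / 2 : K) • (Kb K 1 + J K 2 - Kb K 2 + J K 1),
    (1 / 2 : K) • (Kb K 1 + J K 2 + Kb K 2 - J K 1)]
  A := ![(1 / 2 : K) • (Kb K 1 - J K 2 - Kb K 2 - J K 1),
    (1 / 2 : K) • (Kb K 1 - J K 2 + Kb K 2 + J K 1)]
  J1 := J K 0

/-- The eight generators `H_±, T_±, T_a, B_a` of the carrier subalgebra. -/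
def carrierGens : Fin 8 → so42 K :=
  ![(weylSO K).Hp, (weylSO K).Hm, (weylSO K).Tp, (weylSO K).Tm, (weylSO K).T 0, (weylSO K).T 1,
    (weylSO K).B 0, (weylSO K).B 1]

/-- The eleven generators `J_i, K_i, P_μ, D` of the Weyl--Poincaré subalgebra. -/
def weylPoincareGens : Fin 11 → so42 K :=
  ![J K 0, J K 1, J K 2, Kb K 0, Kb K 1, Kb K 2, P0 K, P K 0, P K 1, P K 2, D K]

/-- The carrier subalgebra `L`, generated by `H_±, T_±, T_a, B_a`. -/
def carrier : LieSubalgebra K (so42 K) :=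
  LieSubalgebra.lieSpan K (so42 K) (Set.range (carrierGens K))

/-- The Weyl--Poincaré subalgebra `WP`, generated by `J_i, K_i, P_μ, D`. -/
def weylPoincare : LieSubalgebra K (so42 K) :=
  LieSubalgebra.lieSpan K (so42 K) (Set.range (weylPoincareGens K))

theorem carrierGens_mem (i : Fin 8) : carrierGens K i ∈ carrier K :=
  LieSubalgebra.subset_lieSpan ⟨i, rfl⟩

theorem weylPoincareGens_mem (i : Fin 11) : weylPoincareGens K i ∈ weylPoincare K :=
  LieSubalgebra.subset_lieSpan ⟨i, rfl⟩

/-- `H_±, T_±, T_a, B_a` as elements of `L`. -/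
def carrierL : CarrierGens (carrier K) where
  Hp := ⟨(weylSO K).Hp, carrierGens_mem K 0⟩
  Hm := ⟨(weylSO K).Hm, carrierGens_mem K 1⟩
  Tp := ⟨(weylSO K).Tp, carrierGens_mem K 2⟩
  Tm := ⟨(weylSO K).Tm, carrierGens_mem K 3⟩
  T := ![⟨(weylSO K).T 0, carrierGens_mem K 4⟩, ⟨(weylSO K).T 1, carrierGens_mem K 5⟩]
  B := ![⟨(weylSO K).B 0, carrierGens_mem K 6⟩, ⟨(weylSO K).B 1, carrierGens_mem K 7⟩]

theorem weylSO_mem :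
    (weylSO K).Hp ∈ weylPoincare K ∧ (weylSO K).Hm ∈ weylPoincare K ∧
    (weylSO K).Tp ∈ weylPoincare K ∧ (weylSO K).Tm ∈ weylPoincare K ∧
    (∀ a, (weylSO K).T a ∈ weylPoincare K) ∧ (∀ a, (weylSO K).B a ∈ weylPoincare K) ∧
    (∀ a, (weylSO K).A a ∈ weylPoincare K) ∧ (weylSO K).J1 ∈ weylPoincare K := by
  have hJ : ∀ i, J K i ∈ weylPoincare K := by
    intro i; fin_cases i
    exacts [weylPoincareGens_mem K 0, weylPoincareGens_mem K 1, weylPoincareGens_mem K 2]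
  have hK : ∀ i, Kb K i ∈ weylPoincare K := by
    intro i; fin_cases i
    exacts [weylPoincareGens_mem K 3, weylPoincareGens_mem K 4, weylPoincareGens_mem K 5]
  have hP0 : P0 K ∈ weylPoincare K := weylPoincareGens_mem K 6
  have hP : ∀ i, P K i ∈ weylPoincare K := by
    intro i; fin_cases i
    exacts [weylPoincareGens_mem K 7, weylPoincareGens_mem K 8, weylPoincareGens_mem K 9]
  have hD : D K ∈ weylPoincare K := weylPoincareGens_mem K 10
  have hs : ∀ x, x ∈ weylPoincare K → (1 / 2 : K) • x ∈ weylPoincare K :=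
    fun x hx => (weylPoincare K).smul_mem _ hx
  refine ⟨hs _ (add_mem hD (hK 0)), hs _ (sub_mem hD (hK 0)), hs _ (add_mem hP0 (hP 0)),
    hs _ (sub_mem hP0 (hP 0)), ?_, ?_, ?_, hJ 0⟩ <;> intro a <;> fin_cases a
  · exact hs _ (sub_mem (hP 1) (hP 2))
  · exact hs _ (add_mem (hP 1) (hP 2))
  · exact hs _ (add_mem (sub_mem (add_mem (hK 1) (hJ 2)) (hK 2)) (hJ 1))
  · exact hs _ (sub_mem (add_mem (add_mem (hK 1) (hJ 2)) (hK 2)) (hJ 1))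
  · exact hs _ (sub_mem (sub_mem (sub_mem (hK 1) (hJ 2)) (hK 2)) (hJ 1))
  · exact hs _ (add_mem (add_mem (sub_mem (hK 1) (hJ 2)) (hK 2)) (hJ 1))

/-- `H_±, T_±, T_a, B_a, A_a, J_1` as elements of `WP`. -/
def weylWP : WeylGens (weylPoincare K) where
  Hp := ⟨(weylSO K).Hp, (weylSO_mem K).1⟩
  Hm := ⟨(weylSO K).Hm, (weylSO_mem K).2.1⟩
  Tp := ⟨(weylSO K).Tp, (weylSO_mem K).2.2.1⟩
  Tm := ⟨(weylSO K).Tm, (weylSO_mem K).2.2.2.1⟩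
  T := fun a => ⟨(weylSO K).T a, (weylSO_mem K).2.2.2.2.1 a⟩
  B := fun a => ⟨(weylSO K).B a, (weylSO_mem K).2.2.2.2.2.1 a⟩
  A := fun a => ⟨(weylSO K).A a, (weylSO_mem K).2.2.2.2.2.2.1 a⟩
  J1 := ⟨(weylSO K).J1, (weylSO_mem K).2.2.2.2.2.2.2⟩

theorem carrier_le_weylPoincare : carrier K ≤ weylPoincare K := by
  obtain ⟨h1, h2, h3, h4, hT, hB, -, -⟩ := weylSO_mem K
  refine LieSubalgebra.lieSpan_le.mpr ?_
  rintro _ ⟨i, rfl⟩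
  fin_cases i
  exacts [h1, h2, h3, h4, hT 0, hT 1, hB 0, hB 1]

/-- The inclusion `U(L) → U(WP)`. -/
def inclL : U K (carrier K) →ₐ[K] U K (weylPoincare K) :=
  uMap K (LieSubalgebra.inclusion (carrier_le_weylPoincare K))

/-- The inclusion `U(WP) → U(so(4,2))`. -/
def inclWP : U K (weylPoincare K) →ₐ[K] U K (so42 K) := uMap K (weylPoincare K).incl

/-- `D ∧ P_0 + K_1 ∧ P_1 + K_2 ∧ P_2 + K_3 ∧ P_3 + J_3 ∧ P_2 - J_2 ∧ P_3`. -/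
def rConformal : so42 K ⊗[K] so42 K :=
  wedge K (D K) (P0 K) + wedge K (Kb K 0) (P K 0) + wedge K (Kb K 1) (P K 1) +
    wedge K (Kb K 2) (P K 2) + (wedge K (J K 2) (P K 1) - wedge K (J K 1) (P K 2))

end SO42

end ConformalTwist

end

open ConformalTwist

/-!
The twisting element is a product of exponentials whose exponents are tensors of first order, so
everything reduces to conjugation by an exponential. Substituting a series without constant term
into a scalar power series gives Taylor's formula `fsub_mul_eq`, which terminates because the
commutators that occur vanish after at most two steps. Hence the conjugates of the generators by
`Φ_J`, `Φ_E` and `Φ_A` are explicit (the lemmas `ad_J_*`, `ad_E_*` and `ad_A_*`), and composing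
them yields all the twisted coproducts. The two factors of `Φ_E` commute, so that `Φ_E` is a
single exponential (`ΦE_eq`).

For the twist property two factorizations are shown. The identity `(Δ ⊗ id)(F) = F₁₃ F₂₃`
(`comulL_F`) holds because the first legs of the exponents are primitive and their second legs
commute. For `(id ⊗ Δ_F)(F) = F₁₂ F₁₃` (`comulR_F`), the elements `e^{σ_-} = 1 - 2 z T_-` and
`e^{σ_+} = 1 - 2 z T` are group-like for `Δ_F`, so `σ_±` are primitive, which settles `Φ_J` and
`Φ_A`. The legs of `Φ_E` are reordered by conjugating with `(Φ_J)₁₂` and `(Φ_A)₁₃`, which act on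
`B_a` through its weights. The two factorizations imply the cocycle identity
(`isFactorizableTwist_of_factor`). From it the Hopf algebra structure
(`isFormalHopfAlgebra_of_twist`) and the triangular `R`-matrix (`isTriangularRMatrix_of_twist`)
follow formally: the inverse of `v` is read off by applying `a ⊗ b ⊗ c ↦ a S(b) c` to the cocycle
identity, and the classical Yang--Baxter equation is the part of order `z²` of the quantum one.

All of this uses only the brackets of the eight generators and is natural in the Lie algebra
(`map_F`, `isFormalHopfHom_uMap`). Injectivity of the maps of enveloping algebras and minimality of
the carrier are obtained without the Poincaré--Birkhoff--Witt theorem. In characteristic zero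
the operator `m ∘ Δ` acts as `2ⁿ` modulo lower terms on elements of degree `n`, so every primitive
element of `U(𝔞)` comes from `𝔞` (`exists_eq_ι_of_primitive`). Consequently a map of Lie algebras
`𝔞 → 𝔟` is injective on enveloping algebras as soon as `𝔞 → U(𝔟)` is injective
(`uMap_injective`), which holds here because matrices embed into an associative algebra. For the
carrier, the coefficient of `z` in `F` is `-2 ∑ X_i ⊗ Y_i` with linearly independent `X_i` and
linearly independent `Y_i`, which are the eight generators; an algebra that supports `F` therefore
contains them (`mem_of_supportedOn`).

The relations and the bases in `so(4,2)` are computed from the brackets of the matrices `M_{ab}`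
(`M_lie`).
-/

set_option linter.unusedSectionVars false


noncomputable section

namespace ConformalTwist

/-! ### Substitution into formal power series -/

section Substitution

variable {K : Type*} [Field K] {A B : Type*} [Ring A] [Algebra K A] [Ring B] [Algebra K B]

open PowerSeries

theorem exists_eq_X_mul {x : A⟦X⟧} (hx : constantCoeff x = 0) : ∃ y, x = X * y :=
  X_dvd_iff.mpr hx

theorem coeff_pow_eq_zero {x : A⟦X⟧} (hx : constantCoeff x = 0) {n k : ℕ} (h : n < k) :
    coeff n (x ^ k) = 0 := by
  obtain ⟨y, rfl⟩ := exists_eq_X_mul hx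
  rw [((commute_X y).symm).mul_pow, coeff_X_pow_mul', if_neg (by omega)]

theorem coeff_mul_eq_zero {x y : A⟦X⟧} {n i j : ℕ} (hx : X ^ i ∣ x) (hy : X ^ j ∣ y)
    (h : n < i + j) : coeff n (x * y) = 0 := by
  obtain ⟨x, rfl⟩ := hx
  obtain ⟨y, rfl⟩ := hy
  rw [mul_assoc, ← mul_assoc x, ← X_pow_mul (φ := x), mul_assoc, ← mul_assoc, ← pow_add,
    coeff_X_pow_mul', if_neg (by omega)]

/-- The substitution `f(x) = ∑ fₖ xᵏ` of a series `x` without constant term into a scalar series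
`f`. -/
def fsub (x : A⟦X⟧) (f : K⟦X⟧) : A⟦X⟧ :=
  mk fun n => ∑ k ∈ Finset.range (n + 1), coeff k f • coeff n (x ^ k)

theorem coeff_aeval {x : A⟦X⟧} (hx : constantCoeff x = 0) (p : Polynomial K) (n : ℕ) :
    coeff n (Polynomial.aeval x p) =
      ∑ k ∈ Finset.range (n + 1), p.coeff k • coeff n (x ^ k) := by
  rw [Polynomial.aeval_eq_sum_range' (n := max (n + 1) (p.natDegree + 1))
    (lt_of_lt_of_le (Nat.lt_succ_self _) (le_max_right _ _)), map_sum]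
  simp only [coeff_smul]
  refine (Finset.sum_subset ?_ ?_).symm
  · intro k; simp only [Finset.mem_range]; omega
  · intro k _ hk
    simp only [Finset.mem_range, not_lt] at hk
    rw [coeff_pow_eq_zero hx (by omega), smul_zero]

theorem coeff_fsub_of_lt {x : A⟦X⟧} (hx : constantCoeff x = 0) (f : K⟦X⟧) {n m : ℕ} (h : n < m) :
    coeff n (fsub x f) = coeff n (Polynomial.aeval x (trunc m f)) := by
  rw [coeff_aeval hx, fsub, coeff_mk]
  refine Finset.sum_congr rfl fun k hk => ?_
  simp only [Finset.mem_range] at hk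
  rw [coeff_trunc, if_pos (by omega)]

theorem fsub_one (x : A⟦X⟧) : fsub x (1 : K⟦X⟧) = 1 := by
  ext n
  simp [fsub, coeff_one]

theorem fsub_mul {x : A⟦X⟧} (hx : constantCoeff x = 0) (f g : K⟦X⟧) :
    fsub x (f * g) = fsub x f * fsub x g := by
  ext n
  have h1 : coeff n (fsub x f * fsub x g) =
      coeff n (Polynomial.aeval x (trunc (n + 1) f * trunc (n + 1) g)) := by
    rw [map_mul (Polynomial.aeval x), coeff_mul, coeff_mul]
    refine Finset.sum_congr rfl fun p hp => ?_
    have := Finset.HasAntidiagonal.mem_antidiagonal.mp hp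
    rw [coeff_fsub_of_lt hx f (m := n + 1) (by omega),
      coeff_fsub_of_lt hx g (m := n + 1) (by omega)]
  rw [h1, coeff_aeval hx, fsub, coeff_mk]
  refine Finset.sum_congr rfl fun k hk => ?_
  simp only [Finset.mem_range] at hk
  congr 1
  rw [coeff_mul, Polynomial.coeff_mul]
  refine Finset.sum_congr rfl fun p hp => ?_
  have := Finset.HasAntidiagonal.mem_antidiagonal.mp hp
  rw [coeff_trunc, coeff_trunc, if_pos (by omega), if_pos (by omega)]

/-- Substitution as an algebra map. -/
def fsubHom (x : A⟦X⟧) (hx : constantCoeff x = 0) : K⟦X⟧ →ₐ[K] A⟦X⟧ :=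
  AlgHom.ofLinearMap
    { toFun := fsub x
      map_add' := fun f g => by ext n; simp [fsub, add_smul, Finset.sum_add_distrib]
      map_smul' := fun c f => by ext n; simp [fsub, mul_smul, Finset.smul_sum] }
    (fsub_one x) (fsub_mul hx)

@[simp]
theorem fsubHom_apply (x : A⟦X⟧) (hx : constantCoeff x = 0) (f : K⟦X⟧) :
    fsubHom x hx f = fsub x f := rfl

theorem fsub_X {x : A⟦X⟧} (hx : constantCoeff x = 0) : fsub x (X : K⟦X⟧) = x := by
  ext n
  rw [coeff_fsub_of_lt hx _ (m := n + 2) (by omega), trunc_X, Polynomial.aeval_X]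

theorem constantCoeff_fsub (x : A⟦X⟧) {f : K⟦X⟧} (hf : constantCoeff f = 0) :
    constantCoeff (fsub x f) = 0 := by
  rw [← coeff_zero_eq_constantCoeff_apply]
  simp [fsub, hf]

/-- An algebra map that is `X`-adically continuous commutes with substitution. -/
theorem map_fsub (Φ : A⟦X⟧ →ₐ[K] B⟦X⟧) (hΦ : constantCoeff (Φ X) = 0) {x : A⟦X⟧}
    (hx : constantCoeff x = 0) (f : K⟦X⟧) : Φ (fsub x f) = fsub (Φ x) f := by
  have hx' : constantCoeff (Φ x) = 0 := by
    obtain ⟨y, rfl⟩ := exists_eq_X_mul hx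
    rw [map_mul, map_mul, hΦ, zero_mul]
  ext n
  have h : X ^ (n + 1) ∣ fsub x f - Polynomial.aeval x (trunc (n + 1) f) := by
    refine X_pow_dvd_iff.mpr fun m hm => ?_
    rw [map_sub, coeff_fsub_of_lt hx f hm, sub_self]
  obtain ⟨y, hy⟩ := h
  rw [sub_eq_iff_eq_add.mp hy, map_add, map_mul, map_pow, map_add,
    coeff_mul_eq_zero (i := n + 1) (j := 0) _ (by simp) (by omega), zero_add,
    coeff_fsub_of_lt hx' f (Nat.lt_succ_self n), ← Polynomial.aeval_algHom_apply]
  obtain ⟨z, hz⟩ := exists_eq_X_mul hΦ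
  rw [hz, ((commute_X z).symm).mul_pow]
  exact Dvd.intro _ rfl

theorem fsub_fsub {x : A⟦X⟧} (hx : constantCoeff x = 0) {g : K⟦X⟧} (hg : constantCoeff g = 0)
    (f : K⟦X⟧) : fsub x (fsub g f) = fsub (fsub x g) f :=
  map_fsub (fsubHom x hx) (by simpa [fsub_X hx] using hx) hg f

theorem semiconjBy_fsub {y x x' : A⟦X⟧} (hx : constantCoeff x = 0) (hx' : constantCoeff x' = 0)
    (h : SemiconjBy y x x') (f : K⟦X⟧) : SemiconjBy y (fsub x f) (fsub x' f) := by
  have key : ∀ p : Polynomial K, SemiconjBy y (Polynomial.aeval x p) (Polynomial.aeval x' p) := by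
    intro p
    induction p using Polynomial.induction_on' with
    | add p q hp hq => simpa using hp.add_right hq
    | monomial n a =>
      simp only [Polynomial.aeval_monomial, ← Algebra.smul_def, SemiconjBy]
      rw [mul_smul_comm, smul_mul_assoc, (h.pow_right n).eq]
  ext n
  rw [coeff_mul, coeff_mul]
  have e := congrArg (coeff n) (key (trunc (n + 1) f)).eq
  rw [coeff_mul, coeff_mul] at e
  refine (Finset.sum_congr rfl fun p hp => ?_).trans
    (e.trans (Finset.sum_congr rfl fun p hp => ?_))
  all_goals
    have := Finset.HasAntidiagonal.mem_antidiagonal.mp hp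
  · rw [coeff_fsub_of_lt hx f (m := n + 1) (by omega)]
  · rw [coeff_fsub_of_lt hx' f (m := n + 1) (by omega)]

theorem commute_fsub {y x : A⟦X⟧} (hx : constantCoeff x = 0) (h : Commute y x) (f : K⟦X⟧) :
    Commute y (fsub x f) := semiconjBy_fsub hx hx h f

end Substitution

/-! ### Exponential and logarithm -/

section ExpLog

variable {K : Type*} [Field K] {A B : Type*} [Ring A] [Algebra K A] [Ring B] [Algebra K B]

open PowerSeries

variable (K) in
/-- The scalar series `exp X`. -/
def expS : K⟦X⟧ := mk fun k => (k.factorial : K)⁻¹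

variable (K) in
/-- The scalar series `ln (1 + X)`. -/
def logS : K⟦X⟧ := mk fun k => (-1 : K) ^ (k + 1) / (k : K)

theorem fexp_eq_fsub (x : A⟦X⟧) : fexp K x = fsub x (expS K) := by
  ext n; simp [fexp, fsub, expS]

theorem flog_eq_fsub (x : A⟦X⟧) : flog K x = fsub x (logS K) := by
  ext n
  simp only [flog, fsub, logS, coeff_mk]
  rw [Finset.range_eq_Ico, Finset.sum_eq_sum_Ico_succ_bot (Nat.succ_pos n)]
  simp only [Nat.cast_zero, div_zero, zero_smul, zero_add]
  rfl

theorem constantCoeff_expS : constantCoeff (expS K) = 1 := by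
  simp [expS, constantCoeff_mk]

theorem constantCoeff_logS : constantCoeff (logS K) = 0 := by
  simp [logS, constantCoeff_mk]

theorem derivative_expS [CharZero K] : d⁄dX K (expS K) = expS K := by
  ext n
  rw [coeff_derivative, expS, coeff_mk, coeff_mk, Nat.factorial_succ]
  have : ((n : K) + 1) ≠ 0 := by exact_mod_cast n.succ_ne_zero
  push_cast
  field_simp

theorem derivative_logS_mul [CharZero K] : d⁄dX K (logS K) * (1 + X) = 1 := by
  ext n
  rw [mul_add, mul_one, map_add]
  rcases n with _ | n
  · simp [coeff_derivative, logS]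
  · have h1 : ((n : K) + 1) ≠ 0 := by exact_mod_cast n.succ_ne_zero
    have h2 : ((n : K) + 1 + 1) ≠ 0 := by exact_mod_cast (n + 1).succ_ne_zero
    simp [coeff_succ_mul_X, coeff_derivative, logS, coeff_one]
    field_simp
    ring

theorem derivative_fsub {g : K⟦X⟧} (hg : constantCoeff g = 0) (f : K⟦X⟧) :
    d⁄dX K (fsub g f) = fsub g (d⁄dX K f) * d⁄dX K g := by
  ext n
  rw [coeff_derivative, coeff_fsub_of_lt hg f (m := n + 2) (by omega), ← coeff_derivative,
    Derivation.map_aeval, smul_eq_mul, coeff_mul, coeff_mul]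
  refine Finset.sum_congr rfl fun p hp => ?_
  have := Finset.HasAntidiagonal.mem_antidiagonal.mp hp
  rw [coeff_fsub_of_lt hg _ (m := n + 1) (by omega), ← trunc_derivative]

theorem fsub_logS_expS [CharZero K] : fsub (logS K) (expS K) = 1 + X := by
  have h0 := constantCoeff_logS (K := K)
  set u := d⁄dX K (logS K) with hu
  have hu1 : u * (1 + X) = 1 := derivative_logS_mul
  set E := fsub (logS K) (expS K) with hE
  have dE : d⁄dX K E = E * u := by rw [hE, derivative_fsub h0, derivative_expS]
  have du : d⁄dX K u = -u ^ 2 := by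
    have e := congrArg (d⁄dX K) hu1
    rw [Derivation.leibniz, map_add, derivative_X, Derivation.map_one_eq_zero,
      zero_add, smul_eq_mul, smul_eq_mul, mul_one] at e
    linear_combination u * e - d⁄dX K u * hu1
  have hEu : E * u = 1 := by
    refine derivative.ext ?_ ?_
    · rw [Derivation.leibniz, dE, du, Derivation.map_one_eq_zero, smul_eq_mul, smul_eq_mul]
      ring
    · have h1 : constantCoeff u = 1 := by simpa using congrArg constantCoeff hu1
      rw [map_mul, h1, ← coeff_zero_eq_constantCoeff_apply]
      simp [hE, fsub, constantCoeff_expS]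
  linear_combination E * hu1 * (-1) + (1 + X) * hEu

theorem fsub_expS_logS [CharZero K] : fsub (expS K - 1) (logS K) = X := by
  have h0 : constantCoeff (expS K - 1) = 0 := by simp [constantCoeff_expS]
  refine derivative.ext ?_ ?_
  · rw [derivative_fsub h0, map_sub, derivative_expS, Derivation.map_one_eq_zero, sub_zero,
      derivative_X]
    have e := congrArg (fsubHom (expS K - 1) h0) (derivative_logS_mul (K := K))
    simp only [map_mul, map_add, map_one, fsubHom_apply, fsub_X h0] at e
    rwa [add_sub_cancel] at e
  · rw [constantCoeff_fsub _ constantCoeff_logS, constantCoeff_X]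

@[simp]
theorem constantCoeff_flog (x : A⟦X⟧) : constantCoeff (flog K x) = 0 := by
  rw [flog_eq_fsub]; exact constantCoeff_fsub x constantCoeff_logS

@[simp]
theorem constantCoeff_fexp (x : A⟦X⟧) : constantCoeff (fexp K x) = 1 := by
  rw [← coeff_zero_eq_constantCoeff_apply]; simp [fexp]

theorem fexp_flog [CharZero K] {x : A⟦X⟧} (hx : constantCoeff x = 0) :
    fexp K (flog K x) = 1 + x := by
  rw [fexp_eq_fsub, flog_eq_fsub, ← fsub_fsub hx constantCoeff_logS, fsub_logS_expS,
    ← fsubHom_apply x hx, map_add, map_one, fsubHom_apply, fsub_X hx]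

theorem flog_fexp_sub_one [CharZero K] {x : A⟦X⟧} (hx : constantCoeff x = 0) :
    flog K (fexp K x - 1) = x := by
  have e : fexp K x - 1 = fsub x (expS K - 1) := by
    rw [fexp_eq_fsub, ← fsubHom_apply x hx, ← fsubHom_apply x hx, map_sub, map_one]
  rw [e, flog_eq_fsub, ← fsub_fsub hx (by simp [constantCoeff_expS]), fsub_expS_logS, fsub_X hx]

theorem fexp_zero : fexp K (0 : A⟦X⟧) = 1 := by
  ext n
  rw [fexp, coeff_mk, Finset.sum_eq_single 0]
  · simp
  · intro k _ hk; simp [hk]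
  · simp

theorem fexp_add {x y : A⟦X⟧} [CharZero K] (hx : constantCoeff x = 0) (hy : constantCoeff y = 0)
    (h : Commute x y) : fexp K (x + y) = fexp K x * fexp K y := by
  ext n
  set c : ℕ → K := fun k => (k.factorial : K)⁻¹
  set g : ℕ × ℕ → A := fun p => (c p.1 * c p.2) • coeff n (x ^ p.1 * y ^ p.2) with hg
  set S := Finset.range (n + 1) ×ˢ Finset.range (n + 1)
  have hR : coeff n (fexp K x * fexp K y) = ∑ p ∈ S, g p := by
    have : coeff n (fexp K x * fexp K y) = coeff n
        ((Polynomial.aeval x (trunc (n + 1) (expS K))) *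
          Polynomial.aeval y (trunc (n + 1) (expS K))) := by
      rw [coeff_mul, coeff_mul]
      refine Finset.sum_congr rfl fun p hp => ?_
      have := Finset.HasAntidiagonal.mem_antidiagonal.mp hp
      rw [fexp_eq_fsub, fexp_eq_fsub, coeff_fsub_of_lt hx _ (m := n + 1) (by omega),
        coeff_fsub_of_lt hy _ (m := n + 1) (by omega)]
    have ha : ∀ z : A⟦X⟧, Polynomial.aeval z (trunc (n + 1) (expS K)) =
        ∑ k ∈ Finset.range (n + 1), c k • z ^ k := by
      intro z
      rw [Polynomial.aeval_eq_sum_range' (natDegree_trunc_lt _ n)]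
      refine Finset.sum_congr rfl fun k hk => ?_
      rw [coeff_trunc, if_pos (Finset.mem_range.mp hk), expS, coeff_mk]
    rw [this, ha, ha, Finset.sum_mul_sum, ← Finset.sum_product', map_sum]
    refine Finset.sum_congr rfl fun p _ => ?_
    rw [hg, smul_mul_smul_comm, coeff_smul]
  have hL : coeff n (fexp K (x + y)) = ∑ p ∈ S with p.1 + p.2 ≤ n, g p := by
    rw [← Finset.sum_fiberwise_of_maps_to (t := Finset.range (n + 1)) (g := fun p => p.1 + p.2)
      (by intro p hp; simp only [Finset.mem_filter, Finset.mem_range] at hp ⊢; omega), fexp,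
      coeff_mk]
    refine Finset.sum_congr rfl fun k hk => ?_
    have : ({p ∈ {p ∈ S | p.1 + p.2 ≤ n} | p.1 + p.2 = k} : Finset (ℕ × ℕ)) =
        Finset.HasAntidiagonal.antidiagonal k := by
      ext p
      simp only [S, Finset.mem_filter, Finset.mem_product, Finset.mem_range,
        Finset.HasAntidiagonal.mem_antidiagonal] at hk ⊢
      omega
    rw [this, h.add_pow', map_sum, Finset.smul_sum]
    refine Finset.sum_congr rfl fun p hp => ?_
    have hp := Finset.HasAntidiagonal.mem_antidiagonal.mp hp
    rw [hg, ← Nat.cast_smul_eq_nsmul K, coeff_smul, smul_smul]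
    congr 1
    rw [← hp, Nat.choose_symm_add, Nat.add_choose,
      Nat.cast_div (Nat.factorial_mul_factorial_dvd_factorial_add _ _)
      (by exact_mod_cast mul_ne_zero (Nat.factorial_ne_zero _) (Nat.factorial_ne_zero _))]
    have h1 : ((p.1.factorial : ℕ) : K) ≠ 0 := by exact_mod_cast Nat.factorial_ne_zero _
    have h2 : ((p.2.factorial : ℕ) : K) ≠ 0 := by exact_mod_cast Nat.factorial_ne_zero _
    have h3 : (((p.1 + p.2).factorial : ℕ) : K) ≠ 0 := by exact_mod_cast Nat.factorial_ne_zero _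
    simp only [c]
    push_cast
    field_simp
  rw [hL, hR, Finset.sum_filter]
  refine Finset.sum_congr rfl fun p _ => ?_
  split_ifs with hp
  · rfl
  · rw [hg]
    dsimp only
    obtain ⟨x', rfl⟩ := exists_eq_X_mul hx
    obtain ⟨y', rfl⟩ := exists_eq_X_mul hy
    rw [coeff_mul_eq_zero (i := p.1) (j := p.2), smul_zero]
    · rw [((commute_X x').symm).mul_pow]; exact Dvd.intro _ rfl
    · rw [((commute_X y').symm).mul_pow]; exact Dvd.intro _ rfl
    · omega

theorem fexp_neg_mul [CharZero K] {x : A⟦X⟧} (hx : constantCoeff x = 0) :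
    fexp K (-x) * fexp K x = 1 := by
  rw [← fexp_add (by simp [hx]) hx (Commute.refl x).neg_left, neg_add_cancel, fexp_zero]

theorem fexp_mul_neg [CharZero K] {x : A⟦X⟧} (hx : constantCoeff x = 0) :
    fexp K x * fexp K (-x) = 1 := by
  simpa using fexp_neg_mul (K := K) (x := -x) (by simp [hx])

theorem isUnit_fexp [CharZero K] {x : A⟦X⟧} (hx : constantCoeff x = 0) : IsUnit (fexp K x) :=
  ⟨⟨_, _, fexp_mul_neg hx, fexp_neg_mul hx⟩, rfl⟩

theorem map_fexp (Φ : A⟦X⟧ →ₐ[K] B⟦X⟧) (hΦ : Φ X = X) {x : A⟦X⟧} (hx : constantCoeff x = 0) :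
    Φ (fexp K x) = fexp K (Φ x) := by
  rw [fexp_eq_fsub, fexp_eq_fsub, map_fsub Φ (by simp [hΦ]) hx]

theorem map_flog (Φ : A⟦X⟧ →ₐ[K] B⟦X⟧) (hΦ : Φ X = X) {x : A⟦X⟧} (hx : constantCoeff x = 0) :
    Φ (flog K x) = flog K (Φ x) := by
  rw [flog_eq_fsub, flog_eq_fsub, map_fsub Φ (by simp [hΦ]) hx]

theorem semiconjBy_fexp {y x x' : A⟦X⟧} (hx : constantCoeff x = 0) (hx' : constantCoeff x' = 0)
    (h : SemiconjBy y x x') : SemiconjBy y (fexp K x) (fexp K x') := by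
  rw [fexp_eq_fsub, fexp_eq_fsub]; exact semiconjBy_fsub hx hx' h _

theorem commute_fexp {y x : A⟦X⟧} (hx : constantCoeff x = 0) (h : Commute y x) :
    Commute y (fexp K x) := semiconjBy_fexp hx hx h

theorem commute_flog {y x : A⟦X⟧} (hx : constantCoeff x = 0) (h : Commute y x) :
    Commute y (flog K x) := by
  rw [flog_eq_fsub]; exact commute_fsub hx h _

theorem aeval_mul_eq [CharZero K] {P x y w : A⟦X⟧} (h1 : P * x = x * P + y)
    (h2 : P * y = y * P + w) (h3 : P * w = w * P) (p : Polynomial K) :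
    Polynomial.aeval P p * x = x * Polynomial.aeval P p +
      y * Polynomial.aeval P (Polynomial.derivative p) + (1 / 2 : K) •
      (w * Polynomial.aeval P (Polynomial.derivative (Polynomial.derivative p))) := by
  induction p using Polynomial.induction_on with
  | C a => simp [Algebra.commutes]
  | add p q hp hq => simp only [map_add, add_mul, mul_add, hp, hq, smul_add]; abel
  | monomial n a ih =>
    rw [pow_succ', ← mul_assoc, Polynomial.C_mul_X_eq_monomial, ← Polynomial.C_mul_X_eq_monomial,
      mul_comm (Polynomial.C a), mul_assoc]
    generalize Polynomial.C a * Polynomial.X ^ n = q at ih ⊢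
    have e1 : Polynomial.derivative (Polynomial.X * q) =
        q + Polynomial.X * Polynomial.derivative q := by simp
    have e2 : Polynomial.derivative (Polynomial.derivative (Polynomial.X * q)) =
        (2 : K) • Polynomial.derivative q +
          Polynomial.X * Polynomial.derivative (Polynomial.derivative q) := by
      rw [e1]; simp only [Polynomial.derivative_add, Polynomial.derivative_mul,
        Polynomial.derivative_X, one_mul, two_smul]; abel
    rw [e2, e1]
    simp only [map_mul, map_add, map_smul, Polynomial.aeval_X, mul_assoc, ih, mul_add,
      mul_smul_comm, smul_add, smul_smul, one_div]
    simp only [← mul_assoc, h1, h2, h3, add_mul]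
    rw [inv_mul_cancel₀ (two_ne_zero), one_smul]
    abel

/-- Taylor's formula `f(P) x = x f(P) + [P, x] f'(P) + ½ [P, [P, x]] f''(P)`, when `P` commutes with
`[P, [P, x]]`. -/
theorem fsub_mul_eq [CharZero K] {P x y w : A⟦X⟧} (hP : constantCoeff P = 0)
    (h1 : P * x = x * P + y) (h2 : P * y = y * P + w) (h3 : P * w = w * P) (f : K⟦X⟧) :
    fsub P f * x = x * fsub P f + y * fsub P (d⁄dX K f) +
      (1 / 2 : K) • (w * fsub P (d⁄dX K (d⁄dX K f))) := by
  ext n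
  have e := congrArg (coeff n) (aeval_mul_eq h1 h2 h3 (trunc (n + 3) f))
  rw [← trunc_derivative, ← trunc_derivative] at e
  simp only [map_add, coeff_smul, coeff_mul] at e ⊢
  have key : ∀ (m : ℕ) (g : K⟦X⟧) (p : ℕ × ℕ), n < m → p ∈ Finset.HasAntidiagonal.antidiagonal n →
      coeff p.1 (fsub P g) = coeff p.1 (Polynomial.aeval P (trunc m g)) ∧
      coeff p.2 (fsub P g) = coeff p.2 (Polynomial.aeval P (trunc m g)) := by
    intro m g p hm hp
    have := Finset.HasAntidiagonal.mem_antidiagonal.mp hp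
    exact ⟨coeff_fsub_of_lt hP _ (by omega), coeff_fsub_of_lt hP _ (by omega)⟩
  convert e using 1
  · refine Finset.sum_congr rfl fun p hp => ?_
    rw [(key (n + 3) _ p (by omega) hp).1]
  · congr 1
    · congr 1
      · refine Finset.sum_congr rfl fun p hp => ?_
        rw [(key (n + 3) _ p (by omega) hp).2]
      · refine Finset.sum_congr rfl fun p hp => ?_
        rw [(key (n + 2) _ p (by omega) hp).2]
    · congr 1
      refine Finset.sum_congr rfl fun p hp => ?_
      rw [(key (n + 1) _ p (by omega) hp).2]

/-- `[ln (1 + x), y] = [x, y] (1 + x)⁻¹`, when `x` commutes with `[x, y]`. -/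
theorem flog_mul_eq [CharZero K] {x y w : A⟦X⟧} (hx : constantCoeff x = 0)
    (h1 : x * y = y * x + w) (h2 : Commute x w) :
    flog K x * y = y * flog K x + w * fexp K (-flog K x) := by
  have e := fsub_mul_eq hx h1 (w := 0) (by simpa using h2.eq) (by simp) (logS K)
  rw [flog_eq_fsub, e, zero_mul, smul_zero, add_zero]
  congr 2
  have hu : IsUnit (1 + x) := by
    rw [← fexp_flog (K := K) hx]; exact isUnit_fexp (constantCoeff_flog x)
  refine hu.mul_right_cancel ?_
  have e1 := congrArg (fsubHom x hx) (derivative_logS_mul (K := K))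
  simp only [map_mul, map_add, map_one, fsubHom_apply, fsub_X hx] at e1
  rw [e1, ← flog_eq_fsub, ← fexp_flog (K := K) hx, fexp_neg_mul (constantCoeff_flog x)]

/-- `e^P x e^{-P} = x + [P, x] + ½ [P, [P, x]]`, when `P` commutes with `[P, [P, x]]`. -/
theorem semiconjBy_fexp_of_second [CharZero K] {P x y w : A⟦X⟧} (hP : constantCoeff P = 0)
    (h1 : P * x = x * P + y) (h2 : P * y = y * P + w) (h3 : P * w = w * P) :
    SemiconjBy (fexp K P) x (x + y + (1 / 2 : K) • w) := by
  have e := fsub_mul_eq hP h1 h2 h3 (expS K)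
  rw [derivative_expS, derivative_expS, ← fexp_eq_fsub] at e
  rw [SemiconjBy, e, add_mul, add_mul, smul_mul_assoc]

/-- `e^P x e^{-P} = x + [P, x]`, when `P` commutes with `[P, x]`. -/
theorem semiconjBy_fexp_of_first [CharZero K] {P x y : A⟦X⟧} (hP : constantCoeff P = 0)
    (h1 : P * x = x * P + y) (h2 : Commute P y) :
    SemiconjBy (fexp K P) x (x + y) := by
  simpa using semiconjBy_fexp_of_second (K := K) hP h1 (w := 0) (by simpa using h2.eq) (by simp)

/-- `e^{hs} x e^{-hs} = x e^{cs}`, when `[h, x] = c x` and `s` commutes with `h` and `x`. -/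
theorem semiconjBy_fexp_of_weight [CharZero K] {h s x : A⟦X⟧} {c : K} (hs : constantCoeff s = 0)
    (h1 : h * x = x * h + c • x) (h2 : Commute h s) (h3 : Commute s x) :
    SemiconjBy (fexp K (h * s)) x (x * fexp K (c • s)) := by
  have hc : Commute (c • s) (h * s) :=
    ((Commute.mul_right h2.symm (Commute.refl s)).smul_left c)
  have e : SemiconjBy x (c • s + h * s) (h * s) := by
    rw [SemiconjBy, mul_add, mul_assoc h, h3.eq, ← mul_assoc h, h1, add_mul, mul_smul_comm,
      smul_mul_assoc, mul_assoc, add_comm]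
  have e2 := (semiconjBy_fexp (K := K) (by simp [hs]) (by simp [hs]) e).eq
  rw [fexp_add (by simp [hs]) (by simp [hs]) hc] at e2
  rw [SemiconjBy, ← e2, mul_assoc]

end ExpLog

/-! ### Continuous `z`-linear maps and legs of tensors -/

section Legs

variable {K : Type*} [Field K] {A B A' B' : Type*} [Ring A] [Algebra K A] [Ring B] [Algebra K B]
  [Ring A'] [Algebra K A'] [Ring B'] [Algebra K B']

open PowerSeries

/-- A `z`-linear map is determined by its values on constants. (Continuity is automatic.) -/
theorem ext_of_C {f g : A⟦X⟧ →ₗ[K] B⟦X⟧} (hf : ∀ x, f (X * x) = X * f x)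
    (hg : ∀ x, g (X * x) = X * g x) (h : ∀ a, f (PowerSeries.C a) = g (PowerSeries.C a))
    (x : A⟦X⟧) : f x = g x := by
  have key : ∀ n x, coeff n (f x) = coeff n (g x) := by
    intro n
    induction n with
    | zero =>
      intro x
      rw [eq_X_mul_shift_add_const x]
      simp only [map_add, hf, hg, h, coeff_zero_X_mul]
    | succ n ih =>
      intro x
      rw [eq_X_mul_shift_add_const x]
      simp only [map_add, hf, hg, h, coeff_succ_X_mul, ih]
  exact PowerSeries.ext fun n => key n x

/-- A `z`-linear algebra map is determined by its values on constants. -/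
theorem algHom_ext_of_C {Φ Ψ : A⟦X⟧ →ₐ[K] B⟦X⟧} (hΦ : Φ X = X) (hΨ : Ψ X = X)
    (h : ∀ a, Φ (PowerSeries.C a) = Ψ (PowerSeries.C a)) (x : A⟦X⟧) : Φ x = Ψ x :=
  ext_of_C (f := Φ.toLinearMap) (g := Ψ.toLinearMap) (by simp [hΦ]) (by simp [hΨ]) h x

@[simp]
theorem zExt_C (f : A →ₗ[K] B⟦X⟧) (a : A) : zExt K f (PowerSeries.C a) = f a := by
  ext n
  simp only [zExt, LinearMap.coe_mk, AddHom.coe_mk, coeff_mk]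
  rw [Finset.sum_eq_single (0, n)]
  · simp
  · rintro ⟨i, j⟩ hp hne
    have := Finset.HasAntidiagonal.mem_antidiagonal.mp hp
    have hi : i ≠ 0 := by rintro rfl; exact hne (by simp_all)
    simp [coeff_C, hi]
  · simp

theorem zExt_X_mul (f : A →ₗ[K] B⟦X⟧) (x : A⟦X⟧) : zExt K f (X * x) = X * zExt K f x := by
  ext n
  rcases n with _ | n
  · simp [zExt]
  · simp only [zExt, LinearMap.coe_mk, AddHom.coe_mk, coeff_mk, coeff_succ_X_mul]
    rw [Finset.Nat.sum_antidiagonal_succ]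
    simp

@[simp]
theorem coeffwise_C (f : A →ₗ[K] B) (a : A) :
    coeffwise K f (PowerSeries.C a) = PowerSeries.C (f a) := by
  ext n
  simp only [coeffwise, LinearMap.coe_mk, AddHom.coe_mk, coeff_mk, coeff_C]
  split_ifs <;> simp

theorem coeffwise_X_mul (f : A →ₗ[K] B) (x : A⟦X⟧) :
    coeffwise K f (X * x) = X * coeffwise K f x := by
  ext n
  rcases n with _ | n
  · simp [coeffwise]
  · simp [coeffwise, coeff_succ_X_mul]

theorem mapAlgHom_C (f : A →ₐ[K] B) (a : A) :
    mapAlgHom f (PowerSeries.C a) = PowerSeries.C (f a) := by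
  simp [mapAlgHom_apply]

theorem mapAlgHom_X (f : A →ₐ[K] B) : mapAlgHom f (X : A⟦X⟧) = X := by
  simp [mapAlgHom_apply]

@[simp]
theorem constL_apply (a : A) : constL K a = PowerSeries.C a := rfl

theorem commute_mapAlgHom {f : A →ₐ[K] A'} {g : B →ₐ[K] A'} (h : ∀ a b, Commute (f a) (g b))
    (x : A⟦X⟧) (y : B⟦X⟧) : Commute (mapAlgHom f x) (mapAlgHom g y) := by
  ext n
  rw [coeff_mul, coeff_mul, ← Finset.Nat.sum_antidiagonal_swap]
  exact Finset.sum_congr rfl fun p _ => by simpa [mapAlgHom_apply] using (h _ _).eq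

/-- The constants, as an algebra map `A → A⟦z⟧`. -/
def constHom : A →ₐ[K] A⟦X⟧ :=
  AlgHom.ofLinearMap (constL K) (map_one PowerSeries.C) (fun a b => map_mul PowerSeries.C a b)

@[simp]
theorem constHom_apply (a : A) : constHom (K := K) a = PowerSeries.C a := rfl

/-- The extension of an algebra map `A → B⟦z⟧` to `A⟦z⟧`. -/
def zExtHom (f : A →ₐ[K] B⟦X⟧) : A⟦X⟧ →ₐ[K] B⟦X⟧ :=
  AlgHom.ofLinearMap (zExt K f.toLinearMap)
    (by rw [← map_one (PowerSeries.C (R := A)), zExt_C]; exact map_one f)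
    (fun x y => by
      refine ext_of_C (f := zExt K f.toLinearMap ∘ₗ LinearMap.mulRight K y)
        (g := LinearMap.mulRight K (zExt K f.toLinearMap y) ∘ₗ zExt K f.toLinearMap)
        (by intro x; simp [mul_assoc, zExt_X_mul]) (by intro x; simp [mul_assoc, zExt_X_mul])
        (fun a => ?_) x
      refine ext_of_C (f := zExt K f.toLinearMap ∘ₗ LinearMap.mulLeft K (PowerSeries.C a))
        (g := LinearMap.mulLeft K (f a) ∘ₗ zExt K f.toLinearMap) ?_ ?_ ?_ y |>.trans ?_
      · intro x
        simp only [LinearMap.comp_apply, LinearMap.mulLeft_apply]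
        rw [← mul_assoc, ← X_mul, mul_assoc, zExt_X_mul]
      · intro x
        simp only [LinearMap.comp_apply, LinearMap.mulLeft_apply]
        rw [zExt_X_mul, ← mul_assoc, ← X_mul, mul_assoc]
      · intro b
        simp only [LinearMap.comp_apply, LinearMap.mulLeft_apply, ← map_mul, zExt_C]
        simp
      · simp)

theorem zExtHom_apply (f : A →ₐ[K] B⟦X⟧) (x : A⟦X⟧) :
    zExtHom f x = zExt K f.toLinearMap x := rfl

@[simp]
theorem zExtHom_C (f : A →ₐ[K] B⟦X⟧) (a : A) : zExtHom f (PowerSeries.C a) = f a := zExt_C _ a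

@[simp]
theorem zExtHom_X (f : A →ₐ[K] B⟦X⟧) : zExtHom f X = X := by
  have := zExt_X_mul f.toLinearMap 1
  rw [mul_one] at this
  rw [zExtHom_apply, this, ← zExtHom_apply, map_one, mul_one]

/-- `a ↦ a ⊗ 1`. -/
def inl : A⟦X⟧ →ₐ[K] (A ⊗[K] B)⟦X⟧ := mapAlgHom Algebra.TensorProduct.includeLeft

/-- `b ↦ 1 ⊗ b`. -/
def inr : B⟦X⟧ →ₐ[K] (A ⊗[K] B)⟦X⟧ := mapAlgHom Algebra.TensorProduct.includeRight

theorem ftmul_eq (a : A⟦X⟧) (b : B⟦X⟧) : ftmul K a b = inl a * inr b := rfl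

@[simp] theorem inl_X : inl (K := K) (A := A) (B := B) X = X := mapAlgHom_X _
@[simp] theorem inr_X : inr (K := K) (A := A) (B := B) X = X := mapAlgHom_X _
theorem inl_C (a : A) : inl (K := K) (B := B) (PowerSeries.C a) = PowerSeries.C (a ⊗ₜ 1) :=
    mapAlgHom_C _ _
theorem inr_C (b : B) : inr (K := K) (A := A) (PowerSeries.C b) = PowerSeries.C (1 ⊗ₜ b) :=
    mapAlgHom_C _ _

theorem inl_mul_inr_C (a : A) (b : B) :
    inl (K := K) (PowerSeries.C a) * inr (PowerSeries.C b) = PowerSeries.C (a ⊗ₜ b) := by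
  rw [inl_C, inr_C, ← map_mul, Algebra.TensorProduct.tmul_mul_tmul, one_mul, mul_one]

theorem commute_inl_inr (a : A⟦X⟧) (b : B⟦X⟧) : Commute (inl (K := K) a) (inr b) :=
  commute_mapAlgHom (fun a b => by
    simp [Commute, SemiconjBy, Algebra.TensorProduct.tmul_mul_tmul]) a b

@[simp]
theorem constantCoeff_mapAlgHom (f : A →ₐ[K] B) (x : A⟦X⟧) :
    constantCoeff (mapAlgHom f x) = f (constantCoeff x) := by
  rw [← coeff_zero_eq_constantCoeff_apply, ← coeff_zero_eq_constantCoeff_apply]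
  simp [mapAlgHom_apply]

@[simp]
theorem constantCoeff_inl (x : A⟦X⟧) :
    constantCoeff (inl (K := K) (B := B) x) = constantCoeff x ⊗ₜ 1 :=
  constantCoeff_mapAlgHom _ x

@[simp]
theorem constantCoeff_inr (x : B⟦X⟧) :
    constantCoeff (inr (K := K) (A := A) x) = 1 ⊗ₜ constantCoeff x :=
  constantCoeff_mapAlgHom _ x

/-- A `z`-linear map on `(A ⊗ B)⟦z⟧` is determined by its values on pure tensors of constants. -/
theorem ext_of_tmul {f g : (A ⊗[K] B)⟦X⟧ →ₗ[K] A'⟦X⟧} (hf : ∀ x, f (X * x) = X * f x)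
    (hg : ∀ x, g (X * x) = X * g x)
    (h : ∀ a b, f (PowerSeries.C (a ⊗ₜ b)) = g (PowerSeries.C (a ⊗ₜ b)))
    (x : (A ⊗[K] B)⟦X⟧) : f x = g x := by
  refine ext_of_C hf hg (fun t => ?_) x
  induction t with
  | zero => simp
  | tmul a b => exact h a b
  | add s t hs ht => rw [map_add, map_add, map_add, hs, ht]

/-- Two algebra maps on `(A ⊗ B)⟦z⟧` are intertwined by `G` if they are so on both factors. -/
theorem semiconjBy_of_legs {Φ Ψ : (A ⊗[K] B)⟦X⟧ →ₐ[K] A'⟦X⟧} (hΦ : Φ X = X) (hΨ : Ψ X = X)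
    {G : A'⟦X⟧} (h1 : ∀ a : A⟦X⟧, SemiconjBy G (Φ (inl a)) (Ψ (inl a)))
    (h2 : ∀ b : B⟦X⟧, SemiconjBy G (Φ (inr b)) (Ψ (inr b))) (x : (A ⊗[K] B)⟦X⟧) :
    SemiconjBy G (Φ x) (Ψ x) := by
  refine ext_of_tmul (f := LinearMap.mulLeft K G ∘ₗ Φ.toLinearMap)
    (g := LinearMap.mulRight K G ∘ₗ Ψ.toLinearMap) ?_ ?_ ?_ x
  · intro x
    simp only [LinearMap.comp_apply, LinearMap.mulLeft_apply, AlgHom.toLinearMap_apply, map_mul,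
      hΦ]
    rw [← mul_assoc, ← X_mul, mul_assoc]
  · intro x
    simp [hΨ, mul_assoc]
  · intro a b
    have := (h1 (PowerSeries.C a)).mul_right (h2 (PowerSeries.C b))
    rw [← map_mul, ← map_mul, inl_mul_inr_C] at this
    exact this

theorem algHom_ext_of_legs {Φ Ψ : (A ⊗[K] B)⟦X⟧ →ₐ[K] A'⟦X⟧} (hΦ : Φ X = X) (hΨ : Ψ X = X)
    (h1 : ∀ a : A⟦X⟧, Φ (inl a) = Ψ (inl a)) (h2 : ∀ b : B⟦X⟧, Φ (inr b) = Ψ (inr b))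
    (x : (A ⊗[K] B)⟦X⟧) : Φ x = Ψ x := by
  have := semiconjBy_of_legs (G := 1) hΦ hΨ (fun a => by simp [SemiconjBy, h1])
    (fun b => by simp [SemiconjBy, h2]) x
  simpa [SemiconjBy] using this

theorem commute_of_legs {Φ : (A ⊗[K] B)⟦X⟧ →ₐ[K] A'⟦X⟧} (hΦ : Φ X = X) {G : A'⟦X⟧}
    (h1 : ∀ a : A⟦X⟧, Commute G (Φ (inl a))) (h2 : ∀ b : B⟦X⟧, Commute G (Φ (inr b)))
    (x : (A ⊗[K] B)⟦X⟧) : Commute G (Φ x) :=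
  semiconjBy_of_legs hΦ hΦ h1 h2 x

/-- The tensor product of algebra maps `A → A'⟦z⟧` and `B → B'⟦z⟧`. -/
def zTensorHom (f : A →ₐ[K] A'⟦X⟧) (g : B →ₐ[K] B'⟦X⟧) : A ⊗[K] B →ₐ[K] (A' ⊗[K] B')⟦X⟧ :=
  Algebra.TensorProduct.algHomOfLinearMapTensorProduct (zTensor K f.toLinearMap g.toLinearMap)
    (fun a a' b b' => by
      simp only [zTensor, TensorProduct.lift.tmul, LinearMap.mk₂_apply, AlgHom.toLinearMap_apply,
        map_mul, ftmul_eq]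
      rw [mul_assoc, ← mul_assoc (inl (f a')), (commute_inl_inr (f a') (g b)).eq]
      simp only [mul_assoc])
    (by simp [zTensor, ftmul_eq])

@[simp]
theorem zTensor_tmul (f : A →ₗ[K] A'⟦X⟧) (g : B →ₗ[K] B'⟦X⟧) (a : A) (b : B) :
    zTensor K f g (a ⊗ₜ b) = inl (f a) * inr (g b) := by
  simp [zTensor, ftmul_eq]

@[simp]
theorem zTensorHom_tmul (f : A →ₐ[K] A'⟦X⟧) (g : B →ₐ[K] B'⟦X⟧) (a : A) (b : B) :
    zTensorHom f g (a ⊗ₜ b) = inl (f a) * inr (g b) := zTensor_tmul _ _ a b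

theorem zExtHom_zTensorHom_inl (f : A →ₐ[K] A'⟦X⟧) (g : B →ₐ[K] B'⟦X⟧) (a : A⟦X⟧) :
    zExtHom (zTensorHom f g) (inl a) = inl (zExtHom f a) :=
  algHom_ext_of_C (Φ := (zExtHom (zTensorHom f g)).comp inl) (Ψ := inl.comp (zExtHom f))
    (by simp) (by simp) (fun a => by simp [inl_C]) a

theorem zExtHom_zTensorHom_inr (f : A →ₐ[K] A'⟦X⟧) (g : B →ₐ[K] B'⟦X⟧) (b : B⟦X⟧) :
    zExtHom (zTensorHom f g) (inr b) = inr (zExtHom g b) :=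
  algHom_ext_of_C (Φ := (zExtHom (zTensorHom f g)).comp inr) (Ψ := inr.comp (zExtHom g))
    (by simp) (by simp) (fun a => by simp [inr_C]) b

theorem zExtHom_constHom (a : A⟦X⟧) : zExtHom (constHom (K := K)) a = a :=
  algHom_ext_of_C (Φ := zExtHom constHom) (Ψ := AlgHom.id K _) (by simp) (by simp)
    (fun a => by simp) a

/-! ### The three legs of a triple tensor product -/

/-- `a ↦ a ⊗ 1 ⊗ 1`. -/
def in1 : A⟦X⟧ →ₐ[K] (A ⊗[K] (A ⊗[K] A))⟦X⟧ := inl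

/-- `a ↦ 1 ⊗ a ⊗ 1`. -/
def in2 : A⟦X⟧ →ₐ[K] (A ⊗[K] (A ⊗[K] A))⟦X⟧ := inr.comp inl

/-- `a ↦ 1 ⊗ 1 ⊗ a`. -/
def in3 : A⟦X⟧ →ₐ[K] (A ⊗[K] (A ⊗[K] A))⟦X⟧ := inr.comp inr

theorem commute_in1_in2 (a b : A⟦X⟧) : Commute (in1 (K := K) a) (in2 b) := commute_inl_inr _ _
theorem commute_in1_in3 (a b : A⟦X⟧) : Commute (in1 (K := K) a) (in3 b) := commute_inl_inr _ _
theorem commute_in2_in3 (a b : A⟦X⟧) : Commute (in2 (K := K) a) (in3 b) :=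
  (commute_inl_inr (K := K) a b).map inr

/-- `F ↦ F₁₂` as an algebra map. -/
def hom12 : (A ⊗[K] A)⟦X⟧ →ₐ[K] (A ⊗[K] (A ⊗[K] A))⟦X⟧ := mapAlgHom (leg12 K)

/-- `F ↦ F₁₃` as an algebra map. -/
def hom13 : (A ⊗[K] A)⟦X⟧ →ₐ[K] (A ⊗[K] (A ⊗[K] A))⟦X⟧ := mapAlgHom (leg13 K)

/-- `F ↦ F₂₃` as an algebra map. -/
def hom23 : (A ⊗[K] A)⟦X⟧ →ₐ[K] (A ⊗[K] (A ⊗[K] A))⟦X⟧ := mapAlgHom (leg23 K)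

/-- `τ` as an algebra map. -/
def flipHom : (A ⊗[K] A)⟦X⟧ →ₐ[K] (A ⊗[K] A)⟦X⟧ :=
  mapAlgHom (Algebra.TensorProduct.comm K A A).toAlgHom

theorem fleg12_eq (F : (A ⊗[K] A)⟦X⟧) : fleg12 K F = hom12 F := rfl
theorem fleg23_eq (F : (A ⊗[K] A)⟦X⟧) : fleg23 K F = hom23 F := rfl
theorem flip_eq (F : (A ⊗[K] A)⟦X⟧) : flip K F = flipHom F := rfl

@[simp] theorem hom12_X : hom12 (K := K) (A := A) X = X := mapAlgHom_X _
@[simp] theorem hom13_X : hom13 (K := K) (A := A) X = X := mapAlgHom_X _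
@[simp] theorem hom23_X : hom23 (K := K) (A := A) X = X := mapAlgHom_X _
@[simp] theorem flipHom_X : flipHom (K := K) (A := A) X = X := mapAlgHom_X _

theorem mapAlgHom_mapAlgHom (f : A →ₐ[K] B) (g : B →ₐ[K] A') (x : A⟦X⟧) :
    mapAlgHom g (mapAlgHom f x) = mapAlgHom (g.comp f) x := by
  ext n; simp [mapAlgHom_apply]

@[simp] theorem hom12_inl (a : A⟦X⟧) : hom12 (K := K) (inl a) = in1 a := by
  ext n; simp [hom12, inl, in1, mapAlgHom_apply, leg12]; rfl
@[simp] theorem hom12_inr (a : A⟦X⟧) : hom12 (K := K) (inr a) = in2 a := by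
  ext n; simp [hom12, inl, inr, in2, mapAlgHom_apply, leg12]
@[simp] theorem hom13_inl (a : A⟦X⟧) : hom13 (K := K) (inl a) = in1 a := by
  ext n; simp [hom13, inl, in1, mapAlgHom_apply, leg13]; rfl
@[simp] theorem hom13_inr (a : A⟦X⟧) : hom13 (K := K) (inr a) = in3 a := by
  ext n; simp [hom13, inr, in3, mapAlgHom_apply, leg13]
@[simp] theorem hom23_inl (a : A⟦X⟧) : hom23 (K := K) (inl a) = in2 a := rfl
@[simp] theorem hom23_inr (a : A⟦X⟧) : hom23 (K := K) (inr a) = in3 a := rfl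
@[simp] theorem flipHom_inl (a : A⟦X⟧) : flipHom (K := K) (inl a) = inr a := by
  ext n; simp [flipHom, inl, inr, mapAlgHom_apply]
@[simp] theorem flipHom_inr (a : A⟦X⟧) : flipHom (K := K) (inr a) = inl a := by
  ext n; simp [flipHom, inl, inr, mapAlgHom_apply]

/-- `F ↦ (f ⊗ id)(F)` as an algebra map. -/
def comulL (f : A →ₐ[K] (A ⊗[K] A)⟦X⟧) : (A ⊗[K] A)⟦X⟧ →ₐ[K] (A ⊗[K] (A ⊗[K] A))⟦X⟧ :=
  (mapAlgHom (Algebra.TensorProduct.assoc K K K A A A).toAlgHom).comp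
    (zExtHom (zTensorHom f constHom))

/-- `F ↦ (id ⊗ f)(F)` as an algebra map. -/
def comulR (f : A →ₐ[K] (A ⊗[K] A)⟦X⟧) : (A ⊗[K] A)⟦X⟧ →ₐ[K] (A ⊗[K] (A ⊗[K] A))⟦X⟧ :=
  zExtHom (zTensorHom constHom f)

theorem comulTensorId_eq (f : A →ₐ[K] (A ⊗[K] A)⟦X⟧) (F : (A ⊗[K] A)⟦X⟧) :
    comulTensorId K f.toLinearMap F = comulL f F := rfl

theorem idTensorComul_eq (f : A →ₐ[K] (A ⊗[K] A)⟦X⟧) (F : (A ⊗[K] A)⟦X⟧) :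
    idTensorComul K f.toLinearMap F = comulR f F := rfl

@[simp] theorem comulL_X (f : A →ₐ[K] (A ⊗[K] A)⟦X⟧) : comulL f X = X := by
  simp only [comulL, AlgHom.comp_apply, zExtHom_X, mapAlgHom_X]
@[simp] theorem comulR_X (f : A →ₐ[K] (A ⊗[K] A)⟦X⟧) : comulR f X = X := zExtHom_X _

@[simp]
theorem comulL_inl (f : A →ₐ[K] (A ⊗[K] A)⟦X⟧) (a : A⟦X⟧) :
    comulL f (inl a) = hom12 (zExtHom f a) := by
  have h : ∀ F : (A ⊗[K] A)⟦X⟧, mapAlgHom (Algebra.TensorProduct.assoc K K K A A A).toAlgHom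
      (inl (K := K) F) = hom12 F := by
    refine algHom_ext_of_C
      (Φ := (mapAlgHom (Algebra.TensorProduct.assoc K K K A A A).toAlgHom).comp inl) (Ψ := hom12)
      (by rw [AlgHom.comp_apply, inl_X, mapAlgHom_X]) hom12_X (fun t => ?_)
    simp only [AlgHom.comp_apply, inl_C, mapAlgHom_C, hom12]
    congr 1
    induction t with
    | zero => simp
    | tmul a b => simp [leg12]
    | add s t hs ht => rw [TensorProduct.add_tmul, map_add, map_add, hs, ht]
  rw [comulL, AlgHom.comp_apply, zExtHom_zTensorHom_inl, h]

@[simp]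
theorem comulL_inr (f : A →ₐ[K] (A ⊗[K] A)⟦X⟧) (b : A⟦X⟧) : comulL f (inr b) = in3 b := by
  rw [comulL, AlgHom.comp_apply, zExtHom_zTensorHom_inr, zExtHom_constHom]
  ext n
  simp [inr, in3, mapAlgHom_apply, Algebra.TensorProduct.one_def]

@[simp]
theorem comulR_inl (f : A →ₐ[K] (A ⊗[K] A)⟦X⟧) (a : A⟦X⟧) : comulR f (inl a) = in1 a := by
  rw [comulR, zExtHom_zTensorHom_inl, zExtHom_constHom]; rfl

@[simp]
theorem comulR_inr (f : A →ₐ[K] (A ⊗[K] A)⟦X⟧) (b : A⟦X⟧) :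
    comulR f (inr b) = hom23 (zExtHom f b) := by
  rw [comulR, zExtHom_zTensorHom_inr]; rfl

/-- `F ↦ (e ⊗ id)(F)` as an algebra map. -/
def counitL (e : A →ₐ[K] K⟦X⟧) : (A ⊗[K] A)⟦X⟧ →ₐ[K] A⟦X⟧ :=
  (mapAlgHom (Algebra.TensorProduct.lid K A).toAlgHom).comp (zExtHom (zTensorHom e constHom))

/-- `F ↦ (id ⊗ e)(F)` as an algebra map. -/
def counitR (e : A →ₐ[K] K⟦X⟧) : (A ⊗[K] A)⟦X⟧ →ₐ[K] A⟦X⟧ :=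
  (mapAlgHom (Algebra.TensorProduct.rid K K A).toAlgHom).comp (zExtHom (zTensorHom constHom e))

@[simp] theorem counitL_X (e : A →ₐ[K] K⟦X⟧) : counitL e X = X := by
  simp only [counitL, AlgHom.comp_apply, zExtHom_X, mapAlgHom_X]
@[simp] theorem counitR_X (e : A →ₐ[K] K⟦X⟧) : counitR e X = X := by
  simp only [counitR, AlgHom.comp_apply, zExtHom_X, mapAlgHom_X]

@[simp]
theorem counitL_inl (e : A →ₐ[K] K⟦X⟧) (a : A⟦X⟧) :
    counitL e (inl a) = mapAlgHom (Algebra.ofId K A) (zExtHom e a) := by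
  rw [counitL, AlgHom.comp_apply, zExtHom_zTensorHom_inl]
  ext n
  simp [inl, mapAlgHom_apply, Algebra.algebraMap_eq_smul_one]

@[simp]
theorem counitL_inr (e : A →ₐ[K] K⟦X⟧) (b : A⟦X⟧) : counitL e (inr b) = b := by
  rw [counitL, AlgHom.comp_apply, zExtHom_zTensorHom_inr, zExtHom_constHom]
  ext n
  simp [inr, mapAlgHom_apply]

@[simp]
theorem counitR_inl (e : A →ₐ[K] K⟦X⟧) (a : A⟦X⟧) : counitR e (inl a) = a := by
  rw [counitR, AlgHom.comp_apply, zExtHom_zTensorHom_inl, zExtHom_constHom]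
  ext n
  simp [inl, mapAlgHom_apply]

@[simp]
theorem counitR_inr (e : A →ₐ[K] K⟦X⟧) (b : A⟦X⟧) :
    counitR e (inr b) = mapAlgHom (Algebra.ofId K A) (zExtHom e b) := by
  rw [counitR, AlgHom.comp_apply, zExtHom_zTensorHom_inr]
  ext n
  simp [inr, mapAlgHom_apply, Algebra.algebraMap_eq_smul_one]

end Legs

/-! ### Twisting -/

section Twisting

variable {K : Type*} [Field K] {A : Type*} [Ring A] [Algebra K A]

open PowerSeries

/-- The twisted coproduct as an algebra map. -/
def twistHom (D : A →ₐ[K] (A ⊗[K] A)⟦X⟧) {F : (A ⊗[K] A)⟦X⟧} (hF : IsUnit F) :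
    A →ₐ[K] (A ⊗[K] A)⟦X⟧ :=
  AlgHom.ofLinearMap (twistComul K D.toLinearMap F)
    (by simp [twistComul, Ring.mul_inverse_cancel F hF])
    (fun a b => by
      simp only [twistComul, LinearMap.comp_apply, LinearMap.mulLeft_apply,
        LinearMap.mulRight_apply, AlgHom.toLinearMap_apply, map_mul]
      simp only [mul_assoc]
      rw [← mul_assoc (Ring.inverse F) F, Ring.inverse_mul_cancel F hF, one_mul])

theorem twistHom_toLinearMap (D : A →ₐ[K] (A ⊗[K] A)⟦X⟧) {F : (A ⊗[K] A)⟦X⟧} (hF : IsUnit F) :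
    (twistHom D hF).toLinearMap = twistComul K D.toLinearMap F := rfl

theorem twistComul_apply (Δ : A →ₗ[K] (A ⊗[K] A)⟦X⟧) (F : (A ⊗[K] A)⟦X⟧) (a : A) :
    twistComul K Δ F a = F * Δ a * Ring.inverse F := by
  simp [twistComul, mul_assoc]

theorem twistComul_eq_of_semiconjBy {Δ : A →ₗ[K] (A ⊗[K] A)⟦X⟧} {F y : (A ⊗[K] A)⟦X⟧}
    (hF : IsUnit F) {a : A} (h : SemiconjBy F (Δ a) y) : twistComul K Δ F a = y := by
  rw [twistComul_apply, h.eq, mul_assoc, Ring.mul_inverse_cancel F hF, mul_one]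

theorem semiconjBy_twistHom (D : A →ₐ[K] (A ⊗[K] A)⟦X⟧) {F : (A ⊗[K] A)⟦X⟧} (hF : IsUnit F)
    (a : A) : SemiconjBy F (D a) (twistHom D hF a) := by
  change _ = twistComul K D.toLinearMap F a * F
  rw [twistComul_apply, mul_assoc, Ring.inverse_mul_cancel F hF, mul_one]
  rfl

theorem twistHom_eq_of_semiconjBy {D : A →ₐ[K] (A ⊗[K] A)⟦X⟧} {F y : (A ⊗[K] A)⟦X⟧}
    (hF : IsUnit F) {a : A} (h : SemiconjBy F (D a) y) : twistHom D hF a = y :=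
  twistComul_eq_of_semiconjBy (Δ := D.toLinearMap) hF h

theorem twistComul_twistComul (Δ : A →ₗ[K] (A ⊗[K] A)⟦X⟧) {F G : (A ⊗[K] A)⟦X⟧}
    (hF : IsUnit F) (hG : IsUnit G) :
    twistComul K (twistComul K Δ F) G = twistComul K Δ (G * F) := by
  ext1 a
  have : Ring.inverse (G * F) = Ring.inverse F * Ring.inverse G := by
    obtain ⟨u, rfl⟩ := hF
    obtain ⟨v, rfl⟩ := hG
    rw [← Units.val_mul, Ring.inverse_unit, Ring.inverse_unit, Ring.inverse_unit, mul_inv_rev,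
      Units.val_mul]
  simp only [twistComul_apply, this, mul_assoc]

theorem semiconjBy_zExtHom_twistHom (D : A →ₐ[K] (A ⊗[K] A)⟦X⟧) {F : (A ⊗[K] A)⟦X⟧}
    (hF : IsUnit F) (x : A⟦X⟧) : SemiconjBy F (zExtHom D x) (zExtHom (twistHom D hF) x) := by
  refine ext_of_C (f := LinearMap.mulLeft K F ∘ₗ (zExtHom D).toLinearMap)
    (g := LinearMap.mulRight K F ∘ₗ (zExtHom (twistHom D hF)).toLinearMap) ?_ ?_ ?_ x
  · intro x
    simp only [LinearMap.comp_apply, LinearMap.mulLeft_apply, AlgHom.toLinearMap_apply, map_mul,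
      zExtHom_X]
    rw [← mul_assoc, ← X_mul, mul_assoc]
  · intro x; simp [mul_assoc]
  · intro a; simpa using (semiconjBy_twistHom D hF a).eq

theorem commute_hom12_in3 (F : (A ⊗[K] A)⟦X⟧) (b : A⟦X⟧) : Commute (hom12 F) (in3 b) := by
  refine (commute_of_legs (K := K) (A := A) (B := A) (Φ := hom12) hom12_X (fun a => ?_)
    (fun a => ?_) F).symm
  · rw [hom12_inl]; exact (commute_in1_in3 (K := K) a b).symm
  · rw [hom12_inr]; exact (commute_in2_in3 (K := K) a b).symm

theorem commute_in1_hom23 (a : A⟦X⟧) (F : (A ⊗[K] A)⟦X⟧) : Commute (in1 a) (hom23 F) := by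
  refine commute_of_legs (K := K) (A := A) (B := A) (Φ := hom23) hom23_X (fun b => ?_)
    (fun b => ?_) F
  · rw [hom23_inl]; exact commute_in1_in2 (K := K) a b
  · rw [hom23_inr]; exact commute_in1_in3 (K := K) a b

theorem semiconjBy_comulL_twistHom (D : A →ₐ[K] (A ⊗[K] A)⟦X⟧) {F : (A ⊗[K] A)⟦X⟧}
    (hF : IsUnit F) (x : (A ⊗[K] A)⟦X⟧) :
    SemiconjBy (hom12 F) (comulL D x) (comulL (twistHom D hF) x) :=
  semiconjBy_of_legs (by simp) (by simp)
    (fun a => by simpa using (semiconjBy_zExtHom_twistHom D hF a).map hom12)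
    (fun b => by rw [comulL_inr, comulL_inr]; exact commute_hom12_in3 F b) x

theorem semiconjBy_comulR_twistHom (D : A →ₐ[K] (A ⊗[K] A)⟦X⟧) {F : (A ⊗[K] A)⟦X⟧}
    (hF : IsUnit F) (x : (A ⊗[K] A)⟦X⟧) :
    SemiconjBy (hom23 F) (comulR D x) (comulR (twistHom D hF) x) :=
  semiconjBy_of_legs (by simp) (by simp)
    (fun a => by rw [comulR_inl, comulR_inl]; exact (commute_in1_hom23 a F).symm)
    (fun b => by simpa using (semiconjBy_zExtHom_twistHom D hF b).map hom23) x

/-- The factorization properties imply the cocycle identity: both of its sides are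
`F₁₂ F₁₃ F₂₃`. -/
theorem isFactorizableTwist_of_factor {D : A →ₐ[K] (A ⊗[K] A)⟦X⟧} {e : A →ₐ[K] K⟦X⟧}
    {F : (A ⊗[K] A)⟦X⟧} (hF : IsUnit F) (h1 : counitL e F = 1) (h2 : counitR e F = 1)
    (h3 : comulL D F = hom13 F * hom23 F)
    (h4 : comulR (twistHom D hF) F = hom12 F * hom13 F) :
    IsFactorizableTwist K D.toLinearMap e.toLinearMap F where
  isUnit := hF
  counit_left := h1
  counit_right := h2
  cocycle := by
    rw [fleg12_eq, fleg23_eq, comulTensorId_eq, idTensorComul_eq,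
      (semiconjBy_comulR_twistHom D hF F).eq, h4, h3, mul_assoc]
  factor_left := h3
  factor_right := h4

/-- Twisting a coassociative coproduct by a twist gives a coassociative coproduct. -/
theorem coassoc_twistHom {D : A →ₐ[K] (A ⊗[K] A)⟦X⟧} {F : (A ⊗[K] A)⟦X⟧} (hF : IsUnit F)
    (hc : hom12 F * comulL D F = hom23 F * comulR D F)
    (hD : ∀ a, comulL D (D a) = comulR D (D a)) (a : A) :
    comulL (twistHom D hF) (twistHom D hF a) = comulR (twistHom D hF) (twistHom D hF a) := by
  have h := semiconjBy_twistHom D hF a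
  have hL := (semiconjBy_comulL_twistHom D hF (twistHom D hF a)).mul_left (h.map (comulL D))
  have hR := (semiconjBy_comulR_twistHom D hF (twistHom D hF a)).mul_left (h.map (comulR D))
  rw [← hc, ← hD] at hR
  have hu : IsUnit (hom12 F * comulL D F) := (hF.map hom12).mul (hF.map (comulL D))
  exact hu.mul_right_cancel (hL.eq.symm.trans hR.eq)

theorem counitL_twistHom {D : A →ₐ[K] (A ⊗[K] A)⟦X⟧} {e : A →ₐ[K] K⟦X⟧} {F : (A ⊗[K] A)⟦X⟧}
    (hF : IsUnit F) (he : counitL e F = 1) (hD : ∀ a, counitL e (D a) = PowerSeries.C a) (a : A) :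
    counitL e (twistHom D hF a) = PowerSeries.C a := by
  have h := (semiconjBy_twistHom D hF a).map (counitL e)
  rw [he, SemiconjBy, one_mul, mul_one] at h
  rw [← h, hD]

theorem counitR_twistHom {D : A →ₐ[K] (A ⊗[K] A)⟦X⟧} {e : A →ₐ[K] K⟦X⟧} {F : (A ⊗[K] A)⟦X⟧}
    (hF : IsUnit F) (he : counitR e F = 1) (hD : ∀ a, counitR e (D a) = PowerSeries.C a) (a : A) :
    counitR e (twistHom D hF a) = PowerSeries.C a := by
  have h := (semiconjBy_twistHom D hF a).map (counitR e)
  rw [he, SemiconjBy, one_mul, mul_one] at h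
  rw [← h, hD]

end Twisting

/-! ### The universal `R`-matrix of a factorizable twist -/

section RMatrix

variable {K : Type*} [Field K] {A : Type*} [Ring A] [Algebra K A]

open PowerSeries

/-- The exchange of the first two legs. -/
def swap12 : (A ⊗[K] (A ⊗[K] A))⟦X⟧ →ₐ[K] (A ⊗[K] (A ⊗[K] A))⟦X⟧ :=
  mapAlgHom (Algebra.TensorProduct.leftComm K A A A).toAlgHom

/-- The exchange of the last two legs. -/
def swap23 : (A ⊗[K] (A ⊗[K] A))⟦X⟧ →ₐ[K] (A ⊗[K] (A ⊗[K] A))⟦X⟧ :=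
  mapAlgHom (Algebra.TensorProduct.map (AlgHom.id K A)
    (Algebra.TensorProduct.comm K A A).toAlgHom)

theorem swap12_X : swap12 (K := K) (A := A) X = X := mapAlgHom_X _
theorem swap23_X : swap23 (K := K) (A := A) X = X := mapAlgHom_X _

theorem swap12_in1 (a : A⟦X⟧) : swap12 (K := K) (in1 a) = in2 a := by
  ext n; simp [swap12, in1, in2, inl, inr, mapAlgHom_apply, Algebra.TensorProduct.one_def]
theorem swap12_in2 (a : A⟦X⟧) : swap12 (K := K) (in2 a) = in1 a := by
  ext n; simp [swap12, in1, in2, inl, inr, mapAlgHom_apply, Algebra.TensorProduct.one_def]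
theorem swap12_in3 (a : A⟦X⟧) : swap12 (K := K) (in3 a) = in3 a := by
  ext n; simp [swap12, in3, inr, mapAlgHom_apply]
theorem swap23_in1 (a : A⟦X⟧) : swap23 (K := K) (in1 a) = in1 a := by
  ext n; simp [swap23, in1, inl, mapAlgHom_apply, Algebra.TensorProduct.one_def]
theorem swap23_in2 (a : A⟦X⟧) : swap23 (K := K) (in2 a) = in3 a := by
  ext n; simp [swap23, in2, in3, inl, inr, mapAlgHom_apply]
theorem swap23_in3 (a : A⟦X⟧) : swap23 (K := K) (in3 a) = in2 a := by
  ext n; simp [swap23, in2, in3, inl, inr, mapAlgHom_apply]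

theorem swap12_hom12 (F : (A ⊗[K] A)⟦X⟧) : swap12 (hom12 F) = hom12 (flipHom F) :=
  algHom_ext_of_legs (K := K) (A := A) (B := A) (Φ := swap12.comp hom12) (Ψ := hom12.comp flipHom)
    (by simp [swap12_X]) (by simp) (fun a => by simp [swap12_in1]) (fun a => by simp [swap12_in2]) F
theorem swap12_hom13 (F : (A ⊗[K] A)⟦X⟧) : swap12 (hom13 F) = hom23 F :=
  algHom_ext_of_legs (K := K) (A := A) (B := A) (Φ := swap12.comp hom13) (Ψ := hom23)
    (by simp [swap12_X]) (by simp) (fun a => by simp [swap12_in1]) (fun a => by simp [swap12_in3]) F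
theorem swap12_hom23 (F : (A ⊗[K] A)⟦X⟧) : swap12 (hom23 F) = hom13 F :=
  algHom_ext_of_legs (K := K) (A := A) (B := A) (Φ := swap12.comp hom23) (Ψ := hom13)
    (by simp [swap12_X]) (by simp) (fun a => by simp [swap12_in2]) (fun a => by simp [swap12_in3]) F
theorem swap23_hom12 (F : (A ⊗[K] A)⟦X⟧) : swap23 (hom12 F) = hom13 F :=
  algHom_ext_of_legs (K := K) (A := A) (B := A) (Φ := swap23.comp hom12) (Ψ := hom13)
    (by simp [swap23_X]) (by simp) (fun a => by simp [swap23_in1]) (fun a => by simp [swap23_in2]) F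
theorem swap23_hom13 (F : (A ⊗[K] A)⟦X⟧) : swap23 (hom13 F) = hom12 F :=
  algHom_ext_of_legs (K := K) (A := A) (B := A) (Φ := swap23.comp hom13) (Ψ := hom12)
    (by simp [swap23_X]) (by simp) (fun a => by simp [swap23_in1]) (fun a => by simp [swap23_in3]) F
theorem swap23_hom23 (F : (A ⊗[K] A)⟦X⟧) : swap23 (hom23 F) = hom23 (flipHom F) :=
  algHom_ext_of_legs (K := K) (A := A) (B := A) (Φ := swap23.comp hom23) (Ψ := hom23.comp flipHom)
    (by simp [swap23_X]) (by simp) (fun a => by simp [swap23_in2]) (fun a => by simp [swap23_in3]) F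

theorem flipHom_flipHom (F : (A ⊗[K] A)⟦X⟧) : flipHom (flipHom F) = F :=
  algHom_ext_of_legs (K := K) (A := A) (B := A) (Φ := flipHom.comp flipHom) (Ψ := AlgHom.id K _)
    (by simp) (by simp) (fun a => by simp) (fun a => by simp) F

theorem flipHom_zExtHom {D : A →ₐ[K] (A ⊗[K] A)⟦X⟧} (hD : ∀ a, flipHom (D a) = D a) (x : A⟦X⟧) :
    flipHom (zExtHom D x) = zExtHom D x :=
  algHom_ext_of_C (Φ := flipHom.comp (zExtHom D)) (Ψ := zExtHom D)
    (by simp) (by simp) (fun a => by simp [hD]) x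

theorem swap12_comulL {D : A →ₐ[K] (A ⊗[K] A)⟦X⟧} (hD : ∀ a, flipHom (D a) = D a)
    (F : (A ⊗[K] A)⟦X⟧) : swap12 (comulL D F) = comulL D F :=
  algHom_ext_of_legs (K := K) (A := A) (B := A) (Φ := swap12.comp (comulL D)) (Ψ := comulL D)
    (by simp [swap12_X]) (by simp) (fun a => by simp [swap12_hom12, flipHom_zExtHom hD])
    (fun a => by simp [swap12_in3]) F

theorem swap23_comulR {D : A →ₐ[K] (A ⊗[K] A)⟦X⟧} (hD : ∀ a, flipHom (D a) = D a)
    (F : (A ⊗[K] A)⟦X⟧) : swap23 (comulR D F) = comulR D F :=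
  algHom_ext_of_legs (K := K) (A := A) (B := A) (Φ := swap23.comp (comulR D)) (Ψ := comulR D)
    (by simp [swap23_X]) (by simp) (fun a => by simp [swap23_in1])
    (fun a => by simp [swap23_hom23, flipHom_zExtHom hD]) F

theorem comulL_flipHom (D : A →ₐ[K] (A ⊗[K] A)⟦X⟧) (F : (A ⊗[K] A)⟦X⟧) :
    comulL D (flipHom F) = swap23 (swap12 (comulR D F)) :=
  algHom_ext_of_legs (K := K) (A := A) (B := A) (Φ := (comulL D).comp flipHom)
    (Ψ := swap23.comp (swap12.comp (comulR D)))
    (by simp) (by simp [swap12_X, swap23_X]) (fun a => by simp [swap12_in1, swap23_in2])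
    (fun a => by simp [swap12_hom23, swap23_hom13]) F

theorem comulR_flipHom (D : A →ₐ[K] (A ⊗[K] A)⟦X⟧) (F : (A ⊗[K] A)⟦X⟧) :
    comulR D (flipHom F) = swap12 (swap23 (comulL D F)) :=
  algHom_ext_of_legs (K := K) (A := A) (B := A) (Φ := (comulR D).comp flipHom)
    (Ψ := swap12.comp (swap23.comp (comulL D)))
    (by simp) (by simp [swap12_X, swap23_X]) (fun a => by simp [swap12_hom13, swap23_hom12])
    (fun a => by simp [swap23_in3, swap12_in2]) F

/-- `R = τ(F) F⁻¹` is a triangular `R`-matrix for the twist by `F` of a cocommutative coproduct.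
Cocommutativity turns the permutations of the two factorization identities into the commutation
relations of the legs of `F` that the hexagon identities of `R` require. -/
theorem isTriangularRMatrix_of_twist {D : A →ₐ[K] (A ⊗[K] A)⟦X⟧} {e : A →ₐ[K] K⟦X⟧}
    (hD : ∀ a, flipHom (D a) = D a) {F : (A ⊗[K] A)⟦X⟧}
    (h : IsFactorizableTwist K D.toLinearMap e.toLinearMap F) :
    IsTriangularRMatrix K (twistComul K D.toLinearMap F) (flip K F * Ring.inverse F) := by
  have hF := h.isUnit
  have hL : comulL D F = hom13 F * hom23 F := h.factor_left
  have hc : hom23 F * comulR D F = hom12 F * hom13 F * hom23 F := by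
    rw [mul_assoc, ← hL]; exact h.cocycle.symm
  rw [← twistHom_toLinearMap D hF, flip_eq]
  set R := flipHom F * Ring.inverse F with hR
  have hRF : R * F = flipHom F := by rw [hR, mul_assoc, Ring.inverse_mul_cancel F hF, mul_one]
  have h12 : hom12 R * hom12 F = hom12 (flipHom F) := by rw [← map_mul, hRF]
  have h13 : hom13 R * hom13 F = hom13 (flipHom F) := by rw [← map_mul, hRF]
  have h23 : hom23 R * hom23 F = hom23 (flipHom F) := by rw [← map_mul, hRF]
  have hfR : flipHom R * flipHom F = F := by rw [← map_mul, hRF, flipHom_flipHom]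
  have c1 : hom13 F * hom23 F = hom23 F * hom13 F := by
    have := congrArg swap12 hL
    rw [swap12_comulL hD, map_mul, swap12_hom13, swap12_hom23, hL] at this
    exact this
  have c2 : hom12 F * hom23 (flipHom F) = hom23 (flipHom F) * hom12 F := by
    have := congrArg swap23 c1
    simpa only [map_mul, swap23_hom13, swap23_hom23] using this
  have c3 : hom23 (flipHom F) * comulR D F = hom13 F * hom12 F * hom23 (flipHom F) := by
    have := congrArg swap23 hc
    simpa only [map_mul, swap23_comulR hD, swap23_hom12, swap23_hom13, swap23_hom23] using this
  refine ⟨?_, ?_, ?_, ?_, ?_⟩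
  · exact (hF.map flipHom).mul ⟨⟨Ring.inverse F, F, Ring.inverse_mul_cancel F hF,
      Ring.mul_inverse_cancel F hF⟩, rfl⟩
  · intro a
    refine hF.mul_right_cancel ?_
    have ha := (semiconjBy_twistHom D hF a).eq
    change R * twistHom D hF a * F = flipHom (twistHom D hF a) * R * F
    rw [mul_assoc, ← ha, ← mul_assoc, hRF, mul_assoc, hRF, ← map_mul, ← ha, map_mul, hD]
  · rw [comulTensorId_eq]
    change comulL (twistHom D hF) R = hom13 R * hom23 R
    have h1 := (semiconjBy_comulL_twistHom D hF R).eq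
    refine (hF.map hom12).mul_right_cancel ((hF.map (comulL D)).mul_right_cancel ?_)
    rw [← h1, mul_assoc, ← map_mul, hRF, mul_assoc (hom13 R * hom23 R), hL, ← mul_assoc (hom12 F),
      ← hc, mul_assoc (hom13 R), ← mul_assoc (hom23 R), h23, c3, ← mul_assoc, ← mul_assoc,
      h13, mul_assoc, c2]
    have := congrArg (fun x => swap23 (swap12 x)) hc
    simpa only [map_mul, ← comulL_flipHom, swap12_hom12, swap12_hom13, swap12_hom23,
      swap23_hom12, swap23_hom13, swap23_hom23, mul_assoc] using this
  · rw [idTensorComul_eq]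
    change comulR (twistHom D hF) R = hom13 R * hom12 R
    have h1 := (semiconjBy_comulR_twistHom D hF R).eq
    refine (hF.map hom23).mul_right_cancel ((hF.map (comulR D)).mul_right_cancel ?_)
    rw [← h1, mul_assoc, ← map_mul, hRF, mul_assoc (hom13 R * hom12 R), hc, mul_assoc (hom13 R),
      mul_assoc (hom12 F), ← mul_assoc (hom12 R), h12, comulR_flipHom, hL]
    conv_rhs => rw [c1]
    simp only [map_mul, swap12_hom12, swap12_hom23, swap23_hom13, swap23_hom23]
    -- the two expressions for `(id ⊗ Δ)(F)`, with the first two legs exchanged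
    have e1 : hom13 F * swap12 (comulR D F) = hom12 (flipHom F) * hom23 F * hom13 F := by
      have := congrArg swap12 hc
      simpa only [map_mul, swap12_hom12, swap12_hom13, swap12_hom23] using this
    have e2 : hom13 (flipHom F) * swap12 (comulR D F) =
        hom23 F * hom12 (flipHom F) * hom13 (flipHom F) := by
      have := congrArg swap12 c3
      simpa only [map_mul, swap12_hom12, swap12_hom13, swap12_hom23] using this
    rw [← mul_assoc (hom12 (flipHom F)), ← e1, ← mul_assoc (hom13 R), h13, e2, mul_assoc]
  · rw [flip_eq]
    refine hF.mul_right_cancel ?_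
    rw [mul_assoc, hRF, hfR, one_mul]

/-- A universal `R`-matrix satisfies the quantum Yang--Baxter equation. -/
theorem quantumYangBaxter {D : A →ₐ[K] (A ⊗[K] A)⟦X⟧} {R : (A ⊗[K] A)⟦X⟧}
    (h : IsTriangularRMatrix K D.toLinearMap R) :
    hom12 R * (hom13 R * hom23 R) = hom23 R * hom13 R * hom12 R := by
  have hL : comulL D R = hom13 R * hom23 R := h.comul_left
  have hx : ∀ x : A⟦X⟧, SemiconjBy R (zExtHom D x) (flipHom (zExtHom D x)) := by
    intro x
    refine ext_of_C (f := LinearMap.mulLeft K R ∘ₗ (zExtHom D).toLinearMap)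
      (g := LinearMap.mulRight K R ∘ₗ (flipHom.comp (zExtHom D)).toLinearMap) ?_ ?_ ?_ x
    · intro x
      simp only [LinearMap.comp_apply, LinearMap.mulLeft_apply, AlgHom.toLinearMap_apply, map_mul,
        zExtHom_X]
      rw [← mul_assoc, ← X_mul, mul_assoc]
    · intro x; simp [mul_assoc]
    · intro a; simpa [flip_eq] using h.intertwines a
  have key : SemiconjBy (hom12 R) (comulL D R) (swap12 (comulL D R)) :=
    semiconjBy_of_legs (Φ := comulL D) (Ψ := swap12.comp (comulL D)) (by simp)
      (by simp [swap12_X])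
      (fun a => by
        simp only [AlgHom.comp_apply, comulL_inl, swap12_hom12]
        exact (hx a).map hom12)
      (fun b => by
        simp only [AlgHom.comp_apply, comulL_inr, swap12_in3]
        exact commute_hom12_in3 R b) R
  have e := key.eq
  rwa [hL, map_mul, swap12_hom13, swap12_hom23] at e

/-- The order-two term of the quantum Yang--Baxter equation is the classical one. -/
theorem classical_of_quantumYangBaxter {R : (A ⊗[K] A)⟦X⟧} {r : A ⊗[K] A}
    (h : hom12 R * (hom13 R * hom23 R) = hom23 R * hom13 R * hom12 R)
    (h0 : coeff 0 R = 1) (h1 : coeff 1 R = r) :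
    ringCommutator (leg12 K r) (leg13 K r) + ringCommutator (leg12 K r) (leg23 K r) +
      ringCommutator (leg13 K r) (leg23 K r) = 0 := by
  have e := congrArg (coeff 2) h
  have hc : ∀ (f : A ⊗[K] A →ₐ[K] A ⊗[K] (A ⊗[K] A)) n, coeff n (mapAlgHom f R) =
      f (coeff n R) := fun f n => by simp [mapAlgHom_apply]
  simp only [coeff_mul, Finset.Nat.antidiagonal_succ, Finset.Nat.antidiagonal_zero,
    Finset.map_singleton, Finset.sum_cons, Finset.sum_singleton, Finset.map_cons, hom12, hom13,
    hom23, hc, Function.Embedding.prodMap, Function.Embedding.coeFn_mk, Prod.map,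
    Function.Embedding.refl_apply, Nat.succ_eq_add_one, zero_add, h0, h1, map_one, one_mul,
    mul_one, Nat.reduceAdd] at e
  rw [← sub_eq_zero] at e
  rw [← e]
  simp only [ringCommutator]
  noncomm_ring

end RMatrix

/-! ### The Hopf structure of the enveloping algebra -/

section EnvelopingHopf

variable {K : Type*} [Field K] {𝔞 : Type*} [LieRing 𝔞] [LieAlgebra K 𝔞]
  {𝔟 : Type*} [LieRing 𝔟] [LieAlgebra K 𝔟]

open PowerSeries

local notation "ι" => UniversalEnvelopingAlgebra.ι K

theorem uHom_ext {A : Type*} [Ring A] [Algebra K A] {f g : U K 𝔞 →ₐ[K] A}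
    (h : ∀ x, f (ι x) = g (ι x)) (a : U K 𝔞) : f a = g a :=
  DFunLike.congr_fun (UniversalEnvelopingAlgebra.hom_ext K (LieHom.ext h)) a

theorem adjoin_range_ι : Algebra.adjoin K (Set.range (ι : 𝔞 → U K 𝔞)) = ⊤ := by
  set s := Algebra.adjoin K (Set.range (ι : 𝔞 → U K 𝔞)) with hs
  let f : 𝔞 →ₗ⁅K⁆ s :=
    { toFun := fun x => ⟨ι x, Algebra.subset_adjoin ⟨x, rfl⟩⟩
      map_add' := fun x y => Subtype.ext (map_add _ x y)
      map_smul' := fun c x => Subtype.ext (map_smul _ c x)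
      map_lie' := fun {x y} => Subtype.ext (LieHom.map_lie _ x y) }
  have h : ∀ a, (s.val.comp (UniversalEnvelopingAlgebra.lift K f)) a = a :=
    uHom_ext (g := AlgHom.id K _) fun x => by
      rw [AlgHom.comp_apply, UniversalEnvelopingAlgebra.lift_ι_apply]; rfl
  exact eq_top_iff.mpr fun a _ => by rw [← h a]; exact Subtype.property _

theorem uComul_ι (x : 𝔞) : uComul K 𝔞 (ι x) = ι x ⊗ₜ[K] 1 + 1 ⊗ₜ[K] ι x :=
  UniversalEnvelopingAlgebra.lift_ι_apply K _ x

theorem uCounit_ι (x : 𝔞) : uCounit K 𝔞 (ι x) = 0 :=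
  UniversalEnvelopingAlgebra.lift_ι_apply K _ x

theorem uMap_ι (f : 𝔞 →ₗ⁅K⁆ 𝔟) (x : 𝔞) : uMap K f (ι x) = ι (f x) :=
  UniversalEnvelopingAlgebra.lift_ι_apply K _ x

variable (K 𝔞) in
/-- The undeformed coproduct as an algebra map. -/
def comul₀ : U K 𝔞 →ₐ[K] (U K 𝔞 ⊗[K] U K 𝔞)⟦X⟧ := constHom.comp (uComul K 𝔞)

variable (K 𝔞) in
/-- The undeformed counit as an algebra map. -/
def counit₀ : U K 𝔞 →ₐ[K] K⟦X⟧ := constHom.comp (uCounit K 𝔞)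

variable (K 𝔞) in
/-- The antipode of `U(𝔞)`. -/
def uAntipode : U K 𝔞 →ₗ[K] U K 𝔞 :=
  (MulOpposite.opLinearEquiv K).symm.toLinearMap ∘ₗ (uAntipodeOp K 𝔞).toLinearMap

theorem comul₀_toLinearMap : (comul₀ K 𝔞).toLinearMap = Δ₀ K 𝔞 := rfl
theorem counit₀_toLinearMap : (counit₀ K 𝔞).toLinearMap = ε₀ K 𝔞 := rfl

theorem S₀_apply (a : U K 𝔞) : S₀ K 𝔞 a = PowerSeries.C (uAntipode K 𝔞 a) := rfl

theorem uAntipode_one : uAntipode K 𝔞 1 = 1 := by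
  simp [uAntipode]

theorem uAntipode_mul (a b : U K 𝔞) :
    uAntipode K 𝔞 (a * b) = uAntipode K 𝔞 b * uAntipode K 𝔞 a := by
  simp [uAntipode]

theorem uAntipode_ι (x : 𝔞) : uAntipode K 𝔞 (ι x) = -ι x := by
  have : uAntipodeOp K 𝔞 (ι x) = MulOpposite.op (-ι x) :=
    UniversalEnvelopingAlgebra.lift_ι_apply K _ x
  rw [uAntipode, LinearMap.comp_apply, AlgHom.toLinearMap_apply, this]
  rfl

theorem comul₀_ι (x : 𝔞) : comul₀ K 𝔞 (ι x) = inl (gen K x) + inr (gen K x) := by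
  rw [comul₀, AlgHom.comp_apply, uComul_ι, constHom_apply, map_add, gen, inl_C, inr_C]

theorem counit₀_ι (x : 𝔞) : counit₀ K 𝔞 (ι x) = 0 := by
  rw [counit₀, AlgHom.comp_apply, uCounit_ι, constHom_apply, map_zero]

@[simp]
theorem zExtHom_comul₀_gen (x : 𝔞) :
    zExtHom (comul₀ K 𝔞) (gen K x) = inl (gen K x) + inr (gen K x) := by
  rw [gen, zExtHom_C, comul₀_ι]; rfl

theorem zExtHom_counit₀_gen (x : 𝔞) : zExtHom (counit₀ K 𝔞) (gen K x) = 0 := by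
  rw [gen, zExtHom_C, counit₀_ι]

theorem flipHom_comul₀ (a : U K 𝔞) : flipHom (comul₀ K 𝔞 a) = comul₀ K 𝔞 a :=
  uHom_ext (f := flipHom.comp (comul₀ K 𝔞)) (g := comul₀ K 𝔞)
    (fun x => by
      rw [AlgHom.comp_apply, comul₀_ι, map_add, flipHom_inl, flipHom_inr, add_comm]) a

theorem coassoc₀ (a : U K 𝔞) :
    comulL (comul₀ K 𝔞) (comul₀ K 𝔞 a) = comulR (comul₀ K 𝔞) (comul₀ K 𝔞 a) :=
  uHom_ext (f := (comulL (comul₀ K 𝔞)).comp (comul₀ K 𝔞))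
    (g := (comulR (comul₀ K 𝔞)).comp (comul₀ K 𝔞))
    (fun x => by
      simp only [AlgHom.comp_apply, comul₀_ι, map_add, comulL_inl, comulL_inr, comulR_inl,
        comulR_inr, zExtHom_comul₀_gen, hom12_inl, hom12_inr, hom23_inl, hom23_inr, add_assoc]) a

theorem counitL_comul₀ (a : U K 𝔞) :
    counitL (counit₀ K 𝔞) (comul₀ K 𝔞 a) = PowerSeries.C a :=
  uHom_ext (f := (counitL (counit₀ K 𝔞)).comp (comul₀ K 𝔞)) (g := constHom)
    (fun x => by
      simp only [AlgHom.comp_apply, comul₀_ι, map_add, counitL_inl, counitL_inr,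
        zExtHom_counit₀_gen, map_zero, zero_add]
      rfl) a

theorem counitR_comul₀ (a : U K 𝔞) :
    counitR (counit₀ K 𝔞) (comul₀ K 𝔞 a) = PowerSeries.C a :=
  uHom_ext (f := (counitR (counit₀ K 𝔞)).comp (comul₀ K 𝔞)) (g := constHom)
    (fun x => by
      simp only [AlgHom.comp_apply, comul₀_ι, map_add, counitR_inl, counitR_inr,
        zExtHom_counit₀_gen, map_zero, add_zero]
      rfl) a

/-! ### The antipode of a twisted enveloping algebra -/

section MulTensor

variable {A : Type*} [Ring A] [Algebra K A]

theorem coeffwise_mul'_inl_inr (a b : A⟦X⟧) :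
    coeffwise K (LinearMap.mul' K A) (inl a * inr b) = a * b := by
  refine ext_of_C (f := coeffwise K (LinearMap.mul' K A) ∘ₗ LinearMap.mulRight K (inr b) ∘ₗ
    (inl (K := K)).toLinearMap) (g := LinearMap.mulRight K b) ?_ ?_ ?_ a
  · intro x; simp [mul_assoc, coeffwise_X_mul]
  · intro x; simp [mul_assoc]
  · intro a
    refine ext_of_C (f := coeffwise K (LinearMap.mul' K A) ∘ₗ
      LinearMap.mulLeft K (inl (PowerSeries.C a)) ∘ₗ (inr (K := K)).toLinearMap)
      (g := LinearMap.mulLeft K (PowerSeries.C a)) ?_ ?_ ?_ b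
    · intro x
      simp only [LinearMap.comp_apply, LinearMap.mulLeft_apply, AlgHom.toLinearMap_apply, map_mul,
        inr_X]
      rw [← mul_assoc, ← X_mul, mul_assoc, coeffwise_X_mul]
    · intro x
      simp only [LinearMap.mulLeft_apply]
      rw [← mul_assoc, ← X_mul, mul_assoc]
    · intro b
      simp only [LinearMap.comp_apply, LinearMap.mulLeft_apply, AlgHom.toLinearMap_apply,
        inl_mul_inr_C, coeffwise_C, LinearMap.mul'_apply, map_mul]

theorem mulTensor_C_tmul (f g : A →ₗ[K] A⟦X⟧) (a b : A) :
    mulTensor K f g (PowerSeries.C (a ⊗ₜ b)) = f a * g b := by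
  simp only [mulTensor, zExt_C, zTensor_tmul, coeffwise_mul'_inl_inr]

theorem mulTensor_X_mul (f g : A →ₗ[K] A⟦X⟧) (x : (A ⊗[K] A)⟦X⟧) :
    mulTensor K f g (X * x) = X * mulTensor K f g x := by
  simp only [mulTensor, zExt_X_mul, coeffwise_X_mul]

/-- `mulTensor` as a linear map. -/
def mulTensorLin (f g : A →ₗ[K] A⟦X⟧) : (A ⊗[K] A)⟦X⟧ →ₗ[K] A⟦X⟧ :=
  coeffwise K (LinearMap.mul' K A) ∘ₗ zExt K (zTensor K f g)

theorem mulTensorLin_apply (f g : A →ₗ[K] A⟦X⟧) (x : (A ⊗[K] A)⟦X⟧) :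
    mulTensorLin f g x = mulTensor K f g x := rfl

end MulTensor

theorem X_mul_comm_mul {A : Type*} [Ring A] (a x b : A⟦X⟧) : a * (X * x) * b = X * (a * x * b) := by
  rw [← mul_assoc a, ← X_mul, mul_assoc, mul_assoc, mul_assoc]

theorem coeffwise_mul_ext {A A' B B' : Type*} [Ring A] [Algebra K A] [Ring A'] [Algebra K A']
    [Ring B] [Algebra K B] [Ring B'] [Algebra K B'] {Φ : (A ⊗[K] A')⟦X⟧ →ₐ[K] B⟦X⟧} (hΦ : Φ X = X)
    (μ : B →ₗ[K] B') (L R : B⟦X⟧) {g : (A ⊗[K] A')⟦X⟧ →ₗ[K] B'⟦X⟧}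
    (hg : ∀ x, g (X * x) = X * g x)
    (h : ∀ a b, coeffwise K μ (L * Φ (PowerSeries.C (a ⊗ₜ b)) * R) = g (PowerSeries.C (a ⊗ₜ b)))
    (x : (A ⊗[K] A')⟦X⟧) : coeffwise K μ (L * Φ x * R) = g x := by
  refine ext_of_tmul (f := coeffwise K μ ∘ₗ LinearMap.mulRight K R ∘ₗ LinearMap.mulLeft K L ∘ₗ
    Φ.toLinearMap) ?_ hg h x
  intro x
  simp only [LinearMap.comp_apply, LinearMap.mulRight_apply, LinearMap.mulLeft_apply,
    AlgHom.toLinearMap_apply, map_mul, hΦ, X_mul_comm_mul, coeffwise_X_mul]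

/-- The right action `∑ S(x') w x''` of `x = ∑ x' ⊗ x''` on `w`. -/
def rightAct (w : (U K 𝔞)⟦X⟧) : (U K 𝔞 ⊗[K] U K 𝔞)⟦X⟧ →ₗ[K] (U K 𝔞)⟦X⟧ :=
  mulTensorLin (LinearMap.mulRight K w ∘ₗ S₀ K 𝔞) (constL K)

/-- The left action `∑ x' w S(x'')` of `x = ∑ x' ⊗ x''` on `w`. -/
def leftAct (w : (U K 𝔞)⟦X⟧) : (U K 𝔞 ⊗[K] U K 𝔞)⟦X⟧ →ₗ[K] (U K 𝔞)⟦X⟧ :=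
  mulTensorLin (LinearMap.mulRight K w ∘ₗ constL K) (S₀ K 𝔞)

theorem rightAct_C_tmul (w : (U K 𝔞)⟦X⟧) (a b : U K 𝔞) :
    rightAct w (PowerSeries.C (a ⊗ₜ b)) =
      PowerSeries.C (uAntipode K 𝔞 a) * w * PowerSeries.C b :=
  mulTensor_C_tmul _ _ a b

theorem leftAct_C_tmul (w : (U K 𝔞)⟦X⟧) (a b : U K 𝔞) :
    leftAct w (PowerSeries.C (a ⊗ₜ b)) =
      PowerSeries.C a * w * PowerSeries.C (uAntipode K 𝔞 b) :=
  mulTensor_C_tmul _ _ a b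

theorem rightAct_X_mul (w : (U K 𝔞)⟦X⟧) (x : (U K 𝔞 ⊗[K] U K 𝔞)⟦X⟧) :
    rightAct w (X * x) = X * rightAct w x := mulTensor_X_mul _ _ x

theorem leftAct_X_mul (w : (U K 𝔞)⟦X⟧) (x : (U K 𝔞 ⊗[K] U K 𝔞)⟦X⟧) :
    leftAct w (X * x) = X * leftAct w x := mulTensor_X_mul _ _ x

theorem rightAct_mul_C_tmul (w : (U K 𝔞)⟦X⟧) (x : (U K 𝔞 ⊗[K] U K 𝔞)⟦X⟧) (c d : U K 𝔞) :
    rightAct w (x * PowerSeries.C (c ⊗ₜ d)) =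
      PowerSeries.C (uAntipode K 𝔞 c) * rightAct w x * PowerSeries.C d := by
  refine ext_of_tmul (f := rightAct w ∘ₗ LinearMap.mulRight K (PowerSeries.C (c ⊗ₜ d)))
    (g := LinearMap.mulLeft K (PowerSeries.C (uAntipode K 𝔞 c)) ∘ₗ
      LinearMap.mulRight K (PowerSeries.C d) ∘ₗ rightAct w) ?_ ?_ ?_ x |>.trans ?_
  · intro x; simp [mul_assoc, rightAct_X_mul]
  · intro x
    simp only [LinearMap.comp_apply, LinearMap.mulLeft_apply, LinearMap.mulRight_apply,
      rightAct_X_mul, mul_assoc]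
    rw [← mul_assoc, ← X_mul, mul_assoc]
  · intro a b
    simp only [LinearMap.comp_apply, LinearMap.mulLeft_apply, LinearMap.mulRight_apply, ← map_mul,
      Algebra.TensorProduct.tmul_mul_tmul, rightAct_C_tmul, uAntipode_mul]
    simp only [map_mul, mul_assoc]
  · simp [mul_assoc]

theorem leftAct_C_tmul_mul (w : (U K 𝔞)⟦X⟧) (x : (U K 𝔞 ⊗[K] U K 𝔞)⟦X⟧) (c d : U K 𝔞) :
    leftAct w (PowerSeries.C (c ⊗ₜ d) * x) =
      PowerSeries.C c * leftAct w x * PowerSeries.C (uAntipode K 𝔞 d) := by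
  refine ext_of_tmul (f := leftAct w ∘ₗ LinearMap.mulLeft K (PowerSeries.C (c ⊗ₜ d)))
    (g := LinearMap.mulLeft K (PowerSeries.C c) ∘ₗ
      LinearMap.mulRight K (PowerSeries.C (uAntipode K 𝔞 d)) ∘ₗ leftAct w) ?_ ?_ ?_ x |>.trans ?_
  · intro x
    have := X_mul_comm_mul (PowerSeries.C (c ⊗ₜ d)) x (1 : (U K 𝔞 ⊗[K] U K 𝔞)⟦X⟧)
    rw [mul_one, mul_one] at this
    simp only [LinearMap.comp_apply, LinearMap.mulLeft_apply, this, leftAct_X_mul]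
  · intro x
    simp only [LinearMap.comp_apply, LinearMap.mulLeft_apply, LinearMap.mulRight_apply,
      leftAct_X_mul, mul_assoc]
    rw [← mul_assoc, ← X_mul, mul_assoc]
  · intro a b
    simp only [LinearMap.comp_apply, LinearMap.mulLeft_apply, LinearMap.mulRight_apply, ← map_mul,
      Algebra.TensorProduct.tmul_mul_tmul, leftAct_C_tmul, uAntipode_mul]
    simp only [map_mul, mul_assoc]
  · simp [mul_assoc]

theorem rightAct_mul (w : (U K 𝔞)⟦X⟧) (x y : (U K 𝔞 ⊗[K] U K 𝔞)⟦X⟧) :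
    rightAct w (x * y) = rightAct (rightAct w x) y := by
  refine ext_of_tmul (f := rightAct w ∘ₗ LinearMap.mulLeft K x)
    (g := rightAct (rightAct w x)) ?_ (rightAct_X_mul _) ?_ y
  · intro y
    have := X_mul_comm_mul x y (1 : (U K 𝔞 ⊗[K] U K 𝔞)⟦X⟧)
    rw [mul_one, mul_one] at this
    simp only [LinearMap.comp_apply, LinearMap.mulLeft_apply, this, rightAct_X_mul]
  · intro c d
    simp only [LinearMap.comp_apply, LinearMap.mulLeft_apply, rightAct_mul_C_tmul, rightAct_C_tmul]

theorem leftAct_mul (w : (U K 𝔞)⟦X⟧) (x y : (U K 𝔞 ⊗[K] U K 𝔞)⟦X⟧) :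
    leftAct w (x * y) = leftAct (leftAct w y) x := by
  refine ext_of_tmul (f := leftAct w ∘ₗ LinearMap.mulRight K y)
    (g := leftAct (leftAct w y)) ?_ (leftAct_X_mul _) ?_ x
  · intro x
    simp only [LinearMap.comp_apply, LinearMap.mulRight_apply, mul_assoc, leftAct_X_mul]
  · intro c d
    simp only [LinearMap.comp_apply, LinearMap.mulRight_apply, leftAct_C_tmul_mul, leftAct_C_tmul]

theorem rightAct_one (w : (U K 𝔞)⟦X⟧) : rightAct w 1 = w := by
  have := rightAct_C_tmul w 1 1
  rwa [uAntipode_one, ← Algebra.TensorProduct.one_def, map_one PowerSeries.C, map_one PowerSeries.C,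
    one_mul, mul_one] at this

theorem leftAct_one (w : (U K 𝔞)⟦X⟧) : leftAct w 1 = w := by
  have := leftAct_C_tmul w 1 1
  rwa [uAntipode_one, ← Algebra.TensorProduct.one_def, map_one PowerSeries.C, map_one PowerSeries.C,
    one_mul, mul_one] at this

theorem rightAct_smul (c : K) (w : (U K 𝔞)⟦X⟧) (x : (U K 𝔞 ⊗[K] U K 𝔞)⟦X⟧) :
    rightAct (c • w) x = c • rightAct w x := by
  refine ext_of_tmul (f := rightAct (c • w)) (g := c • rightAct w)
    (rightAct_X_mul _) ?_ ?_ x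
  · intro x; simp [rightAct_X_mul]
  · intro a b; simp [rightAct_C_tmul]

theorem leftAct_smul (c : K) (w : (U K 𝔞)⟦X⟧) (x : (U K 𝔞 ⊗[K] U K 𝔞)⟦X⟧) :
    leftAct (c • w) x = c • leftAct w x := by
  refine ext_of_tmul (f := leftAct (c • w)) (g := c • leftAct w)
    (leftAct_X_mul _) ?_ ?_ x
  · intro x; simp [leftAct_X_mul]
  · intro a b; simp [leftAct_C_tmul]

/-- `∑ S(a') a'' = ε(a)`. -/
theorem rightAct_comul₀ (a : U K 𝔞) :
    rightAct 1 (comul₀ K 𝔞 a) = uCounit K 𝔞 a • (1 : (U K 𝔞)⟦X⟧) := by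
  have ha : a ∈ Algebra.adjoin K (Set.range (ι : 𝔞 → U K 𝔞)) := by
    rw [adjoin_range_ι]; trivial
  induction ha using Algebra.adjoin_induction with
  | mem a h =>
    obtain ⟨x, rfl⟩ := h
    rw [comul₀_ι, uCounit_ι, zero_smul, gen, inl_C, inr_C, map_add, rightAct_C_tmul,
      rightAct_C_tmul, uAntipode_ι, uAntipode_one]
    simp only [map_neg, map_one, mul_one, one_mul, neg_add_cancel]
  | algebraMap c =>
    rw [AlgHom.commutes, AlgHom.commutes, Algebra.algebraMap_eq_smul_one, map_smul, rightAct_one]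
    rfl
  | add a b _ _ ha hb => rw [map_add, map_add, ha, hb, map_add, add_smul]
  | mul a b _ _ ha hb =>
    rw [map_mul, rightAct_mul, ha, rightAct_smul, hb, smul_smul, map_mul]

/-- `∑ a' S(a'') = ε(a)`. -/
theorem leftAct_comul₀ (a : U K 𝔞) :
    leftAct 1 (comul₀ K 𝔞 a) = uCounit K 𝔞 a • (1 : (U K 𝔞)⟦X⟧) := by
  have ha : a ∈ Algebra.adjoin K (Set.range (ι : 𝔞 → U K 𝔞)) := by
    rw [adjoin_range_ι]; trivial
  induction ha using Algebra.adjoin_induction with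
  | mem a h =>
    obtain ⟨x, rfl⟩ := h
    rw [comul₀_ι, uCounit_ι, zero_smul, gen, inl_C, inr_C, map_add, leftAct_C_tmul,
      leftAct_C_tmul, uAntipode_ι, uAntipode_one]
    simp only [map_neg, map_one, mul_one, one_mul, add_neg_cancel]
  | algebraMap c =>
    rw [AlgHom.commutes, AlgHom.commutes, Algebra.algebraMap_eq_smul_one, map_smul, leftAct_one]
    rfl
  | add a b _ _ ha hb => rw [map_add, map_add, ha, hb, map_add, add_smul]
  | mul a b _ _ ha hb =>
    rw [map_mul, leftAct_mul, hb, leftAct_smul, ha, smul_smul, map_mul, mul_comm]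

/-- `a ⊗ b ⊗ c ↦ a S(b) c`. -/
def mulAntipodeMul : U K 𝔞 ⊗[K] (U K 𝔞 ⊗[K] U K 𝔞) →ₗ[K] U K 𝔞 :=
  LinearMap.mul' K (U K 𝔞) ∘ₗ TensorProduct.map LinearMap.id
    (LinearMap.mul' K (U K 𝔞) ∘ₗ TensorProduct.map (uAntipode K 𝔞) LinearMap.id)

theorem coeffwise_mulAntipodeMul (a h : U K 𝔞) (x y : (U K 𝔞 ⊗[K] U K 𝔞)⟦X⟧) :
    coeffwise K mulAntipodeMul (in1 (PowerSeries.C a) * hom23 x *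
      (hom12 y * in3 (PowerSeries.C h))) =
      PowerSeries.C a * leftAct 1 y * (rightAct 1 x * PowerSeries.C h) := by
  refine coeffwise_mul_ext (K := K) (Φ := hom23 (K := K) (A := U K 𝔞)) hom23_X _ _ _
      (g := LinearMap.mulLeft K (PowerSeries.C a * leftAct 1 y) ∘ₗ
      LinearMap.mulRight K (PowerSeries.C h) ∘ₗ rightAct 1) ?_ ?_ x
  · intro x
    simp only [LinearMap.comp_apply, LinearMap.mulRight_apply, LinearMap.mulLeft_apply,
      rightAct_X_mul, mul_assoc]
    rw [← mul_assoc (leftAct 1 y), ← X_mul, mul_assoc, ← mul_assoc (PowerSeries.C a), ← X_mul]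
    simp only [mul_assoc]
  · intro r s
    rw [← mul_assoc, LinearMap.comp_apply, LinearMap.comp_apply, LinearMap.mulLeft_apply,
      LinearMap.mulRight_apply]
    refine coeffwise_mul_ext (K := K) (Φ := hom12 (K := K) (A := U K 𝔞)) hom12_X _ _ _
      (g := LinearMap.mulRight K
      (rightAct 1 (PowerSeries.C (r ⊗ₜ s)) * PowerSeries.C h) ∘ₗ
        LinearMap.mulLeft K (PowerSeries.C a) ∘ₗ leftAct 1) ?_ ?_ y
    · intro y
      simp only [LinearMap.comp_apply, LinearMap.mulRight_apply, LinearMap.mulLeft_apply,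
        leftAct_X_mul, X_mul_comm_mul]
    · intro p q
      simp only [LinearMap.comp_apply, LinearMap.mulRight_apply, LinearMap.mulLeft_apply,
        rightAct_C_tmul, leftAct_C_tmul, in1, in3, hom12, hom23,
        mapAlgHom_C, AlgHom.comp_apply, inl_C, inr_C, leg12, leg23,
        Algebra.TensorProduct.map_tmul, AlgHom.id_apply,
        Algebra.TensorProduct.includeLeft_apply, Algebra.TensorProduct.includeRight_apply,
        Algebra.TensorProduct.one_def, ← map_mul, Algebra.TensorProduct.tmul_mul_tmul, one_mul,
        mul_one, coeffwise_C, mulAntipodeMul, TensorProduct.map_tmul, LinearMap.mul'_apply,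
        LinearMap.id_apply, uAntipode_mul, mul_assoc]

/-- `a ⊗ b ⊗ c ↦ a S(b) c` maps `(id ⊗ Δ)(F) (Δ ⊗ id)(G)` to `(id ⊗ ε)(F) (ε ⊗ id)(G)`. -/
theorem coeffwise_mulAntipodeMul_comul (F G : (U K 𝔞 ⊗[K] U K 𝔞)⟦X⟧) :
    coeffwise K mulAntipodeMul (comulR (comul₀ K 𝔞) F * comulL (comul₀ K 𝔞) G) =
      counitR (counit₀ K 𝔞) F * counitL (counit₀ K 𝔞) G := by
  rw [← one_mul (comulR (comul₀ K 𝔞) F)]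
  refine coeffwise_mul_ext (K := K) (Φ := comulR (comul₀ K 𝔞)) (comulR_X _) _ _ _
      (g := LinearMap.mulRight K
    (counitL (counit₀ K 𝔞) G) ∘ₗ (counitR (counit₀ K 𝔞)).toLinearMap) ?_ ?_ F
  · intro x; simp [mul_assoc]
  · intro a b
    rw [one_mul, ← mul_one (comulR (comul₀ K 𝔞) _ * _)]
    refine coeffwise_mul_ext (K := K) (Φ := comulL (comul₀ K 𝔞)) (comulL_X _) _ _ _
      (g := LinearMap.mulLeft K
      (counitR (counit₀ K 𝔞) (PowerSeries.C (a ⊗ₜ b))) ∘ₗ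
        (counitL (counit₀ K 𝔞)).toLinearMap) ?_ ?_ G
    · intro x
      simp only [LinearMap.comp_apply, LinearMap.mulLeft_apply, AlgHom.toLinearMap_apply,
        map_mul, counitL_X]
      rw [← mul_assoc, ← X_mul, mul_assoc]
    · intro g h
      have e1 : ∀ c : K, mapAlgHom (Algebra.ofId K (U K 𝔞)) (PowerSeries.C c) =
          c • (1 : (U K 𝔞)⟦X⟧) := by
        intro c
        rw [mapAlgHom_C, Algebra.ofId_apply, Algebra.algebraMap_eq_smul_one,
          ← map_one PowerSeries.C]
        exact map_smul (constL K) c (1 : U K 𝔞)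
      simp only [LinearMap.comp_apply, LinearMap.mulLeft_apply, AlgHom.toLinearMap_apply, mul_one]
      rw [← inl_mul_inr_C, ← inl_mul_inr_C]
      simp only [map_mul, comulR_inl, comulR_inr, comulL_inl, comulL_inr, counitR_inl, counitR_inr,
        counitL_inl, counitL_inr, zExtHom_C, coeffwise_mulAntipodeMul, rightAct_comul₀,
        leftAct_comul₀, counit₀, AlgHom.comp_apply, constHom_apply, e1]
      simp [smul_smul, mul_comm]

theorem isUnit_of_constantCoeff_eq_one [CharZero K] {A : Type*} [Ring A] [Algebra K A] {y : A⟦X⟧}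
    (h : constantCoeff y = 1) : IsUnit y := by
  have := isUnit_fexp (K := K) (constantCoeff_flog (K := K) (y - 1))
  rwa [fexp_flog (by simp [h]), add_sub_cancel] at this

variable {F : (U K 𝔞 ⊗[K] U K 𝔞)⟦X⟧}

theorem twistV_eq : twistV K (S₀ K 𝔞) F = leftAct 1 F := by
  have : LinearMap.mulRight K 1 ∘ₗ constL K = constL K (A := U K 𝔞) := by ext a; simp
  rw [leftAct, this]; rfl

theorem twistAntipode_apply (S : U K 𝔞 →ₗ[K] (U K 𝔞)⟦X⟧) (a : U K 𝔞) :
    twistAntipode K S F a = twistV K S F * (S a * Ring.inverse (twistV K S F)) := rfl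

variable [CharZero K]

/-- `v` is `1` modulo `z`. -/
theorem isUnit_twistV (h0 : constantCoeff F = 1) : IsUnit (twistV K (S₀ K 𝔞) F) := by
  refine isUnit_of_constantCoeff_eq_one (K := K) ?_
  obtain ⟨G, hG⟩ := exists_eq_X_mul (x := F - 1) (by simp [h0])
  rw [twistV_eq, ← sub_add_cancel F 1, hG, map_add, leftAct_X_mul, leftAct_one]
  simp

/-- `v⁻¹ = ∑ S(g') g''` for `F⁻¹ = ∑ g' ⊗ g''`. -/
theorem inverse_twistV (h0 : constantCoeff F = 1)
    (hF : IsTwist K (Δ₀ K 𝔞) (ε₀ K 𝔞) F) :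
    Ring.inverse (twistV K (S₀ K 𝔞) F) = rightAct 1 (Ring.inverse F) := by
  have hu := hF.isUnit
  have hi : Ring.inverse F * F = 1 := Ring.inverse_mul_cancel F hu
  have hi' : F * Ring.inverse F = 1 := Ring.mul_inverse_cancel F hu
  have hc : hom12 F * comulL (comul₀ K 𝔞) F = hom23 F * comulR (comul₀ K 𝔞) F := hF.cocycle
  have h1 : counitL (counit₀ K 𝔞) F = 1 := hF.counit_left
  have h2 : counitR (counit₀ K 𝔞) F = 1 := hF.counit_right
  have key : hom23 (Ring.inverse F) * hom12 F =
      comulR (comul₀ K 𝔞) F * comulL (comul₀ K 𝔞) (Ring.inverse F) := by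
    have := congrArg (fun x => hom23 (Ring.inverse F) * x * comulL (comul₀ K 𝔞) (Ring.inverse F)) hc
    simp only [mul_assoc, ← map_mul, hi', map_one, mul_one] at this
    rwa [← mul_assoc, ← map_mul, hi, map_one, one_mul] at this
  have h3 : counitL (counit₀ K 𝔞) (Ring.inverse F) = 1 := by
    have := congrArg (counitL (counit₀ K 𝔞)) hi
    rwa [map_mul, h1, mul_one, map_one] at this
  have h4 := congrArg (coeffwise K mulAntipodeMul) key
  rw [coeffwise_mulAntipodeMul_comul, h2, h3, mul_one] at h4
  have h5 := coeffwise_mulAntipodeMul 1 1 (Ring.inverse F) F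
  simp only [map_one, one_mul, mul_one] at h5
  rw [h4] at h5
  have hv := isUnit_twistV (K := K) (𝔞 := 𝔞) h0
  refine hv.mul_left_cancel ?_
  rw [Ring.mul_inverse_cancel _ hv, twistV_eq, ← h5]

/-- A twist of the enveloping algebra makes `U(𝔞)⟦z⟧` a topological Hopf algebra. -/
theorem isFormalHopfAlgebra_of_twist (h0 : constantCoeff F = 1)
    (hF : IsTwist K (Δ₀ K 𝔞) (ε₀ K 𝔞) F) :
    IsFormalHopfAlgebra K (twistComul K (Δ₀ K 𝔞) F) (ε₀ K 𝔞) (twistAntipode K (S₀ K 𝔞) F) := by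
  have hu := hF.isUnit
  have hi : Ring.inverse F * F = 1 := Ring.inverse_mul_cancel F hu
  have hv := isUnit_twistV (K := K) (𝔞 := 𝔞) h0
  have hw := inverse_twistV h0 hF
  set v := twistV K (S₀ K 𝔞) F with hvd
  set w := rightAct 1 (Ring.inverse F) with hwd
  have hwF : rightAct w F = 1 := by rw [hwd, ← rightAct_mul, hi, rightAct_one]
  have hvF : leftAct v (Ring.inverse F) = 1 := by
    rw [hvd, twistV_eq, ← leftAct_mul, hi, leftAct_one]
  have hvw : v * w = 1 := by rw [← hw, Ring.mul_inverse_cancel _ hv]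
  have hε : ∀ a, PowerSeries.map (algebraMap K (U K 𝔞)) (ε₀ K 𝔞 a) =
      uCounit K 𝔞 a • (1 : (U K 𝔞)⟦X⟧) := by
    intro a
    change PowerSeries.map _ (PowerSeries.C _) = _
    rw [map_C, Algebra.algebraMap_eq_smul_one, ← map_one PowerSeries.C]
    exact map_smul (constL K) _ (1 : U K 𝔞)
  have hD : ∀ a, twistComul K (Δ₀ K 𝔞) F a = F * comul₀ K 𝔞 a * Ring.inverse F :=
    fun a => twistComul_apply _ _ _
  have hsw : ∀ a : U K 𝔞, twistAntipode K (S₀ K 𝔞) F a = v * (S₀ K 𝔞 a * w) := by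
    intro a; rw [twistAntipode_apply, ← hvd, hw]
  rw [← comul₀_toLinearMap, ← counit₀_toLinearMap] at *
  rw [← twistHom_toLinearMap (comul₀ K 𝔞) hu]
  refine ⟨map_one (twistHom _ hu), map_mul (twistHom _ hu), map_one (counit₀ K 𝔞),
    map_mul (counit₀ K 𝔞), ?_, ?_, ?_, ?_, ?_⟩
  · exact coassoc_twistHom hu hF.cocycle coassoc₀
  · exact counitL_twistHom hu hF.counit_left counitL_comul₀
  · exact counitR_twistHom hu hF.counit_right counitR_comul₀
  · intro a
    rw [hε]
    have e : ∀ x, mulTensor K (twistAntipode K (S₀ K 𝔞) F) (constL K) x = v * rightAct w x := by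
      refine ext_of_tmul (f := mulTensorLin (twistAntipode K (S₀ K 𝔞) F) (constL K))
        (g := LinearMap.mulLeft K v ∘ₗ rightAct w) (mulTensor_X_mul _ _) ?_ ?_
      · intro x
        have := X_mul_comm_mul v (rightAct w x) 1
        rw [mul_one, mul_one] at this
        simp only [LinearMap.comp_apply, LinearMap.mulLeft_apply, rightAct_X_mul, this]
      · intro a b
        rw [mulTensorLin_apply, mulTensor_C_tmul, hsw, LinearMap.comp_apply, rightAct_C_tmul,
          LinearMap.mulLeft_apply, S₀_apply, constL_apply]
        simp only [mul_assoc]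
    rw [e]
    change v * rightAct w (twistComul K (comul₀ K 𝔞).toLinearMap F a) = _
    rw [hD, rightAct_mul, rightAct_mul, hwF, rightAct_comul₀, rightAct_smul, mul_smul_comm, ← hwd,
      hvw]
  · intro a
    rw [hε]
    have e : ∀ x, mulTensor K (constL K) (twistAntipode K (S₀ K 𝔞) F) x = leftAct v x * w := by
      refine ext_of_tmul (f := mulTensorLin (constL K) (twistAntipode K (S₀ K 𝔞) F))
        (g := LinearMap.mulRight K w ∘ₗ leftAct v) (mulTensor_X_mul _ _) ?_ ?_
      · intro x
        simp only [LinearMap.comp_apply, LinearMap.mulRight_apply, leftAct_X_mul, mul_assoc]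
      · intro a b
        rw [mulTensorLin_apply, mulTensor_C_tmul, hsw, LinearMap.comp_apply, leftAct_C_tmul,
          LinearMap.mulRight_apply, S₀_apply, constL_apply]
        simp only [mul_assoc]
    rw [e]
    change leftAct v (twistComul K (comul₀ K 𝔞).toLinearMap F a) * w = _
    rw [hD, mul_assoc, leftAct_mul, leftAct_mul, hvF, leftAct_comul₀, leftAct_smul, ← twistV_eq,
      ← hvd, smul_mul_assoc, hvw]

end EnvelopingHopf

/-! ### Commutators -/

section Commutators

variable {K : Type*} [Field K] {A B : Type*} [Ring A] [Algebra K A] [Ring B] [Algebra K B]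

open PowerSeries

theorem lie_eq_iff {R : Type*} [Ring R] {a b c : R} : ⁅a, b⁆ = c ↔ a * b = b * a + c := by
  rw [Ring.lie_def, sub_eq_iff_eq_add, add_comm]

theorem commute_iff_lie {R : Type*} [Ring R] {a b : R} : Commute a b ↔ ⁅a, b⁆ = 0 := by
  rw [lie_eq_iff, add_zero]; rfl

theorem mul_lie_mul {R : Type*} [Ring R] (a b c : R) : ⁅a * b, c⁆ = a * ⁅b, c⁆ + ⁅a, c⁆ * b := by
  simp only [Ring.lie_def]; noncomm_ring

theorem lie_X (a : A⟦X⟧) : ⁅(X : A⟦X⟧), a⁆ = 0 := by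
  rw [Ring.lie_def, X_mul, sub_self]

theorem lie_X_mul (a b : A⟦X⟧) : ⁅a, X * b⁆ = X * ⁅a, b⁆ := by
  rw [Ring.lie_def, Ring.lie_def, mul_sub, ← mul_assoc, ← X_mul, mul_assoc, mul_assoc]

theorem X_mul_lie (a b : A⟦X⟧) : ⁅X * a, b⁆ = X * ⁅a, b⁆ := by
  rw [mul_lie_mul, lie_X, zero_mul, add_zero]

theorem map_lie_series (f : A⟦X⟧ →ₐ[K] B⟦X⟧) (a b : A⟦X⟧) : f ⁅a, b⁆ = ⁅f a, f b⁆ := by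
  simp only [Ring.lie_def, map_sub, map_mul]

theorem inl_mul_inr_mul (a c : A⟦X⟧) (b d : B⟦X⟧) :
    inl (K := K) (A := A) (B := B) a * inr (K := K) (A := A) (B := B) b *
      (inl (K := K) (A := A) (B := B) c * inr (K := K) (A := A) (B := B) d) =
      inl (a * c) * inr (b * d) := by
  rw [map_mul, map_mul, mul_assoc, ← mul_assoc (inr b), ← (commute_inl_inr (K := K) c b).eq]
  simp only [mul_assoc]

theorem lie_inl_mul_inr_inl (a c : A⟦X⟧) (b : B⟦X⟧) :
    ⁅inl (K := K) (A := A) (B := B) a * inr b, inl (K := K) (A := A) (B := B) c⁆ =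
      inl ⁅a, c⁆ * inr b := by
  have := inl_mul_inr_mul (K := K) (A := A) (B := B) a c b 1
  have h2 := inl_mul_inr_mul (K := K) (A := A) (B := B) c a 1 b
  simp only [map_one, mul_one, one_mul] at this h2
  rw [Ring.lie_def, this, h2, Ring.lie_def, map_sub, sub_mul]

theorem lie_inl_mul_inr_inr (a : A⟦X⟧) (b d : B⟦X⟧) :
    ⁅inl (K := K) (A := A) (B := B) a * inr b, inr (K := K) (A := A) (B := B) d⁆ =
      inl a * inr ⁅b, d⁆ := by
  have := inl_mul_inr_mul (K := K) (A := A) (B := B) a 1 b d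
  have h2 := inl_mul_inr_mul (K := K) (A := A) (B := B) 1 a d b
  simp only [map_one, mul_one, one_mul] at this h2
  rw [Ring.lie_def, this, h2, Ring.lie_def, map_sub, mul_sub]

theorem lie_inl_mul_inr_of_commute (a c : A⟦X⟧) {b d : B⟦X⟧} (h : Commute b d) :
    ⁅inl (K := K) (A := A) (B := B) a * inr b, inl c * inr (K := K) (A := A) (B := B) d⁆ =
      inl ⁅a, c⁆ * inr (b * d) := by
  rw [Ring.lie_def, inl_mul_inr_mul, inl_mul_inr_mul, ← h.eq, Ring.lie_def, map_sub, sub_mul]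

/-- `e^{a ⊗ s} (x ⊗ 1) e^{-a ⊗ s} = x ⊗ e^{c s}`, when `[a, x] = c x`. -/
theorem semiconjBy_inl_of_weight [CharZero K] {a x : A⟦X⟧} {s : B⟦X⟧} {c : K}
    (hs : constantCoeff s = 0) (h : ⁅a, x⁆ = c • x) :
    SemiconjBy (fexp K (inl (K := K) (A := A) (B := B) a * inr s))
      (inl (K := K) (A := A) (B := B) x)
      (inl x * inr (fexp K (c • s))) := by
  rw [map_fexp _ inr_X (by simp [hs]), map_smul]
  refine semiconjBy_fexp_of_weight (by simp [hs]) ?_ (commute_inl_inr _ _)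
    (commute_inl_inr _ _).symm
  rw [← lie_eq_iff, ← map_lie_series, h, map_smul]

/-- `e^{a ⊗ s} (1 ⊗ y) e^{-a ⊗ s} = 1 ⊗ y + a ⊗ [s, y]`, when `s` commutes with `[s, y]`. -/
theorem semiconjBy_inr_of_lie [CharZero K] {a : A⟦X⟧} {s y w : B⟦X⟧}
    (hs : constantCoeff s = 0) (h : ⁅s, y⁆ = w) (hw : Commute s w) :
    SemiconjBy (fexp K (inl (K := K) (A := A) (B := B) a * inr s))
      (inr (K := K) (A := A) (B := B) y)
       (inr y + inl a * inr w) := by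
  refine semiconjBy_fexp_of_first (by simp [hs]) ?_ ?_
  · rw [← lie_eq_iff, lie_inl_mul_inr_inr, h]
  · rw [commute_iff_lie, lie_inl_mul_inr_of_commute _ _ hw, lie_self, map_zero, zero_mul]

theorem semiconjBy_inr_of_commute [CharZero K] {a : A⟦X⟧} {s y : B⟦X⟧}
    (hs : constantCoeff s = 0) (h : Commute s y) :
    SemiconjBy (fexp K (inl (K := K) (A := A) (B := B) a * inr s))
      (inr (K := K) (A := A) (B := B) y)
       (inr y) := by
  simpa using semiconjBy_inr_of_lie (K := K) (a := a) hs (commute_iff_lie.mp h)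
    (Commute.zero_right s)

theorem lie_fexp [CharZero K] {P x y : A⟦X⟧} (hP : constantCoeff P = 0) (h : ⁅P, x⁆ = y)
    (hy : Commute P y) : ⁅fexp K P, x⁆ = y * fexp K P := by
  rw [lie_eq_iff, (semiconjBy_fexp_of_first hP (lie_eq_iff.mp h) hy).eq, add_mul]

theorem lie_flog [CharZero K] {x y w : A⟦X⟧} (hx : constantCoeff x = 0) (h : ⁅x, y⁆ = w)
    (hw : Commute x w) : ⁅flog K x, y⁆ = w * fexp K (-flog K x) := by
  rw [lie_eq_iff, flog_mul_eq hx (lie_eq_iff.mp h) hw]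

end Commutators

/-! ### The carrier algebra -/

section Gen

variable {K : Type*} [Field K] {𝔞 : Type*} [LieRing 𝔞] [LieAlgebra K 𝔞]

theorem lie_gen (x y : 𝔞) : ⁅gen K x, gen K y⁆ = gen K ⁅x, y⁆ := by
  rw [gen, gen, gen, LieHom.map_lie, Ring.lie_def, Ring.lie_def, map_sub, map_mul, map_mul]

theorem gen_smul (c : K) (x : 𝔞) : gen K (c • x) = c • gen K x := by
  rw [gen, map_smul]; exact map_smul (constL K) c _

theorem gen_sub (x y : 𝔞) : gen K (x - y) = gen K x - gen K y := by
  rw [gen, map_sub, map_sub]; rfl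

theorem gen_neg (x : 𝔞) : gen K (-x) = -gen K x := by
  rw [gen, map_neg, map_neg]; rfl

theorem gen_zero : gen K (0 : 𝔞) = 0 := by
  rw [gen, map_zero, map_zero]

theorem commute_gen {x y : 𝔞} (h : ⁅x, y⁆ = 0) : Commute (gen K x) (gen K y) := by
  rw [commute_iff_lie, lie_gen, h, gen_zero]

end Gen

namespace CarrierGens

section

variable {K : Type*} [Field K] [CharZero K] {𝔞 : Type*} [LieRing 𝔞] [LieAlgebra K 𝔞]
variable {o : CarrierGens 𝔞}

open PowerSeries

theorem Relations.swap {x y z : 𝔞} (h : ⁅x, y⁆ = z) : ⁅y, x⁆ = -z := by rw [← h, lie_skew]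

variable (o) in
@[simp] theorem constantCoeff_σm : constantCoeff (o.σm K) = 0 := constantCoeff_flog _
variable (o) in
@[simp] theorem constantCoeff_σp : constantCoeff (o.σp K) = 0 := constantCoeff_flog _

/-- A series commuting with `T_-, T_+, T_a` commutes with `σ_±` and `T`. -/
theorem commute_of_T {x : (U K 𝔞)⟦X⟧} (hm : Commute x (gen K o.Tm)) (hp : Commute x (gen K o.Tp))
    (hT : ∀ a, Commute x (gen K (o.T a))) :
    Commute x (o.σm K) ∧ Commute x (o.Tz K) ∧ Commute x (o.σp K) := by
  have h1 : Commute x (o.σm K) := commute_flog (by simp)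
    ((((commute_X x).mul_right hm).smul_right 2).neg_right)
  have h2 : Commute x (o.Tz K) := hp.add_right ((commute_X x).mul_right
    ((((hT 0).pow_right 2).add_right ((hT 1).pow_right 2)).mul_right
      (commute_fexp (by simp) h1.neg_right)))
  exact ⟨h1, h2, commute_flog (by simp) ((((commute_X x).mul_right h2).smul_right 2).neg_right)⟩

theorem commute_e {x : (U K 𝔞)⟦X⟧} (hm : Commute x (o.σm K)) (hp : Commute x (o.σp K)) (α β : K) :
    Commute x (o.e K α β) :=
  commute_fexp (by simp) ((hp.smul_right α).add_right (hm.smul_right β))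

theorem e_zero_eq (β : K) : o.e K 0 β = fexp K (β • o.σm K) := by
  rw [e, zero_smul, zero_add]

theorem e_eq_zero (α : K) : o.e K α 0 = fexp K (α • o.σp K) := by
  rw [e, zero_smul, add_zero]

@[simp] theorem e_zero_zero : o.e K 0 0 = 1 := by
  rw [e_zero_eq, zero_smul, fexp_zero]

theorem e_zero_one : o.e K 0 1 = 1 - (2 : K) • (X * gen K o.Tm) := by
  rw [e_zero_eq, one_smul, σm, fexp_flog (by simp), sub_eq_add_neg]

theorem e_one_zero : o.e K 1 0 = 1 - (2 : K) • (X * o.Tz K) := by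
  rw [e_eq_zero, one_smul, σp, fexp_flog (by simp), sub_eq_add_neg]

theorem two_X_Tm : (2 : K) • (X * gen K o.Tm) = 1 - o.e K 0 1 := by
  rw [e_zero_one, sub_sub_cancel]

theorem two_X_Tz : (2 : K) • (X * o.Tz K) = 1 - o.e K 1 0 := by
  rw [e_one_zero, sub_sub_cancel]

variable (h : o.Relations K)
include h

theorem commute_Tm_all : Commute (gen K o.Tm) (o.σm K) ∧ Commute (gen K o.Tm) (o.Tz K) ∧
    Commute (gen K o.Tm) (o.σp K) :=
  commute_of_T (Commute.refl _) (commute_gen (by rw [Relations.swap h.Tp_Tm, neg_zero]))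
    (fun a => commute_gen (h.Tm_T a))

theorem commute_Tp_all : Commute (gen K o.Tp) (o.σm K) ∧ Commute (gen K o.Tp) (o.Tz K) ∧
    Commute (gen K o.Tp) (o.σp K) :=
  commute_of_T (commute_gen h.Tp_Tm) (Commute.refl _) (fun a => commute_gen (h.Tp_T a))

theorem commute_T_all (a : Fin 2) : Commute (gen K (o.T a)) (o.σm K) ∧
    Commute (gen K (o.T a)) (o.Tz K) ∧ Commute (gen K (o.T a)) (o.σp K) :=
  commute_of_T (commute_gen (by rw [Relations.swap (h.Tm_T a), neg_zero]))
    (commute_gen (by rw [Relations.swap (h.Tp_T a), neg_zero])) (fun b => commute_gen (h.T_T a b))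

theorem commute_σm_all : Commute (o.σm K) (o.Tz K) ∧ Commute (o.σm K) (o.σp K) :=
  (commute_of_T (commute_Tm_all h).1.symm (commute_Tp_all h).1.symm
    (fun a => (commute_T_all h a).1.symm)).2

theorem commute_σp_Tz : Commute (o.σp K) (o.Tz K) :=
  (commute_of_T (commute_Tm_all h).2.2.symm (commute_Tp_all h).2.2.symm
    (fun a => (commute_T_all h a).2.2.symm)).2.1

theorem commute_σm_e (α β : K) : Commute (o.σm K) (o.e K α β) :=
  commute_e (Commute.refl _) (commute_σm_all h).2 α β

theorem commute_σp_e (α β : K) : Commute (o.σp K) (o.e K α β) :=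
  commute_e (commute_σm_all h).2.symm (Commute.refl _) α β

theorem commute_T_e (a : Fin 2) (α β : K) : Commute (gen K (o.T a)) (o.e K α β) :=
  commute_e (commute_T_all h a).1 (commute_T_all h a).2.2 α β

theorem commute_Tz_e (α β : K) : Commute (o.Tz K) (o.e K α β) :=
  commute_e (commute_σm_all h).1.symm (commute_σp_Tz h).symm α β

theorem commute_Tm_e (α β : K) : Commute (gen K o.Tm) (o.e K α β) :=
  commute_e (commute_Tm_all h).1 (commute_Tm_all h).2.2 α β

theorem e_mul_e (α β γ δ : K) : o.e K α β * o.e K γ δ = o.e K (α + γ) (β + δ) := by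
  have hc := (commute_σm_all h).2
  rw [e, e, e, ← fexp_add (by simp) (by simp)]
  · congr 1; module
  · exact (((Commute.refl _).smul_right γ).add_right (hc.symm.smul_right δ)).smul_left α |>.add_left
      (((hc.smul_right γ).add_right ((Commute.refl _).smul_right δ)).smul_left β)

theorem commute_T_T (a b : Fin 2) : Commute (gen K (o.T a)) (gen K (o.T b)) :=
  commute_gen (h.T_T a b)

theorem commute_Q {x : (U K 𝔞)⟦X⟧} (hx : ∀ a, Commute x (gen K (o.T a))) :
    Commute x (gen K (o.T 0) ^ 2 + gen K (o.T 1) ^ 2) :=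
  ((hx 0).pow_right 2).add_right ((hx 1).pow_right 2)

/-! ### Commutators with `σ_±` -/

theorem lie_gen_T_Hm (a : Fin 2) :
    ⁅gen K (o.T a), gen K o.Hm⁆ = -((1 / 2 : K) • gen K (o.T a)) := by
  rw [lie_gen, Relations.swap (h.Hm_T a), gen_neg, gen_smul]

theorem lie_gen_T_Hp (a : Fin 2) :
    ⁅gen K (o.T a), gen K o.Hp⁆ = -((1 / 2 : K) • gen K (o.T a)) := by
  rw [lie_gen, Relations.swap (h.Hp_T a), gen_neg, gen_smul]

theorem lie_gen_T_B (a b : Fin 2) :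
    ⁅gen K (o.T b), gen K (o.B a)⁆ = if a = b then -gen K o.Tm else 0 := by
  rw [lie_gen, Relations.swap (h.B_T a b)]
  split_ifs
  · rw [gen_neg]
  · rw [neg_zero, gen_zero]

theorem commute_σm_Hp : Commute (o.σm K) (gen K o.Hp) :=
  (commute_flog (by simp) ((((commute_X _).mul_right
    (commute_gen h.Hp_Tm)).smul_right 2).neg_right)).symm

theorem commute_σm_B (a : Fin 2) : Commute (o.σm K) (gen K (o.B a)) :=
  (commute_flog (by simp) ((((commute_X _).mul_right
    (commute_gen (h.B_Tm a))).smul_right 2).neg_right)).symm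

theorem commute_e_B (β : K) (a : Fin 2) : Commute (o.e K 0 β) (gen K (o.B a)) := by
  rw [e_zero_eq]
  exact (commute_fexp (by simp) ((commute_σm_B h a).symm.smul_right β)).symm

theorem commute_e_Hp (β : K) : Commute (o.e K 0 β) (gen K o.Hp) := by
  rw [e_zero_eq]
  exact (commute_fexp (by simp) ((commute_σm_Hp h).symm.smul_right β)).symm

theorem lie_σm_Hm : ⁅o.σm K, gen K o.Hm⁆ = o.e K 0 (-1) - 1 := by
  have hx : ⁅-((2 : K) • (X * gen K o.Tm)), gen K o.Hm⁆ = (2 : K) • (X * gen K o.Tm) := by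
    rw [neg_lie, smul_lie, X_mul_lie, lie_gen, Relations.swap h.Hm_Tm, gen_neg, mul_neg, smul_neg,
      neg_neg]
  rw [σm, lie_flog (by simp) hx ((Commute.refl _).neg_left), ← σm, two_X_Tm, ← neg_one_smul K,
    ← e_zero_eq, sub_mul, one_mul, e_mul_e h]
  simp

theorem lie_e_Hm (β : K) :
    ⁅o.e K 0 β, gen K o.Hm⁆ = β • (o.e K 0 (β - 1) - o.e K 0 β) := by
  have hc : Commute (β • o.σm K) (β • (o.e K 0 (-1) - 1)) :=
    (((commute_σm_e h 0 (-1)).sub_right (Commute.one_right _)).smul_right β).smul_left β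
  rw [e_zero_eq, lie_fexp (by simp) (y := β • (o.e K 0 (-1) - 1))
    (by rw [smul_lie, lie_σm_Hm h]) hc,
    ← e_zero_eq, smul_mul_assoc, sub_mul, e_mul_e h, one_mul, add_zero, neg_add_eq_sub]

theorem lie_T_e_Hm (a : Fin 2) (β : K) :
    ⁅gen K (o.T a) * o.e K 0 β, gen K o.Hm⁆ =
      gen K (o.T a) * (β • o.e K 0 (β - 1) - (β + 1 / 2) • o.e K 0 β) := by
  rw [mul_lie_mul, lie_e_Hm h, lie_gen_T_Hm h]
  simp only [neg_mul, smul_mul_assoc, mul_sub, mul_smul_comm, smul_sub, add_smul, mul_add]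
  abel

theorem lie_T_e_Hp (a : Fin 2) (β : K) :
    ⁅gen K (o.T a) * o.e K 0 β, gen K o.Hp⁆ =
      -((1 / 2 : K) • (gen K (o.T a) * o.e K 0 β)) := by
  rw [mul_lie_mul, commute_iff_lie.mp (commute_e_Hp h β), lie_gen_T_Hp h, mul_zero, zero_add,
    neg_mul, smul_mul_assoc]

theorem lie_T_e_B (a b : Fin 2) (β : K) :
    ⁅gen K (o.T b) * o.e K 0 β, gen K (o.B a)⁆ =
      if a = b then -(gen K o.Tm * o.e K 0 β) else 0 := by
  rw [mul_lie_mul, commute_iff_lie.mp (commute_e_B h β a), lie_gen_T_B h, mul_zero, zero_add]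
  split_ifs
  · rw [neg_mul]
  · rw [zero_mul]

theorem lie_sq_Hm (a : Fin 2) : ⁅gen K (o.T a) ^ 2, gen K o.Hm⁆ = -gen K (o.T a) ^ 2 := by
  rw [pow_two, mul_lie_mul, lie_gen_T_Hm h, mul_neg, neg_mul, mul_smul_comm, smul_mul_assoc]
  module

theorem lie_sq_Hp (a : Fin 2) : ⁅gen K (o.T a) ^ 2, gen K o.Hp⁆ = -gen K (o.T a) ^ 2 := by
  rw [pow_two, mul_lie_mul, lie_gen_T_Hp h, mul_neg, neg_mul, mul_smul_comm, smul_mul_assoc]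
  module

theorem lie_Q_B (a : Fin 2) : ⁅gen K (o.T 0) ^ 2 + gen K (o.T 1) ^ 2, gen K (o.B a)⁆ =
    -((2 : K) • (gen K o.Tm * gen K (o.T a))) := by
  have e : ∀ b, ⁅gen K (o.T b) ^ 2, gen K (o.B a)⁆ =
      if a = b then -((2 : K) • (gen K o.Tm * gen K (o.T a))) else 0 := by
    intro b
    rw [pow_two, mul_lie_mul, lie_gen_T_B h]
    split_ifs with hab
    · subst hab
      rw [mul_neg, neg_mul, ← (commute_gen (h.Tm_T a) : Commute (gen K o.Tm) _).eq, two_smul,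
        neg_add]
    · simp
  rw [add_lie, e, e]
  fin_cases a <;> simp

theorem Tz_eq : o.Tz K = gen K o.Tp +
    X * ((gen K (o.T 0) ^ 2 + gen K (o.T 1) ^ 2) * o.e K 0 (-1)) := by
  rw [Tz, e_zero_eq, neg_one_smul]

theorem lie_Tz_Hp : ⁅o.Tz K, gen K o.Hp⁆ = -o.Tz K := by
  rw [Tz_eq h, add_lie, X_mul_lie, mul_lie_mul, commute_iff_lie.mp (commute_e_Hp h _), add_lie,
    lie_sq_Hp h, lie_sq_Hp h, lie_gen, Relations.swap h.Hp_Tp, gen_neg]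
  noncomm_ring

theorem lie_Tz_Hm : ⁅o.Tz K, gen K o.Hm⁆ =
    -(X * ((gen K (o.T 0) ^ 2 + gen K (o.T 1) ^ 2) * o.e K 0 (-2))) := by
  rw [Tz_eq h, add_lie, X_mul_lie, mul_lie_mul, lie_e_Hm h, add_lie, lie_sq_Hm h, lie_sq_Hm h,
    lie_gen, Relations.swap h.Hm_Tp, neg_zero, gen_zero, show (-1 - 1 : K) = -2 by norm_num,
    neg_one_smul]
  noncomm_ring

theorem lie_Tz_B (a : Fin 2) : ⁅o.Tz K, gen K (o.B a)⁆ = -(gen K (o.T a) * o.e K 0 (-1)) := by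
  have e1 : X * (-((2 : K) • (gen K o.Tm * gen K (o.T a))) * o.e K 0 (-1)) =
      -((2 : K) • (X * gen K o.Tm)) * (gen K (o.T a) * o.e K 0 (-1)) := by
    simp only [neg_mul, mul_neg, smul_mul_assoc, mul_smul_comm, mul_assoc]
  rw [Tz_eq h, add_lie, X_mul_lie, mul_lie_mul, commute_iff_lie.mp (commute_e_B h _ a), lie_Q_B h,
    lie_gen, Relations.swap (h.B_Tp a), gen_neg, mul_zero, zero_add, e1, two_X_Tm, neg_sub, sub_mul,
    one_mul, ← mul_assoc, ← (commute_T_e h a 0 1).eq, mul_assoc, e_mul_e h]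
  simp only [add_zero, add_neg_cancel, e_zero_zero, mul_one]
  abel

theorem lie_σp {x w : (U K 𝔞)⟦X⟧} (hx : ⁅o.Tz K, x⁆ = -w) (hw : Commute (o.Tz K) w) :
    ⁅o.σp K, x⁆ = (2 : K) • (X * (w * o.e K (-1) 0)) := by
  have e1 : ⁅-((2 : K) • (X * o.Tz K)), x⁆ = (2 : K) • (X * w) := by
    rw [neg_lie, smul_lie, X_mul_lie, hx, mul_neg, smul_neg, neg_neg]
  have e2 : Commute (-((2 : K) • (X * o.Tz K))) ((2 : K) • (X * w)) :=
    (((commute_X _).mul_right ((((commute_X w).symm.mul_left hw).smul_left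
      (2 : K)).neg_left)).smul_right 2)
  rw [σp, lie_flog (by simp) e1 e2, ← σp, e_eq_zero, neg_one_smul, smul_mul_assoc, mul_assoc]

theorem lie_σp_Hp : ⁅o.σp K, gen K o.Hp⁆ = o.e K (-1) 0 - 1 := by
  rw [lie_σp h (lie_Tz_Hp h) (Commute.refl _), ← mul_assoc, ← smul_mul_assoc, two_X_Tz, sub_mul,
    one_mul, e_mul_e h]
  simp

theorem commute_Tz_Q : Commute (o.Tz K) (gen K (o.T 0) ^ 2 + gen K (o.T 1) ^ 2) :=
  commute_Q h fun a => (commute_T_all h a).2.1.symm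

theorem lie_σp_Hm : ⁅o.σp K, gen K o.Hm⁆ =
    (2 : K) • (X ^ 2 * ((gen K (o.T 0) ^ 2 + gen K (o.T 1) ^ 2) * o.e K (-1) (-2))) := by
  rw [lie_σp h (lie_Tz_Hm h) ((commute_X _).mul_right
    ((commute_Tz_Q h).mul_right (commute_Tz_e h _ _))), mul_assoc, mul_assoc,
    e_mul_e h, zero_add, add_zero, ← mul_assoc X X, ← sq]

theorem lie_σp_B (a : Fin 2) : ⁅o.σp K, gen K (o.B a)⁆ =
    (2 : K) • (X * (gen K (o.T a) * o.e K (-1) (-1))) := by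
  rw [lie_σp h (lie_Tz_B h a) ((commute_T_all h a).2.1.symm.mul_right (commute_Tz_e h _ _)),
    mul_assoc, e_mul_e h, zero_add, add_zero]

end

end CarrierGens

/-! ### Factorization of exponentials -/

section Factor

variable {K : Type*} [Field K] [CharZero K] {A : Type*} [Ring A] [Algebra K A]

open PowerSeries

/-- `e^{h ⊗ s}` has the first leg primitive: if `D h = h ⊗ 1 + 1 ⊗ h`, then
`(D ⊗ id) (h ⊗ s) = (h ⊗ s)₁₃ + (h ⊗ s)₂₃`. -/
theorem comulL_inl_mul_inr {D : A →ₐ[K] (A ⊗[K] A)⟦X⟧} {h s : A⟦X⟧}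
    (hD : zExtHom D h = inl h + inr h) :
    comulL D (inl h * inr s) = hom13 (inl h * inr s) + hom23 (inl h * inr s) := by
  rw [map_mul, map_mul, map_mul, comulL_inl, hD, comulL_inr, map_add, add_mul, hom12_inl, hom12_inr,
    hom13_inl, hom13_inr, hom23_inl, hom23_inr]

theorem comulR_inl_mul_inr {D : A →ₐ[K] (A ⊗[K] A)⟦X⟧} {h s : A⟦X⟧}
    (hD : zExtHom D s = inl s + inr s) :
    comulR D (inl h * inr s) = hom12 (inl h * inr s) + hom13 (inl h * inr s) := by
  rw [map_mul, map_mul, map_mul, comulR_inl, comulR_inr, hD, map_add, mul_add, hom12_inl, hom12_inr,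
    hom13_inl, hom13_inr, hom23_inl, hom23_inr]

theorem commute_hom13_hom23 {h s h' s' : A⟦X⟧} (hs : Commute s s') :
    Commute (hom13 (K := K) (inl h * inr s)) (hom23 (K := K) (inl h' * inr s')) := by
  rw [map_mul, map_mul, hom13_inl, hom13_inr, hom23_inl, hom23_inr]
  exact ((commute_in1_in2 (K := K) h h').mul_right (commute_in1_in3 (K := K) h s')).mul_left
    ((commute_in2_in3 (K := K) h' s).symm.mul_right (hs.map _))

theorem commute_hom12_hom13 {h s h' s' : A⟦X⟧} (hs : Commute h h') :
    Commute (hom12 (K := K) (inl h * inr s)) (hom13 (K := K) (inl h' * inr s')) := by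
  rw [map_mul, map_mul, hom13_inl, hom13_inr, hom12_inl, hom12_inr]
  exact ((hs.map _).mul_right (commute_in1_in3 (K := K) h s')).mul_left
    ((commute_in1_in2 (K := K) h' s).symm.mul_right (commute_in2_in3 (K := K) s s'))

theorem map_fexp_eq_mul {B : Type*} [Ring B] [Algebra K B] {Φ Ψ Χ : A⟦X⟧ →ₐ[K] B⟦X⟧}
    (hΦ : Φ X = X) (hΨ : Ψ X = X) (hΧ : Χ X = X) {P : A⟦X⟧} (hP : constantCoeff P = 0)
    (h1 : constantCoeff (Ψ P) = 0) (h2 : constantCoeff (Χ P) = 0)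
    (h : Φ P = Ψ P + Χ P) (hc : Commute (Ψ P) (Χ P)) :
    Φ (fexp K P) = Ψ (fexp K P) * Χ (fexp K P) := by
  rw [map_fexp Φ hΦ hP, map_fexp Ψ hΨ hP, map_fexp Χ hΧ hP, h, fexp_add h1 h2 hc]

theorem constantCoeff_hom12 {P : (A ⊗[K] A)⟦X⟧} (hP : constantCoeff P = 0) :
    constantCoeff (hom12 (K := K) P) = 0 := by
  rw [hom12, constantCoeff_mapAlgHom, hP, map_zero]

theorem constantCoeff_hom13 {P : (A ⊗[K] A)⟦X⟧} (hP : constantCoeff P = 0) :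
    constantCoeff (hom13 (K := K) P) = 0 := by
  rw [hom13, constantCoeff_mapAlgHom, hP, map_zero]

theorem constantCoeff_hom23 {P : (A ⊗[K] A)⟦X⟧} (hP : constantCoeff P = 0) :
    constantCoeff (hom23 (K := K) P) = 0 := by
  rw [hom23, constantCoeff_mapAlgHom, hP, map_zero]

theorem comulL_fexp {D : A →ₐ[K] (A ⊗[K] A)⟦X⟧} {P : (A ⊗[K] A)⟦X⟧} (hP : constantCoeff P = 0)
    (h : comulL D P = hom13 P + hom23 P) (hc : Commute (hom13 (K := K) P) (hom23 P)) :
    comulL D (fexp K P) = hom13 (fexp K P) * hom23 (fexp K P) :=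
  map_fexp_eq_mul (by simp) (by simp) (by simp) hP (constantCoeff_hom13 hP)
    (constantCoeff_hom23 hP) h hc

theorem comulR_fexp {D : A →ₐ[K] (A ⊗[K] A)⟦X⟧} {P : (A ⊗[K] A)⟦X⟧} (hP : constantCoeff P = 0)
    (h : comulR D P = hom12 P + hom13 P) (hc : Commute (hom12 (K := K) P) (hom13 P)) :
    comulR D (fexp K P) = hom12 (fexp K P) * hom13 (fexp K P) :=
  map_fexp_eq_mul (by simp) (by simp) (by simp) hP (constantCoeff_hom12 hP)
    (constantCoeff_hom13 hP) h hc

/-- If `D t = t ⊗ (1 - 2 z t) + 1 ⊗ t`, then `1 - 2 z t` is group-like and its logarithm is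
primitive. -/
theorem zExtHom_flog {D : A →ₐ[K] (A ⊗[K] A)⟦X⟧} {t : A⟦X⟧}
    (h : zExtHom D t = inl t * inr (1 - (2 : K) • (X * t)) + inr t) :
    zExtHom D (flog K (-((2 : K) • (X * t)))) =
      inl (flog K (-((2 : K) • (X * t)))) + inr (flog K (-((2 : K) • (X * t)))) := by
  have h0 : constantCoeff (-((2 : K) • (X * t))) = 0 := by simp
  set s := flog K (-((2 : K) • (X * t))) with hs
  have hl : constantCoeff (inl (K := K) (A := A) (B := A) s) = 0 := by simp [hs]
  have hr : constantCoeff (inr (K := K) (A := A) (B := A) s) = 0 := by simp [hs]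
  have e : fexp K (inl (K := K) (A := A) (B := A) s + inr (K := K) (A := A) (B := A) s) - 1 =
      zExtHom D (-((2 : K) • (X * t))) := by
    rw [fexp_add hl hr (commute_inl_inr _ _), ← map_fexp _ inl_X (by simp [hs]),
      ← map_fexp _ inr_X (by simp [hs]), hs, fexp_flog h0, map_neg, map_smul, map_mul, zExtHom_X, h]
    simp only [map_add, map_sub, map_one, map_neg, map_smul, map_mul, inl_X, inr_X]
    simp only [add_mul, mul_add, mul_sub, smul_add, smul_sub, mul_one, one_mul, neg_mul, mul_neg,
      smul_mul_assoc, mul_smul_comm, mul_assoc, smul_neg]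
    abel
  rw [hs, map_flog _ (zExtHom_X D) h0, ← e, flog_fexp_sub_one (by rw [map_add, hl, hr, add_zero])]

end Factor

namespace CarrierGens

section

variable {K : Type*} [Field K] {𝔞 : Type*} [LieRing 𝔞] [LieAlgebra K 𝔞]
variable {o : CarrierGens 𝔞}

open PowerSeries

local notation "inlU" => inl (K := K) (A := U K 𝔞) (B := U K 𝔞)
local notation "inrU" => inr (K := K) (A := U K 𝔞) (B := U K 𝔞)

variable (K o) in
/-- `∑ B_a ⊗ T_a e^{-½ σ_-}`. -/
def PE : (U K 𝔞 ⊗[K] U K 𝔞)⟦X⟧ :=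
  inl (gen K (o.B 0)) * inr (gen K (o.T 0) * o.e K 0 (-(1 / 2))) +
    inl (gen K (o.B 1)) * inr (gen K (o.T 1) * o.e K 0 (-(1 / 2)))

theorem ΦJ_eq : o.ΦJ K = fexp K (inlU (gen K o.Hm) * inrU (o.σm K)) := rfl
theorem ΦA_eq : o.ΦA K = fexp K (inlU (gen K o.Hp) * inrU (o.σp K)) := rfl

variable [CharZero K]

theorem constantCoeff_PJ : constantCoeff (inlU (gen K o.Hm) * inrU (o.σm K)) = 0 := by simp
theorem constantCoeff_PA : constantCoeff (inlU (gen K o.Hp) * inrU (o.σp K)) = 0 := by simp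
theorem constantCoeff_PE : constantCoeff (-((2 : K) • (X * o.PE K))) = 0 := by simp

theorem isUnit_ΦJ : IsUnit (o.ΦJ K) := isUnit_fexp constantCoeff_PJ
theorem isUnit_ΦA : IsUnit (o.ΦA K) := isUnit_fexp constantCoeff_PA

/-- `[∑ B_a ⊗ τ_a, x ⊗ 1]`, where `τ_a = T_a e^{-½ σ_-}`. -/
theorem lie_PE_inl (x : (U K 𝔞)⟦X⟧) : ⁅o.PE K, inlU x⁆ =
    inlU ⁅gen K (o.B 0), x⁆ * inrU (gen K (o.T 0) * o.e K 0 (-(1 / 2))) +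
      inlU ⁅gen K (o.B 1), x⁆ * inrU (gen K (o.T 1) * o.e K 0 (-(1 / 2))) := by
  rw [PE, add_lie, lie_inl_mul_inr_inl, lie_inl_mul_inr_inl]

theorem lie_PE_inr (y : (U K 𝔞)⟦X⟧) : ⁅o.PE K, inrU y⁆ =
    inlU (gen K (o.B 0)) * inrU ⁅gen K (o.T 0) * o.e K 0 (-(1 / 2)), y⁆ +
      inlU (gen K (o.B 1)) * inrU ⁅gen K (o.T 1) * o.e K 0 (-(1 / 2)), y⁆ := by
  rw [PE, add_lie, lie_inl_mul_inr_inr, lie_inl_mul_inr_inr]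

theorem lie_PE_inl_inr (x y : (U K 𝔞)⟦X⟧)
    (h0 : Commute (gen K (o.T 0) * o.e K 0 (-(1 / 2))) y)
    (h1 : Commute (gen K (o.T 1) * o.e K 0 (-(1 / 2))) y) : ⁅o.PE K, inlU x * inrU y⁆ =
    inlU ⁅gen K (o.B 0), x⁆ * inrU (gen K (o.T 0) * o.e K 0 (-(1 / 2)) * y) +
      inlU ⁅gen K (o.B 1), x⁆ * inrU (gen K (o.T 1) * o.e K 0 (-(1 / 2)) * y) := by
  rw [PE, add_lie, lie_inl_mul_inr_of_commute _ _ h0, lie_inl_mul_inr_of_commute _ _ h1]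

theorem smul_X_lie {A : Type*} [Ring A] [Algebra K A] (p x : A⟦X⟧) :
    ⁅-((2 : K) • (X * p)), x⁆ = -((2 : K) • (X * ⁅p, x⁆)) := by
  rw [neg_lie, smul_lie, X_mul_lie]

variable (h : o.Relations K)
include h

theorem commute_τ (a : Fin 2) (β : K) {y : (U K 𝔞)⟦X⟧} (hT : Commute (gen K (o.T a)) y)
    (hm : Commute (gen K o.Tm) y) : Commute (gen K (o.T a) * o.e K 0 β) y := by
  refine hT.mul_left ?_
  rw [e_zero_eq]
  exact (commute_fexp (by simp) ((commute_flog (by simp) ((((commute_X y).mul_right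
    hm.symm).smul_right (2 : K)).neg_right)).smul_right β)).symm

/-- The exponents of the two factors of `Φ_E` commute, because `B_2, B_3` commute and `T_2, T_3`
commute; hence `Φ_E` is a single exponential. -/
theorem ΦE_eq : o.ΦE K = fexp K (-((2 : K) • (X * o.PE K))) := by
  have hcomm : ∀ a b, Commute (-((2 : K) • (X * (inlU (gen K (o.B a)) *
      inrU (gen K (o.T a) * fexp K (-(1 / 2 : K) • o.σm K))))))
      (-((2 : K) • (X * (inlU (gen K (o.B b)) *
      inrU (gen K (o.T b) * fexp K (-(1 / 2 : K) • o.σm K)))))) := by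
    intro a b
    rw [← e_zero_eq, commute_iff_lie, smul_X_lie]
    have : ⁅inlU (gen K (o.B a)) * inrU (gen K (o.T a) * o.e K 0 (-(1 / 2))),
      -((2 : K) • (X * (inlU (gen K (o.B b)) * inrU (gen K (o.T b) * o.e K 0 (-(1 / 2))))))⁆ =
        0 := by
      rw [← commute_iff_lie]
      refine (((commute_X _).mul_right ?_).smul_right _).neg_right
      rw [commute_iff_lie, lie_inl_mul_inr_of_commute, lie_gen, h.B_B, gen_zero, map_zero, zero_mul]
      exact commute_τ h a _ ((commute_T_T h a b).mul_right (commute_T_e h a _ _))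
        ((commute_gen (h.Tm_T b)).mul_right (commute_Tm_e h _ _))
    rw [this, mul_zero, smul_zero, neg_zero]
  rw [ΦE]
  simp only [ftmul_eq]
  rw [← fexp_add (by simp) (by simp) (hcomm 1 0), PE, e_zero_eq]
  congr 1
  rw [mul_add, smul_add, neg_add, add_comm]

theorem isUnit_ΦE : IsUnit (o.ΦE K) := by rw [ΦE_eq h]; exact isUnit_fexp constantCoeff_PE

theorem commute_τ_T (a b : Fin 2) (β : K) :
    Commute (gen K (o.T a) * o.e K 0 β) (gen K (o.T b)) :=
  commute_τ h a _ (commute_T_T h a b) (commute_gen (h.Tm_T b))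

theorem commute_τ_e (a : Fin 2) (β γ δ : K) :
    Commute (gen K (o.T a) * o.e K 0 β) (o.e K γ δ) :=
  commute_τ h a _ (commute_T_e h a _ _) (commute_Tm_e h _ _)

theorem commute_τ_τ (a b : Fin 2) (β γ δ : K) :
    Commute (gen K (o.T a) * o.e K 0 β) (gen K (o.T b) * o.e K γ δ) :=
  (commute_τ_T h a b β).mul_right (commute_τ_e h a _ _ _)

/-- `[∑ B_a ⊗ τ_a, x ⊗ T_b e^{βσ_-}] = 0`, when `x` commutes with `B_a`. -/
theorem lie_PE_eq_zero (x : (U K 𝔞)⟦X⟧) (hx : ∀ a, ⁅gen K (o.B a), x⁆ = 0) (b : Fin 2) (β : K) :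
    ⁅o.PE K, inlU x * inrU (gen K (o.T b) * o.e K 0 β)⁆ = 0 := by
  rw [lie_PE_inl_inr _ _ (commute_τ_τ h _ _ _ _ _) (commute_τ_τ h _ _ _ _ _), hx, hx, map_zero,
    zero_mul, zero_mul, add_zero]

/-- Conjugation by `Φ_E` of an element killed by the third power of the adjoint action of
`∑ B_a ⊗ T_a e^{-½ σ_-}`. -/
theorem semiconjBy_ΦE_of_second {x y w : (U K 𝔞 ⊗[K] U K 𝔞)⟦X⟧} (h1 : ⁅o.PE K, x⁆ = y)
    (h2 : ⁅o.PE K, y⁆ = w) (h3 : ⁅o.PE K, w⁆ = 0) :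
    SemiconjBy (o.ΦE K) x (x - (2 : K) • (X * y) + (2 : K) • (X ^ 2 * w)) := by
  have hX : ∀ u v : (U K 𝔞 ⊗[K] U K 𝔞)⟦X⟧, ⁅u, X * v⁆ = X * ⁅u, v⁆ := fun u v => by
    rw [← lie_skew, X_mul_lie, ← mul_neg, lie_skew]
  have hl : ∀ u : (U K 𝔞 ⊗[K] U K 𝔞)⟦X⟧, ⁅-((2 : K) • (X * o.PE K)), -((2 : K) • (X * u))⁆ =
      (4 : K) • (X ^ 2 * ⁅o.PE K, u⁆) := fun u => by
    rw [smul_X_lie, lie_neg, lie_smul, hX, mul_neg, mul_smul_comm, ← mul_assoc, ← sq]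
    module
  have := semiconjBy_fexp_of_second (K := K) (P := -((2 : K) • (X * o.PE K))) constantCoeff_PE
    (x := x) (y := -((2 : K) • (X * y))) (w := (4 : K) • (X ^ 2 * w)) ?_ ?_ ?_
  · rw [ΦE_eq h]
    convert this using 1
    rw [smul_smul]
    norm_num [sub_eq_add_neg]
  · rw [← lie_eq_iff, smul_X_lie, h1]
  · rw [← lie_eq_iff, hl, h2]
  · change Commute _ _
    rw [commute_iff_lie, lie_smul, smul_X_lie, sq, mul_assoc, hX, hX, h3]
    simp

theorem semiconjBy_ΦE_of_first {x y : (U K 𝔞 ⊗[K] U K 𝔞)⟦X⟧} (h1 : ⁅o.PE K, x⁆ = y)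
    (h2 : ⁅o.PE K, y⁆ = 0) : SemiconjBy (o.ΦE K) x (x - (2 : K) • (X * y)) := by
  simpa using semiconjBy_ΦE_of_second h h1 h2 (lie_zero _)

theorem commute_ΦE {x : (U K 𝔞 ⊗[K] U K 𝔞)⟦X⟧} (h1 : ⁅o.PE K, x⁆ = 0) : Commute (o.ΦE K) x := by
  have := semiconjBy_ΦE_of_first h h1 (lie_zero _)
  rwa [mul_zero, smul_zero, sub_zero] at this

end

end CarrierGens

/-! ### Conjugation by the twists -/

namespace CarrierGens

section

variable {K : Type*} [Field K] [CharZero K] {𝔞 : Type*} [LieRing 𝔞] [LieAlgebra K 𝔞]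
variable {o : CarrierGens 𝔞}

open PowerSeries

local notation "inlU" => inl (K := K) (A := U K 𝔞) (B := U K 𝔞)
local notation "inrU" => inr (K := K) (A := U K 𝔞) (B := U K 𝔞)

theorem semiconjBy_ΦJ_inl {x : (U K 𝔞)⟦X⟧} {c : K} (hx : ⁅gen K o.Hm, x⁆ = c • x) :
    SemiconjBy (o.ΦJ K) (inlU x) (inlU x * inrU (o.e K 0 c)) := by
  rw [ΦJ_eq, e_zero_eq]
  exact semiconjBy_inl_of_weight (by simp) hx

theorem commute_ΦJ_inl {x : (U K 𝔞)⟦X⟧} (hx : Commute (gen K o.Hm) x) :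
    Commute (o.ΦJ K) (inlU x) := by
  have := semiconjBy_ΦJ_inl (o := o) (x := x) (c := 0)
    (by rw [commute_iff_lie.mp hx, zero_smul])
  rwa [e_zero_zero, map_one, mul_one] at this

theorem semiconjBy_ΦJ_inr {y w : (U K 𝔞)⟦X⟧} (hy : ⁅o.σm K, y⁆ = w) (hw : Commute (o.σm K) w) :
    SemiconjBy (o.ΦJ K) (inrU y) (inrU y + inlU (gen K o.Hm) * inrU w) :=
  semiconjBy_inr_of_lie (by simp) hy hw

theorem commute_ΦJ_inr {y : (U K 𝔞)⟦X⟧} (hy : Commute (o.σm K) y) :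
    Commute (o.ΦJ K) (inrU y) := semiconjBy_inr_of_commute (by simp) hy

theorem semiconjBy_ΦA_inl {x : (U K 𝔞)⟦X⟧} {c : K} (hx : ⁅gen K o.Hp, x⁆ = c • x) :
    SemiconjBy (o.ΦA K) (inlU x) (inlU x * inrU (o.e K c 0)) := by
  rw [ΦA_eq, e_eq_zero]
  exact semiconjBy_inl_of_weight (by simp) hx

theorem commute_ΦA_inl {x : (U K 𝔞)⟦X⟧} (hx : Commute (gen K o.Hp) x) :
    Commute (o.ΦA K) (inlU x) := by
  have := semiconjBy_ΦA_inl (o := o) (x := x) (c := 0)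
    (by rw [commute_iff_lie.mp hx, zero_smul])
  rwa [e_zero_zero, map_one, mul_one] at this

theorem semiconjBy_ΦA_inr {y w : (U K 𝔞)⟦X⟧} (hy : ⁅o.σp K, y⁆ = w) (hw : Commute (o.σp K) w) :
    SemiconjBy (o.ΦA K) (inrU y) (inrU y + inlU (gen K o.Hp) * inrU w) :=
  semiconjBy_inr_of_lie (by simp) hy hw

theorem commute_ΦA_inr {y : (U K 𝔞)⟦X⟧} (hy : Commute (o.σp K) y) :
    Commute (o.ΦA K) (inrU y) := semiconjBy_inr_of_commute (by simp) hy

theorem semiconjBy_of_eq {R : Type*} [Mul R] {a x y y' : R} (h : SemiconjBy a x y) (e : y' = y) :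
    SemiconjBy a x y' := e ▸ h

theorem commute_X_smul {A : Type*} [Ring A] [Algebra K A] {a x : A⟦X⟧} (c : K)
    (h : Commute a x) : Commute a (c • (X * x)) :=
  ((commute_X a).mul_right h).smul_right c

theorem semiconjBy_X_smul {A : Type*} [Ring A] [Algebra K A] {a x y : A⟦X⟧} (c : K)
    (h : SemiconjBy a x y) : SemiconjBy a (c • (X * x)) (c • (X * y)) := by
  rw [SemiconjBy, mul_smul_comm, smul_mul_assoc, ((commute_X a).semiconjBy.mul_right h).eq]

theorem semiconjBy_X_sq_smul {A : Type*} [Ring A] [Algebra K A] {a x y : A⟦X⟧} (c : K)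
    (h : SemiconjBy a x y) : SemiconjBy a (c • (X ^ 2 * x)) (c • (X ^ 2 * y)) := by
  rw [SemiconjBy, mul_smul_comm, smul_mul_assoc,
    (((commute_X a).pow_right 2).semiconjBy.mul_right h).eq]

variable (h : o.Relations K)
include h

theorem lie_gen_smul {x y : 𝔞} {c : K} (hxy : ⁅x, y⁆ = c • y) :
    ⁅gen K x, gen K y⁆ = c • gen K y := by rw [lie_gen, hxy, gen_smul]

/-! ### Conjugation by the Jordanian twist -/

theorem ad_J_Tm : SemiconjBy (o.ΦJ K) (inlU (gen K o.Tm) + inrU (gen K o.Tm))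
    (inlU (gen K o.Tm) * inrU (o.e K 0 1) + inrU (gen K o.Tm)) :=
  (semiconjBy_ΦJ_inl (lie_gen_smul h (by rw [h.Hm_Tm, one_smul]))).add_right
    (commute_ΦJ_inr (commute_Tm_all h).1.symm)

theorem ad_J_T (a : Fin 2) : SemiconjBy (o.ΦJ K) (inlU (gen K (o.T a)) + inrU (gen K (o.T a)))
    (inlU (gen K (o.T a)) * inrU (o.e K 0 (1 / 2)) + inrU (gen K (o.T a))) :=
  (semiconjBy_ΦJ_inl (lie_gen_smul h (h.Hm_T a))).add_right
    (commute_ΦJ_inr (commute_T_all h a).1.symm)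

theorem ad_J_B (a : Fin 2) : SemiconjBy (o.ΦJ K) (inlU (gen K (o.B a)) + inrU (gen K (o.B a)))
    (inlU (gen K (o.B a)) * inrU (o.e K 0 (1 / 2)) + inrU (gen K (o.B a))) :=
  (semiconjBy_ΦJ_inl (lie_gen_smul h (h.Hm_B a))).add_right
    (commute_ΦJ_inr (commute_σm_B h a))

theorem ad_J_Hp : SemiconjBy (o.ΦJ K) (inlU (gen K o.Hp) + inrU (gen K o.Hp))
    (inlU (gen K o.Hp) + inrU (gen K o.Hp)) :=
  (commute_ΦJ_inl (commute_gen h.Hp_Hm).symm).add_right (commute_ΦJ_inr (commute_σm_Hp h))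

theorem ad_J_Tp : SemiconjBy (o.ΦJ K) (inlU (gen K o.Tp) + inrU (gen K o.Tp))
    (inlU (gen K o.Tp) + inrU (gen K o.Tp)) :=
  (commute_ΦJ_inl (commute_gen h.Hm_Tp)).add_right (commute_ΦJ_inr (commute_Tp_all h).1.symm)

theorem ad_J_Hm : SemiconjBy (o.ΦJ K) (inlU (gen K o.Hm) + inrU (gen K o.Hm))
    (inlU (gen K o.Hm) * inrU (o.e K 0 (-1)) + inrU (gen K o.Hm)) := by
  refine semiconjBy_of_eq ((commute_ΦJ_inl (o := o)
    (Commute.refl (gen K o.Hm))).semiconjBy.add_right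
    (semiconjBy_ΦJ_inr (lie_σm_Hm h) ((commute_σm_e h _ _).sub_right (Commute.one_right _)))) ?_
  rw [map_sub, map_one, mul_sub, mul_one]
  abel

/-! ### Conjugation by the extension of the Jordanian twist -/

theorem commute_ΦE_inl {x : (U K 𝔞)⟦X⟧} (hx : ∀ a, ⁅gen K (o.B a), x⁆ = 0) :
    Commute (o.ΦE K) (inlU x) :=
  commute_ΦE h (by rw [lie_PE_inl, hx, hx, map_zero, zero_mul, zero_mul, add_zero])

theorem commute_ΦE_inr {y : (U K 𝔞)⟦X⟧}
    (hy : ∀ a, Commute (gen K (o.T a) * o.e K 0 (-(1 / 2))) y) : Commute (o.ΦE K) (inrU y) :=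
  commute_ΦE h (by rw [lie_PE_inr, commute_iff_lie.mp (hy 0), commute_iff_lie.mp (hy 1), map_zero,
    mul_zero, mul_zero, add_zero])

theorem commute_ΦE_e (α β : K) : Commute (o.ΦE K) (inrU (o.e K α β)) :=
  commute_ΦE_inr h fun _ => commute_τ_e h _ _ _ _

theorem ad_E_Tm : SemiconjBy (o.ΦE K) (inlU (gen K o.Tm) * inrU (o.e K 0 1) + inrU (gen K o.Tm))
    (inlU (gen K o.Tm) * inrU (o.e K 0 1) + inrU (gen K o.Tm)) :=
  ((commute_ΦE_inl h fun a => by rw [lie_gen, h.B_Tm, gen_zero]).mul_right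
    (commute_ΦE_e h _ _)).add_right (commute_ΦE_inr h fun a =>
      commute_τ h a _ (commute_gen (by rw [Relations.swap (h.Tm_T a), neg_zero])) (Commute.refl _))

theorem lie_B_Tm (a : Fin 2) : ⁅gen K (o.B a), gen K o.Tm⁆ = 0 := by
  rw [lie_gen, h.B_Tm, gen_zero]

theorem ad_E_T_inl (b : Fin 2) : SemiconjBy (o.ΦE K) (inlU (gen K (o.T b)))
    (inlU (gen K (o.T b)) - (2 : K) • (X * (inlU (gen K o.Tm) *
      inrU (gen K (o.T b) * o.e K 0 (-(1 / 2)))))) := by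
  refine semiconjBy_ΦE_of_first h ?_ (lie_PE_eq_zero h _ (lie_B_Tm h) _ _)
  rw [lie_PE_inl, lie_gen, lie_gen, h.B_T, h.B_T]
  fin_cases b <;> simp [gen_zero]

theorem ad_E_T (b : Fin 2) : SemiconjBy (o.ΦE K)
    (inlU (gen K (o.T b)) * inrU (o.e K 0 (1 / 2)) + inrU (gen K (o.T b)))
    (inlU (gen K (o.T b)) * inrU (o.e K 0 (1 / 2)) + inlU (o.e K 0 1) * inrU (gen K (o.T b))) := by
  refine semiconjBy_of_eq (((ad_E_T_inl h b).mul_right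
    (commute_ΦE_e h 0 (1 / 2)).semiconjBy).add_right
    (commute_ΦE_inr h (y := gen K (o.T b)) fun _ => commute_τ_T h _ _ _).semiconjBy) ?_
  rw [sub_mul, smul_mul_assoc, mul_assoc X, mul_assoc (inlU _), ← map_mul inr, mul_assoc (gen K _),
    e_mul_e h, neg_add_cancel, add_zero, e_zero_zero, mul_one, e_zero_one, map_sub, map_one,
    map_smul, map_mul inl, inl_X, sub_mul, one_mul, smul_mul_assoc, mul_assoc X]
  abel

theorem ad_E_B (b : Fin 2) : SemiconjBy (o.ΦE K)
    (inlU (gen K (o.B b)) * inrU (o.e K 0 (1 / 2)) + inrU (gen K (o.B b)))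
    (inlU (gen K (o.B b)) * inrU (o.e K 0 (-(1 / 2))) + inrU (gen K (o.B b))) := by
  have hBB : ∀ a, ⁅gen K (o.B a), gen K (o.B b)⁆ = 0 := fun a => by
    rw [lie_gen, h.B_B, gen_zero]
  have h1 : ⁅o.PE K, inrU (gen K (o.B b))⁆ =
      -(inlU (gen K (o.B b)) * inrU (gen K o.Tm * o.e K 0 (-(1 / 2)))) := by
    rw [lie_PE_inr, lie_T_e_B h, lie_T_e_B h]
    fin_cases b <;> simp
  have h2 : ⁅o.PE K, -(inlU (gen K (o.B b)) * inrU (gen K o.Tm * o.e K 0 (-(1 / 2))))⁆ = 0 := by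
    have hc : ∀ a, Commute (gen K (o.T a) * o.e K 0 (-(1 / 2)))
        (gen K o.Tm * o.e K 0 (-(1 / 2))) := fun a =>
      (commute_τ h a _ (commute_gen (by rw [Relations.swap (h.Tm_T a), neg_zero]))
        (Commute.refl _)).mul_right (commute_τ_e h _ _ _ _)
    rw [lie_neg, lie_PE_inl_inr _ _ (hc 0) (hc 1), hBB, hBB]
    simp
  refine semiconjBy_of_eq (((commute_ΦE_inl h hBB).mul_right
    (commute_ΦE_e h 0 (1 / 2))).semiconjBy.add_right
    (semiconjBy_ΦE_of_first h h1 h2)) ?_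
  have e1 : (2 : K) • (X * -(inlU (gen K (o.B b)) * inrU (gen K o.Tm * o.e K 0 (-(1 / 2))))) =
      -(inlU (gen K (o.B b)) * inrU ((2 : K) • (X * gen K o.Tm) * o.e K 0 (-(1 / 2)))) := by
    rw [smul_mul_assoc, map_smul, mul_smul_comm, mul_assoc X, map_mul inr X, inr_X,
      ← mul_assoc _ X, ← X_mul (φ := inlU _), mul_assoc X, mul_neg, smul_neg]
  rw [e1, two_X_Tm, sub_mul, one_mul, e_mul_e h, map_sub, mul_sub]
  norm_num
  abel

theorem ad_E_Hp : SemiconjBy (o.ΦE K) (inlU (gen K o.Hp) + inrU (gen K o.Hp))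
    (inlU (gen K o.Hp) + inrU (gen K o.Hp)) := by
  refine commute_ΦE h ?_
  have hB : ∀ a, ⁅gen K (o.B a), gen K o.Hp⁆ = (1 / 2 : K) • gen K (o.B a) := fun a => by
    rw [lie_gen, Relations.swap (h.Hp_B a), ← gen_smul]; congr 1; module
  rw [lie_add, lie_PE_inl, lie_PE_inr, lie_T_e_Hp h, lie_T_e_Hp h, hB, hB]
  simp only [map_smul, map_neg, smul_mul_assoc, mul_smul_comm, mul_neg]
  abel

/-- The conjugate of `H_-` by `Φ_E Φ_J`. The second commutator with the exponent of `Φ_E`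
vanishes. -/
theorem ad_E_Hm : SemiconjBy (o.ΦE K)
    (inlU (gen K o.Hm) * inrU (o.e K 0 (-1)) + inrU (gen K o.Hm))
    (inlU (gen K o.Hm) * inrU (o.e K 0 (-1)) + inrU (gen K o.Hm) +
      (2 : K) • (X * (inlU (gen K (o.B 0)) * inrU (gen K (o.T 0) * o.e K 0 (-(3 / 2))))) +
      (2 : K) • (X * (inlU (gen K (o.B 1)) * inrU (gen K (o.T 1) * o.e K 0 (-(3 / 2)))))) := by
  have hB : ∀ a, ⁅gen K (o.B a), gen K o.Hm⁆ = (-(1 / 2) : K) • gen K (o.B a) := fun a => by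
    rw [lie_gen, Relations.swap (h.Hm_B a), ← gen_smul, neg_smul]
  have hBB : ∀ a b, ⁅gen K (o.B a), gen K (o.B b)⁆ = 0 := fun a b => by
    rw [lie_gen, h.B_B, gen_zero]
  refine semiconjBy_of_eq (semiconjBy_ΦE_of_first h (x := inlU (gen K o.Hm) * inrU (o.e K 0 (-1)) +
    inrU (gen K o.Hm)) (y := -(inlU (gen K (o.B 0)) * inrU (gen K (o.T 0) * o.e K 0 (-(3 / 2)))) -
      inlU (gen K (o.B 1)) * inrU (gen K (o.T 1) * o.e K 0 (-(3 / 2)))) ?_ ?_) ?_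
  rotate_right
  · rw [mul_sub, mul_neg, smul_sub, smul_neg]; abel
  · rw [lie_add, lie_PE_inl_inr _ _ (commute_τ_e h _ _ _ _) (commute_τ_e h _ _ _ _), lie_PE_inr,
      hB, hB, lie_T_e_Hm h, lie_T_e_Hm h, mul_assoc, e_mul_e h, mul_assoc, e_mul_e h]
    norm_num
    module
  · rw [lie_sub, lie_neg, lie_PE_eq_zero h _ (fun a => hBB a 0), lie_PE_eq_zero h _
      (fun a => hBB a 1), neg_zero, sub_zero]

/-- The conjugate of `T_+` by `Φ_E Φ_J`. The term of order `z²` is the second commutator with the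
exponent of `Φ_E`. -/
theorem ad_E_Tp : SemiconjBy (o.ΦE K) (inlU (gen K o.Tp) + inrU (gen K o.Tp))
    (inlU (gen K o.Tp) + inrU (gen K o.Tp) -
      (2 : K) • (X * (inlU (gen K (o.T 0)) * inrU (gen K (o.T 0) * o.e K 0 (-(1 / 2))))) -
      (2 : K) • (X * (inlU (gen K (o.T 1)) * inrU (gen K (o.T 1) * o.e K 0 (-(1 / 2))))) +
      (2 : K) • (X ^ 2 * (inlU (gen K o.Tm) *
        inrU ((gen K (o.T 0) ^ 2 + gen K (o.T 1) ^ 2) * o.e K 0 (-1))))) := by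
  have hsq : ∀ a, gen K (o.T a) * o.e K 0 (-(1 / 2)) * (gen K (o.T a) * o.e K 0 (-(1 / 2))) =
      gen K (o.T a) ^ 2 * o.e K 0 (-1) := fun a => by
    rw [mul_assoc, ← mul_assoc (o.e K _ _), ← (commute_T_e h a _ _).eq, mul_assoc, e_mul_e h,
      ← mul_assoc, sq]
    norm_num
  have hcT : ∀ a, Commute (gen K (o.T a)) (gen K o.Tm) := fun a =>
    commute_gen (by rw [Relations.swap (h.Tm_T a), neg_zero])
  have hQ : ∀ a, Commute (gen K (o.T a) * o.e K 0 (-(1 / 2)))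
      ((gen K (o.T 0) ^ 2 + gen K (o.T 1) ^ 2) * o.e K 0 (-1)) := fun a =>
    (commute_Q h fun b => commute_τ_T h a b _).mul_right (commute_τ_e h _ _ _ _)
  refine semiconjBy_of_eq (semiconjBy_ΦE_of_second h (x := inlU (gen K o.Tp) + inrU (gen K o.Tp))
    (y := inlU (gen K (o.T 0)) * inrU (gen K (o.T 0) * o.e K 0 (-(1 / 2))) +
      inlU (gen K (o.T 1)) * inrU (gen K (o.T 1) * o.e K 0 (-(1 / 2))))
    (w := inlU (gen K o.Tm) * inrU ((gen K (o.T 0) ^ 2 + gen K (o.T 1) ^ 2) * o.e K 0 (-1)))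
    ?_ ?_ ?_) ?_
  rotate_right
  · rw [mul_add, smul_add]; abel
  · rw [lie_add, lie_PE_inl, lie_PE_inr, commute_iff_lie.mp (commute_τ h 0 _
      (commute_gen (by rw [Relations.swap (h.Tp_T 0), neg_zero])) (commute_gen
      (by rw [Relations.swap h.Tp_Tm, neg_zero]))), commute_iff_lie.mp (commute_τ h 1 _
      (commute_gen (by rw [Relations.swap (h.Tp_T 1), neg_zero])) (commute_gen
      (by rw [Relations.swap h.Tp_Tm, neg_zero]))), lie_gen, lie_gen, h.B_Tp, h.B_Tp]
    simp
  · rw [lie_add, lie_PE_inl_inr _ _ (commute_τ_τ h _ _ _ _ _) (commute_τ_τ h _ _ _ _ _),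
      lie_PE_inl_inr _ _ (commute_τ_τ h _ _ _ _ _) (commute_τ_τ h _ _ _ _ _), lie_gen, lie_gen,
      lie_gen, lie_gen, h.B_T, h.B_T, h.B_T, h.B_T, hsq, hsq, add_mul, map_add, mul_add]
    simp [gen_zero]
  · rw [lie_PE_inl_inr _ _ (hQ 0) (hQ 1), lie_B_Tm h, lie_B_Tm h]
    simp

end

end CarrierGens

/-! ### The twisted coproducts of the generators -/

section

variable {K : Type*} [Field K] {𝔞 : Type*} [LieRing 𝔞] [LieAlgebra K 𝔞]

open PowerSeries

/-- A generator is primitive for `Δ`, so its twisted coproduct is the conjugate of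
`x ⊗ 1 + 1 ⊗ x`. -/
theorem zExtHom_twistHom_gen {Φ y : (U K 𝔞 ⊗[K] U K 𝔞)⟦X⟧} (hΦ : IsUnit Φ) {x : 𝔞}
    (h : SemiconjBy Φ (inl (K := K) (gen K x) + inr (gen K x)) y) :
    zExtHom (twistHom (comul₀ K 𝔞) hΦ) (gen K x) = y := by
  rw [gen, zExtHom_C]
  exact twistHom_eq_of_semiconjBy hΦ (by rwa [comul₀_ι])

theorem twistComul_ι {Φ y : (U K 𝔞 ⊗[K] U K 𝔞)⟦X⟧} (hΦ : IsUnit Φ) {x : 𝔞}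
    (h : SemiconjBy Φ (inl (K := K) (gen K x) + inr (gen K x)) y) :
    twistComul K (Δ₀ K 𝔞) Φ (UniversalEnvelopingAlgebra.ι K x) = y :=
  twistComul_eq_of_semiconjBy hΦ (by
    rw [← comul₀_toLinearMap, AlgHom.toLinearMap_apply, comul₀_ι]; exact h)

end

namespace CarrierGens

section

variable {K : Type*} [Field K] [CharZero K] {𝔞 : Type*} [LieRing 𝔞] [LieAlgebra K 𝔞]
variable {o : CarrierGens 𝔞}

open PowerSeries

local notation "inlU" => inl (K := K) (A := U K 𝔞) (B := U K 𝔞)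
local notation "inrU" => inr (K := K) (A := U K 𝔞) (B := U K 𝔞)

variable (h : o.Relations K)
include h

theorem isUnit_ΦEJ : IsUnit (o.ΦE K * o.ΦJ K) := (isUnit_ΦE h).mul isUnit_ΦJ

theorem F_eq : o.F K = o.ΦA K * (o.ΦE K * o.ΦJ K) := mul_assoc _ _ _

theorem isUnit_F : IsUnit (o.F K) := by
  rw [F_eq h]; exact isUnit_ΦA.mul (isUnit_ΦEJ h)

/-- `Δ_J` as an algebra map. -/
def homJ (_ : o.Relations K) : U K 𝔞 →ₐ[K] (U K 𝔞 ⊗[K] U K 𝔞)⟦X⟧ :=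
  twistHom (comul₀ K 𝔞) (isUnit_ΦJ (o := o))

/-- `Δ_E` as an algebra map. -/
def homE (h : o.Relations K) : U K 𝔞 →ₐ[K] (U K 𝔞 ⊗[K] U K 𝔞)⟦X⟧ :=
  twistHom (comul₀ K 𝔞) (isUnit_ΦEJ h)

/-- `Δ_F` as an algebra map. -/
def homF (h : o.Relations K) : U K 𝔞 →ₐ[K] (U K 𝔞 ⊗[K] U K 𝔞)⟦X⟧ :=
  twistHom (comul₀ K 𝔞) (isUnit_F h)

theorem twistHom_homE : twistHom (homE h) (isUnit_ΦA (o := o)) = homF h := by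
  apply AlgHom.toLinearMap_injective
  rw [twistHom_toLinearMap, homE, twistHom_toLinearMap,
    twistComul_twistComul _ (isUnit_ΦEJ h) isUnit_ΦA, ← F_eq h]
  rfl

theorem zExtHom_homJ_Tm : zExtHom (homJ h) (gen K o.Tm) =
    inlU (gen K o.Tm) * inrU (o.e K 0 1) + inrU (gen K o.Tm) :=
  zExtHom_twistHom_gen _ (ad_J_Tm h)

theorem zExtHom_homE_Tm : zExtHom (homE h) (gen K o.Tm) =
    inlU (gen K o.Tm) * inrU (o.e K 0 1) + inrU (gen K o.Tm) :=
  zExtHom_twistHom_gen _ ((ad_E_Tm h).mul_left (ad_J_Tm h))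

theorem zExtHom_homE_T (a : Fin 2) : zExtHom (homE h) (gen K (o.T a)) =
    inlU (gen K (o.T a)) * inrU (o.e K 0 (1 / 2)) + inlU (o.e K 0 1) * inrU (gen K (o.T a)) :=
  zExtHom_twistHom_gen _ ((ad_E_T h a).mul_left (ad_J_T h a))

theorem zExtHom_homE_Hp : zExtHom (homE h) (gen K o.Hp) =
    inlU (gen K o.Hp) + inrU (gen K o.Hp) :=
  zExtHom_twistHom_gen _ ((ad_E_Hp h).mul_left (ad_J_Hp h))

theorem zExtHom_homE_Tp : zExtHom (homE h) (gen K o.Tp) =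
    inlU (gen K o.Tp) + inrU (gen K o.Tp) -
      (2 : K) • (X * (inlU (gen K (o.T 0)) * inrU (gen K (o.T 0) * o.e K 0 (-(1 / 2))))) -
      (2 : K) • (X * (inlU (gen K (o.T 1)) * inrU (gen K (o.T 1) * o.e K 0 (-(1 / 2))))) +
      (2 : K) • (X ^ 2 * (inlU (gen K o.Tm) *
        inrU ((gen K (o.T 0) ^ 2 + gen K (o.T 1) ^ 2) * o.e K 0 (-1)))) :=
  zExtHom_twistHom_gen _ ((ad_E_Tp h).mul_left (ad_J_Tp h))

/-- `σ_-` is primitive as soon as `Δ(T_-) = T_- ⊗ e^{σ_-} + 1 ⊗ T_-`, since then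
`e^{σ_-} = 1 - 2 z T_-` is group-like. -/
theorem zExtHom_σm {D : U K 𝔞 →ₐ[K] (U K 𝔞 ⊗[K] U K 𝔞)⟦X⟧} (hD : zExtHom D (gen K o.Tm) =
    inlU (gen K o.Tm) * inrU (o.e K 0 1) + inrU (gen K o.Tm)) :
    zExtHom D (o.σm K) = inlU (o.σm K) + inrU (o.σm K) :=
  zExtHom_flog (by rw [hD, e_zero_one])

theorem zExtHom_e_zero {D : U K 𝔞 →ₐ[K] (U K 𝔞 ⊗[K] U K 𝔞)⟦X⟧}
    (hD : zExtHom D (o.σm K) = inlU (o.σm K) + inrU (o.σm K)) (β : K) :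
    zExtHom D (o.e K 0 β) = inlU (o.e K 0 β) * inrU (o.e K 0 β) := by
  rw [e_zero_eq, map_fexp _ (zExtHom_X D) (by simp), map_fexp _ inl_X (by simp),
    map_fexp _ inr_X (by simp), ← fexp_add (by simp) (by simp) (commute_inl_inr _ _), map_smul, hD,
    smul_add, map_smul, map_smul]

theorem zExtHom_homE_e (β : K) :
    zExtHom (homE h) (o.e K 0 β) = inlU (o.e K 0 β) * inrU (o.e K 0 β) :=
  zExtHom_e_zero h (zExtHom_σm h (zExtHom_homE_Tm h)) β

theorem zExtHom_homE_sq (a : Fin 2) :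
    zExtHom (homE h) (gen K (o.T a) ^ 2 * o.e K 0 (-1)) =
      inlU (gen K (o.T a) ^ 2 * o.e K 0 (-1)) +
      (2 : K) • (inlU (gen K (o.T a)) * inrU (gen K (o.T a) * o.e K 0 (-(1 / 2)))) +
      inlU (o.e K 0 1) * inrU (gen K (o.T a) ^ 2 * o.e K 0 (-1)) := by
  have c := fun α β => (commute_T_e h a α β).eq
  have e1 : zExtHom (homE h) (gen K (o.T a) * o.e K 0 (-(1 / 2))) =
      inlU (gen K (o.T a) * o.e K 0 (-(1 / 2))) + inlU (o.e K 0 (1 / 2)) *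
        inrU (gen K (o.T a) * o.e K 0 (-(1 / 2))) := by
    rw [map_mul, zExtHom_homE_T h, zExtHom_homE_e h, add_mul, inl_mul_inr_mul, inl_mul_inr_mul,
      e_mul_e h, e_mul_e h]
    norm_num
  have e2 : gen K (o.T a) ^ 2 * o.e K 0 (-1) =
      (gen K (o.T a) * o.e K 0 (-(1 / 2))) * (gen K (o.T a) * o.e K 0 (-(1 / 2))) := by
    rw [mul_assoc, ← mul_assoc (o.e K 0 _), ← c, mul_assoc, e_mul_e h, ← mul_assoc, sq]
    norm_num
  have e3 : o.e K 0 (-(1 / 2)) * o.e K 0 (1 / 2) = 1 := by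
    rw [e_mul_e h, add_zero, neg_add_cancel, e_zero_zero]
  have e4 : o.e K 0 (1 / 2) * o.e K 0 (-(1 / 2)) = 1 := by
    rw [e_mul_e h, add_zero, add_neg_cancel, e_zero_zero]
  have e5 : o.e K 0 (1 / 2) * o.e K 0 (1 / 2) = o.e K 0 1 := by
    rw [e_mul_e h]; norm_num
  have f1 : inlU (gen K (o.T a) * o.e K 0 (-(1 / 2))) * (inlU (o.e K 0 (1 / 2)) *
        inrU (gen K (o.T a) * o.e K 0 (-(1 / 2)))) = inlU (gen K (o.T a)) *
        inrU (gen K (o.T a) * o.e K 0 (-(1 / 2))) := by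
    rw [← mul_assoc, ← map_mul, mul_assoc, e3, mul_one]
  have f2 : (inlU (o.e K 0 (1 / 2)) * inrU (gen K (o.T a) * o.e K 0 (-(1 / 2)))) *
      inlU (gen K (o.T a) * o.e K 0 (-(1 / 2))) = inlU (gen K (o.T a)) *
        inrU (gen K (o.T a) * o.e K 0 (-(1 / 2))) := by
    rw [mul_assoc, ← (commute_inl_inr (K := K) _ _).eq, ← mul_assoc, ← map_mul, c, ← mul_assoc, e4,
      one_mul]
  rw [e2, map_mul, e1, add_mul, mul_add, mul_add, f1, f2, inl_mul_inr_mul, e5, ← map_mul]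
  module

/-- `T` is primitive for `Δ_E`: the correction `z (T_2² + T_3²) e^{-σ_-}` cancels the mixed terms of
`Δ_E(T_+)`. -/
theorem zExtHom_homE_Tz : zExtHom (homE h) (o.Tz K) = inlU (o.Tz K) + inrU (o.Tz K) := by
  rw [Tz_eq h, map_add, map_mul, zExtHom_X, zExtHom_homE_Tp h, add_mul,
    map_add (zExtHom (homE h)) (_ * _), zExtHom_homE_sq h, zExtHom_homE_sq h, e_zero_one]
  simp only [map_add, map_sub, map_one, map_smul, map_mul, inl_X, inr_X, mul_add,
    sub_mul, one_mul, smul_add, mul_sub, smul_mul_assoc, mul_smul_comm, mul_assoc, sq]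
  abel

/-! ### Conjugation by the additional Jordanian twist -/

theorem ad_A_Tz : SemiconjBy (o.ΦA K) (inlU (o.Tz K) + inrU (o.Tz K))
    (inlU (o.Tz K) * inrU (o.e K 1 0) + inrU (o.Tz K)) :=
  (semiconjBy_ΦA_inl (by rw [one_smul, ← lie_skew, lie_Tz_Hp h, neg_neg])).add_right
    (commute_ΦA_inr (commute_σp_Tz h))

theorem ad_A_Tm : SemiconjBy (o.ΦA K) (inlU (gen K o.Tm) * inrU (o.e K 0 1) + inrU (gen K o.Tm))
    (inlU (gen K o.Tm) * inrU (o.e K 0 1) + inrU (gen K o.Tm)) :=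
  ((commute_ΦA_inl (commute_gen h.Hp_Tm)).mul_right (commute_ΦA_inr (commute_σp_e h _ _))).add_right
    (commute_ΦA_inr (commute_Tm_all h).2.2.symm)

theorem inr_e_mul_e (α β γ δ : K) :
    inrU (o.e K α β) * inrU (o.e K γ δ) = inrU (o.e K (α + γ) (β + δ)) := by
  rw [← map_mul, e_mul_e h]

theorem inr_e_mul_mul_e (x : (U K 𝔞)⟦X⟧) (hx : ∀ α β, Commute x (o.e K α β)) (α β γ δ : K) :
    inrU (o.e K α β) * inrU (x * o.e K γ δ) = inrU (x * o.e K (α + γ) (β + δ)) := by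
  rw [← map_mul, ← mul_assoc, ← (hx _ _).eq, mul_assoc, e_mul_e h]

theorem ad_A_T (a : Fin 2) : SemiconjBy (o.ΦA K)
    (inlU (gen K (o.T a)) * inrU (o.e K 0 (1 / 2)) + inlU (o.e K 0 1) * inrU (gen K (o.T a)))
    (inlU (gen K (o.T a)) * inrU (o.e K (1 / 2) (1 / 2)) +
      inlU (o.e K 0 1) * inrU (gen K (o.T a))) := by
  refine semiconjBy_of_eq (((semiconjBy_ΦA_inl (lie_gen_smul h (h.Hp_T a))).mul_right
    (commute_ΦA_inr (commute_σp_e h _ _)).semiconjBy).add_right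
    ((commute_ΦA_inl (commute_e_Hp h 1).symm).mul_right
      (commute_ΦA_inr (commute_T_all h a).2.2.symm)).semiconjBy) ?_
  rw [mul_assoc, inr_e_mul_e h, add_zero, zero_add]

theorem ad_A_Hp : SemiconjBy (o.ΦA K) (inlU (gen K o.Hp) + inrU (gen K o.Hp))
    (inlU (gen K o.Hp) * inrU (o.e K (-1) 0) + inrU (gen K o.Hp)) := by
  refine semiconjBy_of_eq ((commute_ΦA_inl (Commute.refl _)).semiconjBy.add_right
    (semiconjBy_ΦA_inr (lie_σp_Hp h)
      ((commute_σp_e h _ _).sub_right (Commute.one_right _)))) ?_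
  rw [map_sub, map_one, mul_sub, mul_one]
  abel

theorem ad_A_B (a : Fin 2) : SemiconjBy (o.ΦA K)
    (inlU (gen K (o.B a)) * inrU (o.e K 0 (-(1 / 2))) + inrU (gen K (o.B a)))
    (inlU (gen K (o.B a)) * inrU (o.e K (-(1 / 2)) (-(1 / 2))) + inrU (gen K (o.B a)) +
      (2 : K) • (X * (inlU (gen K o.Hp) * inrU (gen K (o.T a) * o.e K (-1) (-1))))) := by
  refine semiconjBy_of_eq (((semiconjBy_ΦA_inl (lie_gen_smul h (h.Hp_B a))).mul_right
    (commute_ΦA_inr (commute_σp_e h 0 (-(1 / 2)))).semiconjBy).add_right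
    (semiconjBy_ΦA_inr (lie_σp_B h a) (commute_X_smul _ ((commute_T_all h a).2.2.symm.mul_right
      (commute_σp_e h _ _))))) ?_
  rw [mul_assoc, inr_e_mul_e h, add_zero, zero_add, map_smul, map_mul inr X, inr_X, mul_smul_comm,
    ← mul_assoc (inlU (gen K o.Hp)), ← X_mul, mul_assoc, add_assoc]

theorem ad_A_Hm : SemiconjBy (o.ΦA K)
    (inlU (gen K o.Hm) * inrU (o.e K 0 (-1)) + inrU (gen K o.Hm) +
      (2 : K) • (X * (inlU (gen K (o.B 0)) * inrU (gen K (o.T 0) * o.e K 0 (-(3 / 2))))) +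
      (2 : K) • (X * (inlU (gen K (o.B 1)) * inrU (gen K (o.T 1) * o.e K 0 (-(3 / 2))))))
    (inlU (gen K o.Hm) * inrU (o.e K 0 (-1)) + inrU (gen K o.Hm) +
      (2 : K) • (X * (inlU (gen K (o.B 0)) * inrU (gen K (o.T 0) * o.e K (-(1 / 2)) (-(3 / 2))))) +
      (2 : K) • (X * (inlU (gen K (o.B 1)) * inrU (gen K (o.T 1) * o.e K (-(1 / 2)) (-(3 / 2))))) +
      (2 : K) • (X ^ 2 * (inlU (gen K o.Hp) *
        inrU ((gen K (o.T 0) ^ 2 + gen K (o.T 1) ^ 2) * o.e K (-1) (-2))))) := by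
  have hB : ∀ a, SemiconjBy (o.ΦA K)
      (inlU (gen K (o.B a)) * inrU (gen K (o.T a) * o.e K 0 (-(3 / 2))))
      (inlU (gen K (o.B a)) * inrU (gen K (o.T a) * o.e K (-(1 / 2)) (-(3 / 2)))) := fun a => by
    refine semiconjBy_of_eq ((semiconjBy_ΦA_inl (lie_gen_smul h (h.Hp_B a))).mul_right
      (commute_ΦA_inr ((commute_T_all h a).2.2.symm.mul_right
        (commute_σp_e h 0 (-(3 / 2))))).semiconjBy) ?_
    rw [mul_assoc, inr_e_mul_mul_e h _ (commute_T_e h a), add_zero, zero_add]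
  have hQ : Commute (o.σp K) ((2 : K) • (X ^ 2 * ((gen K (o.T 0) ^ 2 + gen K (o.T 1) ^ 2) *
      o.e K (-1) (-2)))) :=
    (((commute_X _).pow_right 2).mul_right ((commute_Q h fun a =>
      (commute_T_all h a).2.2.symm).mul_right (commute_σp_e h _ _))).smul_right _
  refine semiconjBy_of_eq (((((commute_ΦA_inl (commute_gen h.Hp_Hm)).mul_right
    (commute_ΦA_inr (commute_σp_e h 0 (-1)))).semiconjBy.add_right
    (semiconjBy_ΦA_inr (lie_σp_Hm h) hQ)).add_right (semiconjBy_X_smul _ (hB 0))).add_right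
    (semiconjBy_X_smul _ (hB 1))) ?_
  rw [map_smul, map_mul inr (X ^ 2), map_pow, inr_X, mul_smul_comm,
    ← mul_assoc (inlU (gen K o.Hp)), ((commute_X (inlU (gen K o.Hp))).pow_right 2).eq, mul_assoc]
  abel

theorem ad_A_Tp : SemiconjBy (o.ΦA K)
    (inlU (gen K o.Tp) + inrU (gen K o.Tp) -
      (2 : K) • (X * (inlU (gen K (o.T 0)) * inrU (gen K (o.T 0) * o.e K 0 (-(1 / 2))))) -
      (2 : K) • (X * (inlU (gen K (o.T 1)) * inrU (gen K (o.T 1) * o.e K 0 (-(1 / 2))))) +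
      (2 : K) • (X ^ 2 * (inlU (gen K o.Tm) *
        inrU ((gen K (o.T 0) ^ 2 + gen K (o.T 1) ^ 2) * o.e K 0 (-1)))))
    (inlU (gen K o.Tp) * inrU (o.e K 1 0) + inrU (gen K o.Tp) -
      (2 : K) • (X * (inlU (gen K (o.T 0)) * inrU (gen K (o.T 0) * o.e K (1 / 2) (-(1 / 2))))) -
      (2 : K) • (X * (inlU (gen K (o.T 1)) * inrU (gen K (o.T 1) * o.e K (1 / 2) (-(1 / 2))))) +
      (2 : K) • (X ^ 2 * (inlU (gen K o.Tm) *
        inrU ((gen K (o.T 0) ^ 2 + gen K (o.T 1) ^ 2) * o.e K 0 (-1))))) := by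
  have hT : ∀ a, SemiconjBy (o.ΦA K)
      (inlU (gen K (o.T a)) * inrU (gen K (o.T a) * o.e K 0 (-(1 / 2))))
      (inlU (gen K (o.T a)) * inrU (gen K (o.T a) * o.e K (1 / 2) (-(1 / 2)))) := fun a => by
    refine semiconjBy_of_eq ((semiconjBy_ΦA_inl (lie_gen_smul h (h.Hp_T a))).mul_right
      (commute_ΦA_inr ((commute_T_all h a).2.2.symm.mul_right
        (commute_σp_e h 0 (-(1 / 2))))).semiconjBy) ?_
    rw [mul_assoc, inr_e_mul_mul_e h _ (commute_T_e h a), add_zero, zero_add]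
  refine ((((semiconjBy_ΦA_inl (lie_gen_smul h (by rw [h.Hp_Tp, one_smul]))).add_right
    (commute_ΦA_inr (commute_Tp_all h).2.2.symm)).sub_right (semiconjBy_X_smul _ (hT 0))).sub_right
    (semiconjBy_X_smul _ (hT 1))).add_right (semiconjBy_X_sq_smul _ ?_)
  exact (commute_ΦA_inl (commute_gen h.Hp_Tm)).mul_right (commute_ΦA_inr ((commute_Q h fun a =>
      (commute_T_all h a).2.2.symm).mul_right (commute_σp_e h _ _)))

theorem semiconjBy_F {x y z w : (U K 𝔞 ⊗[K] U K 𝔞)⟦X⟧} (hJ : SemiconjBy (o.ΦJ K) x y)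
    (hE : SemiconjBy (o.ΦE K) y z) (hA : SemiconjBy (o.ΦA K) z w) : SemiconjBy (o.F K) x w := by
  rw [F_eq h]; exact hA.mul_left (hE.mul_left hJ)

theorem coproducts : o.Coproducts K where
  Hp := by
    simp only [ftmul_eq, map_one, one_mul]
    exact twistComul_ι (isUnit_F h) (semiconjBy_F h (ad_J_Hp h) (ad_E_Hp h) (ad_A_Hp h))
  Hm := by
    simp only [ftmul_eq, map_one, one_mul]
    exact twistComul_ι (isUnit_F h) (semiconjBy_F h (ad_J_Hm h) (ad_E_Hm h) (ad_A_Hm h))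
  B a := by
    simp only [ftmul_eq, map_one, one_mul]
    exact twistComul_ι (isUnit_F h) (semiconjBy_F h (ad_J_B h a) (ad_E_B h a) (ad_A_B h a))
  Tp := by
    simp only [ftmul_eq, map_one, one_mul]
    exact twistComul_ι (isUnit_F h) (semiconjBy_F h (ad_J_Tp h) (ad_E_Tp h) (ad_A_Tp h))
  Tm := by
    simp only [ftmul_eq, map_one, one_mul]
    exact twistComul_ι (isUnit_F h) (semiconjBy_F h (ad_J_Tm h) (ad_E_Tm h) (ad_A_Tm h))
  T a := by
    simp only [ftmul_eq]
    exact twistComul_ι (isUnit_F h) (semiconjBy_F h (ad_J_T h a) (ad_E_T h a) (ad_A_T h a))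

end

end CarrierGens

/-! ### The factorization `(Δ ⊗ id)(F) = F₁₃ F₂₃` -/

section

variable {K : Type*} [Field K] {A B : Type*} [Ring A] [Algebra K A] [Ring B] [Algebra K B]

open PowerSeries

theorem commute_map_fexp {Φ : A⟦X⟧ →ₐ[K] B⟦X⟧} (hΦ : Φ X = X) {P : A⟦X⟧}
    (hP : constantCoeff P = 0) (h0 : constantCoeff (Φ P) = 0) {y : B⟦X⟧} (h : Commute y (Φ P)) :
    Commute y (Φ (fexp K P)) := by
  rw [map_fexp Φ hΦ hP]; exact commute_fexp h0 h

theorem commute_hom_smul_X {Φ : A⟦X⟧ →ₐ[K] B⟦X⟧} (hΦ : Φ X = X) {p : A⟦X⟧} {y : B⟦X⟧}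
    (h : Commute y (Φ p)) : Commute y (Φ (-((2 : K) • (X * p)))) := by
  rw [map_neg, map_smul, map_mul, hΦ]
  exact (((commute_X y).mul_right h).smul_right 2).neg_right

end

namespace CarrierGens

section

variable {K : Type*} [Field K] [CharZero K] {𝔞 : Type*} [LieRing 𝔞] [LieAlgebra K 𝔞]
variable {o : CarrierGens 𝔞}

open PowerSeries

local notation "inlU" => inl (K := K) (A := U K 𝔞) (B := U K 𝔞)
local notation "inrU" => inr (K := K) (A := U K 𝔞) (B := U K 𝔞)
local notation "hom12U" => hom12 (K := K) (A := U K 𝔞)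
local notation "hom13U" => hom13 (K := K) (A := U K 𝔞)
local notation "hom23U" => hom23 (K := K) (A := U K 𝔞)

variable (K o) in
/-- The exponent of `Φ_E`. -/
def expE : (U K 𝔞 ⊗[K] U K 𝔞)⟦X⟧ := -((2 : K) • (X * o.PE K))

theorem constantCoeff_expE : constantCoeff (o.expE K) = 0 := constantCoeff_PE

variable (h : o.Relations K)
include h

theorem ΦE_eq_fexp : o.ΦE K = fexp K (o.expE K) := ΦE_eq h

theorem commute_hom13_hom23_expE {x s : (U K 𝔞)⟦X⟧}
    (hs : ∀ a, Commute s (gen K (o.T a) * o.e K 0 (-(1 / 2)))) :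
    Commute (hom13U (inlU x * inrU s)) (hom23U (o.expE K)) := by
  refine commute_hom_smul_X (K := K) (Φ := hom23U) hom23_X ?_
  rw [PE, map_add]
  exact (commute_hom13_hom23 (K := K) (hs 0)).add_right (commute_hom13_hom23 (K := K) (hs 1))

theorem commute_hom23_hom13_expE {x s : (U K 𝔞)⟦X⟧}
    (hs : ∀ a, Commute s (gen K (o.T a) * o.e K 0 (-(1 / 2)))) :
    Commute (hom23U (inlU x * inrU s)) (hom13U (o.expE K)) := by
  refine commute_hom_smul_X (K := K) (Φ := hom13U) hom13_X ?_
  rw [PE, map_add]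
  exact (commute_hom13_hom23 (K := K) (hs 0).symm).symm.add_right
    (commute_hom13_hom23 (K := K) (hs 1).symm).symm

theorem commute_expE_expE : Commute (hom13U (o.expE K)) (hom23U (o.expE K)) := by
  refine commute_hom_smul_X (K := K) (Φ := hom23U) hom23_X ?_
  rw [PE, map_add]
  exact (commute_hom23_hom13_expE h fun a => commute_τ_τ h _ _ _ _ _).symm.add_right
    (commute_hom23_hom13_expE h fun a => commute_τ_τ h _ _ _ _ _).symm

theorem commute_σm_τ (a : Fin 2) : Commute (o.σm K) (gen K (o.T a) * o.e K 0 (-(1 / 2))) :=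
  (commute_T_all h a).1.symm.mul_right (commute_σm_e h _ _)

theorem commute_σp_τ (a : Fin 2) : Commute (o.σp K) (gen K (o.T a) * o.e K 0 (-(1 / 2))) :=
  (commute_T_all h a).2.2.symm.mul_right (commute_σp_e h _ _)

theorem comulL_ΦJ : comulL (comul₀ K 𝔞) (o.ΦJ K) = hom13U (o.ΦJ K) * hom23U (o.ΦJ K) :=
  comulL_fexp constantCoeff_PJ (comulL_inl_mul_inr (zExtHom_comul₀_gen _))
    (commute_hom13_hom23 (K := K) (Commute.refl _))

theorem comulL_ΦE : comulL (comul₀ K 𝔞) (o.ΦE K) = hom13U (o.ΦE K) * hom23U (o.ΦE K) := by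
  rw [ΦE_eq_fexp h]
  refine comulL_fexp constantCoeff_expE ?_ (commute_expE_expE h)
  simp only [expE, PE, map_neg, map_smul, map_mul (comulL _) X, map_mul hom13U X,
    map_mul hom23U X, comulL_X, hom13_X, hom23_X, map_add,
    comulL_inl_mul_inr (zExtHom_comul₀_gen _), mul_add, smul_add]
  abel

theorem comulL_ΦA {D : U K 𝔞 →ₐ[K] (U K 𝔞 ⊗[K] U K 𝔞)⟦X⟧}
    (hD : zExtHom D (gen K o.Hp) = inlU (gen K o.Hp) + inrU (gen K o.Hp)) :
    comulL D (o.ΦA K) = hom13U (o.ΦA K) * hom23U (o.ΦA K) :=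
  comulL_fexp constantCoeff_PA (comulL_inl_mul_inr hD)
    (commute_hom13_hom23 (K := K) (Commute.refl _))

theorem commute_hom23_ΦE_hom13_ΦJ : Commute (hom23U (o.ΦE K)) (hom13U (o.ΦJ K)) := by
  rw [ΦE_eq_fexp h]
  exact (commute_map_fexp (K := K) (Φ := hom23U) hom23_X constantCoeff_expE
    (constantCoeff_hom23 constantCoeff_expE)
    (commute_map_fexp (K := K) (Φ := hom13U) hom13_X constantCoeff_PJ
      (constantCoeff_hom13 constantCoeff_PJ)
      (commute_hom13_hom23_expE h (commute_σm_τ h)).symm).symm).symm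

theorem commute_hom23_ΦA_hom13_ΦJ : Commute (hom23U (o.ΦA K)) (hom13U (o.ΦJ K)) :=
  (commute_map_fexp (K := K) (Φ := hom23U) hom23_X constantCoeff_PA
    (constantCoeff_hom23 constantCoeff_PA)
    (commute_map_fexp (K := K) (Φ := hom13U) hom13_X constantCoeff_PJ
      (constantCoeff_hom13 constantCoeff_PJ)
      (commute_hom13_hom23 (K := K) (commute_σm_all h).2).symm).symm).symm

theorem commute_hom23_ΦA_hom13_ΦE : Commute (hom23U (o.ΦA K)) (hom13U (o.ΦE K)) := by
  rw [ΦE_eq_fexp h]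
  exact (commute_map_fexp (K := K) (Φ := hom23U) hom23_X constantCoeff_PA
    (constantCoeff_hom23 constantCoeff_PA)
    (commute_map_fexp (K := K) (Φ := hom13U) hom13_X constantCoeff_expE
      (constantCoeff_hom13 constantCoeff_expE)
      (commute_hom23_hom13_expE h (commute_σp_τ h))).symm).symm

theorem comulL_ΦEJ : comulL (comul₀ K 𝔞) (o.ΦE K * o.ΦJ K) =
    hom13U (o.ΦE K * o.ΦJ K) * hom23U (o.ΦE K * o.ΦJ K) := by
  rw [map_mul, comulL_ΦE h, comulL_ΦJ h, map_mul hom13U, map_mul hom23U,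
    (commute_hom23_ΦE_hom13_ΦJ h).mul_mul_mul_comm]

/-- The first legs of the three exponents are primitive, and the second legs commute, so that the
factors can be regrouped. -/
theorem comulL_F : comulL (comul₀ K 𝔞) (o.F K) = hom13U (o.F K) * hom23U (o.F K) := by
  rw [F_eq h, map_mul, comulL_ΦA h (zExtHom_comul₀_gen _), comulL_ΦEJ h, map_mul hom13U (o.ΦA K),
    map_mul hom23U (o.ΦA K)]
  refine Commute.mul_mul_mul_comm ?_ _ _
  rw [map_mul hom13U]
  exact (commute_hom23_ΦA_hom13_ΦE h).mul_right (commute_hom23_ΦA_hom13_ΦJ h)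

/-! ### The factorization `(id ⊗ Δ_F)(F) = F₁₂ F₁₃` -/

theorem comulR_ΦJ {D : U K 𝔞 →ₐ[K] (U K 𝔞 ⊗[K] U K 𝔞)⟦X⟧}
    (hD : zExtHom D (o.σm K) = inlU (o.σm K) + inrU (o.σm K)) :
    comulR D (o.ΦJ K) = hom12U (o.ΦJ K) * hom13U (o.ΦJ K) :=
  comulR_fexp constantCoeff_PJ (comulR_inl_mul_inr hD)
    (commute_hom12_hom13 (K := K) (Commute.refl _))

theorem comulR_ΦA {D : U K 𝔞 →ₐ[K] (U K 𝔞 ⊗[K] U K 𝔞)⟦X⟧}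
    (hD : zExtHom D (o.σp K) = inlU (o.σp K) + inrU (o.σp K)) :
    comulR D (o.ΦA K) = hom12U (o.ΦA K) * hom13U (o.ΦA K) :=
  comulR_fexp constantCoeff_PA (comulR_inl_mul_inr hD)
    (commute_hom12_hom13 (K := K) (Commute.refl _))

theorem zExtHom_homF_Tm : zExtHom (homF h) (gen K o.Tm) =
    inlU (gen K o.Tm) * inrU (o.e K 0 1) + inrU (gen K o.Tm) :=
  zExtHom_twistHom_gen _ (semiconjBy_F h (ad_J_Tm h) (ad_E_Tm h) (ad_A_Tm h))

theorem zExtHom_homF_T (a : Fin 2) : zExtHom (homF h) (gen K (o.T a)) =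
    inlU (gen K (o.T a)) * inrU (o.e K (1 / 2) (1 / 2)) + inlU (o.e K 0 1) * inrU (gen K (o.T a)) :=
  zExtHom_twistHom_gen _ (semiconjBy_F h (ad_J_T h a) (ad_E_T h a) (ad_A_T h a))

theorem zExtHom_homF_σm : zExtHom (homF h) (o.σm K) = inlU (o.σm K) + inrU (o.σm K) :=
  zExtHom_σm h (zExtHom_homF_Tm h)

/-- `T` is primitive for `Δ_E`, so conjugation by `Φ_A` makes `e^{σ_+} = 1 - 2 z T` group-like for
`Δ_F`. -/
theorem zExtHom_homF_σp : zExtHom (homF h) (o.σp K) = inlU (o.σp K) + inrU (o.σp K) := by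
  have hT : zExtHom (homF h) (o.Tz K) = inlU (o.Tz K) * inrU (o.e K 1 0) + inrU (o.Tz K) := by
    have h1 := semiconjBy_zExtHom_twistHom (homE h) (isUnit_ΦA (K := K) (o := o)) (o.Tz K)
    rw [zExtHom_homE_Tz h, twistHom_homE h] at h1
    have h2 := ad_A_Tz h
    exact (isUnit_ΦA (K := K) (o := o)).mul_right_cancel (h1.eq.symm.trans h2.eq)
  exact zExtHom_flog (by rw [hT, e_one_zero])

theorem zExtHom_homE_τ (a : Fin 2) : zExtHom (homE h) (gen K (o.T a) * o.e K 0 (-(1 / 2))) =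
    inlU (gen K (o.T a) * o.e K 0 (-(1 / 2))) +
      inlU (o.e K 0 (1 / 2)) * inrU (gen K (o.T a) * o.e K 0 (-(1 / 2))) := by
  rw [map_mul, zExtHom_homE_T h, zExtHom_homE_e h, add_mul, inl_mul_inr_mul, inl_mul_inr_mul,
    e_mul_e h, e_mul_e h]
  norm_num

theorem zExtHom_homF_τ (a : Fin 2) : zExtHom (homF h) (gen K (o.T a) * o.e K 0 (-(1 / 2))) =
    inlU (gen K (o.T a) * o.e K 0 (-(1 / 2))) * inrU (o.e K (1 / 2) 0) +
      inlU (o.e K 0 (1 / 2)) * inrU (gen K (o.T a) * o.e K 0 (-(1 / 2))) := by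
  rw [map_mul, zExtHom_homF_T h, zExtHom_e_zero h (zExtHom_homF_σm h), add_mul, inl_mul_inr_mul,
    inl_mul_inr_mul, e_mul_e h, e_mul_e h]
  norm_num

variable (K o) in
/-- `-2 z ∑ B_a ⊗ e^{½ σ_-} ⊗ T_a e^{-½ σ_-}`, the conjugate of the exponent of `(Φ_E)₁₃` by
`(Φ_J)₁₂`. -/
def expQ : (U K 𝔞 ⊗[K] (U K 𝔞 ⊗[K] U K 𝔞))⟦X⟧ :=
  -((2 : K) • (X *
    (in1 (gen K (o.B 0)) * (in2 (o.e K 0 (1 / 2)) * in3 (gen K (o.T 0) * o.e K 0 (-(1 / 2)))) +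
    in1 (gen K (o.B 1)) * (in2 (o.e K 0 (1 / 2)) * in3 (gen K (o.T 1) * o.e K 0 (-(1 / 2)))))))

end

end CarrierGens

section

variable {K : Type*} [Field K] {A : Type*} [Ring A] [Algebra K A]

open PowerSeries

theorem commute_hom13_in2 (F : (A ⊗[K] A)⟦X⟧) (b : A⟦X⟧) :
    Commute (hom13 (K := K) F) (in2 (K := K) b) := by
  refine (commute_of_legs (K := K) (A := A) (B := A) (Φ := hom13) hom13_X (fun a => ?_)
    (fun a => ?_) F).symm
  · rw [hom13_inl]; exact (commute_in1_in2 (K := K) a b).symm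
  · rw [hom13_inr]; exact commute_in2_in3 (K := K) b a

theorem commute_in1_in2_in3 {a b c a' b' c' : A⟦X⟧} (ha : Commute a a') (hb : Commute b b')
    (hc : Commute c c') : Commute (in1 (K := K) a * (in2 (K := K) b * in3 (K := K) c))
      (in1 (K := K) a' * (in2 (K := K) b' * in3 (K := K) c')) := by
  refine Commute.mul_left ?_ (Commute.mul_left ?_ ?_)
  · exact (ha.map _).mul_right ((commute_in1_in2 (K := K) a b').mul_right
      (commute_in1_in3 (K := K) a c'))
  · exact (commute_in1_in2 (K := K) a' b).symm.mul_right ((hb.map _).mul_right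
      (commute_in2_in3 (K := K) b c'))
  · exact (commute_in1_in3 (K := K) a' c).symm.mul_right
      ((commute_in2_in3 (K := K) b' c).symm.mul_right (hc.map _))

end

namespace CarrierGens

section

variable {K : Type*} [Field K] [CharZero K] {𝔞 : Type*} [LieRing 𝔞] [LieAlgebra K 𝔞]
variable {o : CarrierGens 𝔞}

open PowerSeries

local notation "inlU" => inl (K := K) (A := U K 𝔞) (B := U K 𝔞)
local notation "inrU" => inr (K := K) (A := U K 𝔞) (B := U K 𝔞)
local notation "hom12U" => hom12 (K := K) (A := U K 𝔞)
local notation "hom13U" => hom13 (K := K) (A := U K 𝔞)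
local notation "hom23U" => hom23 (K := K) (A := U K 𝔞)
local notation "in1U" => in1 (K := K) (A := U K 𝔞)
local notation "in2U" => in2 (K := K) (A := U K 𝔞)
local notation "in3U" => in3 (K := K) (A := U K 𝔞)

variable (K o) in
/-- `-2 z ∑ B_a ⊗ T_a e^{-½ σ_-} ⊗ e^{½ σ_+}`, which `(Φ_A)₁₃` conjugates to the exponent of
`(Φ_E)₁₂`. -/
def expS : (U K 𝔞 ⊗[K] (U K 𝔞 ⊗[K] U K 𝔞))⟦X⟧ :=
  -((2 : K) • (X *
    (in1 (gen K (o.B 0)) * (in2 (gen K (o.T 0) * o.e K 0 (-(1 / 2))) * in3 (o.e K (1 / 2) 0)) +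
    in1 (gen K (o.B 1)) * (in2 (gen K (o.T 1) * o.e K 0 (-(1 / 2))) * in3 (o.e K (1 / 2) 0)))))

theorem constantCoeff_expQ : constantCoeff (o.expQ K) = 0 := by simp [expQ]
theorem constantCoeff_expS : constantCoeff (o.expS K) = 0 := by simp [expS]

theorem constantCoeff_hom12_expE : constantCoeff (hom12U (o.expE K)) = 0 :=
  constantCoeff_hom12 constantCoeff_expE

theorem hom12_expE : hom12U (o.expE K) = -((2 : K) • (X *
    (in1U (gen K (o.B 0)) * in2U (gen K (o.T 0) * o.e K 0 (-(1 / 2))) +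
    in1U (gen K (o.B 1)) * in2U (gen K (o.T 1) * o.e K 0 (-(1 / 2)))))) := by
  rw [expE, PE, map_neg, map_smul, map_mul, hom12_X, map_add, map_mul hom12U, map_mul hom12U,
    hom12_inl, hom12_inr, hom12_inl, hom12_inr]

theorem hom13_expE : hom13U (o.expE K) = -((2 : K) • (X *
    (in1U (gen K (o.B 0)) * in3U (gen K (o.T 0) * o.e K 0 (-(1 / 2))) +
    in1U (gen K (o.B 1)) * in3U (gen K (o.T 1) * o.e K 0 (-(1 / 2)))))) := by
  rw [expE, PE, map_neg, map_smul, map_mul, hom13_X, map_add, map_mul hom13U, map_mul hom13U,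
    hom13_inl, hom13_inr, hom13_inl, hom13_inr]

variable (h : o.Relations K)
include h

theorem commute_B_B (a b : Fin 2) : Commute (gen K (o.B a)) (gen K (o.B b)) :=
  commute_gen (h.B_B a b)

theorem commute_expS_expQ : Commute (o.expS K) (o.expQ K) := by
  have hc : ∀ a b, Commute (in1U (gen K (o.B a)) * (in2U (gen K (o.T a) * o.e K 0 (-(1 / 2))) *
      in3U (o.e K (1 / 2) 0)))
      (in1U (gen K (o.B b)) * (in2U (o.e K 0 (1 / 2)) *
        in3U (gen K (o.T b) * o.e K 0 (-(1 / 2))))) := fun a b =>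
    commute_in1_in2_in3 (commute_B_B h a b) (commute_τ_e h _ _ _ _) (commute_τ_e h _ _ _ _).symm
  exact (commute_X_smul _ (commute_X_smul _ (((hc 0 0).add_right (hc 0 1)).add_left
    ((hc 1 0).add_right (hc 1 1)))).symm).symm.neg_left.neg_right

theorem commute_expE_expQ : Commute (hom12U (o.expE K)) (o.expQ K) := by
  have hc : ∀ a b, Commute (in1U (gen K (o.B a)) * in2U (gen K (o.T a) * o.e K 0 (-(1 / 2))))
      (in1U (gen K (o.B b)) * (in2U (o.e K 0 (1 / 2)) *
        in3U (gen K (o.T b) * o.e K 0 (-(1 / 2))))) := fun a b => by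
    have := commute_in1_in2_in3 (K := K) (commute_B_B h a b) (commute_τ_e h a (-(1 / 2)) 0 (1 / 2))
      (Commute.one_left (gen K (o.T b) * o.e K 0 (-(1 / 2))))
    rwa [map_one, mul_one] at this
  rw [hom12_expE]
  exact (commute_X_smul _ (commute_X_smul _ (((hc 0 0).add_right (hc 0 1)).add_left
    ((hc 1 0).add_right (hc 1 1)))).symm).symm.neg_left.neg_right

theorem comulR_expE {D : U K 𝔞 →ₐ[K] (U K 𝔞 ⊗[K] U K 𝔞)⟦X⟧} : comulR D (o.expE K) =
    -((2 : K) • (X *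
    (in1U (gen K (o.B 0)) * hom23U (zExtHom D (gen K (o.T 0) * o.e K 0 (-(1 / 2)))) +
    in1U (gen K (o.B 1)) * hom23U (zExtHom D (gen K (o.T 1) * o.e K 0 (-(1 / 2))))))) := by
  rw [expE, PE, map_neg, map_smul, map_mul, comulR_X, map_add, map_mul (comulR D),
    map_mul (comulR D), comulR_inl, comulR_inr, comulR_inl, comulR_inr]

theorem comulR_homE_expE : comulR (homE h) (o.expE K) = hom12U (o.expE K) + o.expQ K := by
  rw [comulR_expE h, zExtHom_homE_τ h, zExtHom_homE_τ h, hom12_expE, expQ]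
  simp only [map_add hom23U, map_mul hom23U (inl _), hom23_inl, hom23_inr, mul_add, smul_add]
  abel

theorem comulR_homF_expE : comulR (homF h) (o.expE K) = o.expS K + o.expQ K := by
  rw [comulR_expE h, zExtHom_homF_τ h, zExtHom_homF_τ h, expS, expQ]
  simp only [map_add hom23U, map_mul hom23U (inl _), hom23_inl, hom23_inr, mul_add, smul_add]
  abel

/-- `[H_-, B_a] = ½ B_a`, so that `(Φ_J)₁₂` inserts `e^{½ σ_-}` in the second leg. -/
theorem semiconjBy_hom12_ΦJ : SemiconjBy (hom12U (o.ΦJ K)) (hom13U (o.expE K)) (o.expQ K) := by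
  have hc : ∀ a, SemiconjBy (hom12U (o.ΦJ K))
      (in1U (gen K (o.B a)) * in3U (gen K (o.T a) * o.e K 0 (-(1 / 2))))
      (in1U (gen K (o.B a)) * (in2U (o.e K 0 (1 / 2)) *
        in3U (gen K (o.T a) * o.e K 0 (-(1 / 2))))) := fun a => by
    have := (semiconjBy_ΦJ_inl (o := o) (lie_gen_smul h (h.Hm_B a))).map hom12U
    rw [map_mul hom12U, hom12_inl, hom12_inr] at this
    rw [← mul_assoc]
    exact this.mul_right (commute_hom12_in3 _ _).semiconjBy
  rw [hom13_expE]
  exact (semiconjBy_X_smul _ ((hc 0).add_right (hc 1))).neg_right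

/-- `[H_+, B_a] = -½ B_a`, so that `(Φ_A)₁₃` cancels the third leg `e^{½ σ_+}`. -/
theorem semiconjBy_hom13_ΦA : SemiconjBy (hom13U (o.ΦA K)) (o.expS K) (hom12U (o.expE K)) := by
  have hc : ∀ a, SemiconjBy (hom13U (o.ΦA K))
      (in1U (gen K (o.B a)) * (in2U (gen K (o.T a) * o.e K 0 (-(1 / 2))) *
        in3U (o.e K (1 / 2) 0)))
      (in1U (gen K (o.B a)) * in2U (gen K (o.T a) * o.e K 0 (-(1 / 2)))) := fun a => by
    have h1 := (semiconjBy_ΦA_inl (o := o) (lie_gen_smul h (h.Hp_B a))).map hom13U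
    have h2 := (commute_ΦA_inr (commute_σp_e h (1 / 2) 0)).map hom13U
    rw [map_mul hom13U, hom13_inl, hom13_inr] at h1
    rw [hom13_inr] at h2
    refine semiconjBy_of_eq (h1.mul_right ((commute_hom13_in2 _ _).mul_right h2).semiconjBy) ?_
    rw [mul_assoc, (commute_in2_in3 (K := K) _ _).eq, ← mul_assoc (in3U _), ← map_mul in3U,
      e_mul_e h, neg_add_cancel, add_zero, e_zero_zero, map_one, one_mul]
  rw [hom12_expE]
  exact (semiconjBy_X_smul _ ((hc 0).add_right (hc 1))).neg_right

theorem hom12_ΦJ_mul_hom13_ΦE :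
    hom12U (o.ΦJ K) * hom13U (o.ΦE K) = fexp K (o.expQ K) * hom12U (o.ΦJ K) := by
  rw [ΦE_eq_fexp h, map_fexp hom13U hom13_X constantCoeff_expE]
  exact semiconjBy_fexp (constantCoeff_hom13 (K := K) (constantCoeff_expE (o := o)))
    (constantCoeff_expQ (o := o))
    (semiconjBy_hom12_ΦJ h)

theorem commute_hom12_ΦJ_hom13_ΦA : Commute (hom12U (o.ΦJ K)) (hom13U (o.ΦA K)) :=
  commute_map_fexp (K := K) (Φ := hom13U) hom13_X constantCoeff_PA
    (constantCoeff_hom13 constantCoeff_PA)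
    (commute_map_fexp (K := K) (Φ := hom12U) hom12_X constantCoeff_PJ
      (constantCoeff_hom12 constantCoeff_PJ)
      (commute_hom12_hom13 (K := K) (commute_gen h.Hp_Hm).symm).symm).symm

/-- `(id ⊗ Δ_E)(Φ_E)` is `(Φ_E)₁₂ e^Q`, and moving `(Φ_J)₁₂` to the left through `e^Q` turns
`e^Q` into `(Φ_E)₁₃`. Here `Q` is `expQ`. -/
theorem comulR_ΦEJ : comulR (homE h) (o.ΦE K * o.ΦJ K) =
    hom12U (o.ΦE K * o.ΦJ K) * hom13U (o.ΦE K * o.ΦJ K) := by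
  have e1 : comulR (homE h) (o.ΦE K) = hom12U (o.ΦE K) * fexp K (o.expQ K) := by
    rw [ΦE_eq_fexp h, map_fexp (comulR (homE h)) (comulR_X _) constantCoeff_expE,
      comulR_homE_expE h,
      fexp_add (constantCoeff_hom12_expE (K := K) (o := o)) (constantCoeff_expQ (K := K) (o := o))
        (commute_expE_expQ h),
      map_fexp hom12U hom12_X constantCoeff_expE]
  rw [map_mul, e1, comulR_ΦJ h (zExtHom_σm h (zExtHom_homE_Tm h)), map_mul hom12U, map_mul hom13U,
    mul_assoc, ← mul_assoc (fexp K _), ← hom12_ΦJ_mul_hom13_ΦE h]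
  simp only [mul_assoc]

/-- `(id ⊗ Δ_F)(Φ_E)` is `e^S e^Q`. Conjugation by `(Φ_A)₁₃` turns `e^S` into `(Φ_E)₁₂`, and
conjugation by `(Φ_J)₁₂` relates `e^Q` to `(Φ_E)₁₃`. Here `S` and `Q` are `expS` and `expQ`. -/
theorem comulR_F : comulR (homF h) (o.F K) = hom12U (o.F K) * hom13U (o.F K) := by
  have e1 : hom13U (o.ΦA K) * comulR (homF h) (o.ΦE K) =
      hom12U (o.ΦE K) * (hom13U (o.ΦA K) * fexp K (o.expQ K)) := by
    rw [ΦE_eq_fexp h, map_fexp (comulR (homF h)) (comulR_X _) constantCoeff_expE,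
      comulR_homF_expE h,
      fexp_add (constantCoeff_expS (K := K) (o := o)) (constantCoeff_expQ (K := K) (o := o))
        (commute_expS_expQ h),
      map_fexp hom12U hom12_X constantCoeff_expE, ← mul_assoc, ← mul_assoc,
      (semiconjBy_fexp (constantCoeff_expS (K := K) (o := o))
        (constantCoeff_hom12_expE (K := K) (o := o))
        (semiconjBy_hom13_ΦA h)).eq]
  have e2 := hom12_ΦJ_mul_hom13_ΦE h
  have e3 := (commute_hom12_ΦJ_hom13_ΦA h).eq
  calc comulR (homF h) (o.F K)
      = hom12U (o.ΦA K) * ((hom13U (o.ΦA K) * comulR (homF h) (o.ΦE K)) *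
          (hom12U (o.ΦJ K) * hom13U (o.ΦJ K))) := by
        rw [F, map_mul, map_mul, comulR_ΦA h (zExtHom_homF_σp h), comulR_ΦJ h (zExtHom_homF_σm h)]
        simp only [mul_assoc]
    _ = hom12U (o.ΦA K) * (hom12U (o.ΦE K) * (hom13U (o.ΦA K) * ((fexp K (o.expQ K) *
          hom12U (o.ΦJ K)) * hom13U (o.ΦJ K)))) := by
        rw [e1]; simp only [mul_assoc]
    _ = hom12U (o.ΦA K) * (hom12U (o.ΦE K) * ((hom13U (o.ΦA K) * hom12U (o.ΦJ K)) *
          (hom13U (o.ΦE K) * hom13U (o.ΦJ K)))) := by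
        rw [← e2]; simp only [mul_assoc]
    _ = hom12U (o.F K) * hom13U (o.F K) := by
        rw [← e3, F, map_mul hom12U, map_mul hom12U, map_mul hom13U, map_mul hom13U]
        simp only [mul_assoc]

end

end CarrierGens

/-! ### The Hopf algebra of the carrier -/

section

variable {K : Type*} [Field K] {A B : Type*} [Ring A] [Algebra K A] [Ring B] [Algebra K B]

open PowerSeries

theorem map_fexp_eq_one {Φ : A⟦X⟧ →ₐ[K] B⟦X⟧} (hΦ : Φ X = X) {P : A⟦X⟧}
    (hP : constantCoeff P = 0) (h : Φ P = 0) : Φ (fexp K P) = 1 := by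
  rw [map_fexp Φ hΦ hP, h, fexp_zero]

theorem map_flog_eq_zero [CharZero K] {Φ : A⟦X⟧ →ₐ[K] B⟦X⟧} (hΦ : Φ X = X) {P : A⟦X⟧}
    (hP : constantCoeff P = 0) (h : Φ P = 0) : Φ (flog K P) = 0 := by
  have := flog_fexp_sub_one (K := K) (A := B) (x := 0) (map_zero _)
  rwa [fexp_zero, sub_self, ← h, ← map_flog Φ hΦ hP, h] at this

theorem coeff_one_fexp {P : A⟦X⟧} : coeff 1 (fexp K P) = coeff 1 P := by
  simp [fexp, Finset.sum_range_succ, coeff_one]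

theorem coeff_one_flog {P : A⟦X⟧} : coeff 1 (flog K P) = coeff 1 P := by
  simp [flog]

theorem coeff_one_X_mul (a : A⟦X⟧) : coeff 1 (X * a) = coeff 0 a := coeff_succ_X_mul 0 a

theorem coeff_one_mul_of_one {a b : A⟦X⟧} (ha : constantCoeff a = 1) (hb : constantCoeff b = 1) :
    coeff 1 (a * b) = coeff 1 a + coeff 1 b := by
  rw [coeff_mul, Finset.Nat.antidiagonal_succ]
  simp [ha, hb, add_comm]

theorem coeff_mapAlgHom (f : A →ₐ[K] B) (n : ℕ) (x : A⟦X⟧) :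
    coeff n (mapAlgHom f x) = f (coeff n x) := by
  simp [mapAlgHom_apply]

theorem coeff_inl_C_mul_inr (a : A) (b : B⟦X⟧) (n : ℕ) :
    coeff n (inl (K := K) (PowerSeries.C a) * inr b) = a ⊗ₜ[K] coeff n b := by
  rw [inl_C, coeff_C_mul, inr, coeff_mapAlgHom, Algebra.TensorProduct.includeRight_apply,
    Algebra.TensorProduct.tmul_mul_tmul, mul_one, one_mul]

theorem inverse_mul {R : Type*} [Ring R] {a b : R} (ha : IsUnit a) (hb : IsUnit b) :
    Ring.inverse (a * b) = Ring.inverse b * Ring.inverse a := by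
  obtain ⟨u, rfl⟩ := ha
  obtain ⟨v, rfl⟩ := hb
  rw [← Units.val_mul, Ring.inverse_unit, Ring.inverse_unit, Ring.inverse_unit, mul_inv_rev,
    Units.val_mul]

theorem constantCoeff_inverse {a : A⟦X⟧} (h : IsUnit a) (h0 : constantCoeff a = 1) :
    constantCoeff (Ring.inverse a) = 1 := by
  have := congrArg constantCoeff (Ring.mul_inverse_cancel a h)
  rwa [map_mul, h0, one_mul, map_one] at this

theorem coeff_one_inverse {a : A⟦X⟧} (h : IsUnit a) (h0 : constantCoeff a = 1) :
    coeff 1 (Ring.inverse a) = -coeff 1 a := by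
  have := congrArg (coeff 1) (Ring.mul_inverse_cancel a h)
  rw [coeff_one_mul_of_one h0 (constantCoeff_inverse h h0), coeff_one, if_neg one_ne_zero] at this
  exact (neg_eq_of_add_eq_zero_right this).symm

end

namespace CarrierGens

section

variable {K : Type*} [Field K] [CharZero K] {𝔞 : Type*} [LieRing 𝔞] [LieAlgebra K 𝔞]
variable {o : CarrierGens 𝔞}

open PowerSeries

local notation "inlU" => inl (K := K) (A := U K 𝔞) (B := U K 𝔞)
local notation "inrU" => inr (K := K) (A := U K 𝔞) (B := U K 𝔞)

theorem coeff_inl_gen_mul_inr (x : 𝔞) (b : (U K 𝔞)⟦X⟧) (n : ℕ) :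
    coeff n (inlU (gen K x) * inrU b) = UniversalEnvelopingAlgebra.ι K x ⊗ₜ[K] coeff n b :=
  coeff_inl_C_mul_inr _ _ _

theorem counitL_inl_gen_mul (x : 𝔞) (y : (U K 𝔞)⟦X⟧) :
    counitL (counit₀ K 𝔞) (inlU (gen K x) * inrU y) = 0 := by
  rw [map_mul, counitL_inl, zExtHom_counit₀_gen, map_zero, zero_mul]

theorem counitR_inl_mul_inr {x y : (U K 𝔞)⟦X⟧} (hy : zExtHom (counit₀ K 𝔞) y = 0) :
    counitR (counit₀ K 𝔞) (inlU x * inrU y) = 0 := by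
  rw [map_mul, counitR_inr, hy, map_zero, mul_zero]

theorem counit_σm : zExtHom (counit₀ K 𝔞) (o.σm K) = 0 :=
  map_flog_eq_zero (zExtHom_X _) (by simp) (by
    rw [map_neg, map_smul, map_mul, zExtHom_counit₀_gen, mul_zero, smul_zero, neg_zero])

theorem counit_Tz : zExtHom (counit₀ K 𝔞) (o.Tz K) = 0 := by
  rw [Tz, map_add, zExtHom_counit₀_gen, map_mul, map_mul, map_add, map_pow, map_pow,
    zExtHom_counit₀_gen, zExtHom_counit₀_gen]
  simp

theorem counit_σp : zExtHom (counit₀ K 𝔞) (o.σp K) = 0 :=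
  map_flog_eq_zero (zExtHom_X _) (by simp) (by
    rw [map_neg, map_smul, map_mul, counit_Tz, mul_zero, smul_zero, neg_zero])

theorem counit_τ (a : Fin 2) (β : K) :
    zExtHom (counit₀ K 𝔞) (gen K (o.T a) * o.e K 0 β) = 0 := by
  rw [map_mul, zExtHom_counit₀_gen, zero_mul]

theorem counitL_ΦJ : counitL (counit₀ K 𝔞) (o.ΦJ K) = 1 :=
  map_fexp_eq_one (counitL_X _) constantCoeff_PJ (counitL_inl_gen_mul _ _)

theorem counitR_ΦJ : counitR (counit₀ K 𝔞) (o.ΦJ K) = 1 :=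
  map_fexp_eq_one (counitR_X _) constantCoeff_PJ (counitR_inl_mul_inr counit_σm)

theorem counitL_ΦA : counitL (counit₀ K 𝔞) (o.ΦA K) = 1 :=
  map_fexp_eq_one (counitL_X _) constantCoeff_PA (counitL_inl_gen_mul _ _)

theorem counitR_ΦA : counitR (counit₀ K 𝔞) (o.ΦA K) = 1 :=
  map_fexp_eq_one (counitR_X _) constantCoeff_PA (counitR_inl_mul_inr counit_σp)

theorem constantCoeff_ΦJ : constantCoeff (o.ΦJ K) = 1 := constantCoeff_fexp _
theorem constantCoeff_ΦA : constantCoeff (o.ΦA K) = 1 := constantCoeff_fexp _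
theorem constantCoeff_ΦE : constantCoeff (o.ΦE K) = 1 := by
  rw [ΦE, map_mul, constantCoeff_fexp, constantCoeff_fexp, mul_one]

theorem constantCoeff_F : constantCoeff (o.F K) = 1 := by
  rw [F, map_mul, map_mul, constantCoeff_ΦJ, constantCoeff_ΦE, constantCoeff_ΦA, mul_one, mul_one]

theorem coeff_one_σm : coeff 1 (o.σm K) = -((2 : K) • UniversalEnvelopingAlgebra.ι K o.Tm) := by
  rw [σm, coeff_one_flog, map_neg, coeff_smul, coeff_one_X_mul, gen, coeff_zero_C]

theorem coeff_one_σp : coeff 1 (o.σp K) = -((2 : K) • UniversalEnvelopingAlgebra.ι K o.Tp) := by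
  rw [σp, coeff_one_flog, map_neg, coeff_smul, coeff_one_X_mul, Tz, map_add, gen, coeff_zero_C,
    coeff_zero_X_mul, add_zero]

variable (h : o.Relations K)
include h

theorem counitL_ΦE : counitL (counit₀ K 𝔞) (o.ΦE K) = 1 := by
  rw [ΦE_eq h]
  refine map_fexp_eq_one (counitL_X _) constantCoeff_PE ?_
  rw [map_neg, map_smul, map_mul, PE, map_add, counitL_inl_gen_mul, counitL_inl_gen_mul]
  simp

theorem counitR_ΦE : counitR (counit₀ K 𝔞) (o.ΦE K) = 1 := by
  rw [ΦE_eq h]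
  refine map_fexp_eq_one (counitR_X _) constantCoeff_PE ?_
  rw [map_neg, map_smul, map_mul, PE, map_add, counitR_inl_mul_inr (counit_τ _ _),
    counitR_inl_mul_inr (counit_τ _ _)]
  simp

theorem twist_ΦJ : IsFactorizableTwist K (Δ₀ K 𝔞) (ε₀ K 𝔞) (o.ΦJ K) :=
  isFactorizableTwist_of_factor (D := comul₀ K 𝔞) (e := counit₀ K 𝔞) isUnit_ΦJ counitL_ΦJ
    counitR_ΦJ (comulL_ΦJ h) (comulR_ΦJ h (zExtHom_σm h (zExtHom_homJ_Tm h)))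

theorem twist_ΦEJ : IsFactorizableTwist K (Δ₀ K 𝔞) (ε₀ K 𝔞) (o.ΦE K * o.ΦJ K) :=
  isFactorizableTwist_of_factor (D := comul₀ K 𝔞) (e := counit₀ K 𝔞) (isUnit_ΦEJ h)
    (by rw [map_mul, counitL_ΦE h, counitL_ΦJ, mul_one])
    (by rw [map_mul, counitR_ΦE h, counitR_ΦJ, mul_one])
    (comulL_ΦEJ h) (comulR_ΦEJ h)

theorem twist_F : IsFactorizableTwist K (Δ₀ K 𝔞) (ε₀ K 𝔞) (o.F K) :=
  isFactorizableTwist_of_factor (D := comul₀ K 𝔞) (e := counit₀ K 𝔞) (isUnit_F h)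
    (by rw [F, map_mul, map_mul, counitL_ΦE h, counitL_ΦJ, counitL_ΦA, mul_one, mul_one])
    (by rw [F, map_mul, map_mul, counitR_ΦE h, counitR_ΦJ, counitR_ΦA, mul_one, mul_one])
    (comulL_F h) (comulR_F h)

theorem twist_ΦA : IsFactorizableTwist K (o.ΔE K) (ε₀ K 𝔞) (o.ΦA K) :=
  isFactorizableTwist_of_factor (D := homE h) (e := counit₀ K 𝔞) isUnit_ΦA counitL_ΦA counitR_ΦA
    (comulL_ΦA h (zExtHom_homE_Hp h))
    (by rw [twistHom_homE h]; exact comulR_ΦA h (zExtHom_homF_σp h))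

theorem coeff_one_ΦE : coeff 1 (o.ΦE K) =
    -((2 : K) • (UniversalEnvelopingAlgebra.ι K (o.B 0) ⊗ₜ UniversalEnvelopingAlgebra.ι K (o.T 0) +
      UniversalEnvelopingAlgebra.ι K (o.B 1) ⊗ₜ UniversalEnvelopingAlgebra.ι K (o.T 1))) := by
  have e0 : ∀ a, coeff 0 (gen K (o.T a) * o.e K 0 (-(1 / 2))) =
      UniversalEnvelopingAlgebra.ι K (o.T a) := fun a => by
    rw [gen, coeff_C_mul, e, coeff_zero_eq_constantCoeff_apply, constantCoeff_fexp, mul_one]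
  rw [ΦE_eq h, coeff_one_fexp, map_neg, coeff_smul, coeff_one_X_mul, PE, map_add]
  rw [coeff_inl_gen_mul_inr, coeff_inl_gen_mul_inr, e0, e0]

/-- The classical limit: `F = 1 - 2 z ∑ X_i ⊗ Y_i + O(z²)`. -/
theorem coeff_one_F : coeff 1 (o.F K) =
    -((2 : K) • (UniversalEnvelopingAlgebra.ι K o.Hp ⊗ₜ UniversalEnvelopingAlgebra.ι K o.Tp +
      UniversalEnvelopingAlgebra.ι K o.Hm ⊗ₜ UniversalEnvelopingAlgebra.ι K o.Tm +
      UniversalEnvelopingAlgebra.ι K (o.B 0) ⊗ₜ UniversalEnvelopingAlgebra.ι K (o.T 0) +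
      UniversalEnvelopingAlgebra.ι K (o.B 1) ⊗ₜ UniversalEnvelopingAlgebra.ι K (o.T 1))) := by
  rw [F_eq h, coeff_one_mul_of_one constantCoeff_ΦA
      (by rw [map_mul, constantCoeff_ΦE, constantCoeff_ΦJ, mul_one]),
    coeff_one_mul_of_one constantCoeff_ΦE constantCoeff_ΦJ, coeff_one_ΦE h, ΦA_eq, ΦJ_eq,
    coeff_one_fexp, coeff_one_fexp]
  rw [coeff_inl_gen_mul_inr, coeff_inl_gen_mul_inr, coeff_one_σm, coeff_one_σp,
    TensorProduct.tmul_neg, TensorProduct.tmul_neg, TensorProduct.tmul_smul,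
    TensorProduct.tmul_smul]
  module

theorem coeff_one_R : coeff 1 (o.R K) = toU2 K (o.r K) := by
  rw [R, coeff_one_mul_of_one
      (by rw [flip, constantCoeff_mapAlgHom, constantCoeff_F, map_one])
      (constantCoeff_inverse (isUnit_F h) constantCoeff_F),
    coeff_one_inverse (isUnit_F h) constantCoeff_F, flip, coeff_mapAlgHom, coeff_one_F h]
  have hc : ∀ x y : U K 𝔞, (Algebra.TensorProduct.comm K (U K 𝔞) (U K 𝔞)).toAlgHom (x ⊗ₜ y) =
    y ⊗ₜ x := fun _ _ => rfl
  simp only [hc, r, toU2, wedge, map_neg, map_smul, map_add, map_sub, TensorProduct.map_tmul,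
    LieHom.coe_toLinearMap]
  module

theorem coeff_zero_R : coeff 0 (o.R K) = 1 := by
  rw [coeff_zero_eq_constantCoeff_apply, R, map_mul, flip, constantCoeff_mapAlgHom,
    constantCoeff_F, map_one, constantCoeff_inverse (isUnit_F h) constantCoeff_F, mul_one]

theorem rMatrix_F : IsTriangularRMatrix K (o.ΔF K) (o.R K) :=
  isTriangularRMatrix_of_twist (D := comul₀ K 𝔞) (e := counit₀ K 𝔞) flipHom_comul₀ (twist_F h)

theorem twistedHopf : o.TwistedHopf K where
  twist := twist_F h
  jordanian := twist_ΦJ h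
  extended := twist_ΦEJ h
  additional := twist_ΦA h
  comul_additional := by
    rw [ΔE, twistComul_twistComul _ (isUnit_ΦEJ h) isUnit_ΦA, ← F_eq h]; rfl
  Hp_Tz := by
    have := lie_Tz_Hp h
    rw [← lie_skew, neg_inj] at this
    exact this
  isUnit_v := isUnit_twistV constantCoeff_F
  hopf := isFormalHopfAlgebra_of_twist constantCoeff_F (twist_F h).toIsTwist
  coproducts := coproducts h
  rMatrix := rMatrix_F h
  rMatrix_eq := by
    rw [R, F, inverse_mul (isUnit_ΦA.mul (isUnit_ΦE h)) isUnit_ΦJ, inverse_mul isUnit_ΦA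
      (isUnit_ΦE h)]
    simp only [flip_eq, map_mul, mul_assoc]
  rMatrix_zero := coeff_zero_R h
  rMatrix_one := coeff_one_R h
  -- the part of order `z²` of the quantum Yang--Baxter equation
  yangBaxter := classical_of_quantumYangBaxter
    (quantumYangBaxter (D := homF h) (rMatrix_F h)) (coeff_zero_R h) (coeff_one_R h)

end

end CarrierGens

/-! ### The coproducts of `A_a` and `J_1` -/

namespace WeylGens

section

variable {K : Type*} [Field K] {𝔞 : Type*} [LieRing 𝔞] [LieAlgebra K 𝔞]

variable (K) in
/-- The brackets of `A_a` and `J_1` with the generators of the carrier algebra. -/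
structure WeylRelations (w : WeylGens 𝔞) : Prop extends w.toCarrierGens.Relations K where
  Hp_A : ∀ a, ⁅w.Hp, w.A a⁆ = (1 / 2 : K) • w.A a
  Hm_A : ∀ a, ⁅w.Hm, w.A a⁆ = -(1 / 2 : K) • w.A a
  Tp_A : ∀ a, ⁅w.Tp, w.A a⁆ = 0
  Tm_A : ∀ a, ⁅w.Tm, w.A a⁆ = -w.T a
  T_A : ∀ b a, ⁅w.T b, w.A a⁆ = if a = b then -w.Tp else 0
  B_A : ∀ b a, ⁅w.B b, w.A a⁆ = if a = b then w.Hm - w.Hp else (eps2 a b : K) • w.J1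
  Hp_J1 : ⁅w.Hp, w.J1⁆ = 0
  Hm_J1 : ⁅w.Hm, w.J1⁆ = 0
  Tp_J1 : ⁅w.Tp, w.J1⁆ = 0
  Tm_J1 : ⁅w.Tm, w.J1⁆ = 0
  T_J1 : ∀ a b, a ≠ b → ⁅w.T a, w.J1⁆ = -(eps2 a b : K) • w.T b
  B_J1 : ∀ a b, a ≠ b → ⁅w.B a, w.J1⁆ = -(eps2 a b : K) • w.B b

variable [CharZero K] {w : WeylGens 𝔞}

open PowerSeries CarrierGens

local notation "inlU" => inl (K := K) (A := U K 𝔞) (B := U K 𝔞)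
local notation "inrU" => inr (K := K) (A := U K 𝔞) (B := U K 𝔞)

theorem PE_eq {a b : Fin 2} (hab : a ≠ b) : w.PE K =
    inlU (gen K (w.B a)) * inrU (gen K (w.T a) * w.e K 0 (-(1 / 2))) +
      inlU (gen K (w.B b)) * inrU (gen K (w.T b) * w.e K 0 (-(1 / 2))) := by
  rw [PE]
  fin_cases a <;> fin_cases b <;> first | exact absurd rfl hab | rfl | exact add_comm _ _

variable (h : w.WeylRelations K)
include h

theorem commute_T_Tp (a : Fin 2) : Commute (gen K (w.T a)) (gen K w.Tp) :=
  commute_gen (by rw [Relations.swap (h.Tp_T a), neg_zero])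

theorem lie_σm_A (a : Fin 2) :
    ⁅w.σm K, gen K (w.A a)⁆ = (2 : K) • (X * (gen K (w.T a) * w.e K 0 (-1))) := by
  have e1 : ⁅-((2 : K) • (X * gen K w.Tm)), gen K (w.A a)⁆ = (2 : K) • (X * gen K (w.T a)) := by
    rw [smul_X_lie, lie_gen, h.Tm_A, gen_neg, mul_neg, smul_neg, neg_neg]
  have e2 : Commute (-((2 : K) • (X * gen K w.Tm))) ((2 : K) • (X * gen K (w.T a))) :=
    (commute_X_smul _ (commute_X_smul _ (commute_gen (h.Tm_T a)).symm).symm).neg_left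
  rw [σm, lie_flog (by simp) e1 e2, ← σm, e_zero_eq, neg_one_smul, smul_mul_assoc, mul_assoc]

theorem lie_e_A (a : Fin 2) (β : K) :
    ⁅w.e K 0 β, gen K (w.A a)⁆ = (2 * β) • (X * (gen K (w.T a) * w.e K 0 (β - 1))) := by
  have hc : Commute (β • w.σm K) ((2 * β) • (X * (gen K (w.T a) * w.e K 0 (-1)))) :=
    (commute_X_smul _ ((commute_T_all h.toRelations a).1.symm.mul_right
      (commute_σm_e h.toRelations _ _))).smul_left β
  rw [e_zero_eq, lie_fexp (by simp) (y := (2 * β) • (X * (gen K (w.T a) * w.e K 0 (-1))))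
    (by rw [smul_lie, lie_σm_A h]; module) hc, ← e_zero_eq, smul_mul_assoc, mul_assoc, mul_assoc,
    e_mul_e h.toRelations, zero_add, neg_add_eq_sub]

theorem lie_gen_T_A (a b : Fin 2) :
    ⁅gen K (w.T b), gen K (w.A a)⁆ = if a = b then -gen K w.Tp else 0 := by
  rw [lie_gen, h.T_A]
  split_ifs
  · rw [gen_neg]
  · rw [gen_zero]

/-- The bracket of `T_b e^{-½ σ_-}` with `A_a`. -/
theorem lie_τ_A (a b : Fin 2) : ⁅gen K (w.T b) * w.e K 0 (-(1 / 2)), gen K (w.A a)⁆ =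
    -(X * (gen K (w.T b) * gen K (w.T a) * w.e K 0 (-(3 / 2)))) -
      if a = b then gen K w.Tp * w.e K 0 (-(1 / 2)) else 0 := by
  rw [mul_lie_mul, lie_e_A h, lie_gen_T_A h, show (2 * -(1 / 2) : K) = -1 by norm_num,
    show (-(1 / 2) - 1 : K) = -(3 / 2) by norm_num, neg_one_smul, mul_neg, ← mul_assoc _ X, ← X_mul,
    mul_assoc, mul_assoc]
  split_ifs
  · rw [neg_mul, sub_eq_add_neg]
  · rw [zero_mul, sub_zero, add_zero]

theorem lie_Tz_A (a : Fin 2) : ⁅w.Tz K, gen K (w.A a)⁆ =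
    -((2 : K) • (X * (gen K (w.T a) * (w.Tz K * w.e K 0 (-1))))) := by
  have hr := h.toRelations
  set Q := gen K (w.T 0) ^ 2 + gen K (w.T 1) ^ 2 with hQ
  have hsq : ∀ b, ⁅gen K (w.T b) ^ 2, gen K (w.A a)⁆ =
      if a = b then -((2 : K) • (gen K (w.T a) * gen K w.Tp)) else 0 := fun b => by
    rw [sq, mul_lie_mul, lie_gen_T_A h]
    split_ifs with hab
    · subst hab
      rw [mul_neg, neg_mul, ← (commute_T_Tp h a).eq]; module
    · simp
  have hQA : ⁅Q, gen K (w.A a)⁆ = -((2 : K) • (gen K (w.T a) * gen K w.Tp)) := by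
    rw [hQ, add_lie, hsq, hsq]; fin_cases a <;> simp
  have hTQ : Q * gen K (w.T a) = gen K (w.T a) * Q :=
    (commute_Q hr fun b => commute_T_T hr a b).symm.eq
  rw [Tz_eq hr, ← hQ]
  clear_value Q
  rw [add_lie, lie_gen, h.Tp_A, gen_zero, zero_add, X_mul_lie, mul_lie_mul, hQA,
    lie_e_A h, show (2 * (-1) : K) = -2 by norm_num, show (-1 - 1 : K) = -2 by norm_num]
  have e1 : X * (Q * w.e K 0 (-1)) * w.e K 0 (-1) = X * (Q * w.e K 0 (-2)) := by
    rw [mul_assoc, mul_assoc, e_mul_e hr]; norm_num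
  have e2 : gen K (w.T a) * (X * (Q * w.e K 0 (-2))) =
      Q * (X * (gen K (w.T a) * w.e K 0 (-2))) := by
    rw [← mul_assoc _ X, ← X_mul, mul_assoc, ← mul_assoc _ Q, ← hTQ, ← mul_assoc Q X, ← X_mul,
      mul_assoc X Q, mul_assoc Q]
  rw [add_mul, mul_add (gen K (w.T a)), e1, e2]
  simp only [mul_add, mul_neg, neg_mul, smul_add, mul_smul_comm, smul_mul_assoc, neg_smul,
    mul_assoc]
  abel

theorem lie_σp_A (a : Fin 2) : ⁅w.σp K, gen K (w.A a)⁆ =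
    (2 : K) • (X * (gen K (w.T a) * w.e K (-1) (-1))) -
      (2 : K) • (X * (gen K (w.T a) * w.e K 0 (-1))) := by
  have hr := h.toRelations
  rw [lie_σp hr (lie_Tz_A h a) (commute_X_smul _ ((commute_T_all hr a).2.1.symm.mul_right
    ((Commute.refl _).mul_right (commute_Tz_e hr _ _))))]
  have e1 : (2 : K) • (X * (gen K (w.T a) * (w.Tz K * w.e K 0 (-1)))) =
      gen K (w.T a) * (((2 : K) • (X * w.Tz K)) * w.e K 0 (-1)) := by
    rw [smul_mul_assoc, mul_smul_comm, mul_assoc X, ← mul_assoc _ X, ← X_mul, mul_assoc]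
  rw [e1, two_X_Tz, sub_mul, one_mul, e_mul_e hr, mul_assoc, sub_mul, e_mul_e hr, e_mul_e hr,
    mul_sub, mul_sub, smul_sub]
  norm_num

theorem lie_B_A (a b : Fin 2) : ⁅gen K (w.B b), gen K (w.A a)⁆ =
    if a = b then gen K w.Hm - gen K w.Hp else (eps2 a b : K) • gen K w.J1 := by
  rw [lie_gen, h.B_A]
  split_ifs
  · rw [gen_sub]
  · rw [gen_smul]

end

end WeylGens

namespace WeylGens

section

variable {K : Type*} [Field K] {𝔞 : Type*} [LieRing 𝔞] [LieAlgebra K 𝔞]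
variable [CharZero K] {w : WeylGens 𝔞}

open PowerSeries CarrierGens

local notation "inlU" => inl (K := K) (A := U K 𝔞) (B := U K 𝔞)
local notation "inrU" => inr (K := K) (A := U K 𝔞) (B := U K 𝔞)

theorem inl_mul_inr_X_smul (x y : (U K 𝔞)⟦X⟧) (c : K) :
    inlU x * inrU (c • (X * y)) = c • (X * (inlU x * inrU y)) := by
  rw [map_smul, map_mul inr X, inr_X, mul_smul_comm, ← mul_assoc _ X, ← X_mul, mul_assoc]

variable (h : w.WeylRelations K)
include h

theorem ad_J_A (a : Fin 2) : SemiconjBy (w.ΦJ K) (inlU (gen K (w.A a)) + inrU (gen K (w.A a)))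
    (inlU (gen K (w.A a)) * inrU (w.e K 0 (-(1 / 2))) + inrU (gen K (w.A a)) +
      (2 : K) • (X * (inlU (gen K w.Hm) * inrU (gen K (w.T a) * w.e K 0 (-1))))) := by
  have hr := h.toRelations
  refine semiconjBy_of_eq ((semiconjBy_ΦJ_inl (lie_gen_smul hr (h.Hm_A a))).add_right
    (semiconjBy_ΦJ_inr (lie_σm_A h a) (commute_X_smul _ ((commute_T_all hr a).1.symm.mul_right
      (commute_σm_e hr _ _))))) ?_
  rw [inl_mul_inr_X_smul, add_assoc]

theorem eps2_mul_self {a b : Fin 2} (hab : a ≠ b) : (eps2 a b : K) * (eps2 a b : K) = 1 := by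
  fin_cases a <;> fin_cases b <;> simp_all [eps2]

theorem eps2_swap (a b : Fin 2) : (eps2 b a : K) = -(eps2 a b : K) := by
  simp [eps2]

/-- The bracket of the exponent of `Φ_E` with the conjugate of `A_a` by `Φ_J`. -/
theorem lie_PE_A {a b : Fin 2} (hab : a ≠ b) :
    ⁅w.PE K, inlU (gen K (w.A a)) * inrU (w.e K 0 (-(1 / 2))) + inrU (gen K (w.A a)) +
      (2 : K) • (X * (inlU (gen K w.Hm) * inrU (gen K (w.T a) * w.e K 0 (-1))))⁆ =
    inlU (gen K w.Hm - gen K w.Hp) * inrU (gen K (w.T a) * w.e K 0 (-1)) +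
      (eps2 a b : K) • (inlU (gen K w.J1) * inrU (gen K (w.T b) * w.e K 0 (-1))) -
      inlU (gen K (w.B a)) * inrU (gen K w.Tp * w.e K 0 (-(1 / 2))) -
      (2 : K) • (X * (inlU (gen K (w.B a)) *
        inrU (gen K (w.T a) * gen K (w.T a) * w.e K 0 (-(3 / 2))))) -
      (2 : K) • (X * (inlU (gen K (w.B b)) *
        inrU (gen K (w.T b) * gen K (w.T a) * w.e K 0 (-(3 / 2))))) := by
  have hr := h.toRelations
  have hHm : ∀ c, ⁅gen K (w.B c), gen K w.Hm⁆ = (-(1 / 2) : K) • gen K (w.B c) := fun c => by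
    rw [lie_gen, Relations.swap (hr.Hm_B c), ← gen_smul, neg_smul]
  have he : ∀ c, gen K (w.T c) * w.e K 0 (-(1 / 2)) * w.e K 0 (-(1 / 2)) =
      gen K (w.T c) * w.e K 0 (-1) := fun c => by
    rw [mul_assoc, e_mul_e hr]; norm_num
  have he' : ∀ c, gen K (w.T c) * w.e K 0 (-(1 / 2)) * (gen K (w.T a) * w.e K 0 (-1)) =
      gen K (w.T c) * gen K (w.T a) * w.e K 0 (-(3 / 2)) := fun c => by
    rw [mul_assoc, ← mul_assoc (w.e K _ _), ← (commute_T_e hr a _ _).eq, mul_assoc, e_mul_e hr,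
      ← mul_assoc]
    norm_num
  have h1 : ⁅w.PE K, inlU (gen K (w.A a)) * inrU (w.e K 0 (-(1 / 2)))⁆ =
      inlU (gen K w.Hm - gen K w.Hp) * inrU (gen K (w.T a) * w.e K 0 (-1)) +
      (eps2 a b : K) • (inlU (gen K w.J1) * inrU (gen K (w.T b) * w.e K 0 (-1))) := by
    rw [PE_eq hab, add_lie, lie_inl_mul_inr_of_commute _ _ (commute_τ_e hr _ _ _ _),
      lie_inl_mul_inr_of_commute _ _ (commute_τ_e hr _ _ _ _), lie_B_A h, lie_B_A h, if_pos rfl,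
      if_neg hab, he, he, map_smul, smul_mul_assoc]
  have h2 : ⁅w.PE K, inrU (gen K (w.A a))⁆ =
      -(inlU (gen K (w.B a)) * inrU (gen K w.Tp * w.e K 0 (-(1 / 2)))) -
      (1 : K) • (X * (inlU (gen K (w.B a)) *
        inrU (gen K (w.T a) * gen K (w.T a) * w.e K 0 (-(3 / 2))))) -
      (1 : K) • (X * (inlU (gen K (w.B b)) *
        inrU (gen K (w.T b) * gen K (w.T a) * w.e K 0 (-(3 / 2))))) := by
    rw [PE_eq hab, add_lie, lie_inl_mul_inr_inr, lie_inl_mul_inr_inr, lie_τ_A h, lie_τ_A h,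
      if_pos rfl, if_neg hab, ← inl_mul_inr_X_smul, ← inl_mul_inr_X_smul, one_smul, one_smul,
      sub_zero, map_sub, map_neg, map_neg, mul_sub, mul_neg, mul_neg]
    abel
  have h3 : ⁅w.PE K, inlU (gen K w.Hm) * inrU (gen K (w.T a) * w.e K 0 (-1))⁆ =
      (-(1 / 2) : K) • (inlU (gen K (w.B a)) *
        inrU (gen K (w.T a) * gen K (w.T a) * w.e K 0 (-(3 / 2)))) +
      (-(1 / 2) : K) • (inlU (gen K (w.B b)) *
        inrU (gen K (w.T b) * gen K (w.T a) * w.e K 0 (-(3 / 2)))) := by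
    rw [PE_eq hab, add_lie, lie_inl_mul_inr_of_commute _ _ (commute_τ_τ hr _ _ _ _ _),
      lie_inl_mul_inr_of_commute _ _ (commute_τ_τ hr _ _ _ _ _), hHm, hHm, he', he', map_smul,
      map_smul, smul_mul_assoc, smul_mul_assoc]
  rw [lie_add, lie_add, lie_smul, lie_X_mul, h1, h2, h3, mul_add, mul_smul_comm, mul_smul_comm]
  module

/-- The second bracket of the exponent of `Φ_E` with the conjugate of `A_a` by `Φ_J`. -/
theorem lie_PE_lie_PE_A {a b : Fin 2} (hab : a ≠ b) :
    ⁅w.PE K, inlU (gen K w.Hm - gen K w.Hp) * inrU (gen K (w.T a) * w.e K 0 (-1)) +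
      (eps2 a b : K) • (inlU (gen K w.J1) * inrU (gen K (w.T b) * w.e K 0 (-1))) -
      inlU (gen K (w.B a)) * inrU (gen K w.Tp * w.e K 0 (-(1 / 2))) -
      (2 : K) • (X * (inlU (gen K (w.B a)) *
        inrU (gen K (w.T a) * gen K (w.T a) * w.e K 0 (-(3 / 2))))) -
      (2 : K) • (X * (inlU (gen K (w.B b)) *
        inrU (gen K (w.T b) * gen K (w.T a) * w.e K 0 (-(3 / 2)))))⁆ =
    inlU (gen K (w.B a)) * inrU (gen K (w.T b) * gen K (w.T b) * w.e K 0 (-(3 / 2))) -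
      inlU (gen K (w.B a)) * inrU (gen K (w.T a) * gen K (w.T a) * w.e K 0 (-(3 / 2))) -
      (2 : K) • (inlU (gen K (w.B b)) *
        inrU (gen K (w.T b) * gen K (w.T a) * w.e K 0 (-(3 / 2)))) := by
  have hr := h.toRelations
  have he' : ∀ c d, gen K (w.T c) * w.e K 0 (-(1 / 2)) * (gen K (w.T d) * w.e K 0 (-1)) =
      gen K (w.T c) * gen K (w.T d) * w.e K 0 (-(3 / 2)) := fun c d => by
    rw [mul_assoc, ← mul_assoc (w.e K _ _), ← (commute_T_e hr d _ _).eq, mul_assoc, e_mul_e hr,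
      ← mul_assoc]
    norm_num
  have hBB : ∀ c (y : (U K 𝔞)⟦X⟧), (∀ d, Commute (gen K (w.T d) * w.e K 0 (-(1 / 2))) y) →
      ⁅w.PE K, inlU (gen K (w.B c)) * inrU y⁆ = 0 := fun c y hy => by
    rw [lie_PE_inl_inr _ _ (hy 0) (hy 1), lie_gen, lie_gen, hr.B_B, hr.B_B, gen_zero, map_zero,
      zero_mul, zero_mul, add_zero]
  have hH : ∀ c, ⁅gen K (w.B c), gen K w.Hm - gen K w.Hp⁆ = -gen K (w.B c) := fun c => by
    rw [lie_sub, lie_gen, lie_gen, Relations.swap (hr.Hm_B c), Relations.swap (hr.Hp_B c),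
      ← gen_sub, ← gen_neg]
    congr 1; module
  have h1 : ⁅w.PE K, inlU (gen K w.Hm - gen K w.Hp) * inrU (gen K (w.T a) * w.e K 0 (-1))⁆ =
      -(inlU (gen K (w.B a)) * inrU (gen K (w.T a) * gen K (w.T a) * w.e K 0 (-(3 / 2)))) -
      inlU (gen K (w.B b)) * inrU (gen K (w.T b) * gen K (w.T a) * w.e K 0 (-(3 / 2))) := by
    rw [PE_eq hab, add_lie, lie_inl_mul_inr_of_commute _ _ (commute_τ_τ hr _ _ _ _ _),
      lie_inl_mul_inr_of_commute _ _ (commute_τ_τ hr _ _ _ _ _), hH, hH, he', he', map_neg,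
      map_neg, neg_mul, neg_mul, sub_eq_add_neg]
  have h2 : ⁅w.PE K, (eps2 a b : K) • (inlU (gen K w.J1) *
      inrU (gen K (w.T b) * w.e K 0 (-1)))⁆ =
      inlU (gen K (w.B a)) * inrU (gen K (w.T b) * gen K (w.T b) * w.e K 0 (-(3 / 2))) -
      inlU (gen K (w.B b)) * inrU (gen K (w.T b) * gen K (w.T a) * w.e K 0 (-(3 / 2))) := by
    rw [PE_eq hab, lie_smul, add_lie, lie_inl_mul_inr_of_commute _ _ (commute_τ_τ hr _ _ _ _ _),
      lie_inl_mul_inr_of_commute _ _ (commute_τ_τ hr _ _ _ _ _), lie_gen, lie_gen,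
      h.B_J1 a b hab, h.B_J1 b a hab.symm, he', he', eps2_swap h a b, (commute_T_T hr a b).eq,
      gen_smul, gen_smul, map_smul, map_smul, smul_mul_assoc, smul_mul_assoc, smul_add, smul_smul,
      smul_smul, neg_neg, mul_neg, eps2_mul_self h hab]
    module
  have hTT : ∀ c d e, Commute (gen K (w.T c) * w.e K 0 (-(1 / 2)))
      (gen K (w.T d) * gen K (w.T e) * w.e K 0 (-(3 / 2))) := fun c d e =>
    ((commute_τ_T hr _ _ _).mul_right (commute_τ_T hr _ _ _)).mul_right (commute_τ_e hr _ _ _ _)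
  have hTp : ∀ c, Commute (gen K (w.T c) * w.e K 0 (-(1 / 2)))
      (gen K w.Tp * w.e K 0 (-(1 / 2))) := fun c =>
    (commute_τ hr c _ (commute_T_Tp h c) (commute_gen (by
      rw [Relations.swap hr.Tp_Tm, neg_zero]))).mul_right (commute_τ_e hr _ _ _ _)
  rw [lie_sub, lie_sub, lie_sub, lie_add, h1, h2, lie_smul, lie_smul, lie_X_mul, lie_X_mul,
    hBB a _ hTp, hBB a _ (fun c => hTT c a a), hBB b _ (fun c => hTT c b a)]
  simp only [mul_zero, smul_zero, sub_zero]
  module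

/-- The conjugate of `A_a` by `Φ_E Φ_J`. The terms of order `z²` combine `T_+` with
`z (T_2² + T_3²) e^{-σ_-}` to `T`. -/
theorem ad_E_A {a b : Fin 2} (hab : a ≠ b) : SemiconjBy (w.ΦE K)
    (inlU (gen K (w.A a)) * inrU (w.e K 0 (-(1 / 2))) + inrU (gen K (w.A a)) +
      (2 : K) • (X * (inlU (gen K w.Hm) * inrU (gen K (w.T a) * w.e K 0 (-1)))))
    (inlU (gen K (w.A a)) * inrU (w.e K 0 (-(1 / 2))) + inrU (gen K (w.A a)) +
      (2 : K) • (X * (inlU (gen K w.Hp) * inrU (gen K (w.T a) * w.e K 0 (-1)))) +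
      (2 : K) • (X * (inlU (gen K (w.B a)) * inrU (w.Tz K * w.e K 0 (-(1 / 2))))) -
      (2 * (eps2 a b : K)) • (X * (inlU (gen K w.J1) * inrU (gen K (w.T b) * w.e K 0 (-1))))) := by
  have hr := h.toRelations
  have hBB : ∀ c (y : (U K 𝔞)⟦X⟧), (∀ d, Commute (gen K (w.T d) * w.e K 0 (-(1 / 2))) y) →
      ⁅w.PE K, inlU (gen K (w.B c)) * inrU y⁆ = 0 := fun c y hy => by
    rw [lie_PE_inl_inr _ _ (hy 0) (hy 1), lie_gen, lie_gen, hr.B_B, hr.B_B, gen_zero, map_zero,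
      zero_mul, zero_mul, add_zero]
  have hTT : ∀ c d e, Commute (gen K (w.T c) * w.e K 0 (-(1 / 2)))
      (gen K (w.T d) * gen K (w.T e) * w.e K 0 (-(3 / 2))) := fun c d e =>
    ((commute_τ_T hr _ _ _).mul_right (commute_τ_T hr _ _ _)).mul_right (commute_τ_e hr _ _ _ _)
  refine semiconjBy_of_eq (semiconjBy_ΦE_of_second hr (lie_PE_A h hab) (lie_PE_lie_PE_A h hab)
    ?_) ?_
  · rw [lie_sub, lie_sub, lie_smul, hBB a _ fun c => hTT c b b, hBB a _ fun c => hTT c a a,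
      hBB b _ fun c => hTT c b a]
    simp
  · have e1 : inlU (gen K (w.B a)) * inrU (w.Tz K * w.e K 0 (-(1 / 2))) =
        inlU (gen K (w.B a)) * inrU (gen K w.Tp * w.e K 0 (-(1 / 2))) +
        X * (inlU (gen K (w.B a)) * inrU (gen K (w.T a) * gen K (w.T a) * w.e K 0 (-(3 / 2)))) +
        X * (inlU (gen K (w.B a)) *
          inrU (gen K (w.T b) * gen K (w.T b) * w.e K 0 (-(3 / 2)))) := by
      have hQ : gen K (w.T 0) ^ 2 + gen K (w.T 1) ^ 2 =
          gen K (w.T a) * gen K (w.T a) + gen K (w.T b) * gen K (w.T b) := by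
        rw [sq, sq]
        fin_cases a <;> fin_cases b <;>
          first | exact absurd rfl hab | rfl | exact add_comm _ _
      have hX : ∀ y, inlU (gen K (w.B a)) * (X * inrU y) =
          X * (inlU (gen K (w.B a)) * inrU y) := fun y => by
        rw [← mul_assoc, ← X_mul, mul_assoc]
      rw [Tz_eq hr, hQ, add_mul, mul_assoc X, mul_assoc (_ + _), e_mul_e hr, add_mul, mul_add X,
        map_add, map_add, map_mul inr X, map_mul inr X, inr_X, mul_add, mul_add,
        hX, hX, show (0 : K) + 0 = 0 by norm_num, show (-1 + -(1 / 2) : K) = -(3 / 2) by norm_num,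
        add_assoc]
    rw [e1, map_sub]
    simp only [mul_add, mul_sub, sub_mul, smul_add, smul_sub, mul_smul_comm, smul_smul, sq,
      mul_assoc X X]
    module

theorem ad_A_A {a b : Fin 2} : SemiconjBy (w.ΦA K)
    (inlU (gen K (w.A a)) * inrU (w.e K 0 (-(1 / 2))) + inrU (gen K (w.A a)) +
      (2 : K) • (X * (inlU (gen K w.Hp) * inrU (gen K (w.T a) * w.e K 0 (-1)))) +
      (2 : K) • (X * (inlU (gen K (w.B a)) * inrU (w.Tz K * w.e K 0 (-(1 / 2))))) -
      (2 * (eps2 a b : K)) • (X * (inlU (gen K w.J1) * inrU (gen K (w.T b) * w.e K 0 (-1)))))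
    (inlU (gen K (w.A a)) * inrU (w.e K (1 / 2) (-(1 / 2))) + inrU (gen K (w.A a)) +
      (2 : K) • (X * (inlU (gen K w.Hp) * inrU (gen K (w.T a) * w.e K (-1) (-1)))) +
      (2 : K) • (X * (inlU (gen K (w.B a)) * inrU (w.Tz K * w.e K (-(1 / 2)) (-(1 / 2))))) -
      (2 * (eps2 a b : K)) •
        (X * (inlU (gen K w.J1) * inrU (gen K (w.T b) * w.e K 0 (-1))))) := by
  have hr := h.toRelations
  have hσT : ∀ c α β, Commute (w.σp K) (gen K (w.T c) * w.e K α β) := fun c α β =>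
    (commute_T_all hr c).2.2.symm.mul_right (commute_σp_e hr α β)
  have hA := (semiconjBy_ΦA_inl (lie_gen_smul hr (h.Hp_A a))).mul_right
    (commute_ΦA_inr (commute_σp_e hr 0 (-(1 / 2)))).semiconjBy
  have hB := (semiconjBy_ΦA_inl (lie_gen_smul hr (hr.Hp_B a))).mul_right
    (commute_ΦA_inr ((commute_σp_Tz hr).mul_right (commute_σp_e hr 0 (-(1 / 2))))).semiconjBy
  have hH : Commute (w.ΦA K) (inlU (gen K w.Hp) * inrU (gen K (w.T a) * w.e K 0 (-1))) :=
    (commute_ΦA_inl (Commute.refl _)).mul_right (commute_ΦA_inr (hσT _ _ _))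
  have hJ : Commute (w.ΦA K) (inlU (gen K w.J1) * inrU (gen K (w.T b) * w.e K 0 (-1))) :=
    (commute_ΦA_inl (commute_gen h.Hp_J1)).mul_right (commute_ΦA_inr (hσT _ _ _))
  have hR := semiconjBy_ΦA_inr (lie_σp_A h a)
    ((commute_X_smul 2 (hσT a (-1) (-1))).sub_right (commute_X_smul 2 (hσT a 0 (-1))))
  refine semiconjBy_of_eq ((((hA.add_right hR).add_right
    (semiconjBy_X_smul 2 hH.semiconjBy)).add_right
    (semiconjBy_X_smul 2 hB)).sub_right (semiconjBy_X_smul _ hJ.semiconjBy)) ?_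
  rw [map_sub, mul_sub, inl_mul_inr_X_smul, inl_mul_inr_X_smul, mul_assoc, mul_assoc (inlU _),
    inr_e_mul_e hr, inr_e_mul_mul_e hr _ (commute_Tz_e hr), add_zero, add_zero, zero_add]
  abel

theorem lie_T_J1 {a b : Fin 2} (hab : a ≠ b) :
    ⁅gen K (w.T a), gen K w.J1⁆ = -((eps2 a b : K) • gen K (w.T b)) := by
  rw [lie_gen, h.T_J1 a b hab, gen_smul, neg_smul]

theorem lie_B_J1 {a b : Fin 2} (hab : a ≠ b) :
    ⁅gen K (w.B a), gen K w.J1⁆ = -((eps2 a b : K) • gen K (w.B b)) := by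
  rw [lie_gen, h.B_J1 a b hab, gen_smul, neg_smul]

theorem commute_σm_J1 : Commute (w.σm K) (gen K w.J1) :=
  (commute_flog (by simp) (commute_X_smul _ (commute_gen h.Tm_J1).symm).neg_right).symm

theorem commute_e_J1 (β : K) : Commute (w.e K 0 β) (gen K w.J1) := by
  rw [e_zero_eq]
  exact (commute_fexp (by simp) ((commute_σm_J1 h).symm.smul_right β)).symm

theorem commute_Tz_J1 : Commute (w.Tz K) (gen K w.J1) := by
  have hr := h.toRelations
  have h01 : (0 : Fin 2) ≠ 1 := by decide
  rw [Tz_eq hr]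
  refine (commute_gen h.Tp_J1).add_left ((commute_X _).symm.mul_left (Commute.mul_left ?_
    (commute_e_J1 h _)))
  rw [commute_iff_lie, add_lie, sq, sq, mul_lie_mul, mul_lie_mul, lie_T_J1 h h01,
    lie_T_J1 h h01.symm, eps2_swap h 0 1]
  simp only [mul_neg, neg_mul, neg_smul, neg_neg, mul_smul_comm, smul_mul_assoc,
    (commute_T_T hr 0 1).eq]
  abel

theorem commute_σp_J1 : Commute (w.σp K) (gen K w.J1) :=
  (commute_flog (by simp) (commute_X_smul _ (commute_Tz_J1 h).symm).neg_right).symm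

theorem ad_J_J1 : SemiconjBy (w.ΦJ K) (inlU (gen K w.J1) + inrU (gen K w.J1))
    (inlU (gen K w.J1) + inrU (gen K w.J1)) :=
  (commute_ΦJ_inl (commute_gen h.Hm_J1)).add_right (commute_ΦJ_inr (commute_σm_J1 h))

theorem ad_E_J1 : SemiconjBy (w.ΦE K) (inlU (gen K w.J1) + inrU (gen K w.J1))
    (inlU (gen K w.J1) + inrU (gen K w.J1)) := by
  have h01 : (0 : Fin 2) ≠ 1 := by decide
  refine commute_ΦE h.toRelations ?_
  rw [lie_add, lie_PE_inl, lie_PE_inr, mul_lie_mul, mul_lie_mul,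
    commute_iff_lie.mp (commute_e_J1 h _), lie_B_J1 h h01, lie_B_J1 h h01.symm, lie_T_J1 h h01,
    lie_T_J1 h h01.symm, eps2_swap h 0 1]
  simp only [mul_zero, zero_add, neg_smul, neg_neg, neg_mul, mul_neg, map_neg, map_smul,
    smul_mul_assoc, mul_smul_comm]
  abel

theorem ad_A_J1 : SemiconjBy (w.ΦA K) (inlU (gen K w.J1) + inrU (gen K w.J1))
    (inlU (gen K w.J1) + inrU (gen K w.J1)) :=
  (commute_ΦA_inl (commute_gen h.Hp_J1)).add_right (commute_ΦA_inr (commute_σp_J1 h))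

theorem sum_eps2 {M : Type*} [AddCommGroup M] [Module K M] {a b : Fin 2} (hab : a ≠ b)
    (f : Fin 2 → M) : ∑ c, ((2 : K) * (eps2 a c : K)) • f c = ((2 : K) * (eps2 a b : K)) • f b := by
  fin_cases a <;> fin_cases b <;> simp_all [eps2]

theorem coproducts : w.Coproducts K where
  J1_J := by
    simp only [ftmul_eq, map_one, one_mul, mul_one]
    exact twistComul_ι isUnit_ΦJ (ad_J_J1 h)
  J1_E := by
    simp only [ftmul_eq, map_one, one_mul, mul_one]
    exact twistComul_ι (isUnit_ΦEJ h.toRelations) ((ad_E_J1 h).mul_left (ad_J_J1 h))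
  J1_F := by
    simp only [ftmul_eq, map_one, one_mul, mul_one]
    exact twistComul_ι (isUnit_F h.toRelations)
      (semiconjBy_F h.toRelations (ad_J_J1 h) (ad_E_J1 h) (ad_A_J1 h))
  A_J a := by
    simp only [ftmul_eq, map_one, one_mul]
    exact twistComul_ι isUnit_ΦJ (ad_J_A h a)
  A_E a := by
    obtain ⟨b, hab⟩ := exists_ne a
    rw [sum_eps2 h hab.symm]
    simp only [ftmul_eq, map_one, one_mul]
    exact twistComul_ι (isUnit_ΦEJ h.toRelations) ((ad_E_A h hab.symm).mul_left (ad_J_A h a))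
  A_F a := by
    obtain ⟨b, hab⟩ := exists_ne a
    rw [sum_eps2 h hab.symm]
    simp only [ftmul_eq, map_one, one_mul]
    exact twistComul_ι (isUnit_F h.toRelations)
      (semiconjBy_F h.toRelations (ad_J_A h a) (ad_E_A h hab.symm) (ad_A_A h))

end

end WeylGens

/-! ### Primitive elements and injectivity

The filtration of `U(𝔞)` by degree and the operator `m ∘ Δ`, which acts on the associated graded
space by `2ⁿ` in degree `n`, replace the Poincaré--Birkhoff--Witt theorem. -/

section Primitive

variable {K : Type*} [Field K] {𝔞 : Type*} [LieRing 𝔞] [LieAlgebra K 𝔞]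
  {𝔟 : Type*} [LieRing 𝔟] [LieAlgebra K 𝔟]

open UniversalEnvelopingAlgebra (ι)

theorem lie_mem_pow {A : Type*} [Ring A] [Algebra K A] {M : Submodule K A} {x : A}
    (hM : ∀ m ∈ M, m * x - x * m ∈ M) (n : ℕ) : ∀ m ∈ M ^ n, m * x - x * m ∈ M ^ n := by
  induction n with
  | zero =>
    intro m hm
    obtain ⟨c, rfl⟩ := Submodule.mem_one.mp (by simpa using hm)
    rw [Algebra.commutes, sub_self]
    exact zero_mem _
  | succ n ih =>
    intro m hm
    rw [Submodule.pow_succ] at hm ⊢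
    refine Submodule.mul_induction_on hm (fun a ha b hb => ?_) (fun a b ha hb => ?_)
    · have : a * b * x - x * (a * b) = a * (b * x - x * b) + (a * x - x * a) * b := by noncomm_ring
      rw [this]
      exact add_mem (Submodule.mul_mem_mul ha (hM b hb)) (Submodule.mul_mem_mul (ih a ha) hb)
    · have : (a + b) * x - x * (a + b) = (a * x - x * a) + (b * x - x * b) := by noncomm_ring
      rw [this]
      exact add_mem ha hb

variable (K 𝔞) in
/-- The elements of degree at most one of `U(𝔞)`; its powers are the degree filtration. -/
def degOne : Submodule K (U K 𝔞) := 1 ⊔ LinearMap.range (ι K : 𝔞 →ₗ⁅K⁆ U K 𝔞).toLinearMap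

local notation "V" => degOne K 𝔞

theorem mem_degOne {v : U K 𝔞} : v ∈ V ↔ ∃ (c : K) (x : 𝔞), v = algebraMap K _ c + ι K x := by
  constructor
  · intro hv
    obtain ⟨a, ha, b, ⟨x, rfl⟩, rfl⟩ := Submodule.mem_sup.mp hv
    obtain ⟨c, rfl⟩ := Submodule.mem_one.mp ha
    exact ⟨c, x, rfl⟩
  · rintro ⟨c, x, rfl⟩
    exact add_mem (Submodule.mem_sup_left (Submodule.mem_one.mpr ⟨c, rfl⟩))
      (Submodule.mem_sup_right ⟨x, rfl⟩)

theorem one_le_degOne : (1 : Submodule K (U K 𝔞)) ≤ V := le_sup_left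

theorem ι_mem_degOne (x : 𝔞) : ι K x ∈ V := Submodule.mem_sup_right ⟨x, rfl⟩

theorem degOne_pow_mono {m n : ℕ} (h : m ≤ n) : V ^ m ≤ V ^ n := pow_le_pow_right₀ one_le_degOne h

theorem exists_mem_degOne_pow (u : U K 𝔞) : ∃ n, u ∈ V ^ n := by
  have hu : u ∈ Algebra.adjoin K (Set.range (ι K : 𝔞 → U K 𝔞)) := by
    rw [adjoin_range_ι]; trivial
  induction hu using Algebra.adjoin_induction with
  | mem a ha => obtain ⟨x, rfl⟩ := ha; exact ⟨1, by rw [pow_one]; exact ι_mem_degOne x⟩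
  | algebraMap c => exact ⟨0, by rw [pow_zero]; exact Submodule.mem_one.mpr ⟨c, rfl⟩⟩
  | add a b _ _ ha hb =>
    obtain ⟨m, hm⟩ := ha
    obtain ⟨n, hn⟩ := hb
    exact ⟨max m n, add_mem (degOne_pow_mono (le_max_left m n) hm)
      (degOne_pow_mono (le_max_right m n) hn)⟩
  | mul a b _ _ ha hb =>
    obtain ⟨m, hm⟩ := ha
    obtain ⟨n, hn⟩ := hb
    exact ⟨m + n, by rw [pow_add]; exact Submodule.mul_mem_mul hm hn⟩

theorem lie_mem_degOne {v : U K 𝔞} (hv : v ∈ V) : ∀ m ∈ V, m * v - v * m ∈ V := by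
  intro m hm
  obtain ⟨c, x, rfl⟩ := mem_degOne.mp hv
  obtain ⟨d, y, rfl⟩ := mem_degOne.mp hm
  refine mem_degOne.mpr ⟨0, ⁅y, x⁆, ?_⟩
  rw [LieHom.map_lie, LieRing.of_associative_ring_bracket, map_zero, zero_add]
  have h1 := Algebra.commutes c (ι K y : U K 𝔞)
  have h2 := Algebra.commutes d (ι K x : U K 𝔞)
  have h3 := Algebra.commutes d (algebraMap K (U K 𝔞) c)
  rw [mul_add, add_mul, add_mul, mul_add, add_mul, add_mul, h1, h2, h3]
  abel

/-- Tensors whose legs have degree at most `n`. -/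
def tensorFil (K : Type*) [Field K] (𝔞 : Type*) [LieRing 𝔞] [LieAlgebra K 𝔞] (n : ℕ) :
    Submodule K (U K 𝔞 ⊗[K] U K 𝔞) :=
  Submodule.map₂ (TensorProduct.mk K _ _) (degOne K 𝔞 ^ n) (degOne K 𝔞 ^ n)

theorem tmul_mem_tensorFil {n : ℕ} {a b : U K 𝔞} (ha : a ∈ V ^ n) (hb : b ∈ V ^ n) :
    a ⊗ₜ b ∈ tensorFil K 𝔞 n := Submodule.apply_mem_map₂ _ ha hb

theorem tensorFil_mul_left {n : ℕ} {t : U K 𝔞 ⊗[K] U K 𝔞} (ht : t ∈ tensorFil K 𝔞 n) (x : 𝔞) :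
    t * (ι K x ⊗ₜ 1) ∈ tensorFil K 𝔞 (n + 1) := by
  have : tensorFil K 𝔞 n ≤ (tensorFil K 𝔞 (n + 1)).comap (LinearMap.mulRight K (ι K x ⊗ₜ 1)) :=
    Submodule.map₂_le.mpr fun a ha b hb => by
      simp only [Submodule.mem_comap, LinearMap.mulRight_apply, TensorProduct.mk_apply,
        Algebra.TensorProduct.tmul_mul_tmul, mul_one]
      exact tmul_mem_tensorFil (Submodule.mul_mem_mul ha (ι_mem_degOne x))
        (degOne_pow_mono n.le_succ hb)
  exact this ht

theorem tensorFil_mul_right {n : ℕ} {t : U K 𝔞 ⊗[K] U K 𝔞} (ht : t ∈ tensorFil K 𝔞 n) (x : 𝔞) :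
    t * (1 ⊗ₜ ι K x) ∈ tensorFil K 𝔞 (n + 1) := by
  have : tensorFil K 𝔞 n ≤ (tensorFil K 𝔞 (n + 1)).comap (LinearMap.mulRight K (1 ⊗ₜ ι K x)) :=
    Submodule.map₂_le.mpr fun a ha b hb => by
      simp only [Submodule.mem_comap, LinearMap.mulRight_apply, TensorProduct.mk_apply,
        Algebra.TensorProduct.tmul_mul_tmul, mul_one]
      exact tmul_mem_tensorFil (degOne_pow_mono n.le_succ ha)
        (Submodule.mul_mem_mul hb (ι_mem_degOne x))
  exact this ht

theorem tensorFil_mono {m n : ℕ} (h : m ≤ n) : tensorFil K 𝔞 m ≤ tensorFil K 𝔞 n :=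
  Submodule.map₂_le_map₂ (degOne_pow_mono h) (degOne_pow_mono h)

variable (K 𝔞) in
/-- The reduced coproduct `u ↦ Δ u - u ⊗ 1 - 1 ⊗ u`. -/
def redComul : U K 𝔞 →ₗ[K] U K 𝔞 ⊗[K] U K 𝔞 :=
  (uComul K 𝔞).toLinearMap -
    (Algebra.TensorProduct.includeLeft : U K 𝔞 →ₐ[K] U K 𝔞 ⊗[K] U K 𝔞).toLinearMap -
    (Algebra.TensorProduct.includeRight : U K 𝔞 →ₐ[K] U K 𝔞 ⊗[K] U K 𝔞).toLinearMap

theorem redComul_apply (u : U K 𝔞) : redComul K 𝔞 u = uComul K 𝔞 u - u ⊗ₜ 1 - 1 ⊗ₜ u := rfl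

/-- The reduced coproduct lowers the degree of each leg. -/
theorem redComul_mem (n : ℕ) : ∀ u ∈ V ^ (n + 1), redComul K 𝔞 u ∈ tensorFil K 𝔞 n := by
  induction n with
  | zero =>
    intro u hu
    rw [zero_add, pow_one] at hu
    obtain ⟨c, x, rfl⟩ := mem_degOne.mp hu
    have : redComul K 𝔞 (algebraMap K _ c + ι K x) = -(algebraMap K (U K 𝔞) c ⊗ₜ 1) := by
      rw [redComul_apply, map_add, uComul_ι, AlgHom.commutes, TensorProduct.add_tmul,
        TensorProduct.tmul_add, Algebra.TensorProduct.algebraMap_apply,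
        ← Algebra.TensorProduct.algebraMap_apply, Algebra.TensorProduct.algebraMap_apply']
      abel
    rw [this]
    exact neg_mem (tmul_mem_tensorFil (by rw [pow_zero]; exact Submodule.mem_one.mpr ⟨c, rfl⟩)
      (by rw [pow_zero]; exact Submodule.one_le.mp le_rfl))
  | succ n ih =>
    intro u hu
    rw [Submodule.pow_succ] at hu
    refine Submodule.mul_induction_on hu (fun a ha v hv => ?_) (fun a b ha hb => ?_)
    · obtain ⟨c, x, rfl⟩ := mem_degOne.mp hv
      have ht := ih a ha
      have key : redComul K 𝔞 (a * (algebraMap K _ c + ι K x)) = c • redComul K 𝔞 a +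
          (redComul K 𝔞 a * (ι K x ⊗ₜ 1) + redComul K 𝔞 a * (1 ⊗ₜ ι K x) + a ⊗ₜ ι K x +
            ι K x ⊗ₜ a) := by
        rw [mul_add, map_add, ← Algebra.commutes c a, ← Algebra.smul_def, map_smul]
        congr 1
        simp only [redComul_apply, map_mul, uComul_ι, sub_mul, mul_add,
          Algebra.TensorProduct.tmul_mul_tmul, one_mul, mul_one]
        abel
      rw [key]
      have hx : ι K x ∈ V ^ (n + 1) := degOne_pow_mono (Nat.le_add_left 1 n)
        (by rw [pow_one]; exact ι_mem_degOne x)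
      exact add_mem (Submodule.smul_mem _ _ (tensorFil_mono n.le_succ ht))
        (add_mem (add_mem (add_mem (tensorFil_mul_left ht x) (tensorFil_mul_right ht x))
          (tmul_mem_tensorFil ha hx)) (tmul_mem_tensorFil hx ha))
    · rw [map_add]; exact add_mem ha hb

/-- The operator `m ∘ Δ`, where `m` is the multiplication, an analogue of an Adams operation. -/
def adams (K : Type*) [Field K] (𝔞 : Type*) [LieRing 𝔞] [LieAlgebra K 𝔞] : U K 𝔞 →ₗ[K] U K 𝔞 :=
  LinearMap.mul' K (U K 𝔞) ∘ₗ (uComul K 𝔞).toLinearMap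

theorem adams_apply (u : U K 𝔞) : adams K 𝔞 u = LinearMap.mul' K _ (uComul K 𝔞 u) := rfl

/-- Tensors of total degree at most one; the powers give the filtration by total degree. -/
def degOne₂ (K : Type*) [Field K] (𝔞 : Type*) [LieRing 𝔞] [LieAlgebra K 𝔞] :
    Submodule K (U K 𝔞 ⊗[K] U K 𝔞) :=
  (degOne K 𝔞).map (Algebra.TensorProduct.includeLeft : U K 𝔞 →ₐ[K] U K 𝔞 ⊗[K] U K 𝔞).toLinearMap ⊔
  (degOne K 𝔞).map (Algebra.TensorProduct.includeRight : U K 𝔞 →ₐ[K] U K 𝔞 ⊗[K] U K 𝔞).toLinearMap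

local notation "V₂" => degOne₂ K 𝔞

theorem uComul_mem {n : ℕ} {u : U K 𝔞} (hu : u ∈ V ^ n) : uComul K 𝔞 u ∈ V₂ ^ n := by
  have h1 : (degOne K 𝔞).map (uComul K 𝔞).toLinearMap ≤ V₂ := by
    rintro _ ⟨v, hv, rfl⟩
    obtain ⟨c, x, rfl⟩ := mem_degOne.mp hv
    refine Submodule.mem_sup.mpr ⟨_, ⟨_, hv, rfl⟩, _, ⟨_, ι_mem_degOne x, rfl⟩, ?_⟩
    simp only [AlgHom.toLinearMap_apply, map_add, uComul_ι, AlgHom.commutes,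
      Algebra.TensorProduct.includeLeft_apply, Algebra.TensorProduct.includeRight_apply, add_assoc,
      Algebra.TensorProduct.algebraMap_apply]
  have h2 : uComul K 𝔞 u ∈ (V ^ n).map (uComul K 𝔞).toLinearMap := ⟨u, hu, rfl⟩
  rw [Submodule.map_pow] at h2
  exact pow_le_pow_left' h1 n h2

theorem lie_mem_degOne₂_pow {v : U K 𝔞} (hv : v ∈ V) {n : ℕ} {t : U K 𝔞 ⊗[K] U K 𝔞}
    (ht : t ∈ V₂ ^ n) : t * (v ⊗ₜ 1) - (v ⊗ₜ 1) * t ∈ V₂ ^ n := by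
  refine lie_mem_pow (fun m hm => ?_) n t ht
  obtain ⟨_, ⟨a, ha, rfl⟩, _, ⟨b, hb, rfl⟩, rfl⟩ := Submodule.mem_sup.mp hm
  refine Submodule.mem_sup_left ⟨a * v - v * a, lie_mem_degOne hv a ha, ?_⟩
  simp [add_mul, mul_add, TensorProduct.sub_tmul]

theorem mul'_mul_right (t : U K 𝔞 ⊗[K] U K 𝔞) (v : U K 𝔞) :
    LinearMap.mul' K _ (t * (1 ⊗ₜ v)) = LinearMap.mul' K _ t * v := by
  induction t with
  | zero => simp
  | tmul a b => simp [mul_assoc]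
  | add s t hs ht => rw [add_mul, map_add, map_add, hs, ht, add_mul]

theorem mul'_mul_left (t : U K 𝔞 ⊗[K] U K 𝔞) (v : U K 𝔞) :
    LinearMap.mul' K _ ((v ⊗ₜ 1) * t) = v * LinearMap.mul' K _ t := by
  induction t with
  | zero => simp
  | tmul a b => simp [mul_assoc]
  | add s t hs ht => rw [mul_add, map_add, map_add, hs, ht, mul_add]

theorem mul'_mem {n : ℕ} : ∀ t ∈ V₂ ^ n, LinearMap.mul' K (U K 𝔞) t ∈ V ^ n := by
  induction n with
  | zero =>
    intro t ht
    obtain ⟨c, rfl⟩ := Submodule.mem_one.mp (by rwa [pow_zero] at ht)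
    rw [pow_zero]
    exact Submodule.mem_one.mpr ⟨c, by simp [Algebra.TensorProduct.algebraMap_apply]⟩
  | succ n ih =>
    intro t ht
    rw [Submodule.pow_succ] at ht
    refine Submodule.mul_induction_on ht (fun s hs v hv => ?_) (fun a b ha hb => ?_)
    · obtain ⟨_, ⟨a, ha, rfl⟩, _, ⟨b, hb, rfl⟩, rfl⟩ := Submodule.mem_sup.mp hv
      have : s * (a ⊗ₜ[K] 1 + 1 ⊗ₜ[K] b) = (a ⊗ₜ[K] 1) * s + (s * (a ⊗ₜ[K] 1) - (a ⊗ₜ[K] 1) * s) +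
          s * (1 ⊗ₜ[K] b) := by noncomm_ring
      simp only [AlgHom.toLinearMap_apply, Algebra.TensorProduct.includeLeft_apply,
        Algebra.TensorProduct.includeRight_apply]
      rw [this, map_add, map_add, mul'_mul_left, mul'_mul_right]
      refine add_mem (add_mem ?_ (degOne_pow_mono n.le_succ (ih _ (lie_mem_degOne₂_pow ha hs)))) ?_
      · rw [pow_succ']; exact Submodule.mul_mem_mul ha (ih s hs)
      · rw [pow_succ]; exact Submodule.mul_mem_mul (ih s hs) hb
    · rw [map_add]; exact add_mem ha hb

/-- In degree `n`, the operator `m ∘ Δ` is multiplication by `2ⁿ` up to terms of lower degree. -/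
theorem adams_sub_mem (n : ℕ) :
    ∀ u ∈ V ^ (n + 1), adams K 𝔞 u - (2 : K) ^ (n + 1) • u ∈ V ^ n := by
  induction n with
  | zero =>
    intro u hu
    rw [zero_add, pow_one] at hu
    obtain ⟨c, x, rfl⟩ := mem_degOne.mp hu
    have : adams K 𝔞 (algebraMap K _ c + ι K x) - (2 : K) ^ (0 + 1) • (algebraMap K _ c + ι K x) =
        -algebraMap K _ c := by
      simp only [adams_apply, map_add, uComul_ι, AlgHom.commutes,
        Algebra.TensorProduct.algebraMap_apply, LinearMap.mul'_apply, mul_one, one_mul]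
      module
    rw [this, pow_zero]
    exact neg_mem (Submodule.mem_one.mpr ⟨c, rfl⟩)
  | succ n ih =>
    intro u hu
    rw [Submodule.pow_succ] at hu
    refine Submodule.mul_induction_on hu (fun a ha v hv => ?_) (fun a b ha hb => ?_)
    · obtain ⟨c, x, rfl⟩ := mem_degOne.mp hv
      have hr := ih a ha
      have hA : adams K 𝔞 a ∈ V ^ (n + 1) := mul'_mem _ (uComul_mem ha)
      set r := adams K 𝔞 a - (2 : K) ^ (n + 1) • a with hr'
      have hs := mul'_mem _ (lie_mem_degOne₂_pow (ι_mem_degOne x) (uComul_mem ha))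
      set s := LinearMap.mul' K _ (uComul K 𝔞 a * (ι K x ⊗ₜ 1) - (ι K x ⊗ₜ 1) * uComul K 𝔞 a)
        with hs'
      have key : adams K 𝔞 (a * (algebraMap K _ c + ι K x)) -
          (2 : K) ^ (n + 1 + 1) • (a * (algebraMap K _ c + ι K x)) =
          c • adams K 𝔞 a - ((2 : K) ^ (n + 1 + 1) * c) • a + ι K x * r + r * ι K x -
            (2 : K) ^ (n + 1) • (a * ι K x - ι K x * a) + s := by
        have e1 : adams K 𝔞 (a * ι K x) = ι K x * adams K 𝔞 a + s + adams K 𝔞 a * ι K x := by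
          rw [adams_apply, map_mul, uComul_ι, hs', mul_add, map_add, map_sub, mul'_mul_left,
            mul'_mul_right, ← adams_apply]
          abel
        rw [mul_add, map_add, e1, ← Algebra.commutes c a, ← Algebra.smul_def, map_smul, hr',
          mul_sub,
          sub_mul, mul_smul_comm, smul_mul_assoc, pow_succ (2 : K) (n + 1)]
        module
      rw [key]
      have hx := lie_mem_pow (lie_mem_degOne (ι_mem_degOne x)) (n + 1) a ha
      refine add_mem (sub_mem (add_mem (add_mem (sub_mem (Submodule.smul_mem _ _ hA)
        (Submodule.smul_mem _ _ ha)) ?_) ?_) (Submodule.smul_mem _ _ hx)) hs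
      · rw [pow_succ']; exact Submodule.mul_mem_mul (ι_mem_degOne x) hr
      · rw [pow_succ]; exact Submodule.mul_mem_mul hr (ι_mem_degOne x)
    · have : adams K 𝔞 (a + b) - (2 : K) ^ (n + 1 + 1) • (a + b) =
          (adams K 𝔞 a - (2 : K) ^ (n + 1 + 1) • a) +
            (adams K 𝔞 b - (2 : K) ^ (n + 1 + 1) • b) := by
        rw [map_add]; module
      rw [this]
      exact add_mem ha hb

/-- The primitive elements of `U(𝔞)` are the images of the elements of `𝔞`. On a primitive element
`m ∘ Δ` is multiplication by `2`, which excludes degrees above one. -/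
theorem exists_eq_ι_of_primitive [CharZero K] {u : U K 𝔞} (hu : redComul K 𝔞 u = 0) :
    ∃ x : 𝔞, u = ι K x := by
  have hΔ : uComul K 𝔞 u = u ⊗ₜ 1 + 1 ⊗ₜ u := by
    rw [redComul_apply, sub_sub, sub_eq_zero] at hu; exact hu
  have hψ : adams K 𝔞 u = (2 : K) • u := by
    rw [adams_apply, hΔ, map_add, LinearMap.mul'_apply, LinearMap.mul'_apply, one_mul, mul_one,
      two_smul]
  have hdeg : ∀ n, u ∈ V ^ (n + 1) → u ∈ V := by
    intro n
    induction n with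
    | zero => intro h; rwa [zero_add, pow_one] at h
    | succ n ih =>
      intro h
      have h1 := adams_sub_mem (n + 1) u h
      rw [hψ, ← sub_smul] at h1
      -- `(2 - 2ⁿ⁺²) u` has degree at most `n + 1`, and the scalar is invertible
      have hne : (2 : K) - 2 ^ (n + 1 + 1) ≠ 0 := by
        rw [sub_ne_zero]
        intro e
        have : (2 : ℕ) = 2 ^ (n + 1 + 1) := by exact_mod_cast e
        have h2 : 2 ^ 2 ≤ 2 ^ (n + 1 + 1) := Nat.pow_le_pow_right two_pos (by omega)
        omega
      exact ih (by simpa [smul_smul, hne] using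
        Submodule.smul_mem _ ((2 : K) - 2 ^ (n + 1 + 1))⁻¹ h1)
  obtain ⟨n, hn⟩ := exists_mem_degOne_pow u
  obtain ⟨c, x, rfl⟩ := mem_degOne.mp (hdeg n (degOne_pow_mono n.le_succ hn))
  -- the constant term of a primitive element vanishes, because `(ε ⊗ ε) ∘ Δ = ε`
  have hε : ∀ a, Algebra.TensorProduct.lift (uCounit K 𝔞) (uCounit K 𝔞) (fun _ _ => Commute.all _ _)
      (uComul K 𝔞 a) = uCounit K 𝔞 a :=
    uHom_ext (f := (Algebra.TensorProduct.lift (uCounit K 𝔞) (uCounit K 𝔞)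
      (fun _ _ => Commute.all _ _)).comp (uComul K 𝔞)) (g := uCounit K 𝔞) fun y => by
        rw [AlgHom.comp_apply, uComul_ι, map_add, Algebra.TensorProduct.lift_tmul,
          Algebra.TensorProduct.lift_tmul, uCounit_ι]
        simp
  have := hε (algebraMap K _ c + ι K x)
  rw [hΔ, map_add, Algebra.TensorProduct.lift_tmul, Algebra.TensorProduct.lift_tmul, map_one,
    mul_one, one_mul, map_add, uCounit_ι, AlgHom.commutes] at this
  have hc : c = 0 := by simpa using this
  exact ⟨x, by rw [hc, map_zero, zero_add]⟩

theorem map_uComul (f : 𝔞 →ₗ⁅K⁆ 𝔟) (u : U K 𝔞) :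
    uComul K 𝔟 (uMap K f u) =
      Algebra.TensorProduct.map (uMap K f) (uMap K f) (uComul K 𝔞 u) :=
  uHom_ext (f := (uComul K 𝔟).comp (uMap K f))
    (g := (Algebra.TensorProduct.map (uMap K f) (uMap K f)).comp (uComul K 𝔞)) (fun x => by
      rw [AlgHom.comp_apply, AlgHom.comp_apply, uMap_ι, uComul_ι, uComul_ι, map_add,
        Algebra.TensorProduct.map_tmul, Algebra.TensorProduct.map_tmul, uMap_ι, map_one]) u

theorem map_redComul (f : 𝔞 →ₗ⁅K⁆ 𝔟) (u : U K 𝔞) :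
    redComul K 𝔟 (uMap K f u) =
      Algebra.TensorProduct.map (uMap K f) (uMap K f) (redComul K 𝔞 u) := by
  rw [redComul_apply, redComul_apply, map_uComul, map_sub, map_sub, Algebra.TensorProduct.map_tmul,
    Algebra.TensorProduct.map_tmul, map_one]

theorem tensorMap_injective {M M' N N' : Type*} [AddCommGroup M] [Module K M] [AddCommGroup M']
    [Module K M'] [AddCommGroup N] [Module K N] [AddCommGroup N'] [Module K N']
    {f : M →ₗ[K] M'} {g : N →ₗ[K] N'} (hf : Function.Injective f) (hg : Function.Injective g) :
    Function.Injective (TensorProduct.map f g) := by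
  obtain ⟨f', hf'⟩ := f.exists_leftInverse_of_injective (LinearMap.ker_eq_bot.mpr hf)
  obtain ⟨g', hg'⟩ := g.exists_leftInverse_of_injective (LinearMap.ker_eq_bot.mpr hg)
  refine Function.LeftInverse.injective (g := TensorProduct.map f' g') fun t => ?_
  rw [← LinearMap.comp_apply, ← TensorProduct.map_comp, hf', hg', TensorProduct.map_id,
    LinearMap.id_apply]

/-- A Lie algebra map `f : 𝔞 → 𝔟` induces an injective map of enveloping algebras as soon as the
composite `𝔞 → 𝔟 → U(𝔟)` is injective. By induction on the degree, an element of the kernel is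
primitive, since the map is injective on the tensors of smaller degree that contain its reduced
coproduct. -/
theorem uMap_injective [CharZero K] (f : 𝔞 →ₗ⁅K⁆ 𝔟)
    (hf : Function.Injective fun x => (ι K (f x) : U K 𝔟)) : Function.Injective (uMap K f) := by
  have hι : ∀ x : 𝔞, uMap K f (ι K x) = 0 → ι K x = 0 := fun x hx => by
    rw [uMap_ι] at hx
    have : x = 0 := hf (by change ι K (f x) = ι K (f 0); rw [hx, map_zero, map_zero])
    rw [this, map_zero]
  have step : ∀ n, ∀ u ∈ V ^ n, uMap K f u = 0 → u = 0 := by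
    intro n
    induction n with
    | zero =>
      intro u hu h0
      obtain ⟨c, rfl⟩ := Submodule.mem_one.mp (by simpa using hu)
      have : uCounit K 𝔟 (uMap K f (algebraMap K _ c)) = 0 := by rw [h0, map_zero]
      rw [AlgHom.commutes, AlgHom.commutes] at this
      have hc : c = 0 := by simpa using this
      rw [hc, map_zero]
    | succ n ih =>
      intro u hu h0
      have h1 := redComul_mem n u hu
      have h2 := map_redComul f u
      rw [h0, map_zero] at h2
      have h3 : redComul K 𝔞 u = 0 := by
        rw [tensorFil, ← TensorProduct.range_mapIncl] at h1
        obtain ⟨t, ht⟩ := h1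
        have hinj : Function.Injective ((uMap K f).toLinearMap ∘ₗ (V ^ n).subtype) := by
          rw [← LinearMap.ker_eq_bot, LinearMap.ker_eq_bot']
          intro v hv
          exact Subtype.ext (ih v v.2 hv)
        have : TensorProduct.map ((uMap K f).toLinearMap ∘ₗ (V ^ n).subtype)
            ((uMap K f).toLinearMap ∘ₗ (V ^ n).subtype) t = 0 := by
          rw [TensorProduct.map_comp, LinearMap.comp_apply]
          change Algebra.TensorProduct.map (uMap K f) (uMap K f) (TensorProduct.mapIncl _ _ t) = 0
          rw [ht, ← h2]
        rw [← ht, (tensorMap_injective hinj hinj) (this.trans (map_zero _).symm), map_zero]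
      obtain ⟨x, rfl⟩ := exists_eq_ι_of_primitive h3
      exact hι x h0
  rw [injective_iff_map_eq_zero]
  intro u h0
  obtain ⟨n, hn⟩ := exists_mem_degOne_pow u
  exact step n u hn h0

/-- An element of `𝔟` that lies in the image of `U(𝔞)` lies in the image of `𝔞`. -/
theorem exists_of_ι_mem_range [CharZero K] {f : 𝔞 →ₗ⁅K⁆ 𝔟} (hf : Function.Injective (uMap K f))
    (hι : Function.Injective (ι K : 𝔟 → U K 𝔟)) {y : 𝔟} (hy : ι K y ∈ (uMap K f).range) :
    ∃ x, f x = y := by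
  obtain ⟨u, hu⟩ := hy
  have hu : uMap K f u = ι K y := hu
  have h1 := map_redComul f u
  rw [hu, redComul_apply, uComul_ι, sub_sub, sub_self] at h1
  have hinj : Function.Injective (uMap K f).toLinearMap := hf
  have h2 : redComul K 𝔞 u = 0 := tensorMap_injective hinj hinj (h1.symm.trans (map_zero _).symm)
  obtain ⟨x, rfl⟩ := exists_eq_ι_of_primitive h2
  exact ⟨x, hι (by rw [← uMap_ι, hu])⟩

end Primitive

/-! ### Naturality in the Lie algebra -/

namespace CarrierGens

section Naturality

variable {K : Type*} [Field K] {𝔞 : Type*} [LieRing 𝔞] [LieAlgebra K 𝔞]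
  {𝔟 : Type*} [LieRing 𝔟] [LieAlgebra K 𝔟]

open PowerSeries

/-- The images of the eight generators under a Lie algebra map. -/
def map (f : 𝔞 →ₗ⁅K⁆ 𝔟) (o : CarrierGens 𝔞) : CarrierGens 𝔟 where
  Hp := f o.Hp
  Hm := f o.Hm
  Tp := f o.Tp
  Tm := f o.Tm
  T := fun a => f (o.T a)
  B := fun a => f (o.B a)

variable (f : 𝔞 →ₗ⁅K⁆ 𝔟) (o : CarrierGens 𝔞)

/-- The map induced by `f` on `U(𝔞)⟦z⟧`. -/
local notation "φ" => mapAlgHom (uMap K f)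

/-- The map induced by `f` on `(U(𝔞) ⊗ U(𝔞))⟦z⟧`. -/
local notation "φ₂" => mapAlgHom (Algebra.TensorProduct.map (uMap K f) (uMap K f))

theorem map_gen (x : 𝔞) : φ (gen K x) = gen K (f x) := by
  rw [gen, mapAlgHom_C, uMap_ι]; rfl

theorem map_ftmul (a b : (U K 𝔞)⟦X⟧) : φ₂ (a ⊠[K] b) = φ a ⊠[K] φ b := by
  rw [ftmul, ftmul, map_mul, mapAlgHom_mapAlgHom, mapAlgHom_mapAlgHom, mapAlgHom_mapAlgHom,
    mapAlgHom_mapAlgHom, Algebra.TensorProduct.map_comp_includeLeft,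
    Algebra.TensorProduct.map_comp_includeRight]

theorem map_σm : φ (o.σm K) = (o.map f).σm K := by
  rw [σm, map_flog _ (mapAlgHom_X _) (by simp), map_neg, map_smul, map_mul, mapAlgHom_X, map_gen]
  rfl

theorem map_fexp_smul_σm (c : K) : φ (fexp K (c • o.σm K)) = fexp K (c • (o.map f).σm K) := by
  rw [map_fexp _ (mapAlgHom_X _) (by simp [σm, constantCoeff_flog]), map_smul, map_σm]

theorem map_Tz : φ (o.Tz K) = (o.map f).Tz K := by
  have h1 : fexp K (-o.σm K) = fexp K ((-1 : K) • o.σm K) := by rw [neg_one_smul]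
  have h2 : fexp K (-(o.map f).σm K) = fexp K ((-1 : K) • (o.map f).σm K) := by rw [neg_one_smul]
  rw [Tz, Tz, map_add, map_mul, map_mul, map_add, map_pow, map_pow, mapAlgHom_X, h1,
    map_fexp_smul_σm, h2, map_gen, map_gen, map_gen]
  rfl

theorem map_σp : φ (o.σp K) = (o.map f).σp K := by
  rw [σp, map_flog _ (mapAlgHom_X _) (by simp), map_neg, map_smul, map_mul, mapAlgHom_X, map_Tz]
  rfl

theorem constantCoeff_ftmul {a b : (U K 𝔞)⟦X⟧} (hb : constantCoeff b = 0) :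
    constantCoeff (a ⊠[K] b) = 0 := by
  rw [ftmul, map_mul, constantCoeff_mapAlgHom _ b, hb, map_zero, mul_zero]

theorem map_ΦJ : φ₂ (o.ΦJ K) = (o.map f).ΦJ K := by
  rw [ΦJ, map_fexp _ (mapAlgHom_X _)
    (constantCoeff_ftmul (a := gen K o.Hm) (b := o.σm K) (constantCoeff_flog _)), map_ftmul,
    map_gen, map_σm]
  rfl

theorem map_ΦA : φ₂ (o.ΦA K) = (o.map f).ΦA K := by
  rw [ΦA, map_fexp _ (mapAlgHom_X _)
    (constantCoeff_ftmul (a := gen K o.Hp) (b := o.σp K) (constantCoeff_flog _)), map_ftmul,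
    map_gen, map_σp]
  rfl

theorem map_fexp_BT (a : Fin 2) :
    φ₂ (fexp K (-((2 : K) • (X * gen K (o.B a) ⊠[K]
      (gen K (o.T a) * fexp K (-(1 / 2 : K) • o.σm K)))))) =
    fexp K (-((2 : K) • (X * gen K ((o.map f).B a) ⊠[K]
      (gen K ((o.map f).T a) * fexp K (-(1 / 2 : K) • (o.map f).σm K))))) := by
  rw [map_fexp _ (mapAlgHom_X _) (by simp), map_neg, map_smul, map_mul, mapAlgHom_X, map_ftmul,
    map_mul, map_fexp_smul_σm, map_gen, map_gen]
  rfl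

theorem map_ΦE : φ₂ (o.ΦE K) = (o.map f).ΦE K := by
  rw [ΦE, map_mul, map_fexp_BT, map_fexp_BT]
  rfl

/-- A Lie algebra map carries the twisting element to the twisting element of the images of the
generators. -/
theorem map_F : φ₂ (o.F K) = (o.map f).F K := by
  rw [F, map_mul, map_mul, map_ΦA, map_ΦE, map_ΦJ]
  rfl

theorem map_ringInverse {R S : Type*} [Ring R] [Ring S] (g : R →+* S) {x : R} (hx : IsUnit x) :
    g (Ring.inverse x) = Ring.inverse (g x) := by
  obtain ⟨u, rfl⟩ := hx
  rw [Ring.inverse_unit]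
  exact (Ring.inverse_unit (Units.map (g : R →* S) u)).symm

theorem map_uAntipode (u : U K 𝔞) :
    uMap K f (uAntipode K 𝔞 u) = uAntipode K 𝔟 (uMap K f u) := by
  have := uHom_ext (f := ((uMap K f).op).comp (uAntipodeOp K 𝔞))
    (g := (uAntipodeOp K 𝔟).comp (uMap K f)) (fun x => by
      refine MulOpposite.unop_injective ?_
      change uMap K f (uAntipode K 𝔞 _) = uAntipode K 𝔟 (uMap K f _)
      rw [uAntipode_ι, map_neg, uMap_ι, uAntipode_ι]) u
  exact congrArg MulOpposite.unop this

theorem map_mulTensor_S₀ (x : (U K 𝔞 ⊗[K] U K 𝔞)⟦X⟧) :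
    φ (twistV K (S₀ K 𝔞) x) = twistV K (S₀ K 𝔟) (φ₂ x) := by
  refine ext_of_tmul
    (f := (mapAlgHom (uMap K f)).toLinearMap ∘ₗ mulTensorLin (constL K) (S₀ K 𝔞))
    (g := mulTensorLin (constL K) (S₀ K 𝔟) ∘ₗ
      (mapAlgHom (Algebra.TensorProduct.map (uMap K f) (uMap K f))).toLinearMap) ?_ ?_ ?_ x
  · intro x
    rw [LinearMap.comp_apply, LinearMap.comp_apply, mulTensorLin_apply, mulTensorLin_apply,
      mulTensor_X_mul, AlgHom.toLinearMap_apply, AlgHom.toLinearMap_apply, map_mul, mapAlgHom_X]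
  · intro x
    rw [LinearMap.comp_apply, LinearMap.comp_apply, mulTensorLin_apply, mulTensorLin_apply,
      AlgHom.toLinearMap_apply, AlgHom.toLinearMap_apply, map_mul, mapAlgHom_X, mulTensor_X_mul]
  · intro a b
    rw [LinearMap.comp_apply, LinearMap.comp_apply, mulTensorLin_apply, mulTensorLin_apply,
      AlgHom.toLinearMap_apply, AlgHom.toLinearMap_apply, mapAlgHom_C,
      Algebra.TensorProduct.map_tmul, mulTensor_C_tmul, mulTensor_C_tmul, map_mul, constL_apply,
      constL_apply, S₀_apply, S₀_apply, mapAlgHom_C, mapAlgHom_C, map_uAntipode]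

/-- The Hopf algebra `U_z(𝔞)` is functorial. -/
theorem isFormalHopfHom_uMap [CharZero K] (h : o.Relations K) :
    IsFormalHopfHom K (uMap K f) (o.ΔF K) (ε₀ K 𝔞) (o.SF K) ((o.map f).ΔF K) (ε₀ K 𝔟)
      ((o.map f).SF K) where
  comul a := by
    have e1 : φ₂ (Δ₀ K 𝔞 a) = Δ₀ K 𝔟 (uMap K f a) := by
      change φ₂ (PowerSeries.C (uComul K 𝔞 a)) = PowerSeries.C (uComul K 𝔟 (uMap K f a))
      rw [mapAlgHom_C, map_uComul]
    have e2 : φ₂ (Ring.inverse (o.F K)) = Ring.inverse ((o.map f).F K) := by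
      rw [← map_F]
      exact map_ringInverse (φ₂ : (U K 𝔞 ⊗[K] U K 𝔞)⟦X⟧ →+* (U K 𝔟 ⊗[K] U K 𝔟)⟦X⟧) (isUnit_F h)
    rw [ΔF, ΔF, twistComul_apply, twistComul_apply, map_mul, map_mul, map_F, e1, e2]
  counit a := congrArg PowerSeries.C <|
    uHom_ext (f := (uCounit K 𝔟).comp (uMap K f)) (g := uCounit K 𝔞) (fun x => by
      rw [AlgHom.comp_apply, uMap_ι, uCounit_ι, uCounit_ι]) a
  antipode a := by
    have e1 : φ (S₀ K 𝔞 a) = S₀ K 𝔟 (uMap K f a) := by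
      rw [S₀_apply, S₀_apply, mapAlgHom_C, map_uAntipode]
    have e2 : φ (Ring.inverse (twistV K (S₀ K 𝔞) (o.F K))) =
        Ring.inverse (twistV K (S₀ K 𝔟) ((o.map f).F K)) := by
      rw [← map_F, ← map_mulTensor_S₀]
      exact map_ringInverse (φ : (U K 𝔞)⟦X⟧ →+* (U K 𝔟)⟦X⟧) (isUnit_twistV constantCoeff_F)
    rw [SF, SF, twistAntipode_apply, twistAntipode_apply, map_mul, map_mul, map_mulTensor_S₀,
      map_F, e1, e2]

theorem supportedOn_map (𝔥 : LieSubalgebra K 𝔟) (o : CarrierGens 𝔥) :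
    SupportedOn K 𝔥 ((o.map 𝔥.incl).F K) := fun n =>
  ⟨coeff n (o.F K), by rw [← map_F, coeff_mapAlgHom]; rfl⟩

end Naturality

end CarrierGens

theorem mapAlgHom_injective {K A B : Type*} [Field K] [Ring A] [Algebra K A] [Ring B] [Algebra K B]
    {f : A →ₐ[K] B} (hf : Function.Injective f) : Function.Injective (PowerSeries.mapAlgHom f) :=
  fun x y hxy => PowerSeries.ext fun n => hf (by
    rw [← coeff_mapAlgHom, ← coeff_mapAlgHom, hxy])

/-! ### Support of a tensor -/

section Support

variable {K : Type*} [Field K]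

/-- If the `a i` are linearly independent and `∑ a i ⊗ b i` lies in the tensor product of two
subspaces, then the `b i` lie in the second subspace. -/
theorem mem_of_sum_tmul_mem {A B A' B' : Type*} [AddCommGroup A] [Module K A] [AddCommGroup B]
    [Module K B] [AddCommGroup A'] [Module K A'] [AddCommGroup B'] [Module K B']
    {n : Type*} [Fintype n] [DecidableEq n] {a : n → A} {b : n → B} (ha : LinearIndependent K a)
    (f : A' →ₗ[K] A) (g : B' →ₗ[K] B)
    (h : ∑ i, a i ⊗ₜ[K] b i ∈ LinearMap.range (TensorProduct.map f g)) (j : n) :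
    b j ∈ LinearMap.range g := by
  obtain ⟨l, hl⟩ := (Fintype.linearCombination K a).exists_leftInverse_of_injective
    (LinearMap.ker_eq_bot.mpr ha.fintypeLinearCombination_injective)
  set c : A →ₗ[K] K := LinearMap.proj j ∘ₗ l
  have hc : ∀ i, c (a i) = if i = j then 1 else 0 := fun i => by
    have h1 := LinearMap.congr_fun hl (Pi.single i 1)
    rw [LinearMap.comp_apply, Fintype.linearCombination_apply_single, one_smul] at h1
    change l (a i) j = _
    rw [h1, LinearMap.id_apply, Pi.single_apply]
    simp only [eq_comm]
  obtain ⟨t, ht⟩ := h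
  have h2 : ∀ t, TensorProduct.lid K B (TensorProduct.map c LinearMap.id
      (TensorProduct.map f g t)) ∈ LinearMap.range g := fun t => by
    induction t with
    | zero => simp
    | tmul x y =>
      rw [TensorProduct.map_tmul, TensorProduct.map_tmul, TensorProduct.lid_tmul]
      exact Submodule.smul_mem _ _ ⟨y, rfl⟩
    | add s t hs ht => simp only [map_add]; exact add_mem hs ht
  have h3 := h2 t
  rw [ht, map_sum, map_sum] at h3
  simpa [hc] using h3

/-- The analogue of `mem_of_sum_tmul_mem` for the first factor. -/
theorem mem_of_sum_tmul_mem' {A B A' B' : Type*} [AddCommGroup A] [Module K A] [AddCommGroup B]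
    [Module K B] [AddCommGroup A'] [Module K A'] [AddCommGroup B'] [Module K B']
    {n : Type*} [Fintype n] [DecidableEq n] {a : n → A} {b : n → B} (hb : LinearIndependent K b)
    (f : A' →ₗ[K] A) (g : B' →ₗ[K] B)
    (h : ∑ i, a i ⊗ₜ[K] b i ∈ LinearMap.range (TensorProduct.map f g)) (j : n) :
    a j ∈ LinearMap.range f := by
  refine mem_of_sum_tmul_mem hb g f ?_ j
  obtain ⟨t, ht⟩ := h
  refine ⟨TensorProduct.comm K A' B' t, ?_⟩
  rw [TensorProduct.map_comm, ht, map_sum]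
  simp only [TensorProduct.comm_tmul]

variable [CharZero K] {𝔞 : Type*} [LieRing 𝔞] [LieAlgebra K 𝔞]

/-- If `F` is supported on `𝔥`, then `𝔥` contains the eight generators, provided that these are
linearly independent. The coefficient of `z` in `F` is `-2 ∑ X_i ⊗ Y_i`, where `X_i` and `Y_i` run
through `H_+, H_-, B_a` and `T_+, T_-, T_a`. -/
theorem CarrierGens.mem_of_supportedOn {o : CarrierGens 𝔞} (h : o.Relations K)
    (hι : Function.Injective (UniversalEnvelopingAlgebra.ι K : 𝔞 → U K 𝔞))
    (h1 : LinearIndependent K ![o.Hp, o.Hm, o.B 0, o.B 1])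
    (h2 : LinearIndependent K ![o.Tp, o.Tm, o.T 0, o.T 1])
    {𝔥 : LieSubalgebra K 𝔞} (hF : SupportedOn K 𝔥 (o.F K)) (i : Fin 4) :
    ![o.Hp, o.Hm, o.B 0, o.B 1] i ∈ 𝔥 ∧ ![o.Tp, o.Tm, o.T 0, o.T 1] i ∈ 𝔥 := by
  have hi : LinearMap.ker (UniversalEnvelopingAlgebra.ι K : 𝔞 →ₗ⁅K⁆ U K 𝔞).toLinearMap = ⊥ :=
    LinearMap.ker_eq_bot.mpr hι
  have hinj : Function.Injective (uMap K 𝔥.incl) :=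
    uMap_injective _ (hι.comp Subtype.val_injective)
  have hmem : ∑ i, UniversalEnvelopingAlgebra.ι K (![o.Hp, o.Hm, o.B 0, o.B 1] i) ⊗ₜ[K]
      UniversalEnvelopingAlgebra.ι K (![o.Tp, o.Tm, o.T 0, o.T 1] i) ∈
      LinearMap.range (TensorProduct.map (uMap K 𝔥.incl).toLinearMap
        (uMap K 𝔥.incl).toLinearMap) := by
    have := hF 1
    rw [coeff_one_F h, ← neg_smul] at this
    have h2 : -(2 : K) ≠ 0 := neg_ne_zero.mpr two_ne_zero
    have h3 := Subalgebra.smul_mem _ this (-(2 : K))⁻¹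
    rw [smul_smul, inv_mul_cancel₀ h2, one_smul] at h3
    rw [Fin.sum_univ_four]
    exact h3
  have key : ∀ y : 𝔞, UniversalEnvelopingAlgebra.ι K y ∈
      LinearMap.range (uMap K 𝔥.incl).toLinearMap → y ∈ 𝔥 := fun y hy => by
    obtain ⟨x, rfl⟩ := exists_of_ι_mem_range hinj hι hy
    exact x.2
  exact ⟨key _ (mem_of_sum_tmul_mem' (h2.map' _ hi) _ _ hmem i),
    key _ (mem_of_sum_tmul_mem (h1.map' _ hi) _ _ hmem i)⟩

end Support

/-! ### Commutation relations of the conformal algebra -/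

section Conformal

variable {K : Type*} [Field K]

theorem coe_M (a b : Fin 4 ⊕ Fin 2) :
    (M K a b : Matrix (Fin 4 ⊕ Fin 2) (Fin 4 ⊕ Fin 2) K) =
      Matrix.single a b (η K b) - Matrix.single b a (η K a) := rfl

theorem M_swap (a b : Fin 4 ⊕ Fin 2) : M K b a = -M K a b :=
  Subtype.ext (by rw [coe_M, NegMemClass.coe_neg, coe_M, neg_sub])

theorem M_self (a : Fin 4 ⊕ Fin 2) : M K a a = 0 :=
  Subtype.ext (by rw [coe_M, sub_self]; rfl)

theorem single_mul_single' (a b c d : Fin 4 ⊕ Fin 2) (x y : K) :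
    Matrix.single a b x * Matrix.single c d y = if b = c then Matrix.single a d (x * y) else 0 := by
  split_ifs with h
  · rw [h, Matrix.single_mul_single_same]
  · rw [Matrix.single_mul_single_of_ne _ _ _ _ h]

/-- The commutation relations of the pseudo-orthogonal algebra. -/
theorem M_lie (a b c d : Fin 4 ⊕ Fin 2) : ⁅M K a b, M K c d⁆ =
    (if b = c then η K b • M K a d else 0) - (if b = d then η K b • M K a c else 0) -
      (if a = c then η K a • M K b d else 0) + (if a = d then η K a • M K b c else 0) := by
  refine Subtype.ext ?_
  rw [LieSubalgebra.coe_bracket, Ring.lie_def, coe_M, coe_M]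
  simp only [sub_mul, mul_sub, single_mul_single']
  push_cast
  split_ifs <;> subst_vars <;>
    simp_all [coe_M, smul_sub, Matrix.smul_single, mul_comm] <;> abel

end Conformal

section Conformal

variable {K : Type*} [Field K]

/-- A numbering of the six coordinates, used to put the generators `M_{ab}` in normal form. -/
def coordIndex : Fin 4 ⊕ Fin 2 → ℕ := Sum.elim (fun i => i) (fun i => i + 4)

theorem M_swap_of_lt {a b : Fin 4 ⊕ Fin 2} (_ : coordIndex b < coordIndex a) :
    M K a b = -M K b a := M_swap b a

variable (K) [CharZero K]

set_option maxHeartbeats 4000000 in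
/-- Every generator is a combination of the `M_{ab}`, so the relations are instances of `M_lie`. -/
theorem conformalRelations : ConformalRelations K := by
  constructor
  all_goals
    intros
    try rename_i i
    try fin_cases i
    all_goals
      try rename_i i
      try fin_cases i
  all_goals
    simp (disch := decide) [J, Kb, P0, P, C0, C, D, M_lie, xs, x4, x0, x5, η, M_swap_of_lt,
      Fin.sum_univ_three, eps3]
    try module

set_option maxHeartbeats 4000000 in
theorem weylSO_relations : (weylSO K).WeylRelations K := by
  constructor
  constructor
  case T_J1 | B_J1 =>
    intro a b hab
    fin_cases a <;> fin_cases b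
    all_goals first
      | exact absurd rfl hab
      | simp (disch := decide) [weylSO, J, Kb, P, M_lie, xs, x4, x0, x5, η, M_swap_of_lt, eps2]
        try module
  all_goals
    intros
    try rename_i a
    try fin_cases a
    all_goals
      try rename_i a
      try fin_cases a
  all_goals
    simp (disch := decide) [weylSO, J, Kb, P0, P, D, M_lie, xs, x4, x0, x5, η, M_swap_of_lt,
      eps2]
    try module

theorem r_weylSO : (weylSO K).r K = rConformal K := by
  simp only [CarrierGens.r, rConformal, wedge, weylSO, Matrix.cons_val_zero, Matrix.cons_val_one,
    ← TensorProduct.smul_tmul', TensorProduct.tmul_smul, TensorProduct.tmul_add,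
    TensorProduct.tmul_sub, TensorProduct.add_tmul, TensorProduct.sub_tmul]
  module

end Conformal

/-! ### Bases of the conformal algebra and of its subalgebras -/

section Bases

variable (K : Type*) [Field K] [CharZero K]

theorem linearIndependent_conformalGens : LinearIndependent K (conformalGens K) := by
  rw [Fintype.linearIndependent_iff]
  intro g hg
  have h : ∀ a b, (∑ i, g i • conformalGens K i).1 a b = 0 := fun a b => by
    rw [hg]; rfl
  simp only [Fin.sum_univ_succ, conformalGens, J, Kb, P0, P, C0, C, D] at h
  have h01 := h (Sum.inl 0) (Sum.inl 1)
  have h02 := h (Sum.inl 0) (Sum.inl 2)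
  have h12 := h (Sum.inl 1) (Sum.inl 2)
  have h03 := h (Sum.inl 0) (Sum.inl 3)
  have h13 := h (Sum.inl 1) (Sum.inl 3)
  have h23 := h (Sum.inl 2) (Sum.inl 3)
  have h04 := h (Sum.inl 0) (Sum.inr 0)
  have h14 := h (Sum.inl 1) (Sum.inr 0)
  have h24 := h (Sum.inl 2) (Sum.inr 0)
  have h34 := h (Sum.inl 3) (Sum.inr 0)
  have h05 := h (Sum.inl 0) (Sum.inr 1)
  have h15 := h (Sum.inl 1) (Sum.inr 1)
  have h25 := h (Sum.inl 2) (Sum.inr 1)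
  have h35 := h (Sum.inl 3) (Sum.inr 1)
  have h45 := h (Sum.inr 0) (Sum.inr 1)
  clear h
  simp [coe_M, xs, x4, x0, x5, η]
    at h01 h02 h12 h03 h13 h23 h04 h14 h24 h34 h05 h15 h25 h35 h45
  -- the matrix entries give `g 0, …, g 5, g 14` directly and sums and differences of the others
  have h6 : g 6 = 0 := by linear_combination (h34 - h45) / 2
  have h7 : g 7 = 0 := by linear_combination (h03 - h05) / 2
  have h8 : g 8 = 0 := by linear_combination (h13 - h15) / 2
  have h9 : g 9 = 0 := by linear_combination (h23 - h25) / 2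
  have h10 : g 10 = 0 := by linear_combination h34 + h45
  have h11 : g 11 = 0 := by linear_combination h03 + h05
  have h12' : g 12 = 0 := by linear_combination h13 + h15
  have h13' : g 13 = 0 := by linear_combination h23 + h25
  intro i
  fin_cases i
  exacts [h12, h02, h01, h04, h14, h24, h6, h7, h8, h9, h10, h11, h12', h13', h35]

/-- A matrix in `so(4,2)` is a combination of the generators `M_{ab}`; each pair `a, b` occurs
twice, whence the factor `2`. -/
theorem two_smul_eq_sum_M (x : so42 K) :
    (2 : K) • x = ∑ a, ∑ b, (η K b * (x : Matrix _ _ K) a b) • M K a b := by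
  have hx : ∀ a b, (x : Matrix _ _ K) b a * η K b = -(η K a * (x : Matrix _ _ K) a b) := by
    have h1 : (x : Matrix _ _ K) ∈ skewAdjointMatricesSubmodule
      (LieAlgebra.Orthogonal.indefiniteDiagonal (Fin 4) (Fin 2) K) := x.2
    rw [mem_skewAdjointMatricesSubmodule] at h1
    change (_ : Matrix _ _ K).transpose * Matrix.diagonal (η K) = Matrix.diagonal (η K) * _ at h1
    intro a b
    have := congrFun (congrFun h1 a) b
    simpa [Matrix.mul_diagonal, Matrix.diagonal_mul] using this
  have hη : ∀ a, η K a * η K a = 1 := by rintro (a | a) <;> simp [η]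
  refine Subtype.ext ?_
  ext i j
  have e1 : (∑ a, ∑ b, (η K b * (x : Matrix _ _ K) a b) • M K a b : so42 K).1 i j =
      ∑ a, ∑ b, (η K b * (x : Matrix _ _ K) a b) * (M K a b : Matrix _ _ K) i j := by
    simp [Matrix.sum_apply]
  rw [e1]
  have e2 : ∀ a b, (M K a b).1 i j = (if a = i then if b = j then η K b else 0 else 0) -
      (if b = i then if a = j then η K a else 0 else 0) := fun a b => by
    rw [coe_M, Matrix.sub_apply, Matrix.single_apply, Matrix.single_apply, ite_and, ite_and]
  simp only [e2, mul_sub, mul_ite, mul_zero, Finset.sum_sub_distrib, Finset.sum_ite_eq',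
    Finset.mem_univ, if_true, Finset.sum_ite_irrel, Finset.sum_const_zero]
  change (2 : K) * x.1 i j = _
  linear_combination -x.1 i j * hη j + η K i * hx i j - x.1 i j * hη i

theorem span_conformalGens : Submodule.span K (Set.range (conformalGens K)) = ⊤ := by
  set S := Submodule.span K (Set.range (conformalGens K)) with hS
  have hg : ∀ i, conformalGens K i ∈ S := fun i => Submodule.subset_span ⟨i, rfl⟩
  have hsw : ∀ {a b}, M K a b ∈ S → M K b a ∈ S := fun {a b} h => by
    rw [M_swap]; exact neg_mem h
  have h2 : ∀ {x y : so42 K}, x + y ∈ S → (1 / 2 : K) • (x - y) ∈ S → x ∈ S ∧ y ∈ S := by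
    intro x y h1 h2
    have e1 : x = (1 / 2 : K) • (x + y) + (1 / 2 : K) • (x - y) := by module
    have e2 : y = (1 / 2 : K) • (x + y) - (1 / 2 : K) • (x - y) := by module
    constructor
    · rw [e1]; exact add_mem (Submodule.smul_mem _ _ h1) h2
    · rw [e2]; exact sub_mem (Submodule.smul_mem _ _ h1) h2
  have h10 : M K (Sum.inl 1) (Sum.inl 0) ∈ S := hg 2
  have h02 : M K (Sum.inl 0) (Sum.inl 2) ∈ S := hg 1
  have h21 : M K (Sum.inl 2) (Sum.inl 1) ∈ S := hg 0
  have h40 : M K (Sum.inr 0) (Sum.inl 0) ∈ S := hg 3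
  have h41 : M K (Sum.inr 0) (Sum.inl 1) ∈ S := hg 4
  have h42 : M K (Sum.inr 0) (Sum.inl 2) ∈ S := hg 5
  have h4 : M K (Sum.inr 0) (Sum.inl 3) ∈ S ∧ M K (Sum.inr 0) (Sum.inr 1) ∈ S := h2 (hg 6) (hg 10)
  have h0 : M K (Sum.inl 0) (Sum.inl 3) ∈ S ∧ M K (Sum.inl 0) (Sum.inr 1) ∈ S := h2 (hg 7) (hg 11)
  have h1 : M K (Sum.inl 1) (Sum.inl 3) ∈ S ∧ M K (Sum.inl 1) (Sum.inr 1) ∈ S := h2 (hg 8) (hg 12)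
  have h3 : M K (Sum.inl 2) (Sum.inl 3) ∈ S ∧ M K (Sum.inl 2) (Sum.inr 1) ∈ S := h2 (hg 9) (hg 13)
  have h35 : M K (Sum.inl 3) (Sum.inr 1) ∈ S := by
    have := neg_mem (hg 14)
    rwa [show conformalGens K 14 = -M K (Sum.inl 3) (Sum.inr 1) from rfl, neg_neg] at this
  have hM : ∀ a b, M K a b ∈ S := by
    have h00 : ∀ a, M K a a ∈ S := fun a => by rw [M_self]; exact zero_mem _
    rintro (a | a) (b | b) <;> fin_cases a <;> fin_cases b
    exacts [h00 _, hsw h10, h02, h0.1, h10, h00 _, hsw h21, h1.1, hsw h02, h21, h00 _, h3.1,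
      hsw h0.1, hsw h1.1, hsw h3.1, h00 _,
      hsw h40, h0.2, hsw h41, h1.2, hsw h42, h3.2, hsw h4.1, h35,
      h40, h41, h42, h4.1, hsw h0.2, hsw h1.2, hsw h3.2, hsw h35, h00 _, h4.2, hsw h4.2, h00 _]
  rw [eq_top_iff]
  intro x _
  have e : x = (1 / 2 : K) • ((2 : K) • x) := by module
  rw [e, two_smul_eq_sum_M]
  exact Submodule.smul_mem _ _ (Submodule.sum_mem _ fun a _ => Submodule.sum_mem _ fun b _ =>
    Submodule.smul_mem _ _ (hM a b))

theorem linearIndependent_carrierGens : LinearIndependent K (carrierGens K) := by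
  have hc := Fintype.linearIndependent_iff.mp (linearIndependent_conformalGens K)
  rw [Fintype.linearIndependent_iff]
  intro g hg
  -- the coordinates of `∑ gᵢ Xᵢ` in the conformal basis
  have h := hc ![0, (g 6 - g 7) / 2, (g 6 + g 7) / 2, (g 0 - g 1) / 2, (g 6 + g 7) / 2,
    (g 7 - g 6) / 2, (g 2 + g 3) / 2, (g 2 - g 3) / 2, (g 4 + g 5) / 2, (g 5 - g 4) / 2,
    0, 0, 0, 0, (g 0 + g 1) / 2] (by
      rw [← hg]
      simp [Fin.sum_univ_succ, conformalGens, carrierGens, weylSO]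
      module)
  have h1 := h 1
  have h2 := h 2
  have h3 := h 3
  have h6 := h 6
  have h7 := h 7
  have h8 := h 8
  have h9 := h 9
  have h14 := h 14
  clear h
  simp only [Matrix.cons_val] at h1 h2 h3 h6 h7 h8 h9 h14
  have e0 : g 0 = 0 := by linear_combination h14 + h3
  have e1 : g 1 = 0 := by linear_combination h14 - h3
  have e2 : g 2 = 0 := by linear_combination h6 + h7
  have e3 : g 3 = 0 := by linear_combination h6 - h7
  have e4 : g 4 = 0 := by linear_combination h8 - h9
  have e5 : g 5 = 0 := by linear_combination h8 + h9
  have e6 : g 6 = 0 := by linear_combination h2 + h1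
  have e7 : g 7 = 0 := by linear_combination h2 - h1
  intro i
  fin_cases i
  exacts [e0, e1, e2, e3, e4, e5, e6, e7]

theorem linearIndependent_weylPoincareGens : LinearIndependent K (weylPoincareGens K) := by
  have h := (linearIndependent_conformalGens K).comp
    (![0, 1, 2, 3, 4, 5, 6, 7, 8, 9, 14] : Fin 11 → Fin 15) (by decide)
  convert h using 1
  funext i
  fin_cases i <;> rfl

variable {K} in
/-- A subspace spanned by a set closed under brackets is a Lie subalgebra. -/
theorem toSubmodule_lieSpan_of_lie_mem {𝔞 : Type*} [LieRing 𝔞] [LieAlgebra K 𝔞] {s : Set 𝔞}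
    (h : ∀ x ∈ s, ∀ y ∈ s, ⁅x, y⁆ ∈ Submodule.span K s) :
    (LieSubalgebra.lieSpan K 𝔞 s).toSubmodule = Submodule.span K s := by
  refine le_antisymm ?_ LieSubalgebra.submodule_span_le_lieSpan
  let L : LieSubalgebra K 𝔞 :=
    { Submodule.span K s with
      lie_mem' := fun {x y} hx hy => by
        refine Submodule.span_induction₂ (p := fun x y _ _ => ⁅x, y⁆ ∈ Submodule.span K s)
          (fun x y hx hy => h x hx y hy) ?_ ?_ ?_ ?_ ?_ ?_ hx hy
        · intro y _; rw [zero_lie]; exact zero_mem _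
        · intro x _; rw [lie_zero]; exact zero_mem _
        · intro x y z _ _ _ h1 h2; rw [add_lie]; exact add_mem h1 h2
        · intro x y z _ _ _ h1 h2; rw [lie_add]; exact add_mem h1 h2
        · intro c x y _ _ h1; rw [smul_lie]; exact Submodule.smul_mem _ _ h1
        · intro c x y _ _ h1; rw [lie_smul]; exact Submodule.smul_mem _ _ h1 }
  exact (LieSubalgebra.lieSpan_le (K := L)).mpr Submodule.subset_span

theorem toSubmodule_carrier :
    (carrier K).toSubmodule = Submodule.span K (Set.range (carrierGens K)) := by
  refine toSubmodule_lieSpan_of_lie_mem ?_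
  have h : (weylSO K).toCarrierGens.Relations K := (weylSO_relations K).toRelations
  set S := Submodule.span K (Set.range (carrierGens K))
  have hg : ∀ i, carrierGens K i ∈ S := fun i => Submodule.subset_span ⟨i, rfl⟩
  have hT : ∀ a, (weylSO K).T a ∈ S := by intro a; fin_cases a; exacts [hg 4, hg 5]
  have hTp : (weylSO K).Tp ∈ S := hg 2
  have hTm : (weylSO K).Tm ∈ S := hg 3
  have hB : ∀ a, (weylSO K).B a ∈ S := by intro a; fin_cases a; exacts [hg 6, hg 7]
  have hsw : ∀ {x y : so42 K}, ⁅x, y⁆ ∈ S → ⁅y, x⁆ ∈ S := fun {x y} hxy => by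
    rw [← lie_skew]; exact neg_mem hxy
  have cases : ∀ i, carrierGens K i = (weylSO K).Hp ∨ carrierGens K i = (weylSO K).Hm ∨
      carrierGens K i = (weylSO K).Tp ∨ carrierGens K i = (weylSO K).Tm ∨
      (∃ a, carrierGens K i = (weylSO K).T a) ∨ ∃ a, carrierGens K i = (weylSO K).B a := by
    intro i
    fin_cases i
    exacts [.inl rfl, .inr (.inl rfl), .inr (.inr (.inl rfl)), .inr (.inr (.inr (.inl rfl))),
      .inr (.inr (.inr (.inr (.inl ⟨0, rfl⟩)))), .inr (.inr (.inr (.inr (.inl ⟨1, rfl⟩)))),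
      .inr (.inr (.inr (.inr (.inr ⟨0, rfl⟩)))), .inr (.inr (.inr (.inr (.inr ⟨1, rfl⟩))))]
  have h0 : ∀ {x : so42 K}, x = 0 → x ∈ S := fun h => h ▸ zero_mem S
  have hpm : ⁅(weylSO K).Hp, (weylSO K).Hm⁆ ∈ S := h0 h.Hp_Hm
  have hpp : ⁅(weylSO K).Hp, (weylSO K).Tp⁆ ∈ S := by rw [h.Hp_Tp]; exact hTp
  have hpn : ⁅(weylSO K).Hp, (weylSO K).Tm⁆ ∈ S := h0 h.Hp_Tm
  have hpT : ∀ a, ⁅(weylSO K).Hp, (weylSO K).T a⁆ ∈ S := fun a => by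
    rw [h.Hp_T]; exact S.smul_mem _ (hT a)
  have hpB : ∀ a, ⁅(weylSO K).Hp, (weylSO K).B a⁆ ∈ S := fun a => by
    rw [h.Hp_B]; exact S.smul_mem _ (hB a)
  have hmp : ⁅(weylSO K).Hm, (weylSO K).Tp⁆ ∈ S := h0 h.Hm_Tp
  have hmm : ⁅(weylSO K).Hm, (weylSO K).Tm⁆ ∈ S := by rw [h.Hm_Tm]; exact hTm
  have hmT : ∀ a, ⁅(weylSO K).Hm, (weylSO K).T a⁆ ∈ S := fun a => by
    rw [h.Hm_T]; exact S.smul_mem _ (hT a)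
  have hmB : ∀ a, ⁅(weylSO K).Hm, (weylSO K).B a⁆ ∈ S := fun a => by
    rw [h.Hm_B]; exact S.smul_mem _ (hB a)
  have hBp : ∀ a, ⁅(weylSO K).B a, (weylSO K).Tp⁆ ∈ S := fun a => by rw [h.B_Tp]; exact hT a
  have hBm : ∀ a, ⁅(weylSO K).B a, (weylSO K).Tm⁆ ∈ S := fun a => h0 (h.B_Tm a)
  have hBT : ∀ a b, ⁅(weylSO K).B a, (weylSO K).T b⁆ ∈ S := fun a b => by
    rw [h.B_T]; split_ifs; exacts [hTm, zero_mem _]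
  have hBB : ∀ a b, ⁅(weylSO K).B a, (weylSO K).B b⁆ ∈ S := fun a b => h0 (h.B_B a b)
  have htt : ⁅(weylSO K).Tp, (weylSO K).Tm⁆ ∈ S := h0 h.Tp_Tm
  have htT : ∀ a, ⁅(weylSO K).Tp, (weylSO K).T a⁆ ∈ S := fun a => h0 (h.Tp_T a)
  have hnT : ∀ a, ⁅(weylSO K).Tm, (weylSO K).T a⁆ ∈ S := fun a => h0 (h.Tm_T a)
  have hTT : ∀ a b, ⁅(weylSO K).T a, (weylSO K).T b⁆ ∈ S := fun a b => h0 (h.T_T a b)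
  have hxx : ∀ x : so42 K, ⁅x, x⁆ ∈ S := fun x => h0 (lie_self x)
  rintro _ ⟨i, rfl⟩ _ ⟨j, rfl⟩
  rcases cases i with e | e | e | e | ⟨a, e⟩ | ⟨a, e⟩ <;>
    rcases cases j with e' | e' | e' | e' | ⟨b, e'⟩ | ⟨b, e'⟩ <;> rw [e, e']
  exacts [hxx _, hpm, hpp, hpn, hpT _, hpB _, hsw hpm, hxx _, hmp, hmm, hmT _, hmB _,
    hsw hpp, hsw hmp, hxx _, htt, htT _, hsw (hBp _), hsw hpn, hsw hmm, hsw htt, hxx _, hnT _,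
    hsw (hBm _), hsw (hpT _), hsw (hmT _), hsw (htT _), hsw (hnT _), hTT _ _, hsw (hBT _ _),
    hsw (hpB _), hsw (hmB _), hBp _, hBm _, hBT _ _, hBB _ _]

theorem toSubmodule_weylPoincare :
    (weylPoincare K).toSubmodule = Submodule.span K (Set.range (weylPoincareGens K)) := by
  refine toSubmodule_lieSpan_of_lie_mem ?_
  have h := conformalRelations K
  set S := Submodule.span K (Set.range (weylPoincareGens K))
  have hg : ∀ i, weylPoincareGens K i ∈ S := fun i => Submodule.subset_span ⟨i, rfl⟩
  have hJ : ∀ i, J K i ∈ S := by intro i; fin_cases i; exacts [hg 0, hg 1, hg 2]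
  have hK : ∀ i, Kb K i ∈ S := by intro i; fin_cases i; exacts [hg 3, hg 4, hg 5]
  have hP0 : P0 K ∈ S := hg 6
  have hP : ∀ i, P K i ∈ S := by intro i; fin_cases i; exacts [hg 7, hg 8, hg 9]
  have hsw : ∀ {x y : so42 K}, ⁅x, y⁆ ∈ S → ⁅y, x⁆ ∈ S := fun {x y} hxy => by
    rw [← lie_skew]; exact neg_mem hxy
  have cases : ∀ i, (∃ k, weylPoincareGens K i = J K k) ∨ (∃ k, weylPoincareGens K i = Kb K k) ∨
      weylPoincareGens K i = P0 K ∨ (∃ k, weylPoincareGens K i = P K k) ∨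
      weylPoincareGens K i = D K := by
    intro i
    fin_cases i
    exacts [.inl ⟨0, rfl⟩, .inl ⟨1, rfl⟩, .inl ⟨2, rfl⟩, .inr (.inl ⟨0, rfl⟩),
      .inr (.inl ⟨1, rfl⟩), .inr (.inl ⟨2, rfl⟩), .inr (.inr (.inl rfl)),
      .inr (.inr (.inr (.inl ⟨0, rfl⟩))), .inr (.inr (.inr (.inl ⟨1, rfl⟩))),
      .inr (.inr (.inr (.inl ⟨2, rfl⟩))), .inr (.inr (.inr (.inr rfl)))]
  have h0 : ∀ {x : so42 K}, x = 0 → x ∈ S := fun h => h ▸ zero_mem S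
  have hsum : ∀ (c : Fin 3 → ℤ) (v : Fin 3 → so42 K), (∀ k, v k ∈ S) → ∑ k, c k • v k ∈ S :=
    fun c v hv => sum_mem fun k _ => zsmul_mem (hv k) _
  have hJJ : ∀ i j, ⁅J K i, J K j⁆ ∈ S := fun i j => by rw [h.J_J]; exact hsum _ _ hJ
  have hJK : ∀ i j, ⁅J K i, Kb K j⁆ ∈ S := fun i j => by rw [h.J_K]; exact hsum _ _ hK
  have hJP : ∀ i j, ⁅J K i, P K j⁆ ∈ S := fun i j => by rw [h.J_P]; exact hsum _ _ hP
  have hKK : ∀ i j, ⁅Kb K i, Kb K j⁆ ∈ S := fun i j => by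
    rw [h.K_K]; exact neg_mem (hsum _ _ hJ)
  have hKP : ∀ i j, ⁅Kb K i, P K j⁆ ∈ S := fun i j => by
    rw [h.K_P]; split_ifs; exacts [hP0, zero_mem _]
  have hK0 : ∀ i, ⁅Kb K i, P0 K⁆ ∈ S := fun i => by rw [h.K_P0]; exact hP i
  have h0D : ⁅P0 K, D K⁆ ∈ S := by rw [h.P0_D]; exact neg_mem hP0
  have hPD : ∀ i, ⁅P K i, D K⁆ ∈ S := fun i => by rw [h.P_D]; exact neg_mem (hP i)
  have hJ0 : ∀ i, ⁅J K i, P0 K⁆ ∈ S := fun i => h0 (h.J_P0 i)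
  have hJD : ∀ i, ⁅J K i, D K⁆ ∈ S := fun i => h0 (h.J_D i)
  have hKD : ∀ i, ⁅Kb K i, D K⁆ ∈ S := fun i => h0 (h.K_D i)
  have h0P : ∀ i, ⁅P0 K, P K i⁆ ∈ S := fun i => h0 (h.P0_P i)
  have hPP : ∀ i j, ⁅P K i, P K j⁆ ∈ S := fun i j => h0 (h.P_P i j)
  have hxx : ∀ x : so42 K, ⁅x, x⁆ ∈ S := fun x => h0 (lie_self x)
  rintro _ ⟨i, rfl⟩ _ ⟨j, rfl⟩
  rcases cases i with ⟨a, e⟩ | ⟨a, e⟩ | e | ⟨a, e⟩ | e <;>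
    rcases cases j with ⟨b, e'⟩ | ⟨b, e'⟩ | e' | ⟨b, e'⟩ | e' <;> rw [e, e']
  exacts [hJJ _ _, hJK _ _, hJ0 _, hJP _ _, hJD _, hsw (hJK _ _), hKK _ _, hK0 _, hKP _ _, hKD _,
    hsw (hJ0 _), hsw (hK0 _), hxx _, h0P _, h0D, hsw (hJP _ _), hsw (hKP _ _), hsw (h0P _),
    hPP _ _, hPD _, hsw (hJD _), hsw (hKD _), hsw h0D, hsw (hPD _), hxx _]

end Bases

/-! ### Passage to the two subalgebras -/

section Transfer

open CarrierGens

variable {K : Type*} [Field K] {𝔞 : Type*} [LieRing 𝔞] [LieAlgebra K 𝔞]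
  {𝔟 : Type*} [LieRing 𝔟] [LieAlgebra K 𝔟]

/-- The relations of the generators can be checked in a larger Lie algebra. -/
theorem CarrierGens.Relations.of_map {f : 𝔞 →ₗ⁅K⁆ 𝔟} (hf : Function.Injective f)
    {o : CarrierGens 𝔞} (h : (o.map f).Relations K) : o.Relations K where
  Hp_Hm := hf (by rw [LieHom.map_lie, map_zero]; exact h.Hp_Hm)
  Hp_Tp := hf (by rw [LieHom.map_lie]; exact h.Hp_Tp)
  Hp_Tm := hf (by rw [LieHom.map_lie, map_zero]; exact h.Hp_Tm)
  Hp_T a := hf (by rw [LieHom.map_lie, map_smul]; exact h.Hp_T a)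
  Hp_B a := hf (by rw [LieHom.map_lie, map_smul]; exact h.Hp_B a)
  Hm_Tp := hf (by rw [LieHom.map_lie, map_zero]; exact h.Hm_Tp)
  Hm_Tm := hf (by rw [LieHom.map_lie]; exact h.Hm_Tm)
  Hm_T a := hf (by rw [LieHom.map_lie, map_smul]; exact h.Hm_T a)
  Hm_B a := hf (by rw [LieHom.map_lie, map_smul]; exact h.Hm_B a)
  B_Tp a := hf (by rw [LieHom.map_lie]; exact h.B_Tp a)
  B_Tm a := hf (by rw [LieHom.map_lie, map_zero]; exact h.B_Tm a)
  B_T a b := hf (by rw [LieHom.map_lie, apply_ite f, map_zero]; exact h.B_T a b)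
  B_B a b := hf (by rw [LieHom.map_lie, map_zero]; exact h.B_B a b)
  Tp_Tm := hf (by rw [LieHom.map_lie, map_zero]; exact h.Tp_Tm)
  Tp_T a := hf (by rw [LieHom.map_lie, map_zero]; exact h.Tp_T a)
  Tm_T a := hf (by rw [LieHom.map_lie, map_zero]; exact h.Tm_T a)
  T_T a b := hf (by rw [LieHom.map_lie, map_zero]; exact h.T_T a b)

/-- The images of the generators `H_±, T_±, T_a, B_a, A_a, J_1` under a Lie algebra map. -/
def WeylGens.map (f : 𝔞 →ₗ⁅K⁆ 𝔟) (w : WeylGens 𝔞) : WeylGens 𝔟 where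
  toCarrierGens := w.toCarrierGens.map f
  A := fun a => f (w.A a)
  J1 := f w.J1

theorem WeylGens.WeylRelations.of_map {f : 𝔞 →ₗ⁅K⁆ 𝔟} (hf : Function.Injective f)
    {w : WeylGens 𝔞} (h : (w.map f).WeylRelations K) : w.WeylRelations K where
  toRelations := .of_map hf h.toRelations
  Hp_A a := hf (by rw [LieHom.map_lie, map_smul]; exact h.Hp_A a)
  Hm_A a := hf (by rw [LieHom.map_lie, map_smul]; exact h.Hm_A a)
  Tp_A a := hf (by rw [LieHom.map_lie, map_zero]; exact h.Tp_A a)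
  Tm_A a := hf (by rw [LieHom.map_lie, map_neg]; exact h.Tm_A a)
  T_A b a := hf (by rw [LieHom.map_lie, apply_ite f, map_zero, map_neg]; exact h.T_A b a)
  B_A b a := hf (by rw [LieHom.map_lie, apply_ite f, map_smul, map_sub]; exact h.B_A b a)
  Hp_J1 := hf (by rw [LieHom.map_lie, map_zero]; exact h.Hp_J1)
  Hm_J1 := hf (by rw [LieHom.map_lie, map_zero]; exact h.Hm_J1)
  Tp_J1 := hf (by rw [LieHom.map_lie, map_zero]; exact h.Tp_J1)
  Tm_J1 := hf (by rw [LieHom.map_lie, map_zero]; exact h.Tm_J1)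
  T_J1 a b hab := hf (by rw [LieHom.map_lie, map_smul]; exact h.T_J1 a b hab)
  B_J1 a b hab := hf (by rw [LieHom.map_lie, map_smul]; exact h.B_J1 a b hab)

end Transfer

section Subalgebras

open CarrierGens

variable (K : Type*) [Field K]

theorem map_carrierL_incl : (carrierL K).map (carrier K).incl = (weylSO K).toCarrierGens := by
  have hT : ((carrierL K).map (carrier K).incl).T = (weylSO K).T := by
    funext a; fin_cases a <;> rfl
  have hB : ((carrierL K).map (carrier K).incl).B = (weylSO K).B := by
    funext a; fin_cases a <;> rfl
  exact congrArg₂ (CarrierGens.mk _ _ _ _) hT hB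

theorem map_carrierL_inclusion :
    (carrierL K).map (LieSubalgebra.inclusion (carrier_le_weylPoincare K)) =
      (weylWP K).toCarrierGens := by
  have hT : ((carrierL K).map (LieSubalgebra.inclusion (carrier_le_weylPoincare K))).T =
      (weylWP K).T := by
    funext a; fin_cases a <;> rfl
  have hB : ((carrierL K).map (LieSubalgebra.inclusion (carrier_le_weylPoincare K))).B =
      (weylWP K).B := by
    funext a; fin_cases a <;> rfl
  exact congrArg₂ (CarrierGens.mk _ _ _ _) hT hB

/-- A Lie algebra of matrices embeds in its enveloping algebra. -/
theorem ι_so42_injective :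
    Function.Injective (UniversalEnvelopingAlgebra.ι K : so42 K → U K (so42 K)) := by
  intro x y hxy
  have := congrArg (UniversalEnvelopingAlgebra.lift K (so42 K).incl) hxy
  rw [UniversalEnvelopingAlgebra.lift_ι_apply, UniversalEnvelopingAlgebra.lift_ι_apply] at this
  exact Subtype.ext this

variable [CharZero K]

theorem inclWP_injective : Function.Injective (inclWP K) :=
  uMap_injective _ ((ι_so42_injective K).comp Subtype.val_injective)

theorem uMap_comp {𝔞 𝔟 𝔠 : Type*} [LieRing 𝔞] [LieAlgebra K 𝔞] [LieRing 𝔟] [LieAlgebra K 𝔟]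
    [LieRing 𝔠] [LieAlgebra K 𝔠] (g : 𝔟 →ₗ⁅K⁆ 𝔠) (f : 𝔞 →ₗ⁅K⁆ 𝔟) (u : U K 𝔞) :
    uMap K g (uMap K f u) = uMap K (g.comp f) u :=
  uHom_ext (f := (uMap K g).comp (uMap K f)) (g := uMap K (g.comp f)) (fun x => by
    rw [AlgHom.comp_apply, uMap_ι, uMap_ι, uMap_ι]; rfl) u

theorem inclL_injective : Function.Injective (inclL K) := by
  have h : Function.Injective (uMap K (carrier K).incl) :=
    uMap_injective _ ((ι_so42_injective K).comp Subtype.val_injective)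
  refine Function.Injective.of_comp (f := inclWP K) ?_
  convert h using 1
  funext u
  exact uMap_comp K _ _ u

theorem carrierL_relations : (carrierL K).Relations K :=
  .of_map (f := (carrier K).incl) Subtype.val_injective (by
    rw [map_carrierL_incl]; exact (weylSO_relations K).toRelations)

theorem weylWP_relations : (weylWP K).WeylRelations K :=
  .of_map (f := (weylPoincare K).incl) Subtype.val_injective (weylSO_relations K)

/-- `F` comes from `U(𝓛)`, and any subalgebra that supports `F` contains the generators of `𝓛`. -/
theorem isLeast_carrier :
    IsLeast {𝔥 : LieSubalgebra K (so42 K) | SupportedOn K 𝔥 ((weylSO K).F K)} (carrier K) := by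
  refine ⟨?_, fun 𝔥 h𝔥 => ?_⟩
  · have := supportedOn_map (carrier K) (carrierL K)
    rwa [map_carrierL_incl] at this
  · have hli := linearIndependent_carrierGens K
    have h1 : LinearIndependent K ![(weylSO K).Hp, (weylSO K).Hm, (weylSO K).B 0,
        (weylSO K).B 1] := by
      convert hli.comp (![0, 1, 6, 7] : Fin 4 → Fin 8) (by decide) using 1
      funext i
      fin_cases i <;> rfl
    have h2 : LinearIndependent K ![(weylSO K).Tp, (weylSO K).Tm, (weylSO K).T 0,
        (weylSO K).T 1] := by
      convert hli.comp (![2, 3, 4, 5] : Fin 4 → Fin 8) (by decide) using 1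
      funext i
      fin_cases i <;> rfl
    have h := mem_of_supportedOn (weylSO_relations K).toRelations (ι_so42_injective K) h1 h2 h𝔥
    refine LieSubalgebra.lieSpan_le.mpr ?_
    rintro _ ⟨i, rfl⟩
    fin_cases i
    exacts [(h 0).1, (h 1).1, (h 0).2, (h 1).2, (h 2).2, (h 3).2, (h 2).1, (h 3).1]

end Subalgebras

end ConformalTwist

end

theorem mainTheorem1 (K : Type*) [Field K] [CharZero K] :
    -- the conformal generators form a basis of `so(4,2)` with the stated commutation relations
    (LinearIndependent K (conformalGens K) ∧
      Submodule.span K (Set.range (conformalGens K)) = ⊤ ∧ ConformalRelations K) ∧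
    -- the carrier subalgebra `L` has the basis `H_±, T_±, T_a, B_a` with the stated relations
    (LinearIndependent K (carrierGens K) ∧
      (carrier K).toSubmodule = Submodule.span K (Set.range (carrierGens K)) ∧
      (carrierL K).Relations K) ∧
    -- the Weyl--Poincare subalgebra has the basis `J_i, K_i, P_μ, D`
    (LinearIndependent K (weylPoincareGens K) ∧
      (weylPoincare K).toSubmodule = Submodule.span K (Set.range (weylPoincareGens K))) ∧
    -- `F` is a factorizable twist and defines `U_z(L)`, `U_z(WP)` and `U_z(so(4,2))`, with the
    -- stated coproducts, universal `R`-matrix and classical `r`-matrix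
    (carrierL K).TwistedHopf K ∧
    (weylWP K).TwistedHopf K ∧
    (weylSO K).TwistedHopf K ∧
    -- the coproducts of `A_a` and `J_1`
    (weylWP K).Coproducts K ∧
    (weylSO K).Coproducts K ∧
    -- `U_z(L) ⊂ U_z(WP)`, with the same twisting element
    (Function.Injective (PowerSeries.mapAlgHom (inclL K)) ∧
      IsFormalHopfHom K (inclL K)
        ((carrierL K).ΔF K) (ε₀ K (carrier K)) ((carrierL K).SF K)
        ((weylWP K).ΔF K) (ε₀ K (weylPoincare K)) ((weylWP K).SF K) ∧
      PowerSeries.mapAlgHom (Algebra.TensorProduct.map (inclL K) (inclL K)) ((carrierL K).F K) =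
        (weylWP K).F K) ∧
    -- `U_z(WP) ⊂ U_z(so(4,2))`, with the same twisting element
    (Function.Injective (PowerSeries.mapAlgHom (inclWP K)) ∧
      IsFormalHopfHom K (inclWP K)
        ((weylWP K).ΔF K) (ε₀ K (weylPoincare K)) ((weylWP K).SF K)
        ((weylSO K).ΔF K) (ε₀ K (so42 K)) ((weylSO K).SF K) ∧
      PowerSeries.mapAlgHom (Algebra.TensorProduct.map (inclWP K) (inclWP K)) ((weylWP K).F K) =
        (weylSO K).F K) ∧
    -- `L` is the carrier of `F`, the least Lie subalgebra of `so(4,2)` that supports `F`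
    IsLeast {𝔥 : LieSubalgebra K (so42 K) | SupportedOn K 𝔥 ((weylSO K).F K)} (carrier K) ∧
    -- the classical `r`-matrix in the conformal basis
    (weylSO K).r K = rConformal K := by
  have hL := carrierL_relations K
  have hWP := weylWP_relations K
  have hSO := weylSO_relations K
  refine ⟨⟨linearIndependent_conformalGens K, span_conformalGens K, conformalRelations K⟩,
    ⟨linearIndependent_carrierGens K, toSubmodule_carrier K, hL⟩,
    ⟨linearIndependent_weylPoincareGens K, toSubmodule_weylPoincare K⟩,
    CarrierGens.twistedHopf hL, CarrierGens.twistedHopf hWP.toRelations,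
    CarrierGens.twistedHopf hSO.toRelations, WeylGens.coproducts hWP, WeylGens.coproducts hSO,
    ⟨mapAlgHom_injective (inclL_injective K), ?_, ?_⟩,
    ⟨mapAlgHom_injective (inclWP_injective K), ?_, ?_⟩, isLeast_carrier K, r_weylSO K⟩
  · rw [← map_carrierL_inclusion]
    exact CarrierGens.isFormalHopfHom_uMap _ _ hL
  · rw [← map_carrierL_inclusion]
    exact CarrierGens.map_F _ _
  · exact CarrierGens.isFormalHopfHom_uMap (weylPoincare K).incl _ hWP.toRelations
  · exact CarrierGens.map_F (weylPoincare K).incl _
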